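/- Consider the variable-bottom generalized KdV equation (bKdV) $$\partial_t u=-\partial_x\bigl(\partial_x^2u+f(u)-b(t,x)u\bigr),\qquad t\ge 0,\ x\in\mathbb R .$$ Nonlinearity. Assume $f(0)=f'(0)=0$ and, for some $k\ge 3$, $f\in C^k(\mathbb R)$ with $f^{(k)}$ bounded; put $F(y)=\int_0^y f$. Solitary waves. Let $I_0\subset(0,\infty)$ be an open interval such that for every $c\in I_0$ there is a positive even function $Q_c\in C^2(\mathbb R)$, tending to $0$ at infinity, with $-\partial_x^2Q_c+cQ_c-f(Q_c)=0$. Assume that $c\mapsto Q_c(x)$ is $C^3$ on $I_0$ for each $x$, that $x^m\partial_c^nQ_c\in L^1(\mathbb R)$ for $n=1,2,3$ and $m=0,1,2$, and that $\int_{\mathbb R}\partial_cQ_c\,dx\neq0$. Let $\delta(c)=\frac12\|Q_c\|_{L^2}^2$. Potential. Let $\epsilon_a,\epsilon_x,\epsilon_t\in(0,1]$, and let $b:\mathbb R^2\to\mathbb R$ be twice differentiable with $|\partial_t^n\partial_x^mb|\le\epsilon_a\epsilon_t^n\epsilon_x^m$ for $n=0,1$, $m=0,1,2$, $n+m\le2$.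 Solutions. A solution is a function $u\in C([0,\infty),H^1(\mathbb R))$ that satisfies (bKdV) in the sense of distributions. We consider solutions which obey, for all $t\ge0$, the identities $$\frac{d}{dt}\int\Bigl(\tfrac12(\partial_xu)^2-F(u)+\tfrac12bu^2\Bigr)dx=\frac12\int(\partial_tb)u^2dx,\qquad \frac{d}{dt}\,\frac12\int u^2dx=\frac12\int(\partial_xb)u^2dx,$$ $$\frac{d}{dt}\,\frac12\int bu^2dx=\int\Bigl(\tfrac12u^2\partial_tb+\partial_xb\bigl(uf(u)-\tfrac32(\partial_xu)^2-F(u)\bigr)-(\partial_x^2b)\,u\,\partial_xu\Bigr)dx .$$ Theorem. Let $I\subset I_0$ be a non-empty compact set with $\delta'(c)>0$ for all $c\in I$, let $J\subset I_0$ be any neighbourhood of $I$ (that is, $I\subset\operatorname{int}J$), and let $0<s<\frac12$. There are positive constants $C,K,\kappa,\eta$, depending only on $f$, $(Q_c)_{c\in I_0}$, $I$, $J$ and $s$, such that the following holds. Let $\epsilon_a\epsilon_x\le\eta$, $\epsilon_0\le\kappa(\epsilon_a\epsilon_x)^{2s}$, and let $b$ and $u$ be as above with $$\inf_{c\in I,\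 a\in\mathbb R}\|u(0,\cdot)-Q_c(\cdot-a)\|_{H^1}\le\epsilon_0 .$$ Put $T=C\,(\epsilon_t+\epsilon_x+(\epsilon_a\epsilon_x)^s)^{-1}$. Then there are $C^1$ functions $a:[0,T]\to\mathbb R$ and $c:[0,T]\to J$ such that $$u(t,x)=Q_{c(t)}(x-a(t))+\xi(t,x),\qquad \|\xi(t)\|_{H^1}\le K(\epsilon_a\epsilon_x)^s\qquad(0\le t\le T),$$ and, for all $t\in[0,T]$, $$\bigl|\dot a(t)-\bigl(c(t)-b(t,a(t))\bigr)\bigr|\le K\bigl((\epsilon_a\epsilon_x)^{2s}+\epsilon_a\epsilon_x^2\bigr),\qquad |\dot c(t)|\le K\bigl((\epsilon_a\epsilon_x)^{2s}+\epsilon_a\epsilon_x^2\bigr).$$ -/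

import Mathlib

open MeasureTheory Set Filter Topology
open scoped ContDiff

noncomputable section

namespace BKdV

/-! ### The real Sobolev space `H¹(ℝ)` -/

/-- `v` is the weak (distributional) derivative of `u` on `ℝ`. -/
def HasWeakDeriv (u v : ℝ → ℝ) : Prop :=
  ∀ φ : ℝ → ℝ, ContDiff ℝ ∞ φ → HasCompactSupport φ →
    ∫ x, u x * deriv φ x = -∫ x, v x * φ x

/-- `u` is (a representative of) an element of `H¹(ℝ)`. -/
def MemH1 (u : ℝ → ℝ) : Prop :=
  MemLp u 2 volume ∧ ∃ v : ℝ → ℝ, MemLp v 2 volume ∧ HasWeakDeriv u v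

open Classical in
/-- The weak derivative in `L²(ℝ)` when there is one (it is unique almost everywhere). -/
def weakDeriv (u : ℝ → ℝ) : ℝ → ℝ :=
  if h : ∃ v : ℝ → ℝ, MemLp v 2 volume ∧ HasWeakDeriv u v then h.choose else 0

/-- The norm of `H¹(ℝ)`. -/
def h1Norm (u : ℝ → ℝ) : ℝ :=
  Real.sqrt ((∫ x, u x ^ 2) + ∫ x, weakDeriv u x ^ 2)

/-! ### The nonlinearity and the potential -/

/-- The nonlinearity is `C^k` with bounded `k`-th derivative for some `k ≥ 3`,
and `f(0) = f'(0) = 0`. -/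
structure AdmissibleNonlinearity (f : ℝ → ℝ) : Prop where
  smooth : ∃ k : ℕ, 3 ≤ k ∧ ContDiff ℝ k f ∧ ∃ M : ℝ, ∀ x, |iteratedDeriv k f x| ≤ M
  zero : f 0 = 0
  deriv_zero : deriv f 0 = 0

/-- The antiderivative `F` of `f` with `F(0) = 0`. -/
def primitive (f : ℝ → ℝ) (y : ℝ) : ℝ := ∫ r in (0 : ℝ)..y, f r

/-- The partial derivative `∂ₜⁿ ∂ₓᵐ b` at `(t, x)`. -/
def partialDeriv (b : ℝ → ℝ → ℝ) (n m : ℕ) (t x : ℝ) : ℝ :=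
  iteratedDeriv n (fun τ => iteratedDeriv m (b τ) x) t

/-- `b` is twice differentiable on the `(t, x)`-plane and slowly varying, with amplitude, length
and time scales `εa`, `εx`, `εt` in `(0, 1]`. -/
structure AdmissiblePotential (b : ℝ → ℝ → ℝ) (εa εx εt : ℝ) : Prop where
  amplitude : 0 < εa ∧ εa ≤ 1
  length : 0 < εx ∧ εx ≤ 1
  time : 0 < εt ∧ εt ≤ 1
  differentiable : Differentiable ℝ (Function.uncurry b)
  twice_differentiable : Differentiable ℝ (fderiv ℝ (Function.uncurry b))
  bound : ∀ n m : ℕ, n ≤ 1 → m ≤ 2 → n + m ≤ 2 → ∀ t x : ℝ,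
    |partialDeriv b n m t x| ≤ εa * εt ^ n * εx ^ m

/-! ### Conserved quantities -/

/-- The Hamiltonian `H_b`, with `β = b(t, ·)` the potential at a fixed time. -/
def hamiltonian (f β v : ℝ → ℝ) : ℝ :=
  ∫ x, (1 / 2 * weakDeriv v x ^ 2 - primitive f (v x) + 1 / 2 * β x * v x ^ 2)

/-- The momentum `P`. -/
def momentum (v : ℝ → ℝ) : ℝ := 1 / 2 * ∫ x, v x ^ 2

/-! ### Solitary waves -/

/-- `(Q c)` for `c ∈ I₀` is the family of (positive, even, decaying) solitary wave profiles of
the generalized KdV equation with nonlinearity `f`; it depends on the speed `c` in a `C³` way,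
with integrability of the moments of the derivatives in `c`. -/
structure SolitaryWaveFamily (f : ℝ → ℝ) (I₀ : Set ℝ) (Q : ℝ → ℝ → ℝ) : Prop where
  isOpen : IsOpen I₀
  ordConnected : I₀.OrdConnected
  speed_pos : ∀ c ∈ I₀, 0 < c
  contDiff : ∀ c ∈ I₀, ContDiff ℝ 2 (Q c)
  pos : ∀ c ∈ I₀, ∀ x, 0 < Q c x
  even : ∀ c ∈ I₀, ∀ x, Q c (-x) = Q c x
  vanishing : ∀ c ∈ I₀, Tendsto (Q c) atTop (𝓝 0)
  equation : ∀ c ∈ I₀, ∀ x, -iteratedDeriv 2 (Q c) x + c * Q c x - f (Q c x) = 0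
  contDiff_speed : ∀ x, ContDiffOn ℝ 3 (fun c => Q c x) I₀
  moments : ∀ c ∈ I₀, ∀ n m : ℕ, 1 ≤ n → n ≤ 3 → m ≤ 2 →
    Integrable (fun x => x ^ m * iteratedDeriv n (fun c' => Q c' x) c)
  integral_ne_zero : ∀ c ∈ I₀, ∫ x, deriv (fun c' => Q c' x) c ≠ 0

/-! ### Solutions of the bKdV equation -/

/-- `u` is a solution in `C([0, ∞), H¹(ℝ))` of
`∂ₜ u = -∂ₓ (∂ₓ² u + f(u) - b(t, x) u)`, in the sense of distributions. -/
structure IsSolution (f : ℝ → ℝ) (b u : ℝ → ℝ → ℝ) : Prop where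
  memH1 : ∀ t, 0 ≤ t → MemH1 (u t)
  continuous : ∀ t₀, 0 ≤ t₀ →
    Tendsto (fun t => h1Norm (fun x => u t x - u t₀ x)) (𝓝[Ici 0] t₀) (𝓝 0)
  equation : ∀ φ : ℝ → ℝ, ContDiff ℝ ∞ φ → HasCompactSupport φ → ∀ t, 0 ≤ t →
    HasDerivWithinAt (fun τ => ∫ x, u τ x * φ x)
      (∫ x, (u t x * iteratedDeriv 3 φ x + (f (u t x) - b t x * u t x) * deriv φ x)) (Ici 0) t

/-- The identities for the time derivatives of `H_b(u)`, `P(u)` and `½ ∫ b u²` along `u`. -/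
structure SatisfiesBalanceLaws (f : ℝ → ℝ) (b u : ℝ → ℝ → ℝ) : Prop where
  hamiltonian_law : ∀ t, 0 ≤ t →
    HasDerivWithinAt (fun τ => hamiltonian f (b τ) (u τ))
      (1 / 2 * ∫ x, partialDeriv b 1 0 t x * u t x ^ 2) (Ici 0) t
  momentum_law : ∀ t, 0 ≤ t →
    HasDerivWithinAt (fun τ => momentum (u τ))
      (1 / 2 * ∫ x, partialDeriv b 0 1 t x * u t x ^ 2) (Ici 0) t
  potential_law : ∀ t, 0 ≤ t →
    HasDerivWithinAt (fun τ => 1 / 2 * ∫ x, b τ x * u τ x ^ 2)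
      (∫ x, (1 / 2 * u t x ^ 2 * partialDeriv b 1 0 t x
        + partialDeriv b 0 1 t x *
          (u t x * f (u t x) - 3 / 2 * weakDeriv (u t) x ^ 2 - primitive f (u t x))
        - partialDeriv b 0 2 t x * u t x * weakDeriv (u t) x)) (Ici 0) t

end BKdV

end

/-!
The proof follows a solitary wave with modulated speed `c(t)` and position `a(t)`. Write
`ε = εa εx`, `e = ε^(s/2)` and `u(t, x) = Q_c(x - a) + ξ(t, x - a)`. Since `s < 1/2`, `ε` is small
compared with `e⁴` (`exists_small_parameter`).

*Modulation* (`exists_modulation`). The speed is defined by the momentum, `∫ Q_c² = ∫ u²`, which is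
possible because `δ' > 0`. This makes `∫ ξ Q_c` quadratic in `ξ`. The position solves
`a' = c - b(t, a) + K ∫ u Ψ(x - a)` with a fixed localised odd function `Ψ ≈ x`. The last term is a
feedback that damps the translation mode, so that `∫ ξ Ψ` remains small (`abs_le_of_damped`) without
an implicit orthogonality condition.

*Coercivity*. The second variation of the energy at fixed momentum controls `‖ξ‖²` in `H¹` modulo
`∫ ξ Q_c` and `∫ ξ Ψ` (`exists_coercive`, uniform in the speed by `exists_uniform_goodSpeed`). No
spectral theory is needed. Subtracting a multiple of `∂_c Q_c` gives a function that vanishes at the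
origin; on each half-line such a function is treated with Riccati functions built from the explicit
solution `Q_c'` of the linearised equation (`exists_half_line_coercive`). The subtraction costs
nothing because of the sign of `δ'`. The properties of the profiles that are used, such as uniform
decay and the regularity of `∂_c Q_c`, follow from the profile equation, its first integral and the
derivative of the latter in `c` (`first_integral`, `wronskian`, `exists_profileBounds`).

*The energy argument*. Let `Λ = E(u) - E(Q_c)`, where `E` is the energy without potential. Its rate
of change is `∂_x b(t, a) ∫ ξ R_c` up to terms of higher order (`energy_law`, `force_expansion`).
Integrating this linear term over times of order `e⁻²` by brute force would lose too much. It is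
removed by adding to `Λ` the product of `∂_x b(t, a)` with the pairing of `u` with a corrector, that
is, a function `φ` with `L_c φ' ≈ R_c` (`exists_correctors`, `corrector_law`). Such functions are
explicit: `x Q_c` serves for `R_c`, and `∫₀ˣ ∂_c Q_c` for the right-hand side `-Q_c`. The latter does
not decay and is truncated at the scale `e⁻²`, which makes its `L²` norm of size `e⁻¹`. A combination
of the two is insensitive to the velocity of the centre. As a result `Λ` varies by at most
`O(ε e²)` as long as `‖ξ‖ ≤ e³` (`NearSoliton.energy_variation`), and coercivity then gives
`‖ξ‖ ≤ e³/2` (`NearSoliton.exists_displacement_le_half`), so that a continuity argument closes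
(`le_of_bootstrap`).

*The velocity*. The feedback contributes a term of size `e³` to `a'`, more than the allowed `e⁴`.
Adding to `a` a multiple of the pairing with the second corrector removes it; this moves the centre
by `O(e²)` only, which is the size allowed for `ξ` in the theorem (`NearSoliton.exists_position`).
-/

noncomputable section

namespace BKdV

/-! ### Primitives of locally integrable functions -/

/-- `U` is a primitive of the locally integrable function `V`, that is, `U` is locally absolutely
continuous with derivative `V` almost everywhere. -/
structure IsPrim (U V : ℝ → ℝ) : Prop where
  intervalIntegrable : ∀ a b, IntervalIntegrable V volume a b
  integral_eq : ∀ a b, ∫ x in a..b, V x = U b - U a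

namespace IsPrim

variable {U V F f G g : ℝ → ℝ}

lemma of_hasDerivAt (h : ∀ x, HasDerivAt U (V x) x) (hV : Continuous V) : IsPrim U V :=
  ⟨fun a b => hV.intervalIntegrable a b, fun a b =>
    intervalIntegral.integral_eq_sub_of_hasDerivAt (fun x _ => h x) (hV.intervalIntegrable a b)⟩

lemma eq_add (h : IsPrim U V) (a : ℝ) : U = fun x => U a + ∫ y in a..x, V y := by
  funext x; rw [h.integral_eq]; ring

lemma absCont (h : IsPrim U V) (a b : ℝ) : AbsolutelyContinuousOnInterval U a b := by
  rw [h.eq_add a]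
  have h1 := (h.intervalIntegrable a b).absolutelyContinuousOnInterval_intervalIntegral
    (c := a) (by simp)
  have h2 : AbsolutelyContinuousOnInterval (fun _ : ℝ => U a) a b :=
    contDiffOn_const.absolutelyContinuousOnInterval
  exact h2.add h1

lemma continuous (h : IsPrim U V) : Continuous U := by
  rw [h.eq_add 0]
  exact continuous_const.add
    (intervalIntegral.continuous_primitive (fun a b => h.intervalIntegrable a b) 0)

lemma ae_hasDerivAt (h : IsPrim U V) (a b : ℝ) : ∀ᵐ x, x ∈ uIcc a b → HasDerivAt U (V x) x := by
  filter_upwards [(h.intervalIntegrable a b).ae_hasDerivAt_integral] with x hx hxab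
  have := hx hxab a (by simp)
  rw [h.eq_add a]
  exact this.const_add _

lemma mul (hF : IsPrim F f) (hG : IsPrim G g) :
    IsPrim (fun x => F x * G x) (fun x => f x * G x + F x * g x) := by
  refine ⟨fun a b => ?_, fun a b => ?_⟩
  · exact ((hF.intervalIntegrable a b).mul_continuousOn hG.continuous.continuousOn).add
      ((hG.intervalIntegrable a b).continuousOn_mul hF.continuous.continuousOn)
  · rw [← (hF.absCont a b).integral_deriv_mul_eq_sub (hG.absCont a b)]
    apply intervalIntegral.integral_congr_ae
    filter_upwards [hF.ae_hasDerivAt a b, hG.ae_hasDerivAt a b] with x h1 h2 hx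
    rw [(h1 (uIoc_subset_uIcc hx)).deriv, (h2 (uIoc_subset_uIcc hx)).deriv]

lemma add (hF : IsPrim F f) (hG : IsPrim G g) :
    IsPrim (fun x => F x + G x) (fun x => f x + g x) :=
  ⟨fun a b => (hF.intervalIntegrable a b).add (hG.intervalIntegrable a b), fun a b => by
    rw [intervalIntegral.integral_add (hF.intervalIntegrable a b) (hG.intervalIntegrable a b),
      hF.integral_eq, hG.integral_eq]; ring⟩

lemma sub (hF : IsPrim F f) (hG : IsPrim G g) :
    IsPrim (fun x => F x - G x) (fun x => f x - g x) :=
  ⟨fun a b => (hF.intervalIntegrable a b).sub (hG.intervalIntegrable a b), fun a b => by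
    rw [intervalIntegral.integral_sub (hF.intervalIntegrable a b) (hG.intervalIntegrable a b),
      hF.integral_eq, hG.integral_eq]; ring⟩

lemma const_mul (hF : IsPrim F f) (k : ℝ) : IsPrim (fun x => k * F x) (fun x => k * f x) :=
  ⟨fun a b => (hF.intervalIntegrable a b).const_mul k, fun a b => by
    rw [intervalIntegral.integral_const_mul, hF.integral_eq]; ring⟩

lemma comp_add_right (hF : IsPrim F f) (d : ℝ) :
    IsPrim (fun x => F (x + d)) (fun x => f (x + d)) :=
  ⟨fun a b => by simpa using (hF.intervalIntegrable (a + d) (b + d)).comp_add_right d, fun a b => by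
    rw [intervalIntegral.integral_comp_add_right, hF.integral_eq]⟩

lemma comp_neg (hF : IsPrim F f) : IsPrim (fun x => F (-x)) (fun x => -f (-x)) :=
  ⟨fun a b => by
    have := (hF.intervalIntegrable (-a) (-b)).comp_mul_left (c := -1)
    simp only [neg_mul, one_mul, div_neg, div_one, neg_neg] at this
    exact this.neg, fun a b => by
    rw [intervalIntegral.integral_neg, intervalIntegral.integral_comp_neg, hF.integral_eq]; ring⟩

lemma tendsto_atTop_zero (hF : IsPrim F f) {a : ℝ} (h1 : IntegrableOn F (Ioi a))
    (h2 : IntegrableOn f (Ioi a)) : Tendsto F atTop (𝓝 0) := by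
  have h3 : Tendsto F atTop (𝓝 (F a + ∫ x in Ioi a, f x)) := by
    have := (intervalIntegral_tendsto_integral_Ioi a h2 tendsto_id).const_add (F a)
    rw [hF.eq_add a]
    simpa using this
  set l := F a + ∫ x in Ioi a, f x
  by_cases hl : l = 0
  · rwa [hl] at h3
  exfalso
  have h4 : ∀ᶠ x in atTop, |l| / 2 < |F x| :=
    h3.abs.eventually (lt_mem_nhds (half_lt_self (abs_pos.2 hl)))
  obtain ⟨N, hN⟩ := eventually_atTop.1 h4
  have h5 : IntegrableOn (fun _ : ℝ => |l| / 2) (Ioi (max N a)) := by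
    refine Integrable.mono' (h1.mono_set (Ioi_subset_Ioi (le_max_right _ _))).abs
      (by fun_prop) ?_
    filter_upwards [ae_restrict_mem measurableSet_Ioi] with x hx
    rw [Real.norm_of_nonneg (by positivity)]
    exact (hN x ((le_max_left _ _).trans (le_of_lt hx))).le
  rw [integrableOn_const_iff] at h5
  simp [hl] at h5

lemma integral_Ioi (hF : IsPrim F f) {a : ℝ} (h1 : IntegrableOn F (Ioi a))
    (h2 : IntegrableOn f (Ioi a)) : ∫ x in Ioi a, f x = -F a := by
  have h3 := intervalIntegral_tendsto_integral_Ioi a h2 tendsto_id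
  have h4 := (hF.tendsto_atTop_zero h1 h2).sub_const (F a)
  simp only [id, hF.integral_eq] at h3
  simpa using tendsto_nhds_unique h3 h4

lemma integral_eq_zero (hF : IsPrim F f) (h1 : Integrable F) (h2 : Integrable f) :
    ∫ x, f x = 0 := by
  have e1 := hF.integral_Ioi (a := 0) h1.integrableOn h2.integrableOn
  have e2 := hF.comp_neg.integral_Ioi (a := 0) h1.comp_neg.integrableOn h2.comp_neg.neg.integrableOn
  rw [integral_neg, integral_comp_neg_Ioi (0 : ℝ) f] at e2
  rw [← intervalIntegral.integral_Iic_add_Ioi (b := 0) h2.integrableOn h2.integrableOn, e1]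
  simp at e2 ⊢
  linarith

end IsPrim

/-! ### The norms of `L²(ℝ)` and `H¹(ℝ)` -/

/-- The norm of `L²(ℝ)`. -/
def l2 (f : ℝ → ℝ) : ℝ := Real.sqrt (∫ x, f x ^ 2)

section L2

variable {f g : ℝ → ℝ}

lemma l2_nonneg (f : ℝ → ℝ) : 0 ≤ l2 f := Real.sqrt_nonneg _

lemma sq_l2 (f : ℝ → ℝ) : l2 f ^ 2 = ∫ x, f x ^ 2 :=
  Real.sq_sqrt (integral_nonneg fun _ => sq_nonneg _)

lemma l2_eq_toReal (hf : MemLp f 2 volume) : l2 f = (eLpNorm f 2 volume).toReal := by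
  rw [hf.eLpNorm_eq_integral_rpow_norm (by norm_num) (by norm_num), ENNReal.toReal_ofReal
    (by positivity), l2, Real.sqrt_eq_rpow]
  norm_num

lemma l2_add_le (hf : MemLp f 2 volume) (hg : MemLp g 2 volume) :
    l2 (fun x => f x + g x) ≤ l2 f + l2 g := by
  rw [l2_eq_toReal hf, l2_eq_toReal hg, l2_eq_toReal (f := fun x => f x + g x) (hf.add hg),
    ← ENNReal.toReal_add hf.2.ne hg.2.ne]
  exact ENNReal.toReal_mono (ENNReal.add_ne_top.2 ⟨hf.2.ne, hg.2.ne⟩)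
    (eLpNorm_add_le hf.1 hg.1 (by norm_num))

lemma integrable_mul (hf : MemLp f 2 volume) (hg : MemLp g 2 volume) :
    Integrable (fun x => f x * g x) := hf.integrable_mul hg

lemma abs_integral_mul_le (hf : MemLp f 2 volume) (hg : MemLp g 2 volume) :
    |∫ x, f x * g x| ≤ l2 f * l2 g := by
  have h1 := hf.integrable_sq
  have h2 := hg.integrable_sq
  have h3 := integrable_mul hf hg
  have key : ∀ t : ℝ, 0 ≤ (∫ x, g x ^ 2) * (t * t) + (2 * ∫ x, f x * g x) * t + ∫ x, f x ^ 2 := by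
    intro t
    have : 0 ≤ ∫ x, (f x + t * g x) ^ 2 := integral_nonneg fun _ => sq_nonneg _
    have e : ∫ x, (f x + t * g x) ^ 2 =
        ∫ x, (f x ^ 2 + ((2 * t) * (f x * g x) + t ^ 2 * g x ^ 2)) := by
      congr 1; funext x; ring
    have h4 : Integrable fun x => (2 * t) * (f x * g x) + t ^ 2 * g x ^ 2 :=
      (h3.const_mul _).add (h2.const_mul _)
    rw [e, integral_add h1 h4,
      integral_add (h3.const_mul _) (h2.const_mul _), integral_const_mul, integral_const_mul] at this
    linarith
  have := discrim_le_zero key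
  rw [discrim] at this
  apply abs_le_of_sq_le_sq _ (mul_nonneg (l2_nonneg _) (l2_nonneg _))
  rw [mul_pow, sq_l2, sq_l2]
  linarith

lemma l2_const_mul (k : ℝ) (f : ℝ → ℝ) : l2 (fun x => k * f x) = |k| * l2 f := by
  simp only [l2, mul_pow]
  rw [integral_const_mul, Real.sqrt_mul (sq_nonneg k), Real.sqrt_sq_eq_abs]

lemma l2_neg (f : ℝ → ℝ) : l2 (fun x => -f x) = l2 f := by simp [l2]

lemma l2_sub_le (hf : MemLp f 2 volume) (hg : MemLp g 2 volume) :
    l2 (fun x => f x - g x) ≤ l2 f + l2 g := by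
  have := l2_add_le hf hg.neg
  simp only [Pi.neg_apply, ← sub_eq_add_neg] at this
  rwa [show l2 (-g) = l2 g from l2_neg g] at this

lemma l2_mono (hg : MemLp g 2 volume) (h : ∀ x, |f x| ≤ |g x|) : l2 f ≤ l2 g := by
  by_cases hi : Integrable fun x => f x ^ 2
  · exact Real.sqrt_le_sqrt (integral_mono hi hg.integrable_sq fun x => sq_le_sq.2 (h x))
  · rw [l2, integral_undef hi, Real.sqrt_zero]; exact l2_nonneg _

lemma memLp_of_abs_le (hg : MemLp g 2 volume) (hf : AEStronglyMeasurable f volume)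
    (h : ∀ x, |f x| ≤ |g x|) : MemLp f 2 volume :=
  hg.mono hf (ae_of_all _ h)

lemma l2_comp_add_right (f : ℝ → ℝ) (d : ℝ) : l2 (fun x => f (x + d)) = l2 f := by
  rw [l2, integral_add_right_eq_self (fun x => f x ^ 2) d]; rfl

lemma memLp_comp_add_right (hf : MemLp f 2 volume) (d : ℝ) :
    MemLp (fun x => f (x + d)) 2 volume :=
  hf.comp_measurePreserving (measurePreserving_add_right volume d)

lemma memLp_comp_neg (hf : MemLp f 2 volume) : MemLp (fun x => f (-x)) 2 volume :=
  hf.comp_measurePreserving (Measure.measurePreserving_neg volume)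

end L2

/-- `U` belongs to `H¹(ℝ)`, is the continuous representative of its class, and has the weak
derivative `V`. -/
structure H1Pair (U V : ℝ → ℝ) : Prop where
  isPrim : IsPrim U V
  memLp : MemLp U 2 volume
  memLp_deriv : MemLp V 2 volume

/-- The `H¹` norm of the function with weak derivative `V`. -/
def nrm (U V : ℝ → ℝ) : ℝ := Real.sqrt (l2 U ^ 2 + l2 V ^ 2)

section Nrm

variable {U V U' V' : ℝ → ℝ}

lemma nrm_nonneg (U V : ℝ → ℝ) : 0 ≤ nrm U V := Real.sqrt_nonneg _

lemma sq_nrm (U V : ℝ → ℝ) : nrm U V ^ 2 = l2 U ^ 2 + l2 V ^ 2 := Real.sq_sqrt (by positivity)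

lemma l2_le_nrm (U V : ℝ → ℝ) : l2 U ≤ nrm U V :=
  Real.le_sqrt_of_sq_le (by nlinarith [sq_nonneg (l2 V)])

lemma l2_le_nrm' (U V : ℝ → ℝ) : l2 V ≤ nrm U V :=
  Real.le_sqrt_of_sq_le (by nlinarith [sq_nonneg (l2 U)])

lemma nrm_le_add (U V : ℝ → ℝ) : nrm U V ≤ l2 U + l2 V := by
  have h1 := l2_nonneg U
  have h2 := l2_nonneg V
  exact Real.sqrt_le_iff.2 ⟨by positivity, by nlinarith⟩

lemma nrm_comp_add_right (U V : ℝ → ℝ) (d : ℝ) :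
    nrm (fun x => U (x + d)) (fun x => V (x + d)) = nrm U V := by
  rw [nrm, nrm, l2_comp_add_right, l2_comp_add_right]

lemma nrm_neg (U V : ℝ → ℝ) : nrm (fun x => -U x) (fun x => -V x) = nrm U V := by
  rw [nrm, nrm, l2_neg, l2_neg]

lemma H1Pair.add (h : H1Pair U V) (h' : H1Pair U' V') :
    H1Pair (fun x => U x + U' x) (fun x => V x + V' x) :=
  ⟨h.1.add h'.1, h.2.add h'.2, h.3.add h'.3⟩

lemma H1Pair.sub (h : H1Pair U V) (h' : H1Pair U' V') :
    H1Pair (fun x => U x - U' x) (fun x => V x - V' x) :=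
  ⟨h.1.sub h'.1, h.2.sub h'.2, h.3.sub h'.3⟩

lemma H1Pair.const_mul (h : H1Pair U V) (k : ℝ) :
    H1Pair (fun x => k * U x) (fun x => k * V x) :=
  ⟨h.1.const_mul k, h.2.const_mul k, h.3.const_mul k⟩

lemma H1Pair.comp_add_right (h : H1Pair U V) (d : ℝ) :
    H1Pair (fun x => U (x + d)) (fun x => V (x + d)) :=
  ⟨h.1.comp_add_right d, memLp_comp_add_right h.2 d, memLp_comp_add_right h.3 d⟩

lemma nrm_add_le (h : H1Pair U V) (h' : H1Pair U' V') :
    nrm (fun x => U x + U' x) (fun x => V x + V' x) ≤ nrm U V + nrm U' V' := by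
  have a1 := l2_add_le h.2 h'.2
  have a2 := l2_add_le h.3 h'.3
  have b1 := l2_nonneg U
  have b2 := l2_nonneg V
  have b3 := l2_nonneg U'
  have b4 := l2_nonneg V'
  have c1 := l2_nonneg (fun x => U x + U' x)
  have c2 := l2_nonneg (fun x => V x + V' x)
  refine Real.sqrt_le_iff.2 ⟨add_nonneg (nrm_nonneg _ _) (nrm_nonneg _ _), ?_⟩
  have e1 := sq_nrm U V
  have e2 := sq_nrm U' V'
  have cs : l2 U * l2 U' + l2 V * l2 V' ≤ nrm U V * nrm U' V' := by
    apply le_of_sq_le_sq _ (mul_nonneg (nrm_nonneg _ _) (nrm_nonneg _ _))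
    rw [mul_pow, e1, e2]
    nlinarith [sq_nonneg (l2 U * l2 V' - l2 V * l2 U')]
  have d1 : l2 (fun x => U x + U' x) ^ 2 ≤ (l2 U + l2 U') ^ 2 := by gcongr
  have d2 : l2 (fun x => V x + V' x) ^ 2 ≤ (l2 V + l2 V') ^ 2 := by gcongr
  nlinarith

lemma nrm_sub_le (h : H1Pair U V) (h' : H1Pair U' V') :
    nrm (fun x => U x - U' x) (fun x => V x - V' x) ≤ nrm U V + nrm U' V' := by
  have := nrm_add_le h (h'.const_mul (-1))
  simp only [neg_mul, one_mul, ← sub_eq_add_neg] at this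
  rwa [nrm_neg] at this

/-- The embedding of `H¹(ℝ)` into the bounded functions. -/
lemma H1Pair.abs_apply_le (h : H1Pair U V) (x : ℝ) : |U x| ≤ 2 * nrm U V := by
  have hp := h.1.mul h.1
  have i1 : Integrable fun y => U y ^ 2 + V y ^ 2 := h.2.integrable_sq.add h.3.integrable_sq
  have i1' : Integrable fun y => U y ^ 2 := h.2.integrable_sq
  have tot : ∫ y, (U y ^ 2 + V y ^ 2) = nrm U V ^ 2 := by
    rw [sq_nrm, sq_l2, sq_l2, integral_add h.2.integrable_sq h.3.integrable_sq]
  have key : ∀ y ∈ Icc x (x + 1), U x ^ 2 ≤ U y ^ 2 + nrm U V ^ 2 := by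
    intro y hy
    have e := hp.integral_eq y x
    have : |∫ z in y..x, (V z * U z + U z * V z)| ≤ ∫ z, (U z ^ 2 + V z ^ 2) := by
      rw [← Real.norm_eq_abs]
      refine (intervalIntegral.norm_integral_le_integral_norm_uIoc).trans ?_
      refine le_trans (setIntegral_mono_on ?_ i1.integrableOn measurableSet_uIoc
        (g := fun z => U z ^ 2 + V z ^ 2) ?_)
        (setIntegral_le_integral i1 (ae_of_all _ fun z => by positivity))
      · exact ((integrable_mul h.3 h.2).add (integrable_mul h.2 h.3)).norm.integrableOn
      · intro z _
        rw [Real.norm_eq_abs, abs_le]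
        constructor <;> nlinarith [sq_nonneg (U z + V z), sq_nonneg (U z - V z)]
    rw [e, tot] at this
    have := (abs_le.1 this).2
    nlinarith
  have h3 : ∫ y in x..(x+1), U x ^ 2 ≤ ∫ y in x..(x+1), (U y ^ 2 + nrm U V ^ 2) := by
    apply intervalIntegral.integral_mono_on (by linarith) (by simp)
    · exact (i1'.intervalIntegrable).add (by simp)
    · exact key
  have h4 : ∫ y in x..(x+1), U y ^ 2 ≤ l2 U ^ 2 := by
    rw [sq_l2, intervalIntegral.integral_of_le (by linarith)]
    exact setIntegral_le_integral i1' (ae_of_all _ fun z => by positivity)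
  rw [intervalIntegral.integral_add i1'.intervalIntegrable (by simp)] at h3
  simp at h3
  have h5 := sq_nrm U V
  apply abs_le_of_sq_le_sq _ (mul_nonneg zero_le_two (nrm_nonneg _ _))
  nlinarith [sq_nonneg (l2 V)]

/-- Integration by parts on the whole line. -/
lemma integral_mul_eq_neg (hU : IsPrim U V) (hU' : IsPrim U' V')
    (h1 : Integrable fun x => U x * U' x) (h2 : Integrable fun x => V x * U' x)
    (h3 : Integrable fun x => U x * V' x) : ∫ x, V x * U' x = -∫ x, U x * V' x := by
  have := (hU.mul hU').integral_eq_zero h1 (h2.add h3)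
  rw [integral_add h2 h3] at this
  linarith

end Nrm

/-! ### Weak derivatives and continuous representatives -/

lemma locallyIntegrable_of_memLp {f : ℝ → ℝ} (hf : MemLp f 2 volume) : LocallyIntegrable f :=
  hf.locallyIntegrable (by norm_num)

lemma integrable_mul_of_hasCompactSupport {f φ : ℝ → ℝ} (hf : LocallyIntegrable f)
    (hφ : Continuous φ) (hs : HasCompactSupport φ) : Integrable fun x => f x * φ x := by
  have := hf.integrable_smul_right_of_hasCompactSupport hφ hs
  simpa using this

lemma IsPrim.hasWeakDeriv {U V : ℝ → ℝ} (h : IsPrim U V) (hV : LocallyIntegrable V) :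
    HasWeakDeriv U V := by
  intro φ hφ hs
  have hφ1 : ContDiff ℝ 1 φ := hφ.of_le (by exact_mod_cast le_top)
  have hd : Continuous (deriv φ) := hφ1.continuous_deriv le_rfl
  have hp : IsPrim φ (deriv φ) :=
    .of_hasDerivAt (fun x => (hφ1.differentiable (by norm_num) x).hasDerivAt) hd
  have hU := h.continuous.locallyIntegrable (μ := volume)
  have := integral_mul_eq_neg hp h
    (by simpa [mul_comm] using integrable_mul_of_hasCompactSupport hU hφ.continuous hs)
    (by simpa [mul_comm] using integrable_mul_of_hasCompactSupport hU hd hs.deriv)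
    (by simpa [mul_comm] using integrable_mul_of_hasCompactSupport hV hφ.continuous hs)
  simpa [mul_comm] using this

/-- The lemma of du Bois-Reymond. -/
lemma ae_const_of_hasWeakDeriv_zero {u : ℝ → ℝ} (hu : LocallyIntegrable u)
    (h : HasWeakDeriv u 0) : ∃ C, u =ᵐ[volume] fun _ => C := by
  let ρ : ContDiffBump (0 : ℝ) := ⟨1, 2, one_pos, one_lt_two⟩
  let ψ : ℝ → ℝ := ρ.normed volume
  have ψs : HasCompactSupport ψ := ρ.hasCompactSupport_normed
  have ψc : ContDiff ℝ ∞ ψ := ρ.contDiff_normed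
  have ψi : ∫ x, ψ x = 1 := ρ.integral_normed
  refine ⟨∫ x, u x * ψ x, ?_⟩
  apply ae_eq_of_integral_contDiff_smul_eq hu (continuous_const.locallyIntegrable)
  intro g gc gs
  set k := fun x => g x - (∫ y, g y) * ψ x with hk
  have kc : ContDiff ℝ ∞ k := gc.sub (contDiff_const.mul ψc)
  have ks : HasCompactSupport k := gs.sub (ψs.mul_left)
  have ki : Integrable k := kc.continuous.integrable_of_hasCompactSupport ks
  have gi : Integrable g := gc.continuous.integrable_of_hasCompactSupport gs
  have ψint : Integrable ψ := ψc.continuous.integrable_of_hasCompactSupport ψs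
  have k0 : ∫ x, k x = 0 := by
    rw [hk, integral_sub gi (ψint.const_mul _), integral_const_mul, ψi]; ring
  obtain ⟨M, hM⟩ : ∃ M, 0 < M ∧ ∀ x, M ≤ |x| → k x = 0 := by
    obtain ⟨r, hr⟩ := ks.isCompact.isBounded.subset_closedBall (0 : ℝ)
    refine ⟨max r 0 + 1, by positivity, fun x hx => ?_⟩
    by_contra hne
    have := hr (subset_tsupport _ hne)
    rw [mem_closedBall_zero_iff, Real.norm_eq_abs] at this
    have := le_max_left r 0
    linarith
  set Φ := fun x => ∫ y in (-M)..x, k y with hΦ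
  have Φd : ∀ x, HasDerivAt Φ (k x) x := fun x =>
    intervalIntegral.integral_hasDerivAt_right (kc.continuous.intervalIntegrable _ _)
      (kc.continuous.stronglyMeasurableAtFilter _ _) kc.continuous.continuousAt
  have dΦ : deriv Φ = k := funext fun x => (Φd x).deriv
  have Φc : ContDiff ℝ ∞ Φ := by
    rw [contDiff_infty_iff_deriv, dΦ]
    exact ⟨fun x => (Φd x).differentiableAt, kc⟩
  have Φs : HasCompactSupport Φ := by
    apply HasCompactSupport.intro (isCompact_Icc (a := -M) (b := M))
    intro x hx
    rw [mem_Icc, not_and_or, not_le, not_le] at hx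
    rcases hx with hx | hx
    · refine (intervalIntegral.integral_congr (g := fun _ => 0) fun y hy => ?_).trans (by simp)
      rw [uIcc_of_ge hx.le] at hy
      exact hM.2 y (by rw [abs_of_nonpos (by linarith [hy.2, hM.1])]; linarith [hy.2])
    · have e : ∫ y, k y = ∫ y in (-M)..x, k y := by
        rw [intervalIntegral.integral_of_le (by linarith [hM.1])]
        refine (setIntegral_eq_integral_of_forall_compl_eq_zero fun y hy => ?_).symm
        rw [mem_Ioc, not_and_or, not_lt, not_le] at hy
        apply hM.2
        rcases hy with hy | hy
        · rw [abs_of_nonpos (by linarith [hM.1])]; linarith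
        · rw [abs_of_nonneg (by linarith [hM.1])]; linarith
      rw [hΦ]; simp only
      rw [← e, k0]
  have := h Φ Φc Φs
  rw [dΦ] at this
  simp only [Pi.zero_apply, zero_mul, integral_zero, neg_zero] at this
  have i1 := integrable_mul_of_hasCompactSupport hu gc.continuous gs
  have i2 := integrable_mul_of_hasCompactSupport hu ψc.continuous ψs
  have e : ∫ x, u x * k x = (∫ x, u x * g x) - (∫ y, g y) * ∫ x, u x * ψ x := by
    rw [← integral_const_mul, ← integral_sub i1 (i2.const_mul _)]
    congr 1; funext x; simp only [hk]; ring
  rw [e] at this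
  simp only [smul_eq_mul]
  rw [integral_mul_const]
  simp only [mul_comm (g _)]
  linarith

lemma HasWeakDeriv.ae_unique {u v w : ℝ → ℝ} (hv : LocallyIntegrable v) (hw : LocallyIntegrable w)
    (h1 : HasWeakDeriv u v) (h2 : HasWeakDeriv u w) : v =ᵐ[volume] w := by
  apply ae_eq_of_integral_contDiff_smul_eq hv hw
  intro g gc gs
  have := (h1 g gc gs).symm.trans (h2 g gc gs)
  simp only [smul_eq_mul, mul_comm (g _)]
  linarith

lemma weakDeriv_spec {u : ℝ → ℝ} (h : MemH1 u) :
    MemLp (weakDeriv u) 2 volume ∧ HasWeakDeriv u (weakDeriv u) := by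
  have h2 := h.2
  rw [weakDeriv, dif_pos h2]
  exact h2.choose_spec

lemma MemH1.exists_pair {u : ℝ → ℝ} (h : MemH1 u) :
    ∃ U, H1Pair U (weakDeriv u) ∧ u =ᵐ[volume] U := by
  obtain ⟨hv, hw⟩ := weakDeriv_spec h
  set v := weakDeriv u
  have vl := locallyIntegrable_of_memLp hv
  have vi : ∀ a b, IntervalIntegrable v volume a b := fun a b =>
    (vl.integrableOn_isCompact isCompact_uIcc).intervalIntegrable
  have ul := locallyIntegrable_of_memLp h.1
  have P : IsPrim (fun x => ∫ y in (0:ℝ)..x, v y) v := ⟨vi, fun a b =>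
    (intervalIntegral.integral_interval_sub_left (vi 0 b) (vi 0 a)).symm⟩
  have Pl := P.continuous.locallyIntegrable (μ := volume)
  obtain ⟨C, hC⟩ := ae_const_of_hasWeakDeriv_zero (ul.sub Pl) (by
    intro φ hφ hs
    have hφ1 : ContDiff ℝ 1 φ := hφ.of_le (by exact_mod_cast le_top)
    have hd : Continuous (deriv φ) := hφ1.continuous_deriv le_rfl
    have e1 := hw φ hφ hs
    have e2 := P.hasWeakDeriv vl φ hφ hs
    have i1 := integrable_mul_of_hasCompactSupport ul hd hs.deriv
    have i2 := integrable_mul_of_hasCompactSupport Pl hd hs.deriv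
    simp only [Pi.sub_apply, sub_mul, Pi.zero_apply, zero_mul, integral_zero, neg_zero]
    rw [integral_sub i1 i2, e1, e2, sub_self])
  have huU : u =ᵐ[volume] fun x => C + ∫ y in (0:ℝ)..x, v y := by
    filter_upwards [hC] with x hx
    simp only [Pi.sub_apply] at hx
    linarith
  refine ⟨_, ⟨⟨vi, fun a b => ?_⟩, (memLp_congr_ae huU).1 h.1, hv⟩, huU⟩
  rw [P.integral_eq a b]; ring

lemma H1Pair.memH1 {u U V : ℝ → ℝ} (h : H1Pair U V) (hu : u =ᵐ[volume] U) :
    MemH1 u ∧ weakDeriv u =ᵐ[volume] V := by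
  have hw : HasWeakDeriv u V := by
    intro φ hφ hs
    rw [← h.1.hasWeakDeriv (locallyIntegrable_of_memLp h.3) φ hφ hs]
    apply integral_congr_ae
    filter_upwards [hu] with x hx
    rw [hx]
  have hm : MemH1 u := ⟨(memLp_congr_ae hu).2 h.2, V, h.3, hw⟩
  obtain ⟨h1, h2⟩ := weakDeriv_spec hm
  exact ⟨hm, h2.ae_unique (locallyIntegrable_of_memLp h1) (locallyIntegrable_of_memLp h.3) hw⟩

lemma H1Pair.h1Norm_eq {u U V : ℝ → ℝ} (h : H1Pair U V) (hu : u =ᵐ[volume] U) :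
    h1Norm u = nrm U V := by
  obtain ⟨_, h2⟩ := h.memH1 hu
  rw [h1Norm, nrm, sq_l2, sq_l2]
  congr 2 <;> apply integral_congr_ae
  · filter_upwards [hu] with x hx; rw [hx]
  · filter_upwards [h2] with x hx; rw [hx]

/-! ### The nonlinearity -/

namespace AdmissibleNonlinearity

variable {f : ℝ → ℝ}

lemma contDiff_three (hf : AdmissibleNonlinearity f) : ContDiff ℝ 3 f := by
  obtain ⟨k, hk, h, -⟩ := hf.smooth
  exact h.of_le (by exact_mod_cast hk)

lemma continuous (hf : AdmissibleNonlinearity f) : Continuous f := hf.contDiff_three.continuous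

lemma hasDerivAt (hf : AdmissibleNonlinearity f) (x : ℝ) : HasDerivAt f (deriv f x) x :=
  (hf.contDiff_three.differentiable (by norm_num) x).hasDerivAt

lemma contDiff_deriv (hf : AdmissibleNonlinearity f) : ContDiff ℝ 2 (deriv f) :=
  ((contDiff_succ_iff_deriv (n := 2)).1 hf.contDiff_three).2.2

lemma continuous_deriv (hf : AdmissibleNonlinearity f) : Continuous (deriv f) :=
  hf.contDiff_deriv.continuous

lemma hasDerivAt_primitive (hf : AdmissibleNonlinearity f) (x : ℝ) :
    HasDerivAt (primitive f) (f x) x :=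
  intervalIntegral.integral_hasDerivAt_right (hf.continuous.intervalIntegrable _ _)
    (hf.continuous.stronglyMeasurableAtFilter _ _) hf.continuous.continuousAt

lemma continuous_primitive (hf : AdmissibleNonlinearity f) : Continuous (primitive f) :=
  continuous_iff_continuousAt.2 fun x => (hf.hasDerivAt_primitive x).continuousAt

lemma primitive_zero : primitive f 0 = 0 := by simp [primitive]

/-- Local Lipschitz bounds for `f` and `f'`. -/
lemma exists_lipschitz (hf : AdmissibleNonlinearity f) (M : ℝ) : ∃ C > 0,
    (∀ x ∈ Icc (-M) M, |deriv f x| ≤ C) ∧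
    (∀ x ∈ Icc (-M) M, ∀ y ∈ Icc (-M) M, |f y - f x| ≤ C * |y - x|) ∧
    ∀ x ∈ Icc (-M) M, ∀ y ∈ Icc (-M) M, |deriv f y - deriv f x| ≤ C * |y - x| := by
  have h2 := hf.contDiff_deriv.continuous_deriv (by norm_num)
  obtain ⟨C1, hC1⟩ := isCompact_Icc.exists_bound_of_continuousOn
    (hf.continuous_deriv.continuousOn (s := Icc (-M) M))
  obtain ⟨C2, hC2⟩ := isCompact_Icc.exists_bound_of_continuousOn (h2.continuousOn (s := Icc (-M) M))
  refine ⟨max (max C1 C2) 1, by positivity, fun x hx => ?_, fun x hx y hy => ?_, fun x hx y hy => ?_⟩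
  · exact (hC1 x hx).trans ((le_max_left _ _).trans (le_max_left _ _))
  · refine (convex_Icc (-M) M).norm_image_sub_le_of_norm_hasDerivWithin_le
      (fun z _ => (hf.hasDerivAt z).hasDerivWithinAt) (fun z hz => ?_) hx hy
    exact (hC1 z hz).trans ((le_max_left _ _).trans (le_max_left _ _))
  · refine (convex_Icc (-M) M).norm_image_sub_le_of_norm_hasDerivWithin_le
      (fun z _ => (hf.contDiff_deriv.differentiable (by norm_num) z).hasDerivAt.hasDerivWithinAt)
      (fun z hz => ?_) hx hy
    exact (hC2 z hz).trans ((le_max_right _ _).trans (le_max_left _ _))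

/-- Second order Taylor expansions of `f` and third order ones of its primitive. -/
lemma exists_taylor (hf : AdmissibleNonlinearity f) (M : ℝ) : ∃ C > 0,
    (∀ x ∈ Icc (-M) M, ∀ y ∈ Icc (-M) M, |f y - f x - deriv f x * (y - x)| ≤ C * (y - x) ^ 2) ∧
    ∀ x ∈ Icc (-M) M, ∀ y ∈ Icc (-M) M,
      |primitive f y - primitive f x - f x * (y - x) - deriv f x / 2 * (y - x) ^ 2|
        ≤ C * |y - x| ^ 3 := by
  obtain ⟨C, hC, -, -, h⟩ := hf.exists_lipschitz M
  have A : ∀ x ∈ Icc (-M) M, ∀ y ∈ Icc (-M) M,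
      |f y - f x - deriv f x * (y - x)| ≤ C * (y - x) ^ 2 := by
    intro x hx y hy
    have hsub : uIcc x y ⊆ Icc (-M) M := uIcc_subset_Icc hx hy
    have := (convex_uIcc x y).norm_image_sub_le_of_norm_hasDerivWithin_le
      (f := fun z => f z - deriv f x * z) (C := C * |y - x|)
      (fun z _ => ((hf.hasDerivAt z).sub ((hasDerivAt_id z).const_mul _)).hasDerivWithinAt)
      (fun z hz => by
        rw [mul_one, Real.norm_eq_abs]
        refine (h x hx z (hsub hz)).trans ?_
        gcongr 1
        exact abs_sub_left_of_mem_uIcc hz)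
      left_mem_uIcc right_mem_uIcc
    rw [Real.norm_eq_abs, Real.norm_eq_abs, mul_assoc, abs_mul_abs_self] at this
    convert this using 2 <;> ring
  refine ⟨C, hC, A, fun x hx y hy => ?_⟩
  have hsub : uIcc x y ⊆ Icc (-M) M := uIcc_subset_Icc hx hy
  have := (convex_uIcc x y).norm_image_sub_le_of_norm_hasDerivWithin_le
    (f := fun z => primitive f z - f x * z - deriv f x / 2 * (z - x) ^ 2)
    (f' := fun z => f z - f x - deriv f x * (z - x))
    (C := C * |y - x| ^ 2)
    (fun z _ => by
      have h1 := ((hf.hasDerivAt_primitive z).sub ((hasDerivAt_id z).const_mul (f x))).sub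
        ((((hasDerivAt_id z).sub_const x).pow 2).const_mul (deriv f x / 2))
      refine HasDerivAt.hasDerivWithinAt (h1.congr_deriv ?_)
      simp; ring)
    (fun z hz => by
      refine (A x hx z (hsub hz)).trans ?_
      rw [← sq_abs]
      gcongr 2
      exact abs_sub_left_of_mem_uIcc hz)
    left_mem_uIcc right_mem_uIcc
  rw [Real.norm_eq_abs, Real.norm_eq_abs] at this
  refine le_of_eq_of_le ?_ (this.trans_eq ?_)
  · congr 1; ring
  · ring

end AdmissibleNonlinearity

/-! ### A Grönwall estimate for second order equations -/

/-- Grönwall for `|D''| ≤ M |D| + e`, as a bound for `D` and `D'` in terms of the data at the left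
endpoint; `e = δ = 0` gives uniqueness. -/
lemma gronwall_second_order {D D1 D2 : ℝ → ℝ} {a b M e δ : ℝ} (hM : 0 ≤ M) (he : 0 ≤ e)
    (h1 : ∀ x, HasDerivAt D (D1 x) x) (h2 : ∀ x, HasDerivAt D1 (D2 x) x)
    (h3 : ∀ x ∈ Icc a b, |D2 x| ≤ M * |D x| + e) (ha : |D a| ≤ δ) (ha1 : |D1 a| ≤ δ)
    {x : ℝ} (hx : x ∈ Icc a b) :
    |D x| ≤ (δ + e) * Real.exp ((M + 1) * (x - a)) ∧
      |D1 x| ≤ (δ + e) * Real.exp ((M + 1) * (x - a)) := by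
  have hd : ∀ x, HasDerivAt (fun x => (D x, D1 x)) (D1 x, D2 x) x := fun x => (h1 x).prodMk (h2 x)
  have key := norm_le_gronwallBound_of_norm_deriv_right_le (f := fun x => (D x, D1 x))
    (f' := fun x => (D1 x, D2 x)) (δ := δ) (K := M + 1) (ε := e) (a := a) (b := b)
    (fun x _ => (hd x).continuousAt.continuousWithinAt)
    (fun x _ => (hd x).hasDerivWithinAt)
    (by simp only [Prod.norm_def, Real.norm_eq_abs]; exact max_le ha ha1)
    (fun x hx => by
      have := h3 x ⟨hx.1, hx.2.le⟩
      simp only [Prod.norm_def, Real.norm_eq_abs]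
      have l1 := le_max_left |D x| |D1 x|
      have l2 := le_max_right |D x| |D1 x|
      have l3 := abs_nonneg (D x)
      apply max_le <;> nlinarith) x hx
  have hb : gronwallBound δ (M + 1) e (x - a) ≤ (δ + e) * Real.exp ((M + 1) * (x - a)) := by
    rw [gronwallBound_of_K_ne_0 (by positivity)]
    have : 1 ≤ Real.exp ((M + 1) * (x - a)) :=
      Real.one_le_exp (mul_nonneg (by positivity) (by linarith [hx.1]))
    have h4 : e / (M + 1) * (Real.exp ((M + 1) * (x - a)) - 1) ≤
        e * (Real.exp ((M + 1) * (x - a)) - 1) :=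
      mul_le_mul_of_nonneg_right (div_le_self he (by linarith)) (by linarith)
    linarith
  simp only [Prod.norm_def, Real.norm_eq_abs, sup_le_iff] at key
  exact ⟨key.1.trans hb, key.2.trans hb⟩

/-! ### The profile of a single solitary wave -/

namespace SolitaryWaveFamily

variable {f : ℝ → ℝ} {I₀ : Set ℝ} {Q : ℝ → ℝ → ℝ}

lemma hasDerivAt (hQ : SolitaryWaveFamily f I₀ Q) {c : ℝ} (hc : c ∈ I₀) (x : ℝ) :
    HasDerivAt (Q c) (deriv (Q c) x) x :=
  ((hQ.contDiff c hc).differentiable (by norm_num) x).hasDerivAt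

lemma continuous (hQ : SolitaryWaveFamily f I₀ Q) {c : ℝ} (hc : c ∈ I₀) : Continuous (Q c) :=
  (hQ.contDiff c hc).continuous

lemma hasDerivAt_deriv (hQ : SolitaryWaveFamily f I₀ Q) {c : ℝ} (hc : c ∈ I₀) (x : ℝ) :
    HasDerivAt (deriv (Q c)) (c * Q c x - f (Q c x)) x := by
  have h1 : ContDiff ℝ 1 (deriv (Q c)) :=
    ((contDiff_succ_iff_deriv (n := 1)).1 (hQ.contDiff c hc)).2.2
  have h2 := (h1.differentiable (by norm_num) x).hasDerivAt
  have h3 := hQ.equation c hc x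
  rw [iteratedDeriv_succ, iteratedDeriv_one] at h3
  exact h2.congr_deriv (by linarith)

lemma continuous_deriv (hQ : SolitaryWaveFamily f I₀ Q) {c : ℝ} (hc : c ∈ I₀) :
    Continuous (deriv (Q c)) :=
  continuous_iff_continuousAt.2 fun x => (hQ.hasDerivAt_deriv hc x).continuousAt

lemma deriv_neg_arg (hQ : SolitaryWaveFamily f I₀ Q) {c : ℝ} (hc : c ∈ I₀) (x : ℝ) :
    deriv (Q c) (-x) = -deriv (Q c) x := by
  have h : (fun y => Q c (-y)) = Q c := funext (hQ.even c hc)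
  have := deriv_comp_neg (Q c) x
  rw [h] at this
  linarith

lemma deriv_zero (hQ : SolitaryWaveFamily f I₀ Q) {c : ℝ} (hc : c ∈ I₀) : deriv (Q c) 0 = 0 := by
  have := hQ.deriv_neg_arg hc 0
  rw [neg_zero] at this
  linarith

/-- The conserved energy of the profile equation vanishes. -/
lemma first_integral (hQ : SolitaryWaveFamily f I₀ Q) (hf : AdmissibleNonlinearity f) {c : ℝ}
    (hc : c ∈ I₀) (x : ℝ) :
    deriv (Q c) x ^ 2 = c * Q c x ^ 2 - 2 * primitive f (Q c x) := by
  set H : ℝ → ℝ := fun x => deriv (Q c) x ^ 2 - c * Q c x ^ 2 + 2 * primitive f (Q c x) with hH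
  have Hd : ∀ x, HasDerivAt H 0 x := by
    intro x
    have h1 := hQ.hasDerivAt hc x
    have h2 := hQ.hasDerivAt_deriv hc x
    have h3 := (hf.hasDerivAt_primitive (Q c x)).comp x h1
    refine (((h2.pow 2).sub ((h1.pow 2).const_mul c)).add (h3.const_mul 2)).congr_deriv ?_
    push_cast; ring
  have Hc : ∀ x y, H x = H y := fun x y =>
    is_const_of_deriv_eq_zero (fun z => (Hd z).differentiableAt) (fun z => (Hd z).deriv) x y
  -- `H` is constant, and tends to `0` along points with small slope, one in each `[n, n + 1]`
  have hmv : ∀ n : ℕ, ∃ z ∈ Ioo (n : ℝ) (n + 1), deriv (Q c) z = Q c (n + 1) - Q c n := by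
    intro n
    obtain ⟨z, hz, e⟩ := exists_deriv_eq_slope (Q c) (a := n) (b := n + 1) (by linarith)
      (hQ.continuous hc).continuousOn
      (fun x _ => (hQ.hasDerivAt hc x).differentiableAt.differentiableWithinAt)
    exact ⟨z, hz, by rw [e]; simp⟩
  choose z hz hz' using hmv
  have zt : Tendsto z atTop atTop :=
    tendsto_atTop_mono (fun n => (hz n).1.le) tendsto_natCast_atTop_atTop
  have Qt := hQ.vanishing c hc
  have t1 : Tendsto (fun n => deriv (Q c) (z n)) atTop (𝓝 0) := by
    have a1 : Tendsto (fun n : ℕ => Q c ((n : ℝ) + 1)) atTop (𝓝 0) :=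
      Qt.comp (tendsto_atTop_add_const_right _ _ tendsto_natCast_atTop_atTop)
    have a2 : Tendsto (fun n : ℕ => Q c (n : ℝ)) atTop (𝓝 0) := Qt.comp tendsto_natCast_atTop_atTop
    simpa [hz'] using a1.sub a2
  have t2 : Tendsto (fun n => Q c (z n)) atTop (𝓝 0) := Qt.comp zt
  have t3 : Tendsto (fun n => H (z n)) atTop (𝓝 0) := by
    have a3 : Tendsto (fun n => primitive f (Q c (z n))) atTop (𝓝 0) := by
      have := (hf.continuous_primitive.tendsto 0).comp t2
      rwa [AdmissibleNonlinearity.primitive_zero] at this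
    simpa [hH] using ((t1.pow 2).sub ((t2.pow 2).const_mul c)).add (a3.const_mul 2)
  have : H x = 0 :=
    tendsto_nhds_unique (tendsto_const_nhds.congr fun n => Hc x (z n)) t3
  simp only [hH] at this
  linarith

/-- The profile is strictly decreasing on the half-line: another critical point would make it
symmetric about that point as well, hence periodic. -/
lemma deriv_neg (hQ : SolitaryWaveFamily f I₀ Q) (hf : AdmissibleNonlinearity f) {c : ℝ}
    (hc : c ∈ I₀) {x : ℝ} (hx : 0 < x) : deriv (Q c) x < 0 := by
  -- by uniqueness for the profile equation, the profile is symmetric about a critical point `y`,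
  -- so that `2 * y` is a critical point at which the maximum is attained again
  have double : ∀ y, 0 < y → deriv (Q c) y = 0 → Q c (2 * y) = Q c 0 ∧ deriv (Q c) (2 * y) = 0 := by
    intro y hy h0
    have hy2 : ∀ z, HasDerivAt (fun z => 2 * y - z) (-1) z := fun z => by
      simpa using (hasDerivAt_id z).const_sub (2 * y)
    obtain ⟨B, hB⟩ := isCompact_Icc.exists_bound_of_continuousOn
      ((hQ.continuous hc).continuousOn (s := Icc 0 (2 * y)))
    obtain ⟨C, hC, -, hL, -⟩ := hf.exists_lipschitz B
    have := gronwall_second_order (D := fun z => Q c z - Q c (2 * y - z))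
      (D1 := fun z => deriv (Q c) z + deriv (Q c) (2 * y - z))
      (D2 := fun z => (c * Q c z - f (Q c z)) - (c * Q c (2 * y - z) - f (Q c (2 * y - z))))
      (a := y) (b := 2 * y) (M := c + C) (e := 0) (δ := 0) (by have := hQ.speed_pos c hc; positivity)
      le_rfl
      (fun z => by
        exact ((hQ.hasDerivAt hc z).sub
          ((hQ.hasDerivAt hc (2 * y - z)).comp z (hy2 z))).congr_deriv (by ring))
      (fun z => by
        exact ((hQ.hasDerivAt_deriv hc z).add
          ((hQ.hasDerivAt_deriv hc (2 * y - z)).comp z (hy2 z))).congr_deriv (by ring))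
      (fun z hz => by
        have b1 := abs_le.1 (hB z ⟨by linarith [hz.1], hz.2⟩)
        have b2 := abs_le.1 (hB (2 * y - z) ⟨by linarith [hz.2], by linarith [hz.1]⟩)
        have b3 := hL _ b2 _ b1
        have hc0 := hQ.speed_pos c hc
        have e : (c * Q c z - f (Q c z)) - (c * Q c (2 * y - z) - f (Q c (2 * y - z))) =
          c * (Q c z - Q c (2 * y - z)) - (f (Q c z) - f (Q c (2 * y - z))) := by ring
        rw [e]
        refine (abs_sub _ _).trans ?_
        rw [abs_mul, abs_of_pos hc0]
        linarith)
      (by simp [two_mul]) (by simp [two_mul, h0]) (x := 2 * y) ⟨by linarith, le_rfl⟩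
    simp only [sub_self, add_zero, zero_mul, abs_nonpos_iff, hQ.deriv_zero hc] at this
    exact ⟨by linarith [this.1], this.2⟩
  -- iterating the doubling contradicts the decay
  have hne : ∀ y, 0 < y → deriv (Q c) y ≠ 0 := by
    intro y hy h0
    have all : ∀ n : ℕ, deriv (Q c) (2 ^ n * y) = 0 := by
      intro n
      induction n with
      | zero => simpa using h0
      | succ n ih =>
        have := (double _ (by positivity) ih).2
        rwa [pow_succ', mul_assoc]
    have all2 : ∀ n : ℕ, Q c (2 ^ (n + 1) * y) = Q c 0 := fun n => by
      have := (double _ (by positivity) (all n)).1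
      rwa [pow_succ', mul_assoc]
    have t : Tendsto (fun n : ℕ => (2 : ℝ) ^ (n + 1) * y) atTop atTop :=
      ((tendsto_pow_atTop_atTop_of_one_lt one_lt_two).comp
        (tendsto_add_atTop_nat 1)).atTop_mul_const hy
    have := (hQ.vanishing c hc).comp t
    simp only [Function.comp_def, all2] at this
    exact (hQ.pos c hc 0).ne' (tendsto_nhds_unique tendsto_const_nhds this)
  by_contra hcon
  have hpos : 0 < deriv (Q c) x := lt_of_le_of_ne (not_lt.1 hcon) (hne x hx).symm
  have hall : ∀ y, x ≤ y → 0 < deriv (Q c) y := by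
    intro y hy
    by_contra hn
    have hn' : deriv (Q c) y ≤ 0 := not_lt.1 hn
    obtain ⟨z, hz, hz0⟩ := intermediate_value_Icc' hy (hQ.continuous_deriv hc).continuousOn
      (show (0 : ℝ) ∈ Icc (deriv (Q c) y) (deriv (Q c) x) from ⟨hn', hpos.le⟩)
    exact hne z (hx.trans_le hz.1) hz0
  have mono : MonotoneOn (Q c) (Ici x) :=
    monotoneOn_of_deriv_nonneg (convex_Ici x) (hQ.continuous hc).continuousOn
      (fun y _ => (hQ.hasDerivAt hc y).differentiableAt.differentiableWithinAt)
      (fun y hy => by rw [interior_Ici] at hy; exact (hall y (le_of_lt hy)).le)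
  have : Q c x ≤ 0 := ge_of_tendsto (hQ.vanishing c hc)
    (by filter_upwards [eventually_ge_atTop x] with y hy using mono self_mem_Ici hy hy)
  linarith [hQ.pos c hc x]

lemma antitoneOn (hQ : SolitaryWaveFamily f I₀ Q) (hf : AdmissibleNonlinearity f) {c : ℝ}
    (hc : c ∈ I₀) : AntitoneOn (Q c) (Ici 0) :=
  antitoneOn_of_deriv_nonpos (convex_Ici 0) (hQ.continuous hc).continuousOn
    (fun y _ => (hQ.hasDerivAt hc y).differentiableAt.differentiableWithinAt)
    (fun y hy => by rw [interior_Ici] at hy; exact (hQ.deriv_neg hf hc hy).le)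

lemma apply_abs (hQ : SolitaryWaveFamily f I₀ Q) {c : ℝ} (hc : c ∈ I₀) (x : ℝ) :
    Q c |x| = Q c x := by
  rcases abs_choice x with h | h <;> rw [h]
  exact hQ.even c hc x

lemma abs_deriv_abs (hQ : SolitaryWaveFamily f I₀ Q) {c : ℝ} (hc : c ∈ I₀) (x : ℝ) :
    |deriv (Q c) (|x|)| = |deriv (Q c) x| := by
  rcases abs_choice x with h | h <;> rw [h]
  rw [hQ.deriv_neg_arg hc, abs_neg]

lemma le_apply_zero (hQ : SolitaryWaveFamily f I₀ Q) (hf : AdmissibleNonlinearity f) {c : ℝ}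
    (hc : c ∈ I₀) (x : ℝ) : Q c x ≤ Q c 0 := by
  rw [← hQ.apply_abs hc x]
  exact hQ.antitoneOn hf hc self_mem_Ici (abs_nonneg x) (abs_nonneg x)

end SolitaryWaveFamily

/-! ### Dependence of the profile on the speed -/

/-- The derivative of the profile with respect to the speed, `∂_c Q_c`. -/
def speedDeriv (Q : ℝ → ℝ → ℝ) (c x : ℝ) : ℝ := deriv (fun c' => Q c' x) c

namespace SolitaryWaveFamily

variable {f : ℝ → ℝ} {I₀ : Set ℝ} {Q : ℝ → ℝ → ℝ} {α β : ℝ}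

lemma hasDerivAt_speed (hQ : SolitaryWaveFamily f I₀ Q) {c : ℝ} (hc : c ∈ I₀) (x : ℝ) :
    HasDerivAt (fun c' => Q c' x) (speedDeriv Q c x) c :=
  ((hQ.contDiff_speed x).contDiffAt (hQ.isOpen.mem_nhds hc)).differentiableAt
    (by norm_num) |>.hasDerivAt

lemma continuousOn_speed (hQ : SolitaryWaveFamily f I₀ Q) (x : ℝ) :
    ContinuousOn (fun c => Q c x) I₀ := (hQ.contDiff_speed x).continuousOn

lemma continuousOn_speedDeriv (hQ : SolitaryWaveFamily f I₀ Q) (x : ℝ) :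
    ContinuousOn (fun c => speedDeriv Q c x) I₀ :=
  (hQ.contDiff_speed x).continuousOn_deriv_of_isOpen hQ.isOpen (by norm_num)

lemma speedDeriv_neg_arg (hQ : SolitaryWaveFamily f I₀ Q) {c : ℝ} (hc : c ∈ I₀) (x : ℝ) :
    speedDeriv Q c (-x) = speedDeriv Q c x := by
  apply Filter.EventuallyEq.deriv_eq
  filter_upwards [hQ.isOpen.mem_nhds hc] with c' hc' using hQ.even c' hc' x

lemma speedDeriv_apply_abs (hQ : SolitaryWaveFamily f I₀ Q) {c : ℝ} (hc : c ∈ I₀) (x : ℝ) :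
    speedDeriv Q c |x| = speedDeriv Q c x := by
  rcases abs_choice x with h | h <;> rw [h]
  exact hQ.speedDeriv_neg_arg hc x

lemma exists_Icc_subset (hQ : SolitaryWaveFamily f I₀ Q) {c : ℝ} (hc : c ∈ I₀) :
    ∃ α β, α < c ∧ c < β ∧ Icc α β ⊆ I₀ := by
  obtain ⟨r, hr, h⟩ := Metric.isOpen_iff.1 hQ.isOpen c hc
  refine ⟨c - r / 2, c + r / 2, by linarith, by linarith, fun x hx => h ?_⟩
  rw [Real.ball_eq_Ioo]
  exact ⟨by linarith [hx.1], by linarith [hx.2]⟩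

/-- `∂_c Q_c` is a limit of difference quotients; its continuity is only available afterwards, from
the equation that it satisfies. -/
lemma measurable_speedDeriv (hQ : SolitaryWaveFamily f I₀ Q) {c : ℝ} (hc : c ∈ I₀) :
    Measurable (speedDeriv Q c) := by
  obtain ⟨α, β, h1, h2, h3⟩ := hQ.exists_Icc_subset hc
  set δ := β - c
  set s : ℕ → ℝ := fun n => c + δ / (n + 1) with hs
  have hδ : 0 < δ := sub_pos.2 h2
  have smem : ∀ n, s n ∈ I₀ := by
    intro n
    apply h3
    have : δ / ((n : ℝ) + 1) ≤ δ := div_le_self hδ.le (by linarith [n.cast_nonneg (α := ℝ)])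
    have : 0 < δ / ((n : ℝ) + 1) := by positivity
    exact ⟨by simp only [hs]; linarith, by simp only [hs]; linarith [sub_add_cancel β c]⟩
  have st : Tendsto s atTop (𝓝[≠] c) := by
    refine tendsto_nhdsWithin_iff.2 ⟨?_, Eventually.of_forall fun n => ?_⟩
    · have : Tendsto (fun n : ℕ => δ / ((n : ℝ) + 1)) atTop (𝓝 0) :=
        tendsto_const_nhds.div_atTop (tendsto_atTop_add_const_right _ _ tendsto_natCast_atTop_atTop)
      simpa using this.const_add c
    · have : 0 < δ / ((n : ℝ) + 1) := by positivity
      simp only [hs, mem_compl_iff, mem_singleton_iff]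
      linarith
  refine measurable_of_tendsto_metrizable
    (f := fun n x => slope (fun c' => Q c' x) c (s n)) (fun n => ?_) ?_
  · simp only [slope_def_field]
    exact (((hQ.continuous (smem n)).sub (hQ.continuous hc)).div_const _).measurable
  · rw [tendsto_pi_nhds]
    exact fun x => (hasDerivAt_iff_tendsto_slope.1 (hQ.hasDerivAt_speed hc x)).comp st

/-- The profiles are uniformly bounded for speeds in a compact interval. -/
lemma exists_bound (hQ : SolitaryWaveFamily f I₀ Q) (hf : AdmissibleNonlinearity f)
    (h : Icc α β ⊆ I₀) : ∃ M > 0, ∀ c ∈ Icc α β, ∀ x, Q c x ∈ Icc (-M) M := by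
  obtain ⟨M, hM⟩ := isCompact_Icc.exists_bound_of_continuousOn ((hQ.continuousOn_speed 0).mono h)
  refine ⟨max M 1, by positivity, fun c hc x => ?_⟩
  have h1 := (abs_le.1 (hM c hc)).2
  have h2 := hQ.le_apply_zero hf (h hc) x
  have h3 := hQ.pos c (h hc) x
  have h4 := le_max_left M 1
  have h5 := le_max_right M 1
  exact ⟨by linarith, by linarith⟩

/-- On bounded sets of positions the profile and its slope are Lipschitz in the speed. -/
lemma exists_lipschitz_speed (hQ : SolitaryWaveFamily f I₀ Q) (hf : AdmissibleNonlinearity f)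
    (h : Icc α β ⊆ I₀) (X : ℝ) : ∃ C > 0, ∀ c ∈ Icc α β, ∀ c' ∈ Icc α β, ∀ x, |x| ≤ X →
      |Q c x - Q c' x| ≤ C * |c - c'| ∧ |deriv (Q c) x - deriv (Q c') x| ≤ C * |c - c'| := by
  obtain ⟨M, hM, hM'⟩ := hQ.exists_bound hf h
  obtain ⟨C, hC, -, hL, -⟩ := hf.exists_lipschitz M
  obtain ⟨C0, hC0⟩ := isCompact_Icc.exists_bound_of_continuousOn
    ((hQ.continuousOn_speedDeriv 0).mono h)
  have hδ : ∀ c ∈ Icc α β, ∀ c' ∈ Icc α β, |Q c 0 - Q c' 0| ≤ C0 * |c - c'| := by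
    intro c hc c' hc'
    exact (convex_Icc α β).norm_image_sub_le_of_norm_hasDerivWithin_le
      (fun z hz => (hQ.hasDerivAt_speed (h hz) 0).hasDerivWithinAt) hC0 hc' hc
  set E := (|C0| + M) * Real.exp ((|β| + C + 1) * X)
  refine ⟨E + 1, by positivity, fun c hc c' hc' x hx => ?_⟩
  have cpos := hQ.speed_pos c (h hc)
  have cβ : c ≤ |β| := hc.2.trans (le_abs_self β)
  have hx0 := abs_nonneg x
  have key := gronwall_second_order (D := fun z => Q c z - Q c' z)
    (D1 := fun z => deriv (Q c) z - deriv (Q c') z)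
    (D2 := fun z => (c * Q c z - f (Q c z)) - (c' * Q c' z - f (Q c' z)))
    (a := 0) (b := X) (M := |β| + C) (e := M * |c - c'|) (δ := |C0| * |c - c'|) (by positivity)
    (by positivity)
    (fun z => (hQ.hasDerivAt (h hc) z).sub (hQ.hasDerivAt (h hc') z))
    (fun z => (hQ.hasDerivAt_deriv (h hc) z).sub (hQ.hasDerivAt_deriv (h hc') z))
    (fun z hz => by
      have b := hL _ (hM' c' hc' z) _ (hM' c hc z)
      have e : (c * Q c z - f (Q c z)) - (c' * Q c' z - f (Q c' z)) =
        c * (Q c z - Q c' z) + (c - c') * Q c' z - (f (Q c z) - f (Q c' z)) := by ring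
      have b2 : |Q c' z| ≤ M := abs_le.2 (hM' c' hc' z)
      rw [e]
      refine (abs_sub _ _).trans ((add_le_add_left (abs_add_le _ _) _).trans ?_)
      rw [abs_mul, abs_of_pos cpos, abs_mul]
      have b3 : c * |Q c z - Q c' z| ≤ |β| * |Q c z - Q c' z| := by gcongr
      have b4 : |c - c'| * |Q c' z| ≤ |c - c'| * M := by gcongr
      linarith)
    ((hδ c hc c' hc').trans (by gcongr; exact le_abs_self _))
    (by rw [hQ.deriv_zero (h hc), hQ.deriv_zero (h hc'), sub_self, abs_zero]; positivity)
    (x := |x|) ⟨abs_nonneg x, hx⟩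
  have hE : (|C0| * |c - c'| + M * |c - c'|) * Real.exp ((|β| + C + 1) * (|x| - 0)) ≤
      (E + 1) * |c - c'| := by
    have : Real.exp ((|β| + C + 1) * (|x| - 0)) ≤ Real.exp ((|β| + C + 1) * X) := by
      rw [sub_zero]; gcongr
    calc (|C0| * |c - c'| + M * |c - c'|) * Real.exp ((|β| + C + 1) * (|x| - 0))
        ≤ (|C0| * |c - c'| + M * |c - c'|) * Real.exp ((|β| + C + 1) * X) := by gcongr
      _ = E * |c - c'| := by ring
      _ ≤ _ := by nlinarith [abs_nonneg (c - c')]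
  rw [hQ.apply_abs (h hc), hQ.apply_abs (h hc')] at key
  refine ⟨key.1.trans hE, le_trans (le_of_eq ?_) (key.2.trans hE)⟩
  rcases abs_choice x with h' | h' <;> rw [h']
  rw [hQ.deriv_neg_arg (h hc), hQ.deriv_neg_arg (h hc'), ← abs_neg]
  congr 1; ring

lemma deriv_eq_integral (hQ : SolitaryWaveFamily f I₀ Q) (hf : AdmissibleNonlinearity f) {c : ℝ}
    (hc : c ∈ I₀) (x : ℝ) :
    deriv (Q c) x = ∫ y in (0 : ℝ)..x, (c * Q c y - f (Q c y)) := by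
  have := hQ.continuous hc
  have := hf.continuous
  rw [intervalIntegral.integral_eq_sub_of_hasDerivAt (fun y _ => hQ.hasDerivAt_deriv hc y)
    ((by fun_prop : Continuous fun y => c * Q c y - f (Q c y)).intervalIntegrable _ _),
    hQ.deriv_zero hc, sub_zero]

lemma eq_integral_deriv (hQ : SolitaryWaveFamily f I₀ Q) {c : ℝ} (hc : c ∈ I₀) (x : ℝ) :
    Q c x = Q c 0 + ∫ y in (0 : ℝ)..x, deriv (Q c) y := by
  rw [intervalIntegral.integral_eq_sub_of_hasDerivAt (fun y _ => hQ.hasDerivAt hc y)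
    ((hQ.continuous_deriv hc).intervalIntegrable _ _)]
  ring

lemma uIoc_abs_le {x y : ℝ} (hy : y ∈ uIoc 0 x) : |y| ≤ |x| := by
  have := abs_sub_left_of_mem_uIcc (uIoc_subset_uIcc hy)
  simpa using this

/-- The family is differentiable in `c` only pointwise, so `∂_c Q_c'` has to be constructed: the
integrated profile equation is differentiated under the integral sign. -/
lemma hasDerivAt_speed_deriv_aux (hQ : SolitaryWaveFamily f I₀ Q) (hf : AdmissibleNonlinearity f)
    {c : ℝ} (hc : c ∈ I₀) (x : ℝ) :
    IntervalIntegrable (fun y => Q c y + (c - deriv f (Q c y)) * speedDeriv Q c y) volume 0 x ∧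
    HasDerivAt (fun c' => deriv (Q c') x)
      (∫ y in (0 : ℝ)..x, (Q c y + (c - deriv f (Q c y)) * speedDeriv Q c y)) c := by
  obtain ⟨α, β, h1, h2, h3⟩ := hQ.exists_Icc_subset hc
  have hs : Icc α β ∈ 𝓝 c := Icc_mem_nhds h1 h2
  obtain ⟨M, hM, hM'⟩ := hQ.exists_bound hf h3
  obtain ⟨C, hC, -, hL, -⟩ := hf.exists_lipschitz M
  obtain ⟨C1, hC1, hLs⟩ := hQ.exists_lipschitz_speed hf h3 |x|
  have hcont : ∀ c' ∈ I₀, Continuous fun y => c' * Q c' y - f (Q c' y) := fun c' hc' => by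
    have := hQ.continuous hc'
    have := hf.continuous
    fun_prop
  have key := intervalIntegral.hasDerivAt_integral_of_dominated_loc_of_lip (μ := volume)
    (F := fun c' y => c' * Q c' y - f (Q c' y))
    (F' := fun y => Q c y + (c - deriv f (Q c y)) * speedDeriv Q c y)
    (x₀ := c) (a := 0) (b := x) (bound := fun _ => |β| * C1 + M + C * C1) hs
    (by filter_upwards [hs] with c' hc' using (hcont c' (h3 hc')).aestronglyMeasurable)
    ((hcont c hc).intervalIntegrable _ _)
    (by
      have := (hQ.continuous hc).measurable
      have := hf.continuous_deriv.measurable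
      have := hQ.measurable_speedDeriv hc
      exact Measurable.aestronglyMeasurable (by fun_prop))
    (ae_of_all _ fun y hy => by
      refine LipschitzOnWith.of_dist_le_mul fun c1 hc1 c2 hc2 => ?_
      have l := (hLs c1 hc1 c2 hc2 y (uIoc_abs_le hy)).1
      have b := hL _ (hM' c2 hc2 y) _ (hM' c1 hc1 y)
      have cpos := hQ.speed_pos c1 (h3 hc1)
      have cβ : c1 ≤ |β| := hc1.2.trans (le_abs_self β)
      have e : (c1 * Q c1 y - f (Q c1 y)) - (c2 * Q c2 y - f (Q c2 y)) =
        c1 * (Q c1 y - Q c2 y) + (c1 - c2) * Q c2 y - (f (Q c1 y) - f (Q c2 y)) := by ring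
      have b2 : |Q c2 y| ≤ M := abs_le.2 (hM' c2 hc2 y)
      rw [Real.coe_nnabs, Real.dist_eq, Real.dist_eq, e,
        abs_of_nonneg (show 0 ≤ |β| * C1 + M + C * C1 by positivity)]
      refine (abs_sub _ _).trans ((add_le_add_left (abs_add_le _ _) _).trans ?_)
      rw [abs_mul, abs_of_pos cpos, abs_mul]
      have b3 : c1 * |Q c1 y - Q c2 y| ≤ |β| * (C1 * |c1 - c2|) := by gcongr
      have b4 : |c1 - c2| * |Q c2 y| ≤ |c1 - c2| * M := by gcongr
      have b5 : C * |Q c1 y - Q c2 y| ≤ C * (C1 * |c1 - c2|) := by gcongr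
      linarith)
    (by simp)
    (ae_of_all _ fun y _ => by
      have d1 := hQ.hasDerivAt_speed hc y
      have d2 := (hf.hasDerivAt (Q c y)).comp c d1
      exact (((hasDerivAt_id c).mul d1).sub d2).congr_deriv (by simp; ring))
  refine ⟨key.1, key.2.congr_of_eventuallyEq ?_⟩
  filter_upwards [hs] with c' hc' using hQ.deriv_eq_integral hf (h3 hc') x

/-- The derivative in `x` of `∂_c Q_c`. -/
def _root_.BKdV.speedDerivFlux (f : ℝ → ℝ) (Q : ℝ → ℝ → ℝ) (c x : ℝ) : ℝ :=
  ∫ y in (0 : ℝ)..x, (Q c y + (c - deriv f (Q c y)) * speedDeriv Q c y)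

lemma hasDerivAt_speed_deriv (hQ : SolitaryWaveFamily f I₀ Q) (hf : AdmissibleNonlinearity f)
    {c : ℝ} (hc : c ∈ I₀) (x : ℝ) :
    HasDerivAt (fun c' => deriv (Q c') x) (speedDerivFlux f Q c x) c :=
  (hQ.hasDerivAt_speed_deriv_aux hf hc x).2

lemma continuous_speedDerivFlux (hQ : SolitaryWaveFamily f I₀ Q) (hf : AdmissibleNonlinearity f)
    {c : ℝ} (hc : c ∈ I₀) : Continuous (speedDerivFlux f Q c) :=
  intervalIntegral.continuous_primitive (fun a b =>
    ((hQ.hasDerivAt_speed_deriv_aux hf hc a).1.symm).trans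
      (hQ.hasDerivAt_speed_deriv_aux hf hc b).1) 0

lemma speedDeriv_eq_integral (hQ : SolitaryWaveFamily f I₀ Q) (hf : AdmissibleNonlinearity f)
    {c : ℝ} (hc : c ∈ I₀) (x : ℝ) :
    speedDeriv Q c x = speedDeriv Q c 0 + ∫ y in (0 : ℝ)..x, speedDerivFlux f Q c y := by
  obtain ⟨α, β, h1, h2, h3⟩ := hQ.exists_Icc_subset hc
  have hs : Icc α β ∈ 𝓝 c := Icc_mem_nhds h1 h2
  obtain ⟨C1, hC1, hLs⟩ := hQ.exists_lipschitz_speed hf h3 |x|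
  have key := intervalIntegral.hasDerivAt_integral_of_dominated_loc_of_lip (μ := volume)
    (F := fun c' y => deriv (Q c') y) (F' := fun y => speedDerivFlux f Q c y)
    (x₀ := c) (a := 0) (b := x) (bound := fun _ => C1) hs
    (by filter_upwards [hs] with c' hc' using (hQ.continuous_deriv (h3 hc')).aestronglyMeasurable)
    ((hQ.continuous_deriv hc).intervalIntegrable _ _)
    (hQ.continuous_speedDerivFlux hf hc).aestronglyMeasurable
    (ae_of_all _ fun y hy => by
      refine LipschitzOnWith.of_dist_le_mul fun c1 hc1 c2 hc2 => ?_
      rw [Real.coe_nnabs, Real.dist_eq, Real.dist_eq, abs_of_pos hC1]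
      exact (hLs c1 hc1 c2 hc2 y (uIoc_abs_le hy)).2)
    (by simp)
    (ae_of_all _ fun y _ => hQ.hasDerivAt_speed_deriv hf hc y)
  have d := (hQ.hasDerivAt_speed hc 0).add key.2
  refine (hQ.hasDerivAt_speed hc x).unique (d.congr_of_eventuallyEq ?_)
  filter_upwards [hs] with c' hc' using hQ.eq_integral_deriv (h3 hc') x

lemma hasDerivAt_speedDeriv (hQ : SolitaryWaveFamily f I₀ Q) (hf : AdmissibleNonlinearity f)
    {c : ℝ} (hc : c ∈ I₀) (x : ℝ) : HasDerivAt (speedDeriv Q c) (speedDerivFlux f Q c x) x := by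
  have h := hQ.continuous_speedDerivFlux hf hc
  have d := (intervalIntegral.integral_hasDerivAt_right (h.intervalIntegrable 0 x)
    (h.stronglyMeasurableAtFilter _ _) h.continuousAt).const_add (speedDeriv Q c 0)
  exact d.congr_of_eventuallyEq (Eventually.of_forall fun y => hQ.speedDeriv_eq_integral hf hc y)

lemma continuous_speedDeriv (hQ : SolitaryWaveFamily f I₀ Q) (hf : AdmissibleNonlinearity f)
    {c : ℝ} (hc : c ∈ I₀) : Continuous (speedDeriv Q c) :=
  continuous_iff_continuousAt.2 fun x => (hQ.hasDerivAt_speedDeriv hf hc x).continuousAt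

/-- The equation `L_c ∂_c Q_c = -Q_c` for the derivative in the speed. -/
lemma hasDerivAt_speedDerivFlux (hQ : SolitaryWaveFamily f I₀ Q) (hf : AdmissibleNonlinearity f)
    {c : ℝ} (hc : c ∈ I₀) (x : ℝ) :
    HasDerivAt (speedDerivFlux f Q c)
      (Q c x + (c - deriv f (Q c x)) * speedDeriv Q c x) x := by
  have h : Continuous fun y => Q c y + (c - deriv f (Q c y)) * speedDeriv Q c y := by
    have := hQ.continuous hc
    have := hf.continuous_deriv
    have := hQ.continuous_speedDeriv hf hc
    fun_prop
  exact intervalIntegral.integral_hasDerivAt_right (h.intervalIntegrable 0 x)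
    (h.stronglyMeasurableAtFilter _ _) h.continuousAt

lemma hasDerivAt_deriv_deriv (hQ : SolitaryWaveFamily f I₀ Q) (hf : AdmissibleNonlinearity f)
    {c : ℝ} (hc : c ∈ I₀) (x : ℝ) :
    HasDerivAt (fun x => c * Q c x - f (Q c x)) ((c - deriv f (Q c x)) * deriv (Q c) x) x := by
  have d1 := hQ.hasDerivAt hc x
  exact ((d1.const_mul c).sub ((hf.hasDerivAt _).comp x d1)).congr_deriv (by ring)

/-- The Wronskian of `Q_c'` and `∂_c Q_c`. -/
lemma wronskian (hQ : SolitaryWaveFamily f I₀ Q) (hf : AdmissibleNonlinearity f)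
    {c : ℝ} (hc : c ∈ I₀) (x : ℝ) :
    deriv (Q c) x * speedDerivFlux f Q c x - (c * Q c x - f (Q c x)) * speedDeriv Q c x
      = Q c x ^ 2 / 2 := by
  -- the identity is the derivative in `c` of the first integral
  have d1 := hQ.hasDerivAt_speed hc x
  have d2 := hQ.hasDerivAt_speed_deriv hf hc x
  have d3 := (hf.hasDerivAt_primitive (Q c x)).comp c d1
  have l := d2.pow 2
  have r := ((hasDerivAt_id c).mul (d1.pow 2)).sub (d3.const_mul 2)
  have e := l.unique (r.congr_of_eventuallyEq ?_)
  · simp at e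
    linarith
  · filter_upwards [hQ.isOpen.mem_nhds hc] with c' hc'
    exact hQ.first_integral hf hc' x

/-- At the origin the Wronskian identity reads `-Q_c''(0) ∂_c Q_c(0) = Q_c(0)² / 2`. -/
lemma speedDeriv_zero_ne (hQ : SolitaryWaveFamily f I₀ Q) (hf : AdmissibleNonlinearity f)
    {c : ℝ} (hc : c ∈ I₀) : speedDeriv Q c 0 ≠ 0 := by
  intro h
  have := hQ.wronskian hf hc 0
  rw [h, hQ.deriv_zero hc] at this
  have := hQ.pos c hc 0
  nlinarith

end SolitaryWaveFamily

/-! ### Uniform decay of the profiles -/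

/-- The weight `(1 + x²)⁻¹` in which the decay of the profiles is measured. -/
def wt (x : ℝ) : ℝ := (1 + x ^ 2)⁻¹

lemma wt_pos (x : ℝ) : 0 < wt x := by unfold wt; positivity

lemma wt_le_one (x : ℝ) : wt x ≤ 1 := inv_le_one_of_one_le₀ (by nlinarith [sq_nonneg x])

lemma abs_mul_wt_le (x : ℝ) : |x| * wt x ≤ 1 := by
  rw [wt, ← div_eq_mul_inv, div_le_one (by positivity)]
  nlinarith [sq_abs x, sq_nonneg (|x| - 1), abs_nonneg x]

lemma integrable_wt : Integrable wt := integrable_inv_one_add_sq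

lemma continuous_wt : Continuous wt := by
  unfold wt
  exact Continuous.inv₀ (by fun_prop) fun x => by positivity

lemma memLp_wt : MemLp wt 2 volume := by
  rw [memLp_two_iff_integrable_sq continuous_wt.aestronglyMeasurable]
  refine integrable_wt.mono' (continuous_wt.pow 2).aestronglyMeasurable (ae_of_all _ fun x => ?_)
  have h1 := wt_pos x
  have h2 := wt_le_one x
  rw [Real.norm_of_nonneg (by positivity)]
  nlinarith

/-- `F(y) = o(y²)` at the origin. -/
lemma AdmissibleNonlinearity.exists_small {f : ℝ → ℝ} (hf : AdmissibleNonlinearity f) {k : ℝ}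
    (hk : 0 < k) : ∃ r > 0, ∀ y, |y| ≤ r → |primitive f y| ≤ k * y ^ 2 := by
  have h0 : ∀ᶠ y in 𝓝 (0 : ℝ), |deriv f y| < k := by
    have := hf.continuous_deriv.abs.tendsto 0
    rw [hf.deriv_zero, abs_zero] at this
    exact this.eventually (gt_mem_nhds hk)
  obtain ⟨r, hr, h⟩ := Metric.eventually_nhds_iff.1 h0
  have step : ∀ (g g' : ℝ → ℝ) (K y : ℝ), (∀ x, HasDerivAt g (g' x) x) → g 0 = 0 →
      (∀ z, |z| ≤ |y| → |g' z| ≤ K) → |g y| ≤ K * |y| := by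
    intro g g' K y hg hg0 hb
    have := (convex_uIcc 0 y).norm_image_sub_le_of_norm_hasDerivWithin_le
      (fun z _ => (hg z).hasDerivWithinAt) (fun z hz => hb z (by
        simpa using abs_sub_left_of_mem_uIcc hz)) left_mem_uIcc right_mem_uIcc
    simpa [hg0] using this
  refine ⟨r / 2, by positivity, fun y hy => ?_⟩
  have h1 : ∀ z, |z| ≤ |y| → |f z| ≤ k * |y| := fun z hz =>
    (step f (deriv f) k z hf.hasDerivAt hf.zero fun w hw =>
      (h (by rw [Real.dist_eq, sub_zero]; linarith)).le).trans (by gcongr)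
  have := step (primitive f) f (k * |y|) y hf.hasDerivAt_primitive
    AdmissibleNonlinearity.primitive_zero h1
  rwa [mul_assoc, abs_mul_abs_self, ← sq] at this

namespace SolitaryWaveFamily

variable {f : ℝ → ℝ} {I₀ : Set ℝ} {Q : ℝ → ℝ → ℝ} {α β : ℝ}

/-- Uniform vanishing at infinity. The profiles are monotone, so a bound at a single point `X` holds
on `[X, ∞)`, and it is stable under small changes of `c`. -/
lemma exists_uniform_small (hQ : SolitaryWaveFamily f I₀ Q) (hf : AdmissibleNonlinearity f)
    (h : Icc α β ⊆ I₀) {r : ℝ} (hr : 0 < r) :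
    ∃ X > 0, ∀ c ∈ Icc α β, ∀ x, X ≤ x → Q c x ≤ r := by
  apply isCompact_Icc.induction_on (p := fun s => ∃ X > 0, ∀ c ∈ s, ∀ x, X ≤ x → Q c x ≤ r)
  · exact ⟨1, one_pos, by simp⟩
  · exact fun s t hst ⟨X, hX, hh⟩ => ⟨X, hX, fun c hc => hh c (hst hc)⟩
  · rintro s t ⟨X, hX, hh⟩ ⟨Y, hY, hh'⟩
    refine ⟨max X Y, by positivity, fun c hc x hx => ?_⟩
    rcases hc with hc | hc
    · exact hh c hc x ((le_max_left _ _).trans hx)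
    · exact hh' c hc x ((le_max_right _ _).trans hx)
  · intro c hc
    have ev := ((hQ.vanishing c (h hc)).eventually (gt_mem_nhds hr)).and (eventually_gt_atTop 0)
    obtain ⟨X, hX, hX0⟩ := ev.exists
    have cont := ((hQ.continuousOn_speed X).mono h) c hc
    refine ⟨_, (cont.eventually (gt_mem_nhds hX)).and self_mem_nhdsWithin, X, hX0, ?_⟩
    rintro c' ⟨hc', hm⟩ x hx
    exact (hQ.antitoneOn hf (h hm) (le_of_lt hX0) (hX0.le.trans hx) hx).trans (le_of_lt hc')

/-- Exponential decay of the profiles, with the rate in the form `-Q_c' ≥ μ Q_c`, uniformly for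
speeds in a compact interval. -/
lemma exists_decay (hQ : SolitaryWaveFamily f I₀ Q) (hf : AdmissibleNonlinearity f)
    (h : Icc α β ⊆ I₀) (hα : 0 < α) : ∃ X > 0, ∃ μ > 0, ∃ M > 0, ∀ c ∈ Icc α β, ∀ x, X ≤ x →
      deriv (Q c) x ≤ -μ * Q c x ∧ Q c x ≤ M * Real.exp (-μ * x) := by
  obtain ⟨r, hr, hF⟩ := hf.exists_small (k := α / 4) (by positivity)
  obtain ⟨X, hX, hs⟩ := hQ.exists_uniform_small hf h hr
  set μ := Real.sqrt (α / 2)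
  have hμ : 0 < μ := Real.sqrt_pos.2 (by positivity)
  have key : ∀ c ∈ Icc α β, ∀ x, X ≤ x → deriv (Q c) x ≤ -μ * Q c x := by
    intro c hc x hx
    have q0 := hQ.pos c (h hc) x
    have := hF (Q c x) (by rw [abs_of_pos q0]; exact hs c hc x hx)
    have fi := hQ.first_integral hf (h hc) x
    have d := hQ.deriv_neg hf (h hc) (hX.trans_le hx)
    have hμ2 : μ ^ 2 = α / 2 := Real.sq_sqrt (by positivity)
    have : (μ * Q c x) ^ 2 ≤ (-deriv (Q c) x) ^ 2 := by
      rw [neg_sq, fi, mul_pow, hμ2]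
      nlinarith [(abs_le.1 this).2, hc.1, sq_nonneg (Q c x)]
    have := abs_le_of_sq_le_sq this (by linarith)
    linarith [(abs_le.1 this).2, le_abs_self (μ * Q c x)]
  refine ⟨X, hX, μ, hμ, r * Real.exp (μ * X), by positivity, fun c hc x hx => ⟨key c hc x hx, ?_⟩⟩
  have anti : AntitoneOn (fun x => Q c x * Real.exp (μ * x)) (Ici X) := by
    have d : ∀ x, HasDerivAt (fun x => Q c x * Real.exp (μ * x))
        ((deriv (Q c) x + μ * Q c x) * Real.exp (μ * x)) x := by
      intro x
      have e1 := ((hasDerivAt_id x).const_mul μ).exp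
      exact ((hQ.hasDerivAt (h hc) x).mul e1).congr_deriv (by simp; ring)
    refine antitoneOn_of_deriv_nonpos (convex_Ici X) (fun x _ => (d x).continuousAt.continuousWithinAt)
      (fun x _ => (d x).differentiableAt.differentiableWithinAt) (fun x hx => ?_)
    rw [interior_Ici] at hx
    rw [(d x).deriv]
    exact mul_nonpos_of_nonpos_of_nonneg (by linarith [key c hc x (le_of_lt hx)]) (Real.exp_pos _).le
  have h1 := anti self_mem_Ici hx hx
  simp only at h1
  have h2 : Q c X * Real.exp (μ * X) ≤ r * Real.exp (μ * X) := by
    gcongr; exact hs c hc X le_rfl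
  calc Q c x = Q c x * Real.exp (μ * x) * Real.exp (-μ * x) := by
        rw [mul_assoc, ← Real.exp_add]; simp
    _ ≤ _ := mul_le_mul_of_nonneg_right (h1.trans h2) (Real.exp_pos _).le

/-- Uniform bounds for the profiles and their derivatives in position and speed. -/
structure ProfileBounds (f : ℝ → ℝ) (Q : ℝ → ℝ → ℝ) (c A : ℝ) : Prop where
  profile : ∀ x, |Q c x| ≤ A * wt x ^ 2
  slope : ∀ x, |deriv (Q c) x| ≤ A * wt x ^ 2
  second : ∀ x, |c * Q c x - f (Q c x)| ≤ A * wt x ^ 2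
  speed : ∀ x, |speedDeriv Q c x| ≤ A * wt x ^ 2
  flux : ∀ x, |speedDerivFlux f Q c x| ≤ A * wt x ^ 2
  potential : ∀ x, |c - deriv f (Q c x)| ≤ A

/-- The weight `wt²` is `O(x⁻⁴)`, so exponential decay wins, even with a linear factor to spare. -/
lemma exists_profile_tail_bound {μ : ℝ} (hμ : 0 < μ) :
    ∃ K > 0, ∀ x, 0 ≤ x → (1 + x) * Real.exp (-μ * x) ≤ K * wt x ^ 2 := by
  refine ⟨120 / μ ^ 5 * Real.exp μ, by positivity, fun x hx => ?_⟩
  have h1 := Real.pow_div_factorial_le_exp (μ * (1 + x)) (by positivity) 5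
  have h2 : (1 + x) * (1 + x ^ 2) ^ 2 ≤ (1 + x) ^ 5 := by
    have : (1 + x ^ 2) ^ 2 ≤ ((1 + x) ^ 2) ^ 2 := by gcongr; nlinarith
    nlinarith
  have h3 : (1 + x) ^ 5 ≤ 120 / μ ^ 5 * Real.exp (μ * (1 + x)) := by
    rw [mul_pow, show ((Nat.factorial 5 : ℕ) : ℝ) = 120 by norm_num [Nat.factorial]] at h1
    rw [div_mul_eq_mul_div, le_div_iff₀ (by positivity)]
    rw [div_le_iff₀ (by norm_num)] at h1
    linarith
  have h4 : Real.exp (μ * (1 + x)) = Real.exp μ * Real.exp (μ * x) := by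
    rw [← Real.exp_add]; ring_nf
  rw [wt, inv_pow, ← div_eq_mul_inv, le_div_iff₀ (by positivity)]
  calc (1 + x) * Real.exp (-μ * x) * (1 + x ^ 2) ^ 2
      = (1 + x) * (1 + x ^ 2) ^ 2 * Real.exp (-μ * x) := by ring
    _ ≤ (120 / μ ^ 5 * Real.exp (μ * (1 + x))) * Real.exp (-μ * x) := by
        exact mul_le_mul_of_nonneg_right (h2.trans h3) (Real.exp_pos _).le
    _ = 120 / μ ^ 5 * Real.exp μ * (Real.exp (μ * x) * Real.exp (-μ * x)) := by rw [h4]; ring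
    _ = _ := by rw [← Real.exp_add]; simp

/-- The first two derivatives of the profile are controlled by the profile. -/
lemma exists_slope_le (hQ : SolitaryWaveFamily f I₀ Q) (hf : AdmissibleNonlinearity f)
    (h : Icc α β ⊆ I₀) (hα : 0 < α) (hαβ : α < β) : ∃ B1, 1 ≤ B1 ∧ ∀ c ∈ Icc α β, ∀ x,
      |deriv (Q c) x| ≤ B1 * Q c x ∧ |c * Q c x - f (Q c x)| ≤ B1 * Q c x := by
  obtain ⟨B, hB, hBb⟩ := hQ.exists_bound hf h
  obtain ⟨C, hC, -, hL, -⟩ := hf.exists_lipschitz B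
  obtain ⟨C2, hC2, -, hT⟩ := hf.exists_taylor B
  have zmem : (0 : ℝ) ∈ Icc (-B) B := ⟨by linarith, hB.le⟩
  set B1 := β + 2 * C2 * B + C + 1
  have βpos : 0 < β := hα.trans hαβ
  have hB1 : 1 ≤ B1 := by simp only [B1]; nlinarith [mul_pos hC2 hB]
  have fQ : ∀ c ∈ Icc α β, ∀ x, |f (Q c x)| ≤ C * Q c x := by
    intro c hc x
    have := hL 0 zmem _ (hBb c hc x)
    rwa [hf.zero, sub_zero, sub_zero, abs_of_pos (hQ.pos c (h hc) x)] at this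
  have s1 : ∀ c ∈ Icc α β, ∀ x, |deriv (Q c) x| ≤ B1 * Q c x := by
    intro c hc x
    have q0 := hQ.pos c (h hc) x
    apply abs_le_of_sq_le_sq _ (by positivity)
    have := hT 0 zmem _ (hBb c hc x)
    rw [AdmissibleNonlinearity.primitive_zero, hf.zero, hf.deriv_zero] at this
    simp only [sub_zero, zero_div, zero_mul, abs_of_pos q0] at this
    rw [hQ.first_integral hf (h hc)]
    have q1 := (hBb c hc x).2
    have h3 : C2 * Q c x ^ 3 ≤ C2 * B * Q c x ^ 2 := by
      have : 0 ≤ C2 * Q c x ^ 2 * (B - Q c x) := mul_nonneg (by positivity) (by linarith)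
      nlinarith
    have h4 : c * Q c x ^ 2 ≤ β * Q c x ^ 2 := by gcongr; exact hc.2
    have h5 : c * Q c x ^ 2 - 2 * primitive f (Q c x) ≤ B1 * Q c x ^ 2 := by
      simp only [B1]
      nlinarith [(abs_le.1 this).1, mul_pos hC (pow_pos q0 2), pow_pos q0 2]
    rw [mul_pow]
    have h6 : B1 * Q c x ^ 2 ≤ B1 ^ 2 * Q c x ^ 2 :=
      mul_le_mul_of_nonneg_right (by nlinarith) (sq_nonneg _)
    linarith
  have s2 : ∀ c ∈ Icc α β, ∀ x, |c * Q c x - f (Q c x)| ≤ B1 * Q c x := by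
    intro c hc x
    have q0 := hQ.pos c (h hc) x
    have cpos := hQ.speed_pos c (h hc)
    refine (abs_sub _ _).trans ?_
    rw [abs_mul, abs_of_pos q0, abs_of_pos cpos]
    have h4 : c * Q c x ≤ β * Q c x := by gcongr; exact hc.2
    have := fQ c hc x
    simp only [B1]
    nlinarith [mul_pos (mul_pos hC2 hB) q0]
  exact ⟨B1, hB1, fun c hc x => ⟨s1 c hc x, s2 c hc x⟩⟩

set_option maxHeartbeats 1000000 in
/-- Uniform bounds on compact intervals of speeds. For `∂_c Q_c` the bounds at infinity come from the
Wronskian: `(∂_c Q / Q')' = Q² / (2 Q'²)` is bounded since `-Q' ≥ μ Q`, so that `∂_c Q` is at most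
`O(1 + |x|)` times `Q'`. -/
lemma exists_profileBounds (hQ : SolitaryWaveFamily f I₀ Q) (hf : AdmissibleNonlinearity f)
    (h : Icc α β ⊆ I₀) (hα : 0 < α) (hαβ : α < β) :
    ∃ A > 0, ∀ c ∈ Ioo α β, ProfileBounds f Q c A := by
  obtain ⟨X, hX, μ, hμ, M, hM, hdec⟩ := hQ.exists_decay hf h hα
  obtain ⟨B, hB, hBb⟩ := hQ.exists_bound hf h
  obtain ⟨C, hC, hC1, -, -⟩ := hf.exists_lipschitz B
  obtain ⟨C1, hC1', hLs⟩ := hQ.exists_lipschitz_speed hf h X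
  obtain ⟨K, hK, hK'⟩ := exists_profile_tail_bound hμ
  obtain ⟨q0, hq0, hq0'⟩ : ∃ q0 > 0, ∀ c ∈ Icc α β, q0 ≤ Q c X := by
    obtain ⟨c0, hc0, hmin⟩ := isCompact_Icc.exists_isMinOn (nonempty_Icc.2 hαβ.le)
      ((hQ.continuousOn_speed X).mono h)
    exact ⟨Q c0 X, hQ.pos c0 (h hc0) X, fun c hc => hmin hc⟩
  obtain ⟨B1, hB1, hs12⟩ := hQ.exists_slope_le hf h hα hαβ
  have s1 := fun c hc x => (hs12 c hc x).1
  have s2 := fun c hc x => (hs12 c hc x).2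
  have βpos : 0 < β := hα.trans hαβ
  -- the quotient `∂_c Q / Q'` grows at most linearly
  set H := C1 / (μ * q0) + 1 / (2 * μ ^ 2)
  have hH : 0 < H := by positivity
  have s3 : ∀ c ∈ Ioo α β, ∀ x, |x| ≤ X → |speedDeriv Q c x| ≤ C1 ∧ |speedDerivFlux f Q c x| ≤ C1 := by
    intro c hc x hx
    have hn : Icc α β ∈ 𝓝 c := Icc_mem_nhds hc.1 hc.2
    have hc' : c ∈ Icc α β := Ioo_subset_Icc_self hc
    constructor
    · refine (hQ.hasDerivAt_speed (h hc') x).le_of_lip' hC1'.le ?_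
      filter_upwards [hn] with c' h' using (hLs c' h' c hc' x hx).1
    · refine (hQ.hasDerivAt_speed_deriv hf (h hc') x).le_of_lip' hC1'.le ?_
      filter_upwards [hn] with c' h' using (hLs c' h' c hc' x hx).2
  have s4 : ∀ c ∈ Ioo α β, ∀ x, X ≤ x → |speedDeriv Q c x| ≤ H * (1 + x) * |deriv (Q c) x| := by
    intro c hc x hx
    have hc' : c ∈ Icc α β := Ioo_subset_Icc_self hc
    have hd : ∀ y ∈ Icc X x, HasDerivWithinAt (fun y => speedDeriv Q c y / deriv (Q c) y)
        (Q c y ^ 2 / 2 / deriv (Q c) y ^ 2) (Icc X x) y := by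
      intro y hy
      have := (hQ.deriv_neg hf (h hc') (hX.trans_le hy.1)).ne
      refine HasDerivAt.hasDerivWithinAt (((hQ.hasDerivAt_speedDeriv hf (h hc') y).div
        (hQ.hasDerivAt_deriv (h hc') y) this).congr_deriv ?_)
      rw [← hQ.wronskian hf (h hc') y]
      ring
    have := (convex_Icc X x).norm_image_sub_le_of_norm_hasDerivWithin_le
      (C := 1 / (2 * μ ^ 2)) hd (fun y hy => by
        have q0 := hQ.pos c (h hc') y
        have d := (hdec c hc' y hy.1).1
        rw [Real.norm_of_nonneg (by positivity), div_div, div_le_div_iff₀ (by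
          have := (hQ.deriv_neg hf (h hc') (hX.trans_le hy.1)).ne
          positivity) (by positivity)]
        have : (μ * Q c y) ^ 2 ≤ deriv (Q c) y ^ 2 := by
          rw [← neg_sq (deriv (Q c) y)]
          gcongr
          linarith
        nlinarith) (left_mem_Icc.2 hx) (right_mem_Icc.2 hx)
    have hX1 : |speedDeriv Q c X / deriv (Q c) X| ≤ C1 / (μ * q0) := by
      rw [abs_div]
      have d := (hdec c hc' X le_rfl).1
      have d2 : μ * q0 ≤ |deriv (Q c) X| := by
        rw [abs_of_neg (hQ.deriv_neg hf (h hc') hX)]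
        have := mul_le_mul_of_nonneg_left (hq0' c hc') hμ.le
        linarith
      have := (s3 c hc X (by rw [abs_of_pos hX])).1
      gcongr
    have hne := (hQ.deriv_neg hf (h hc') (hX.trans_le hx)).ne
    have hq : |speedDeriv Q c x / deriv (Q c) x| ≤ H * (1 + x) := by
      rw [Real.norm_eq_abs, Real.norm_eq_abs, abs_of_nonneg (by linarith : 0 ≤ x - X)] at this
      have t := abs_sub_abs_le_abs_sub (speedDeriv Q c x / deriv (Q c) x)
        (speedDeriv Q c X / deriv (Q c) X)
      have p1 : 0 < C1 / (μ * q0) := by positivity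
      have p2 : 0 < 1 / (2 * μ ^ 2) := by positivity
      have hx0 : 0 < x := hX.trans_le hx
      have : 1 / (2 * μ ^ 2) * (x - X) ≤ 1 / (2 * μ ^ 2) * x := by gcongr; linarith
      simp only [H]
      nlinarith [mul_pos p1 hx0]
    rwa [abs_div, div_le_iff₀ (abs_pos.2 hne)] at hq
  have s5 : ∀ c ∈ Ioo α β, ∀ x, X ≤ x →
      |speedDerivFlux f Q c x| ≤ (1 / (2 * μ) + B1 * H) * ((1 + x) * (B1 * Q c x)) := by
    intro c hc x hx
    have hc' : c ∈ Icc α β := Ioo_subset_Icc_self hc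
    have q0 := hQ.pos c (h hc') x
    have hx0 : 0 < x := hX.trans_le hx
    have hneg := hQ.deriv_neg hf (h hc') hx0
    have w := hQ.wronskian hf (h hc') x
    have e : speedDerivFlux f Q c x = Q c x ^ 2 / 2 / deriv (Q c) x
        + (c * Q c x - f (Q c x)) * (speedDeriv Q c x / deriv (Q c) x) := by
      field_simp [hneg.ne]
      linarith
    have hq : |speedDeriv Q c x / deriv (Q c) x| ≤ H * (1 + x) := by
      rw [abs_div, div_le_iff₀ (abs_pos.2 hneg.ne)]
      exact s4 c hc x hx
    have hq2 : |Q c x ^ 2 / 2 / deriv (Q c) x| ≤ 1 / (2 * μ) * Q c x := by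
      rw [abs_div, abs_of_pos (by positivity : 0 < Q c x ^ 2 / 2), div_le_iff₀ (abs_pos.2 hneg.ne),
        abs_of_neg hneg]
      have := (hdec c hc' x hx).1
      have : μ * Q c x ≤ -deriv (Q c) x := by linarith
      calc Q c x ^ 2 / 2 = 1 / (2 * μ) * Q c x * (μ * Q c x) := by field_simp
        _ ≤ _ := by gcongr
    rw [e]
    refine (abs_add_le _ _).trans ?_
    rw [abs_mul]
    calc _ ≤ 1 / (2 * μ) * Q c x + B1 * Q c x * (H * (1 + x)) := by
          gcongr
          exact s2 c hc' x
      _ ≤ 1 / (2 * μ) * ((1 + x) * (B1 * Q c x)) + B1 * H * ((1 + x) * (B1 * Q c x)) := by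
          have a1 : Q c x ≤ (1 + x) * (B1 * Q c x) := by
            have : 1 * (1 * Q c x) ≤ (1 + x) * (B1 * Q c x) := by gcongr; linarith
            linarith
          have a2 : B1 * Q c x * (H * (1 + x)) = B1 * H * ((1 + x) * (1 * Q c x)) := by ring
          rw [a2]
          gcongr
      _ = _ := by ring
  -- conversion of the exponential decay into the decay of the weight
  set W := (1 + X ^ 2) ^ 2
  have hW : ∀ x, |x| ≤ X → 1 ≤ W * wt x ^ 2 := by
    intro x hx
    rw [wt, inv_pow, ← div_eq_mul_inv, one_le_div (by positivity)]
    have : x ^ 2 ≤ X ^ 2 := by rw [← sq_abs]; gcongr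
    simp only [W]
    gcongr
  set A1 := M * K + B * (1 + X) * W
  have q1 : ∀ c ∈ Icc α β, ∀ x, 0 ≤ x → (1 + x) * Q c x ≤ A1 * wt x ^ 2 := by
    intro c hc x hx
    have w0 := wt_pos x
    rcases le_total X x with hXx | hXx
    · calc (1 + x) * Q c x ≤ (1 + x) * (M * Real.exp (-μ * x)) := by
            gcongr; exact (hdec c hc x hXx).2
        _ = M * ((1 + x) * Real.exp (-μ * x)) := by ring
        _ ≤ M * (K * wt x ^ 2) := mul_le_mul_of_nonneg_left (hK' x hx) hM.le
        _ ≤ _ := by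
            have : 0 ≤ B * (1 + X) * W * wt x ^ 2 := by positivity
            have e : A1 * wt x ^ 2 = M * (K * wt x ^ 2) + B * (1 + X) * W * wt x ^ 2 := by
              simp only [A1]; ring
            linarith
    · have w1 := hW x (by rwa [abs_of_nonneg hx])
      calc (1 + x) * Q c x ≤ (1 + X) * B := by
            have := hQ.pos c (h hc) x
            gcongr
            exact (hBb c hc x).2
        _ ≤ (1 + X) * B * (W * wt x ^ 2) := le_mul_of_one_le_right (by positivity) w1
        _ ≤ _ := by
            have : 0 ≤ M * K * wt x ^ 2 := by positivity
            have e : A1 * wt x ^ 2 = M * K * wt x ^ 2 + (1 + X) * B * (W * wt x ^ 2) := by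
              simp only [A1]; ring
            linarith
  have hA1 : 0 < A1 := by positivity
  have hwabs : ∀ x, wt |x| = wt x := fun x => by simp [wt]
  set D := 1 + B1 + H * B1 + (1 / (2 * μ) + B1 * H) * B1
  have hD : 1 ≤ D := by
    have : 0 ≤ B1 + H * B1 + (1 / (2 * μ) + B1 * H) * B1 := by positivity
    simp only [D]; linarith
  have hDB : B1 ≤ D := by
    have : 0 ≤ H * B1 + (1 / (2 * μ) + B1 * H) * B1 := by positivity
    simp only [D]; linarith
  have hDH : H * B1 ≤ D := by
    have : 0 ≤ (1 / (2 * μ) + B1 * H) * B1 := by positivity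
    simp only [D]; linarith
  have hDF : (1 / (2 * μ) + B1 * H) * B1 ≤ D := by
    have : 0 ≤ H * B1 := by positivity
    simp only [D]; linarith
  set A := D * A1 + C1 * W + (β + C)
  have final : ∀ (x k : ℝ), 0 ≤ k → k ≤ D * (A1 * wt x ^ 2) → k ≤ A * wt x ^ 2 := by
    intro x k _ hk
    have : 0 ≤ (C1 * W + (β + C)) * wt x ^ 2 := by have := wt_pos x; positivity
    have e : A * wt x ^ 2 = D * (A1 * wt x ^ 2) + (C1 * W + (β + C)) * wt x ^ 2 := by
      simp only [A]; ring
    linarith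
  have finalQ : ∀ c ∈ Icc α β, ∀ x k, 0 ≤ k → k ≤ D * ((1 + |x|) * Q c x) → k ≤ A * wt x ^ 2 := by
    intro c hc x k hk0 hk
    refine final x k hk0 (hk.trans ?_)
    have := q1 c hc |x| (abs_nonneg x)
    rw [hQ.apply_abs (h hc), hwabs] at this
    gcongr
  have hone : ∀ c ∈ Icc α β, ∀ x k, 0 ≤ k → k ≤ B1 * Q c x → k ≤ A * wt x ^ 2 := by
    intro c hc x k hk0 hk
    refine finalQ c hc x k hk0 (hk.trans ?_)
    have q0 := hQ.pos c (h hc) x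
    calc B1 * Q c x ≤ D * (1 * Q c x) := by rw [one_mul]; gcongr
      _ ≤ _ := by gcongr; linarith [abs_nonneg x]
  have hin : ∀ x k, |x| ≤ X → k ≤ C1 → k ≤ A * wt x ^ 2 := by
    intro x k hx hk
    have w1 := hW x hx
    have w0 := wt_pos x
    calc k ≤ C1 := hk
      _ ≤ C1 * (W * wt x ^ 2) := le_mul_of_one_le_right hC1'.le w1
      _ ≤ _ := by
        have : 0 ≤ (D * A1 + (β + C)) * wt x ^ 2 := by positivity
        have e : A * wt x ^ 2 = C1 * (W * wt x ^ 2) + (D * A1 + (β + C)) * wt x ^ 2 := by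
          simp only [A]; ring
        linarith
  refine ⟨A, by positivity, fun c hc => ?_⟩
  have hc' : c ∈ Icc α β := Ioo_subset_Icc_self hc
  refine ⟨fun x => ?_, fun x => ?_, fun x => ?_, fun x => ?_, fun x => ?_, fun x => ?_⟩
  · have q0 := hQ.pos c (h hc') x
    refine hone c hc' x _ (abs_nonneg _) ?_
    rw [abs_of_pos q0]
    exact le_mul_of_one_le_left q0.le hB1
  · exact hone c hc' x _ (abs_nonneg _) (s1 c hc' x)
  · exact hone c hc' x _ (abs_nonneg _) (s2 c hc' x)
  · rcases le_total |x| X with hx | hx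
    · exact hin x _ hx (s3 c hc x hx).1
    · refine finalQ c hc' x _ (abs_nonneg _) ?_
      have := s4 c hc |x| hx
      rw [hQ.speedDeriv_apply_abs (h hc'), hQ.abs_deriv_abs (h hc')] at this
      have q0 := hQ.pos c (h hc') x
      calc |speedDeriv Q c x| ≤ H * (1 + |x|) * (B1 * Q c x) := by
            refine this.trans ?_
            gcongr
            exact s1 c hc' x
        _ = H * B1 * ((1 + |x|) * Q c x) := by ring
        _ ≤ _ := by gcongr
  · rcases le_total |x| X with hx | hx
    · exact hin x _ hx (s3 c hc x hx).2
    · refine finalQ c hc' x _ (abs_nonneg _) ?_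
      have := s5 c hc |x| hx
      have e : |speedDerivFlux f Q c (|x|)| = |speedDerivFlux f Q c x| := by
        rcases abs_choice x with h' | h' <;> rw [h']
        have hodd : speedDerivFlux f Q c (-x) = -speedDerivFlux f Q c x := by
          have d1 := hQ.hasDerivAt_speedDeriv hf (h hc') x
          have d2 := (hQ.hasDerivAt_speedDeriv hf (h hc') (-x)).comp x (hasDerivAt_neg x)
          have : (speedDeriv Q c ∘ Neg.neg) = speedDeriv Q c :=
            funext (hQ.speedDeriv_neg_arg (h hc'))
          rw [this] at d2
          have := d1.unique d2
          linarith
        rw [hodd, abs_neg]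
      rw [hQ.apply_abs (h hc'), e] at this
      have q0 := hQ.pos c (h hc') x
      calc |speedDerivFlux f Q c x| ≤ _ := this
        _ = (1 / (2 * μ) + B1 * H) * B1 * ((1 + |x|) * Q c x) := by ring
        _ ≤ _ := by gcongr
  · refine (abs_sub _ _).trans ?_
    rw [abs_of_pos (hQ.speed_pos c (h hc'))]
    have := hC1 _ (hBb c hc' x)
    have : 0 ≤ D * A1 + C1 * W := by positivity
    simp only [A]
    linarith [hc'.2]

end SolitaryWaveFamily

/-! ### Weighted bounds, momentum and energy of the profiles -/

section Weight

variable {g : ℝ → ℝ} {A : ℝ}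

lemma wt_sq_le (x : ℝ) : wt x ^ 2 ≤ wt x := by
  nlinarith [wt_pos x, wt_le_one x]

lemma nonneg_of_wt (h : ∀ x, |g x| ≤ A * wt x) : 0 ≤ A := by
  have := (abs_nonneg _).trans (h 0)
  exact nonneg_of_mul_nonneg_left this (wt_pos 0)

lemma integrable_of_wt (hg : AEStronglyMeasurable g volume) (h : ∀ x, |g x| ≤ A * wt x) :
    Integrable g :=
  (integrable_wt.const_mul A).mono' hg (ae_of_all _ h)

lemma abs_le_abs_of_wt (h : ∀ x, |g x| ≤ A * wt x) (x : ℝ) : |g x| ≤ |A * wt x| :=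
  (h x).trans (le_abs_self _)

lemma memLp_of_wt (hg : AEStronglyMeasurable g volume) (h : ∀ x, |g x| ≤ A * wt x) :
    MemLp g 2 volume :=
  memLp_of_abs_le (memLp_wt.const_mul A) hg (abs_le_abs_of_wt h)

lemma l2_le_of_wt (h : ∀ x, |g x| ≤ A * wt x) : l2 g ≤ A * l2 wt := by
  have := l2_mono (memLp_wt.const_mul A) (abs_le_abs_of_wt h)
  rwa [l2_const_mul, abs_of_nonneg (nonneg_of_wt h)] at this

lemma le_wt_of_le_sq (h : ∀ x, |g x| ≤ A * wt x ^ 2) (x : ℝ) : |g x| ≤ A * wt x := by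
  have hA : 0 ≤ A := nonneg_of_mul_nonneg_left ((abs_nonneg _).trans (h 0)) (by
    have := wt_pos 0; positivity)
  exact (h x).trans (mul_le_mul_of_nonneg_left (wt_sq_le x) hA)

lemma mul_wt_bound {g' : ℝ → ℝ} {A' : ℝ} (h : ∀ x, |g x| ≤ A * wt x)
    (h' : ∀ x, |g' x| ≤ A' * wt x) (x : ℝ) : |g x * g' x| ≤ A * A' * wt x := by
  have hA := nonneg_of_wt h
  have hA' := nonneg_of_wt h'
  have w := wt_pos x
  rw [abs_mul]
  calc |g x| * |g' x| ≤ (A * wt x) * (A' * wt x) := by gcongr; exacts [h x, h' x]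
    _ = A * A' * wt x ^ 2 := by ring
    _ ≤ _ := by gcongr; exact wt_sq_le x

end Weight

/-- The derivative of the momentum of the solitary wave with respect to the speed. -/
def momentumDeriv (Q : ℝ → ℝ → ℝ) (c : ℝ) : ℝ := ∫ x, Q c x * speedDeriv Q c x

/-- The energy `∫ (½ v_x² - F(v))` of the profile of speed `c`. -/
def profileEnergy (f : ℝ → ℝ) (Q : ℝ → ℝ → ℝ) (c : ℝ) : ℝ :=
  ∫ x, (1 / 2 * deriv (Q c) x ^ 2 - primitive f (Q c x))

namespace SolitaryWaveFamily

variable {f : ℝ → ℝ} {I₀ : Set ℝ} {Q : ℝ → ℝ → ℝ} {α β c A : ℝ}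

lemma h1Pair (hQ : SolitaryWaveFamily f I₀ Q) (hc : c ∈ I₀) (hb : ProfileBounds f Q c A) :
    H1Pair (Q c) (deriv (Q c)) :=
  ⟨.of_hasDerivAt (hQ.hasDerivAt hc) (hQ.continuous_deriv hc),
    memLp_of_wt (hQ.continuous hc).aestronglyMeasurable (le_wt_of_le_sq hb.profile),
    memLp_of_wt (hQ.continuous_deriv hc).aestronglyMeasurable (le_wt_of_le_sq hb.slope)⟩

lemma continuous_second (hQ : SolitaryWaveFamily f I₀ Q) (hf : AdmissibleNonlinearity f)
    (hc : c ∈ I₀) : Continuous fun x => c * Q c x - f (Q c x) := by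
  have := hQ.continuous hc
  have := hf.continuous
  fun_prop

lemma h1Pair_slope (hQ : SolitaryWaveFamily f I₀ Q) (hf : AdmissibleNonlinearity f) (hc : c ∈ I₀)
    (hb : ProfileBounds f Q c A) : H1Pair (deriv (Q c)) (fun x => c * Q c x - f (Q c x)) :=
  ⟨.of_hasDerivAt (hQ.hasDerivAt_deriv hc) (hQ.continuous_second hf hc),
    (hQ.h1Pair hc hb).3,
    memLp_of_wt (hQ.continuous_second hf hc).aestronglyMeasurable (le_wt_of_le_sq hb.second)⟩

lemma h1Pair_speed (hQ : SolitaryWaveFamily f I₀ Q) (hf : AdmissibleNonlinearity f) (hc : c ∈ I₀)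
    (hb : ProfileBounds f Q c A) : H1Pair (speedDeriv Q c) (speedDerivFlux f Q c) :=
  ⟨.of_hasDerivAt (hQ.hasDerivAt_speedDeriv hf hc) (hQ.continuous_speedDerivFlux hf hc),
    memLp_of_wt (hQ.continuous_speedDeriv hf hc).aestronglyMeasurable (le_wt_of_le_sq hb.speed),
    memLp_of_wt (hQ.continuous_speedDerivFlux hf hc).aestronglyMeasurable (le_wt_of_le_sq hb.flux)⟩

lemma exists_nhds_bounds (hQ : SolitaryWaveFamily f I₀ Q) (hf : AdmissibleNonlinearity f)
    (hc : c ∈ I₀) : ∃ α β, α < c ∧ c < β ∧ Icc α β ⊆ I₀ ∧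
      ∃ A > 0, ∀ c' ∈ Ioo α β, ProfileBounds f Q c' A := by
  obtain ⟨α, β, h1, h2, h3⟩ := hQ.exists_Icc_subset hc
  obtain ⟨A, hA, hb⟩ := hQ.exists_profileBounds hf h3
    (hQ.speed_pos α (h3 (left_mem_Icc.2 (h1.trans h2).le))) (h1.trans h2)
  exact ⟨α, β, h1, h2, h3, A, hA, hb⟩

lemma hasDerivAt_momentum (hQ : SolitaryWaveFamily f I₀ Q) (hf : AdmissibleNonlinearity f)
    (hc : c ∈ I₀) : HasDerivAt (fun c => momentum (Q c)) (momentumDeriv Q c) c := by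
  obtain ⟨α, β, h1, h2, h3, A, hA, hb⟩ := hQ.exists_nhds_bounds hf hc
  have hs : Ioo α β ∈ 𝓝 c := Ioo_mem_nhds h1 h2
  have hs' : ∀ c' ∈ Ioo α β, c' ∈ I₀ := fun c' h => h3 (Ioo_subset_Icc_self h)
  have := (hasDerivAt_integral_of_dominated_loc_of_deriv_le (μ := volume)
    (F := fun c x => Q c x ^ 2) (F' := fun c x => 2 * (Q c x * speedDeriv Q c x)) (x₀ := c)
    (bound := fun x => 2 * (A * A * wt x)) hs
    (by filter_upwards [hs] with c' h using ((hQ.continuous (hs' c' h)).pow 2).aestronglyMeasurable)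
    (hQ.h1Pair hc (hb c ⟨h1, h2⟩)).2.integrable_sq
    (((hQ.continuous hc).mul (hQ.continuous_speedDeriv hf hc)).const_mul 2).aestronglyMeasurable
    (ae_of_all _ fun x c' h => by
      rw [Real.norm_eq_abs, abs_mul, abs_two]
      gcongr
      exact mul_wt_bound (le_wt_of_le_sq (hb c' h).profile) (le_wt_of_le_sq (hb c' h).speed) x)
    ((integrable_wt.const_mul _).const_mul _)
    (ae_of_all _ fun x c' h =>
      ((hQ.hasDerivAt_speed (hs' c' h) x).pow 2).congr_deriv (by push_cast; ring))).2
  refine (this.const_mul (1 / 2)).congr_deriv ?_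
  rw [integral_const_mul, momentumDeriv]
  ring

lemma continuousAt_momentumDeriv (hQ : SolitaryWaveFamily f I₀ Q) (hf : AdmissibleNonlinearity f)
    (hc : c ∈ I₀) : ContinuousAt (momentumDeriv Q) c := by
  obtain ⟨α, β, h1, h2, h3, A, hA, hb⟩ := hQ.exists_nhds_bounds hf hc
  have hs : Ioo α β ∈ 𝓝 c := Ioo_mem_nhds h1 h2
  have hs' : ∀ c' ∈ Ioo α β, c' ∈ I₀ := fun c' h => h3 (Ioo_subset_Icc_self h)
  refine continuousAt_of_dominated (bound := fun x => A * A * wt x) ?_ ?_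
    (integrable_wt.const_mul _) (ae_of_all _ fun x => ?_)
  · filter_upwards [hs] with c' h using ((hQ.continuous (hs' c' h)).mul
      (hQ.continuous_speedDeriv hf (hs' c' h))).aestronglyMeasurable
  · filter_upwards [hs] with c' h using ae_of_all _ fun x =>
      mul_wt_bound (le_wt_of_le_sq (hb c' h).profile) (le_wt_of_le_sq (hb c' h).speed) x
  · have hn := hQ.isOpen.mem_nhds hc
    exact ((hQ.continuousOn_speed x).continuousAt hn).mul
      ((hQ.continuousOn_speedDeriv x).continuousAt hn)

/-- The derivative of the energy is `-c` times the derivative of the momentum: the profile is a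
critical point of the energy at fixed momentum, with multiplier `c`. -/
lemma hasDerivAt_profileEnergy (hQ : SolitaryWaveFamily f I₀ Q) (hf : AdmissibleNonlinearity f)
    (hc : c ∈ I₀) : HasDerivAt (profileEnergy f Q) (-c * momentumDeriv Q c) c := by
  obtain ⟨α, β, h1, h2, h3, A, hA, hb⟩ := hQ.exists_nhds_bounds hf hc
  have hs : Ioo α β ∈ 𝓝 c := Ioo_mem_nhds h1 h2
  have hs' : ∀ c' ∈ Ioo α β, c' ∈ I₀ := fun c' h => h3 (Ioo_subset_Icc_self h)
  have hc' : c ∈ Ioo α β := ⟨h1, h2⟩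
  have hbc := hb c hc'
  have hβ : 0 < β := (hQ.speed_pos c hc).trans h2
  -- `f (Q c x)` is bounded by the weight through the equation
  have hfb : ∀ c' ∈ Ioo α β, ∀ x, |f (Q c' x)| ≤ (β * A + A) * wt x := by
    intro c' h x
    have e : f (Q c' x) = c' * Q c' x - (c' * Q c' x - f (Q c' x)) := by ring
    have cpos := hQ.speed_pos c' (hs' c' h)
    rw [e]
    refine (abs_sub _ _).trans ?_
    rw [abs_mul, abs_of_pos cpos, add_mul, mul_assoc]
    gcongr
    · exact h.2.le
    · exact le_wt_of_le_sq (hb c' h).profile x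
    · exact le_wt_of_le_sq (hb c' h).second x
  have hint : Integrable fun x => 1 / 2 * deriv (Q c) x ^ 2 - primitive f (Q c x) := by
    have e : (fun x => 1 / 2 * deriv (Q c) x ^ 2 - primitive f (Q c x)) =
        fun x => deriv (Q c) x ^ 2 - c / 2 * Q c x ^ 2 := by
      funext x
      have := hQ.first_integral hf hc x
      linarith
    rw [e]
    exact (hQ.h1Pair hc hbc).3.integrable_sq.sub ((hQ.h1Pair hc hbc).2.integrable_sq.const_mul _)
  have key := (hasDerivAt_integral_of_dominated_loc_of_deriv_le (μ := volume)
    (F := fun c x => 1 / 2 * deriv (Q c) x ^ 2 - primitive f (Q c x))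
    (F' := fun c x => deriv (Q c) x * speedDerivFlux f Q c x - f (Q c x) * speedDeriv Q c x)
    (x₀ := c) (bound := fun x => A * A * wt x + (β * A + A) * A * wt x) hs
    (by
      filter_upwards [hs] with c' h
      have h1 := hQ.continuous (hs' c' h)
      have h2 := hQ.continuous_deriv (hs' c' h)
      have h3 := hf.continuous_primitive
      exact Continuous.aestronglyMeasurable (by fun_prop))
    hint
    (by
      have h1 := hQ.continuous hc
      have h2 := hQ.continuous_deriv hc
      have h3 := hf.continuous
      have h4 := hQ.continuous_speedDeriv hf hc
      have h5 := hQ.continuous_speedDerivFlux hf hc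
      exact Continuous.aestronglyMeasurable (by fun_prop))
    (ae_of_all _ fun x c' h => by
      refine (abs_sub _ _).trans (add_le_add ?_ ?_)
      · exact mul_wt_bound (le_wt_of_le_sq (hb c' h).slope) (le_wt_of_le_sq (hb c' h).flux) x
      · exact mul_wt_bound (hfb c' h) (le_wt_of_le_sq (hb c' h).speed) x)
    ((integrable_wt.const_mul _).add (integrable_wt.const_mul _))
    (ae_of_all _ fun x c' h => by
      have d1 := (hQ.hasDerivAt_speed_deriv hf (hs' c' h) x).pow 2
      have d2 := (hf.hasDerivAt_primitive (Q c' x)).comp c' (hQ.hasDerivAt_speed (hs' c' h) x)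
      exact ((d1.const_mul (1 / 2)).sub d2).congr_deriv (by push_cast; ring))).2
  refine key.congr_deriv ?_
  have p1 := hQ.h1Pair_slope hf hc hbc
  have p2 := hQ.h1Pair_speed hf hc hbc
  have p0 := hQ.h1Pair hc hbc
  have ibp := integral_mul_eq_neg p2.1 p1.1 (integrable_mul p2.2 p1.2) (integrable_mul p2.3 p1.2)
    (integrable_mul p2.2 p1.3)
  have i1 : Integrable fun x => deriv (Q c) x * speedDerivFlux f Q c x := integrable_mul p1.2 p2.3
  have i2 : Integrable fun x => f (Q c x) * speedDeriv Q c x :=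
    integrable_of_wt (Continuous.aestronglyMeasurable (by
      have h1 := hQ.continuous hc
      have h3 := hf.continuous
      have h4 := hQ.continuous_speedDeriv hf hc
      fun_prop)) (mul_wt_bound (hfb c hc') (le_wt_of_le_sq hbc.speed))
  have i3 : Integrable fun x => Q c x * speedDeriv Q c x := integrable_mul p0.2 p2.2
  rw [integral_sub i1 i2]
  have e1 : ∫ x, deriv (Q c) x * speedDerivFlux f Q c x =
      ∫ x, speedDerivFlux f Q c x * deriv (Q c) x := by congr 1; funext x; ring
  have e2 : ∫ x, speedDeriv Q c x * (c * Q c x - f (Q c x)) =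
      c * (∫ x, Q c x * speedDeriv Q c x) - ∫ x, f (Q c x) * speedDeriv Q c x := by
    rw [← integral_const_mul, ← integral_sub (i3.const_mul c) i2]
    congr 1; funext x; ring
  rw [e1, ibp, e2, momentumDeriv]
  ring

/-- Weighted Lipschitz dependence of the profile and its slope on the speed. -/
lemma lipschitz_wt (hQ : SolitaryWaveFamily f I₀ Q) (hf : AdmissibleNonlinearity f) {s : Set ℝ}
    (hs : Convex ℝ s) (hs' : s ⊆ I₀) (hb : ∀ c ∈ s, ProfileBounds f Q c A) {c c' : ℝ} (hc : c ∈ s)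
    (hc' : c' ∈ s) (x : ℝ) :
    |Q c x - Q c' x| ≤ A * |c - c'| * wt x ^ 2 ∧
      |deriv (Q c) x - deriv (Q c') x| ≤ A * |c - c'| * wt x ^ 2 := by
  constructor
  · have := hs.norm_image_sub_le_of_norm_hasDerivWithin_le
      (fun z hz => (hQ.hasDerivAt_speed (hs' hz) x).hasDerivWithinAt)
      (fun z hz => (hb z hz).speed x) hc' hc
    simp only [Real.norm_eq_abs] at this
    linarith
  · have := hs.norm_image_sub_le_of_norm_hasDerivWithin_le
      (fun z hz => (hQ.hasDerivAt_speed_deriv hf (hs' hz) x).hasDerivWithinAt)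
      (fun z hz => (hb z hz).flux x) hc' hc
    simp only [Real.norm_eq_abs] at this
    linarith

end SolitaryWaveFamily

/-! ### Coercivity of the second variation -/

/-- The quadratic form `∫ (ξ_x² + (c - f'(Q_c)) ξ²)` of the linearised operator `L_c`, where `η` is
the derivative of `ξ`. -/
def quadForm (f : ℝ → ℝ) (Q : ℝ → ℝ → ℝ) (c : ℝ) (ξ η : ℝ → ℝ) : ℝ :=
  ∫ x, (η x ^ 2 + (c - deriv f (Q c x)) * ξ x ^ 2)

/-- Completing the square with a solution `q` of a Riccati inequality. -/
lemma riccati_le {z z' W q q' : ℝ → ℝ} {a b k : ℝ} (hab : a ≤ b) (hz : H1Pair z z')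
    (hW : Continuous W) (hq : ∀ x ∈ Icc a b, HasDerivAt q (q' x) x)
    (hq' : ContinuousOn q' (Icc a b)) (hk : ∀ x ∈ Icc a b, k ≤ W x - q' x - q x ^ 2) :
    k * (∫ x in a..b, z x ^ 2) + (q b * z b ^ 2 - q a * z a ^ 2) ≤
      ∫ x in a..b, (z' x ^ 2 + W x * z x ^ 2) := by
  set p := IccExtend hab (domRestrict (Icc a b) q') with hp
  have hpc : Continuous p := (continuousOn_iff_continuous_domRestrict.1 hq').Icc_extend'
  have hpe : ∀ x ∈ Icc a b, p x = q' x := fun x hx => by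
    rw [hp, IccExtend_of_mem _ _ hx, domRestrict_apply]
  set P : ℝ → ℝ := fun x => q a + ∫ y in a..x, p y with hP
  have hPd : ∀ x, HasDerivAt P (p x) x := fun x =>
    (intervalIntegral.integral_hasDerivAt_right (hpc.intervalIntegrable _ _)
      (hpc.stronglyMeasurableAtFilter _ _) hpc.continuousAt).const_add _
  have hPp : IsPrim P p := .of_hasDerivAt hPd hpc
  have hPe : ∀ x ∈ Icc a b, P x = q x := by
    intro x hx
    have hsub : uIcc a x ⊆ Icc a b := by
      rw [uIcc_of_le hx.1]; exact Icc_subset_Icc_right hx.2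
    have := intervalIntegral.integral_eq_sub_of_hasDerivAt (a := a) (b := x) (f := q) (f' := p)
      (fun y hy => by rw [hpe y (hsub hy)]; exact hq y (hsub hy)) (hpc.intervalIntegrable _ _)
    simp only [hP, this]
    ring
  have prim := hPp.mul (hz.1.mul hz.1)
  have e := prim.integral_eq a b
  rw [hPe a (left_mem_Icc.2 hab), hPe b (right_mem_Icc.2 hab)] at e
  have zc := hz.1.continuous
  have i1 : IntervalIntegrable (fun x => z' x ^ 2 + W x * z x ^ 2) volume a b :=
    hz.3.integrable_sq.intervalIntegrable.add
      ((hW.mul (zc.pow 2)).intervalIntegrable _ _)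
  have i2 : IntervalIntegrable (fun x => k * z x ^ 2) volume a b :=
    (continuous_const.mul (zc.pow 2)).intervalIntegrable _ _
  have i3 := prim.intervalIntegrable a b
  rw [← intervalIntegral.integral_const_mul, sq (z b), sq (z a), ← e,
    ← intervalIntegral.integral_add i2 i3]
  refine intervalIntegral.integral_mono_on hab (i2.add i3) i1 fun x hx => ?_
  rw [hpe x hx, hPe x hx]
  have := mul_le_mul_of_nonneg_right (hk x hx) (sq_nonneg (z x))
  nlinarith [sq_nonneg (z' x - q x * z x)]

namespace SolitaryWaveFamily

variable {f : ℝ → ℝ} {I₀ : Set ℝ} {Q : ℝ → ℝ → ℝ} {c A : ℝ}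

/-- On the half-line, for functions vanishing at the origin, the quadratic form controls the
distance to the line spanned by `Q_c'`. -/
lemma exists_half_line_coercive (hQ : SolitaryWaveFamily f I₀ Q) (hf : AdmissibleNonlinearity f)
    (hc : c ∈ I₀) (hA : 0 < A) (hb : ProfileBounds f Q c A) :
    ∃ k > 0, ∀ ζ ζ' : ℝ → ℝ, H1Pair ζ ζ' → ζ 0 = 0 → ∃ a : ℝ,
      k * (∫ x in Ioi 0, (ζ x - a * deriv (Q c) x) ^ 2) ≤
        ∫ x in Ioi 0, (ζ' x ^ 2 + (c - deriv f (Q c x)) * ζ x ^ 2) := by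
  set q1 := deriv (Q c) with hq1
  set q2 := fun x => c * Q c x - f (Q c x) with hq2
  set V := fun x => c - deriv f (Q c x) with hV
  have Vc : Continuous V := by
    have := hQ.continuous hc
    have := hf.continuous_deriv
    fun_prop
  have d0 : ∀ x, HasDerivAt (Q c) (q1 x) x := hQ.hasDerivAt hc
  have d1 : ∀ x, HasDerivAt q1 (q2 x) x := hQ.hasDerivAt_deriv hc
  have d2 : ∀ x, HasDerivAt q2 (V x * q1 x) x := hQ.hasDerivAt_deriv_deriv hf hc
  have q1c : Continuous q1 := hQ.continuous_deriv hc
  have q2c : Continuous q2 := hQ.continuous_second hf hc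
  have q1neg : ∀ x, 0 < x → q1 x < 0 := fun x hx => hQ.deriv_neg hf hc hx
  have q1z : q1 0 = 0 := hQ.deriv_zero hc
  have Qpos := hQ.pos c hc
  obtain ⟨α, β, h1, h2, h3⟩ := hQ.exists_Icc_subset hc
  have hα : 0 < α := hQ.speed_pos α (h3 (left_mem_Icc.2 (h1.trans h2).le))
  have hcm : c ∈ Icc α β := ⟨h1.le, h2.le⟩
  obtain ⟨B1, hB1, hs⟩ := hQ.exists_slope_le hf h3 hα (h1.trans h2)
  obtain ⟨X, hX, μ, hμ, M, hM, hdec⟩ := hQ.exists_decay hf h3 hα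
  -- the interval `[0, x1]` is so short that the potential is dominated by the kinetic term
  set x1 := 1 / (2 * (A + 1)) with hx1
  have x1pos : 0 < x1 := by positivity
  obtain ⟨M1, hM1, hM1'⟩ : ∃ M1 > 0, ∀ x, x1 ≤ x → Q c x ≤ M1 * |q1 x| := by
    obtain ⟨N, hN⟩ := isCompact_Icc.exists_bound_of_continuousOn (s := Icc x1 X)
      (f := fun x => Q c x / |q1 x|)
      ((hQ.continuous hc).continuousOn.div q1c.abs.continuousOn fun x hx =>
        (abs_pos.2 (q1neg x (x1pos.trans_le hx.1)).ne).ne')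
    refine ⟨max N (1 / μ), by positivity, fun x hx => ?_⟩
    have hpos : 0 < |q1 x| := abs_pos.2 (q1neg x (x1pos.trans_le hx)).ne
    rw [← div_le_iff₀ hpos]
    rcases le_total x X with hxX | hxX
    · exact (le_abs_self _).trans ((hN x ⟨hx, hxX⟩).trans (le_max_left _ _))
    · refine le_trans ?_ (le_max_right _ _)
      rw [div_le_div_iff₀ hpos hμ, one_mul, abs_of_neg (q1neg x (x1pos.trans_le hx))]
      linarith [(hdec c hcm x hxX).1]
  -- the choice of `k` ensures `k * y ^ 3 ≤ 1` for the quotient `y = Q / |Q'| ≤ M1` below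
  set k := 1 / M1 ^ 3 with hk
  have kpos : 0 < k := by positivity
  set k0 := min 1 (k / B1) with hk0
  have k0pos : 0 < k0 := lt_min one_pos (by positivity)
  refine ⟨k0, k0pos, fun ζ ζ' hζ hζ0 => ?_⟩
  -- with this `a` the function `z = ζ - a * Q'` vanishes at `x1`, which decouples the two intervals
  set a := ζ x1 / q1 x1 with ha
  refine ⟨a, ?_⟩
  have hq : H1Pair q1 q2 := hQ.h1Pair_slope hf hc hb
  set z := fun x => ζ x - a * q1 x with hz
  set z' := fun x => ζ' x - a * q2 x with hz'
  have hzp : H1Pair z z' := hζ.sub (hq.const_mul a)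
  have hz0 : z 0 = 0 := by simp [hz, hζ0, q1z]
  have hzx1 : z x1 = 0 := by
    simp only [hz, ha]
    rw [div_mul_cancel₀ _ (q1neg x1 x1pos).ne, sub_self]
  have iV : ∀ {u v : ℝ → ℝ}, MemLp u 2 volume → MemLp v 2 volume →
      Integrable fun x => V x * (u x * v x) := fun hu hv =>
    (integrable_mul hu hv).bdd_mul (c := A) Vc.aestronglyMeasurable (ae_of_all _ hb.potential)
  have iz : Integrable fun x => z' x ^ 2 + V x * z x ^ 2 := by
    simp only [sq]; exact (integrable_mul hzp.3 hzp.3).add (iV hzp.2 hzp.2)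
  have iζ : Integrable fun x => ζ' x ^ 2 + V x * ζ x ^ 2 := by
    simp only [sq]; exact (integrable_mul hζ.3 hζ.3).add (iV hζ.2 hζ.2)
  -- the form does not change when a multiple of `Q'` is subtracted
  have same : ∫ x in Ioi 0, (ζ' x ^ 2 + V x * ζ x ^ 2) =
      ∫ x in Ioi 0, (z' x ^ 2 + V x * z x ^ 2) := by
    have P := ((hzp.1.const_mul (2 * a)).mul
      (IsPrim.of_hasDerivAt d2 (Vc.mul q1c))).add
      ((hq.1.const_mul (a ^ 2)).mul (IsPrim.of_hasDerivAt d2 (Vc.mul q1c)))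
    have iP1 : Integrable fun x => 2 * a * z x * q2 x + a ^ 2 * q1 x * q2 x := by
      simp only [mul_assoc]
      exact (((integrable_mul hzp.2 hq.3).const_mul _).const_mul _).add
        ((integrable_mul hq.2 hq.3).const_mul _)
    have iP2 : Integrable fun x => 2 * a * z' x * q2 x + 2 * a * z x * (V x * q1 x) +
        (a ^ 2 * q2 x * q2 x + a ^ 2 * q1 x * (V x * q1 x)) := by
      have j1 := (integrable_mul hzp.3 hq.3).const_mul (2 * a)
      have j2 := (iV hzp.2 hq.2).const_mul (2 * a)
      have j3 := (integrable_mul hq.3 hq.3).const_mul (a ^ 2)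
      have j4 := (iV hq.2 hq.2).const_mul (a ^ 2)
      refine ((j1.add j2).add (j3.add j4)).congr (ae_of_all _ fun x => ?_)
      simp only [Pi.add_apply]; ring
    have e := P.integral_Ioi (a := 0) iP1.integrableOn iP2.integrableOn
    simp only [hz0, q1z, mul_zero, zero_mul, add_zero, neg_zero] at e
    have e' := integral_add (μ := volume.restrict (Ioi 0)) iz.integrableOn iP2.integrableOn
    rw [e, add_zero] at e'
    rw [← e']
    congr 1; funext x; simp only [hz, hz']; ring
  rw [same]
  -- the two Riccati estimates
  have part1 : k0 * (∫ x in (0 : ℝ)..x1, z x ^ 2) ≤ ∫ x in (0 : ℝ)..x1, (z' x ^ 2 + V x * z x ^ 2) := by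
    have := riccati_le (z := z) (z' := z') (W := V) (q := fun x => -(2 * (A + 1)) * x)
      (q' := fun _ => -(2 * (A + 1))) (a := 0) (b := x1) (k := k0) x1pos.le hzp Vc
      (fun x _ => by simpa using (hasDerivAt_id x).const_mul (-(2 * (A + 1))))
      continuousOn_const (fun x hx => by
        have v := (abs_le.1 (hb.potential x)).1
        have l := min_le_left 1 (k / B1)
        have hx2 : (2 * (A + 1)) * x ≤ 1 := by
          have := mul_le_mul_of_nonneg_left hx.2 (by positivity : 0 ≤ 2 * (A + 1))
          rwa [hx1, mul_one_div_cancel (by positivity)] at this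
        have hx3 : (-(2 * (A + 1)) * x) ^ 2 ≤ 1 := by
          rw [neg_mul, neg_sq]
          exact pow_le_one₀ (mul_nonneg (by positivity) hx.1) hx2
        simp only [hk0, hV]
        linarith)
    simpa [hzx1] using this
  set p := fun x => q2 x / q1 x with hp
  set y := fun x => Q c x / |q1 x| with hy
  have bound2 : ∀ b, x1 ≤ b → k0 * (∫ x in x1..b, z x ^ 2) - (B1 * M1 + k * M1 ^ 2) * z b ^ 2 ≤
      ∫ x in x1..b, (z' x ^ 2 + V x * z x ^ 2) := by
    intro b hbx
    have pos : ∀ x ∈ Icc x1 b, 0 < x := fun x hx => x1pos.trans_le hx.1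
    have ne : ∀ x ∈ Icc x1 b, q1 x ≠ 0 := fun x hx => (q1neg x (pos x hx)).ne
    have yle : ∀ x ∈ Icc x1 b, 0 < y x ∧ y x ≤ M1 ∧ 1 / B1 ≤ y x := fun x hx => by
      have hpos := abs_pos.2 (ne x hx)
      refine ⟨div_pos (Qpos x) hpos, (div_le_iff₀ hpos).2 (hM1' x hx.1), ?_⟩
      rw [div_le_div_iff₀ (by positivity) hpos, one_mul, mul_comm]
      exact (hs c hcm x).1
    -- `Q''/Q'` solves the Riccati equation `q' + q² = V` exactly; the added term `k (Q/Q')²` turns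
    -- this into the strict inequality `V - q' - q² = 2 k y - k² y⁴ ≥ k y`
    have := riccati_le (z := z) (z' := z') (W := V)
      (q := fun x => q2 x / q1 x + k * (Q c x ^ 2 / q1 x ^ 2))
      (q' := fun x => (V x * q1 x * q1 x - q2 x * q2 x) / q1 x ^ 2 +
        k * ((2 * Q c x * q1 x * q1 x ^ 2 - Q c x ^ 2 * (2 * q1 x * q2 x)) / (q1 x ^ 2) ^ 2))
      (a := x1) (b := b) (k := k0) hbx hzp Vc
      (fun x hx => by
        have e1 := (d2 x).div (d1 x) (ne x hx)
        have e2 := ((d0 x).pow 2).div ((d1 x).pow 2) (pow_ne_zero 2 (ne x hx))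
        exact (e1.add (e2.const_mul k)).congr_deriv (by simp))
      (by
        have Qc := hQ.continuous hc
        refine ContinuousOn.add (ContinuousOn.div (by fun_prop) (by fun_prop)
          fun x hx => pow_ne_zero 2 (ne x hx)) (ContinuousOn.const_mul
            (ContinuousOn.div (by fun_prop) (by fun_prop)
              fun x hx => pow_ne_zero 2 (pow_ne_zero 2 (ne x hx))) _))
      (fun x hx => by
        obtain ⟨y0, y1, y2⟩ := yle x hx
        have hn := q1neg x (pos x hx)
        have hne := ne x hx
        have ey : y x = -(Q c x / q1 x) := by
          simp only [hy]; rw [abs_of_neg hn, div_neg]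
        have e : V x - ((V x * q1 x * q1 x - q2 x * q2 x) / q1 x ^ 2 +
            k * ((2 * Q c x * q1 x * q1 x ^ 2 - Q c x ^ 2 * (2 * q1 x * q2 x)) / (q1 x ^ 2) ^ 2))
            - (q2 x / q1 x + k * (Q c x ^ 2 / q1 x ^ 2)) ^ 2
            = 2 * k * y x - k ^ 2 * y x ^ 4 := by
          rw [ey]; field_simp; ring
        rw [e]
        have hky : k * y x ^ 3 ≤ 1 := by
          calc k * y x ^ 3 ≤ k * M1 ^ 3 := by gcongr
            _ = 1 := by rw [hk]; field_simp
        have h4 : k ^ 2 * y x ^ 4 ≤ k * y x := by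
          have : (k * y x) * (k * y x ^ 3) ≤ (k * y x) * 1 := by gcongr
          nlinarith
        have h5 : k / B1 ≤ k * y x := by
          rw [div_eq_mul_one_div]; gcongr
        have := min_le_right 1 (k / B1)
        simp only [hk0]
        linarith)
    rw [hzx1] at this
    have hb' : b ∈ Icc x1 b := right_mem_Icc.2 hbx
    obtain ⟨y0, y1, y2⟩ := yle b hb'
    have hpos := abs_pos.2 (ne b hb')
    have r1 : |q2 b / q1 b| ≤ B1 * M1 := by
      rw [abs_div, div_le_iff₀ hpos, mul_assoc]
      exact ((hs c hcm b).2).trans (by gcongr; exact hM1' b hbx)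
    have r2 : Q c b ^ 2 / q1 b ^ 2 ≤ M1 ^ 2 := by
      rw [← sq_abs (q1 b), ← div_pow]
      gcongr
    have r3 : -(B1 * M1 + k * M1 ^ 2) * z b ^ 2 ≤
        (q2 b / q1 b + k * (Q c b ^ 2 / q1 b ^ 2)) * z b ^ 2 := by
      apply mul_le_mul_of_nonneg_right _ (sq_nonneg _)
      have : 0 ≤ k * (Q c b ^ 2 / q1 b ^ 2) := by positivity
      have : 0 < k * M1 ^ 2 := by positivity
      linarith [(abs_le.1 r1).1]
    linarith
  have t1 : Tendsto (fun b => k0 * (∫ x in (0 : ℝ)..b, z x ^ 2) - (B1 * M1 + k * M1 ^ 2) * z b ^ 2)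
      atTop (𝓝 (k0 * (∫ x in Ioi 0, z x ^ 2) - (B1 * M1 + k * M1 ^ 2) * 0)) := by
    refine ((intervalIntegral_tendsto_integral_Ioi 0 hzp.2.integrable_sq.integrableOn
      tendsto_id).const_mul k0).sub (Tendsto.const_mul _ ?_)
    have P := hzp.1.mul hzp.1
    have := P.tendsto_atTop_zero (a := 0) (integrable_mul hzp.2 hzp.2).integrableOn
      ((integrable_mul hzp.3 hzp.2).add (integrable_mul hzp.2 hzp.3)).integrableOn
    simpa only [sq] using this
  have t2 : Tendsto (fun b => ∫ x in (0 : ℝ)..b, (z' x ^ 2 + V x * z x ^ 2))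
      atTop (𝓝 (∫ x in Ioi 0, (z' x ^ 2 + V x * z x ^ 2))) :=
    intervalIntegral_tendsto_integral_Ioi 0 iz.integrableOn tendsto_id
  rw [mul_zero, sub_zero] at t1
  refine le_of_tendsto_of_tendsto t1 t2 ?_
  filter_upwards [eventually_ge_atTop x1] with b hbx
  have iz2 := hzp.2.integrable_sq
  rw [← intervalIntegral.integral_add_adjacent_intervals (b := x1) iz2.intervalIntegrable
    iz2.intervalIntegrable, ← intervalIntegral.integral_add_adjacent_intervals (b := x1)
    iz.intervalIntegrable iz.intervalIntegrable, mul_add]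
  linarith [bound2 b hbx]

end SolitaryWaveFamily

/-! ### Coercivity modulo two directions -/

/-- A smooth even cutoff function, equal to `1` on `[-1, 1]` and supported in `[-2, 2]`. -/
def cutoff : ContDiffBump (0 : ℝ) := ⟨1, 2, one_pos, one_lt_two⟩

/-- The odd test function that fixes the position of the solitary wave. -/
def centering (x : ℝ) : ℝ := x * cutoff x

lemma contDiff_cutoff {n : ℕ∞} : ContDiff ℝ n (fun x => cutoff x) := cutoff.contDiff

lemma hasCompactSupport_cutoff : HasCompactSupport (fun x => cutoff x) :=
  cutoff.hasCompactSupport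

lemma cutoff_neg (x : ℝ) : cutoff (-x) = cutoff x := cutoff.neg x

lemma contDiff_centering : ContDiff ℝ ∞ centering := contDiff_id.mul contDiff_cutoff

lemma hasCompactSupport_centering : HasCompactSupport centering :=
  hasCompactSupport_cutoff.mul_left

lemma centering_neg (x : ℝ) : centering (-x) = -centering x := by
  simp only [centering, cutoff_neg]; ring

lemma memLp_of_hasCompactSupport {g : ℝ → ℝ} (hg : Continuous g) (hs : HasCompactSupport g) :
    MemLp g 2 volume := hg.memLp_of_hasCompactSupport hs

lemma memLp_centering : MemLp centering 2 volume :=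
  memLp_of_hasCompactSupport contDiff_centering.continuous hasCompactSupport_centering

lemma integrable_sub {g h : ℝ → ℝ} (hg : Integrable g) (hh : Integrable h) :
    Integrable fun x => g x - h x := hg.sub hh

lemma integral_eq_zero_of_odd {g : ℝ → ℝ} (h : ∀ x, g (-x) = -g x) : ∫ x, g x = 0 := by
  have e := integral_neg_eq_self g volume
  simp only [h, integral_neg] at e
  linarith

lemma integral_eq_half_lines {g : ℝ → ℝ} (hg : Integrable g) :
    ∫ x, g x = (∫ x in Ioi 0, g x) + ∫ x in Ioi 0, g (-x) := by
  rw [integral_comp_neg_Ioi (0 : ℝ) g, neg_zero, add_comm,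
    intervalIntegral.integral_Iic_add_Ioi hg.integrableOn hg.integrableOn]

/-- Coercivity of the second variation at `Q_c`, up to the two directions given by `Q_c` and by the
centering function, with constant `C`. -/
def Coercive (f : ℝ → ℝ) (Q : ℝ → ℝ → ℝ) (c C : ℝ) : Prop :=
  ∀ ξ η : ℝ → ℝ, H1Pair ξ η → nrm ξ η ^ 2 ≤ C * (quadForm f Q c ξ η +
    C * ((∫ x, ξ x * Q c x) ^ 2 + (∫ x, ξ x * centering x) ^ 2))

lemma sq_add_four_le (x y z w : ℝ) :
    (x + y + z + w) ^ 2 ≤ 4 * (x ^ 2 + y ^ 2 + z ^ 2 + w ^ 2) := by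
  linarith [sq_nonneg (x - y), sq_nonneg (x - z), sq_nonneg (x - w), sq_nonneg (y - z),
    sq_nonneg (y - w), sq_nonneg (z - w)]

/-- Both constants in the definition of `Coercive` may be taken to be the same. -/
lemma le_const_mul_add {B p s u D v W : ℝ} (hu : 0 ≤ u) (hD : 0 ≤ D) (hv : 0 ≤ v)
    (hY : 0 ≤ B + v * p ^ 2) (h : W ≤ (1 + u) * (B + v * p ^ 2) + D * (p ^ 2 + s ^ 2)) :
    W ≤ (1 + u + D + v) * (B + (1 + u + D + v) * (p ^ 2 + s ^ 2)) := by
  have hp := sq_nonneg p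
  have hs := sq_nonneg s
  have h1 : (1 + u) * (B + v * p ^ 2) ≤ (1 + u + D + v) * (B + v * p ^ 2) := by
    exact mul_le_mul_of_nonneg_right (by linarith) hY
  have h2 : D * (p ^ 2 + s ^ 2) ≤ (1 + u + D + v) * (p ^ 2 + s ^ 2) - v * p ^ 2 := by
    have : 0 ≤ (1 + u) * (p ^ 2 + s ^ 2) + v * s ^ 2 := by positivity
    linarith
  have h0 : 0 ≤ D * (p ^ 2 + s ^ 2) := by positivity
  have h3 := le_mul_of_one_le_left (h0.trans h2) (by linarith : 1 ≤ 1 + u + D + v)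
  linarith

/-- The bookkeeping behind `exists_coercive`: `N` is the size of the remainder, and `lam`, `σ`, `τ`
are the coefficients of the decomposition. -/
lemma exists_coercive_const {lQ lΨ lR lq δ m₁ m₂ A k₀ : ℝ} (lQ0 : 0 ≤ lQ) (lΨ0 : 0 ≤ lΨ)
    (lR0 : 0 ≤ lR) (lq0 : 0 ≤ lq) (hδ : 0 < δ) (m1pos : 0 < m₁) (m2pos : 0 < m₂) (hA : 0 < A)
    (hk0 : 0 < k₀) :
    ∃ C > 0, ∀ N lam p s σ τ B X Z : ℝ, 0 ≤ N → 0 ≤ X →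
      |τ| * m₁ ≤ |p| + |lam| * δ + N * lQ → |σ| * m₂ ≤ |s| + N * lΨ →
      X ≤ |lam| * lR + N + (|σ| * lq + |τ| * lq) →
      k₀ * N ^ 2 - 2 * lam * p + lam ^ 2 * δ ≤ B → Z ≤ B + A * X ^ 2 →
      X ^ 2 + Z ≤ C * (B + C * (p ^ 2 + s ^ 2)) := by
  set T1 := (lQ + 1 + δ) / m₁ with hT1
  set T2 := (lΨ + 1) / m₂ with hT2
  have T1p : 0 < T1 := by positivity
  have T2p : 0 < T2 := by positivity
  set C0 := lR + 1 + lq * T2 + lq * T1 with hC0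
  have C0p : 0 < C0 := by positivity
  set D := (A + 1) * (4 * C0 ^ 2) with hD
  have Dp : 0 < D := by positivity
  set κ := min k₀ (δ / 2)
  have κp : 0 < κ := lt_min hk0 (by positivity)
  refine ⟨1 + D / κ + D + 2 / δ, by positivity, fun N lam p s σ τ B X Z N0 X0 hτ hσ hX hB hZ => ?_⟩
  set E := N + |lam| + |p| + |s| with hE
  have a1 := abs_nonneg lam
  have a2 := abs_nonneg p
  have a3 := abs_nonneg s
  have hτE : |τ| ≤ T1 * E := by
    rw [hT1, div_mul_eq_mul_div, le_div_iff₀ m1pos]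
    refine hτ.trans ?_
    have h1 : 0 ≤ lQ * (|lam| + |p| + |s|) := by positivity
    have h2 : 0 ≤ δ * (N + |p| + |s|) := by positivity
    have e : (lQ + 1 + δ) * E = |p| + |lam| * δ + N * lQ + lQ * (|lam| + |p| + |s|) +
        δ * (N + |p| + |s|) + (N + |lam| + |s|) := by simp only [hE]; ring
    linarith
  have hσE : |σ| ≤ T2 * E := by
    rw [hT2, div_mul_eq_mul_div, le_div_iff₀ m2pos]
    refine hσ.trans ?_
    have h1 : 0 ≤ lΨ * (|lam| + |p| + |s|) := by positivity
    have e : (lΨ + 1) * E = |s| + N * lΨ + lΨ * (|lam| + |p| + |s|) + (N + |lam| + |p|) := by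
      simp only [hE]; ring
    linarith
  have hE0 : 0 ≤ E := by positivity
  have hXE : X ≤ C0 * E := by
    have t5 : |σ| * lq ≤ T2 * E * lq := by gcongr
    have t6 : |τ| * lq ≤ T1 * E * lq := by gcongr
    have t7 : |lam| * lR ≤ E * lR := by
      gcongr
      linarith
    calc X ≤ E * lR + E + (T2 * E * lq + T1 * E * lq) := by linarith
      _ = C0 * E := by simp only [hC0]; ring
  have hE2 : E ^ 2 ≤ 4 * (N ^ 2 + lam ^ 2 + p ^ 2 + s ^ 2) := by
    rw [hE, ← sq_abs lam, ← sq_abs p, ← sq_abs s]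
    exact sq_add_four_le _ _ _ _
  set Y := B + 2 / δ * p ^ 2 with hYdef
  have hY : κ * (N ^ 2 + lam ^ 2) ≤ Y := by
    have h1 : κ * N ^ 2 ≤ k₀ * N ^ 2 := by gcongr; exact min_le_left _ _
    have h2 : κ * lam ^ 2 ≤ δ / 2 * lam ^ 2 := by gcongr; exact min_le_right _ _
    have h3 : 2 * lam * p ≤ δ / 2 * lam ^ 2 + 2 / δ * p ^ 2 := by
      have : 0 ≤ (δ * lam - 2 * p) ^ 2 / (2 * δ) := by positivity
      have e : (δ * lam - 2 * p) ^ 2 / (2 * δ) = δ / 2 * lam ^ 2 + 2 / δ * p ^ 2 - 2 * lam * p := by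
        field_simp; ring
      linarith
    linarith
  have Y0 : 0 ≤ Y := le_trans (by positivity) hY
  have hX2 : (A + 1) * X ^ 2 ≤ D * (Y / κ + p ^ 2 + s ^ 2) := by
    have h1 : X ^ 2 ≤ (C0 * E) ^ 2 := pow_le_pow_left₀ X0 hXE 2
    have h2 : N ^ 2 + lam ^ 2 ≤ Y / κ := by rw [le_div_iff₀ κp]; linarith
    calc (A + 1) * X ^ 2 ≤ (A + 1) * (C0 ^ 2 * E ^ 2) := by rw [← mul_pow]; gcongr
      _ ≤ (A + 1) * (C0 ^ 2 * (4 * (Y / κ + p ^ 2 + s ^ 2))) := by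
          gcongr
          linarith
      _ = _ := by simp only [D]; ring
  refine le_trans ?_ (le_const_mul_add (u := D / κ) (by positivity) Dp.le
    (v := 2 / δ) (by positivity) Y0 le_rfl)
  have : 0 ≤ 2 / δ * p ^ 2 := by positivity
  have e : D * (Y / κ + p ^ 2 + s ^ 2) = D / κ * Y + D * (p ^ 2 + s ^ 2) := by ring
  linarith

namespace SolitaryWaveFamily

variable {f : ℝ → ℝ} {I₀ : Set ℝ} {Q : ℝ → ℝ → ℝ} {c A : ℝ}

lemma continuous_potential (hQ : SolitaryWaveFamily f I₀ Q) (hf : AdmissibleNonlinearity f)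
    (hc : c ∈ I₀) : Continuous fun x => c - deriv f (Q c x) := by
  have := hQ.continuous hc
  have := hf.continuous_deriv
  fun_prop

lemma integrable_potential_mul (hQ : SolitaryWaveFamily f I₀ Q) (hf : AdmissibleNonlinearity f)
    (hc : c ∈ I₀) (hb : ProfileBounds f Q c A) {u v : ℝ → ℝ} (hu : MemLp u 2 volume)
    (hv : MemLp v 2 volume) : Integrable fun x => (c - deriv f (Q c x)) * (u x * v x) :=
  (integrable_mul hu hv).bdd_mul (c := A) (hQ.continuous_potential hf hc).aestronglyMeasurable
    (ae_of_all _ hb.potential)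

/-- The centering function detects translations of the profile. -/
lemma integral_slope_mul_centering_neg (hQ : SolitaryWaveFamily f I₀ Q)
    (hf : AdmissibleNonlinearity f) (hc : c ∈ I₀) :
    0 < -∫ x, deriv (Q c) x * centering x := by
  rw [← integral_neg]
  have hcont : Continuous fun x => -(deriv (Q c) x * centering x) :=
    ((hQ.continuous_deriv hc).mul contDiff_centering.continuous).neg
  have pos : ∀ x, 0 < x → deriv (Q c) x < 0 := fun x hx => hQ.deriv_neg hf hc hx
  have hnn : ∀ x, 0 ≤ -(deriv (Q c) x * centering x) := by
    have half : ∀ x, 0 ≤ x → 0 ≤ -(deriv (Q c) x * centering x) := by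
      intro x hx
      rcases hx.eq_or_lt with rfl | hx
      · simp [centering]
      · have := mul_nonneg hx.le (cutoff.nonneg (x := x))
        simp only [centering]
        nlinarith [pos x hx]
    intro x
    rcases le_total 0 x with hx | hx
    · exact half x hx
    · have := half (-x) (by linarith)
      rwa [hQ.deriv_neg_arg hc, centering_neg, neg_mul_neg] at this
  refine hcont.integral_pos_of_hasCompactSupport_nonneg_nonzero ?_ hnn (x := 1) ?_
  · exact (hasCompactSupport_centering.mul_left).neg
  · have h1 : cutoff 1 = 1 := cutoff.one_of_mem_closedBall (by simp [cutoff])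
    simp only [centering, h1]
    have := pos 1 one_pos
    linarith

/-- Pairing the linearised operator with `∂_c Q_c`. -/
lemma form_speedDeriv (hQ : SolitaryWaveFamily f I₀ Q) (hf : AdmissibleNonlinearity f)
    (hc : c ∈ I₀) (hb : ProfileBounds f Q c A) {g g' : ℝ → ℝ} (hg : H1Pair g g') :
    ∫ x, (g' x * speedDerivFlux f Q c x + (c - deriv f (Q c x)) * (g x * speedDeriv Q c x)) =
      -∫ x, g x * Q c x := by
  have p2 := hQ.h1Pair_speed hf hc hb
  have hVc := hQ.continuous_potential hf hc
  have P : IsPrim (speedDerivFlux f Q c)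
      (fun x => Q c x + (c - deriv f (Q c x)) * speedDeriv Q c x) :=
    .of_hasDerivAt (hQ.hasDerivAt_speedDerivFlux hf hc)
      ((hQ.continuous hc).add (hVc.mul p2.1.continuous))
  have i1 := hQ.integrable_potential_mul hf hc hb hg.2 p2.2
  have i0 := integrable_mul hg.2 (hQ.h1Pair hc hb).2
  have i2 : Integrable fun x => g x * (Q c x + (c - deriv f (Q c x)) * speedDeriv Q c x) :=
    (i0.add i1).congr (ae_of_all _ fun x => by simp only [Pi.add_apply]; ring)
  have ibp := integral_mul_eq_neg hg.1 P (integrable_mul hg.2 p2.3) (integrable_mul hg.3 p2.3) i2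
  rw [integral_add (integrable_mul hg.3 p2.3) i1, ibp, ← integral_neg, ← integral_add i2.fun_neg i1,
    ← integral_neg]
  congr 1; funext x; ring

/-- Coercivity at a single speed with `δ'(c) > 0`: subtracting the right multiple of `∂_c Q_c`
produces a function that vanishes at the origin, for which the half-line estimates apply. -/
lemma exists_coercive (hQ : SolitaryWaveFamily f I₀ Q) (hf : AdmissibleNonlinearity f)
    (hc : c ∈ I₀) (hA : 0 < A) (hb : ProfileBounds f Q c A) (hδ : 0 < momentumDeriv Q c) :
    ∃ C > 0, Coercive f Q c C := by
  obtain ⟨k0, hk0, HL⟩ := hQ.exists_half_line_coercive hf hc hA hb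
  set δ := momentumDeriv Q c with hδdef
  obtain ⟨q1, hq1⟩ : ∃ q1, q1 = deriv (Q c) := ⟨_, rfl⟩
  have q1c : Continuous q1 := hq1 ▸ hQ.continuous_deriv hc
  have q1odd : ∀ x, q1 (-x) = -q1 x := hq1 ▸ hQ.deriv_neg_arg hc
  have q1neg : ∀ x, 0 < x → q1 x < 0 := fun x hx => hq1 ▸ hQ.deriv_neg hf hc hx
  have pQ := hQ.h1Pair hc hb
  have pR := hQ.h1Pair_speed hf hc hb
  have mq1 : MemLp q1 2 volume := hq1 ▸ pQ.3
  have maq1 : MemLp (fun x => |q1 x|) 2 volume := mq1.abs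
  have mΨ := memLp_centering
  have Qeven := hQ.even c hc
  have m1pos : 0 < ∫ x, |q1 x| * Q c x := by
    rw [integral_pos_iff_support_of_nonneg
      (fun x => mul_nonneg (abs_nonneg _) (hQ.pos c hc x).le) (integrable_mul maq1 pQ.2)]
    refine lt_of_lt_of_le ?_ (measure_mono (s := Ioi 0) fun x hx => ?_)
    · simp
    · exact (mul_pos (abs_pos.2 (q1neg x hx).ne) (hQ.pos c hc x)).ne'
  have m2pos := hQ.integral_slope_mul_centering_neg hf hc
  rw [← hq1] at HL m2pos
  obtain ⟨m1, hm1⟩ : ∃ m1, m1 = ∫ x, |q1 x| * Q c x := ⟨_, rfl⟩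
  obtain ⟨m2, hm2⟩ : ∃ m2, m2 = ∫ x, q1 x * centering x := ⟨_, rfl⟩
  rw [← hm1] at m1pos
  rw [← hm2] at m2pos
  obtain ⟨C, hC, hconst⟩ := exists_coercive_const (l2_nonneg (Q c)) (l2_nonneg centering)
    (l2_nonneg (speedDeriv Q c)) (l2_nonneg q1) hδ m1pos m2pos hA hk0
  refine ⟨C, hC, fun ξ η hξ => ?_⟩
  obtain ⟨p, hp⟩ : ∃ p, p = ∫ x, ξ x * Q c x := ⟨_, rfl⟩
  obtain ⟨s, hs⟩ : ∃ s, s = ∫ x, ξ x * centering x := ⟨_, rfl⟩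
  -- `ζ = ξ - lam * ∂_c Q` vanishes at the origin
  obtain ⟨lam, hlam⟩ : ∃ lam, lam = ξ 0 / speedDeriv Q c 0 := ⟨_, rfl⟩
  obtain ⟨ζ, hζ⟩ : ∃ ζ, ζ = fun x => ξ x - lam * speedDeriv Q c x := ⟨_, rfl⟩
  obtain ⟨ζ', hζ'⟩ : ∃ ζ', ζ' = fun x => η x - lam * speedDerivFlux f Q c x := ⟨_, rfl⟩
  have pζ : H1Pair ζ ζ' := hζ ▸ hζ' ▸ hξ.sub (pR.const_mul lam)
  have ζ0 : ζ 0 = 0 := by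
    simp only [hζ, hlam]
    rw [div_mul_cancel₀ _ (hQ.speedDeriv_zero_ne hf hc), sub_self]
  have pζn : H1Pair (fun x => ζ (-x)) (fun x => -ζ' (-x)) :=
    ⟨pζ.1.comp_neg, memLp_comp_neg pζ.2, (memLp_comp_neg pζ.3).neg⟩
  obtain ⟨a, ha⟩ := HL ζ ζ' pζ ζ0
  obtain ⟨a', ha'⟩ := HL _ _ pζn (by simpa using ζ0)
  -- the multiples `a` and `a'` of `Q'` on the two half-lines, split into an odd part `σ * Q'` and an
  -- even part `τ * |Q'|`
  obtain ⟨σ, hσ⟩ : ∃ σ, σ = (a - a') / 2 := ⟨_, rfl⟩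
  obtain ⟨τ, hτ⟩ : ∃ τ, τ = -(a + a') / 2 := ⟨_, rfl⟩
  obtain ⟨z, hz⟩ : ∃ z, z = fun x => ζ x - (σ * q1 x + τ * |q1 x|) := ⟨_, rfl⟩
  have mz : MemLp z 2 volume := hz ▸ pζ.2.sub ((mq1.const_mul σ).add (maq1.const_mul τ))
  have iform : ∀ {u v : ℝ → ℝ}, H1Pair u v →
      Integrable fun x => v x ^ 2 + (c - deriv f (Q c x)) * u x ^ 2 := fun h => by
    simp only [sq]
    exact (integrable_mul h.3 h.3).add (hQ.integrable_potential_mul hf hc hb h.2 h.2)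
  -- the half-line estimates, put together
  have hBζ : k0 * l2 z ^ 2 ≤ quadForm f Q c ζ ζ' := by
    rw [quadForm, integral_eq_half_lines (iform pζ), sq_l2,
      integral_eq_half_lines mz.integrable_sq, mul_add]
    have e1 : ∫ x in Ioi 0, z x ^ 2 = ∫ x in Ioi 0, (ζ x - a * q1 x) ^ 2 := by
      refine setIntegral_congr_fun measurableSet_Ioi fun x hx => ?_
      simp only [hz, hσ, hτ, abs_of_neg (q1neg x hx)]
      ring
    have e2 : ∫ x in Ioi 0, z (-x) ^ 2 = ∫ x in Ioi 0, (ζ (-x) - a' * q1 x) ^ 2 := by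
      refine setIntegral_congr_fun measurableSet_Ioi fun x hx => ?_
      simp only [hz, hσ, hτ, q1odd, abs_neg, abs_of_neg (q1neg x hx)]
      ring
    rw [e1, e2]
    refine add_le_add ha (ha'.trans_eq ?_)
    congr 1; funext x; rw [Qeven, neg_sq]
  -- the decomposition of the form
  have hB : quadForm f Q c ξ η = quadForm f Q c ζ ζ' - 2 * lam * p + lam ^ 2 * δ := by
    have f1 := hQ.form_speedDeriv hf hc hb hξ
    have f2 := hQ.form_speedDeriv hf hc hb pR
    have g1 : Integrable fun x => η x * speedDerivFlux f Q c x +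
        (c - deriv f (Q c x)) * (ξ x * speedDeriv Q c x) :=
      (integrable_mul hξ.3 pR.3).add (hQ.integrable_potential_mul hf hc hb hξ.2 pR.2)
    have g2 : Integrable fun x => speedDerivFlux f Q c x * speedDerivFlux f Q c x +
        (c - deriv f (Q c x)) * (speedDeriv Q c x * speedDeriv Q c x) :=
      (integrable_mul pR.3 pR.3).add (hQ.integrable_potential_mul hf hc hb pR.2 pR.2)
    have e : quadForm f Q c ζ ζ' = quadForm f Q c ξ η +
        ((-2 * lam) * ∫ x, (η x * speedDerivFlux f Q c x +
          (c - deriv f (Q c x)) * (ξ x * speedDeriv Q c x))) +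
        lam ^ 2 * ∫ x, (speedDerivFlux f Q c x * speedDerivFlux f Q c x +
          (c - deriv f (Q c x)) * (speedDeriv Q c x * speedDeriv Q c x)) := by
      rw [quadForm, quadForm, ← integral_const_mul, ← integral_const_mul,
        ← integral_add (iform hξ) (g1.const_mul _),
        ← integral_add ((iform hξ).fun_add (g1.const_mul _)) (g2.const_mul _)]
      congr 1; funext x; simp only [hζ, hζ']; ring
    have e3 : ∫ x, speedDeriv Q c x * Q c x = δ := by
      rw [hδdef, momentumDeriv]; congr 1; funext x; ring
    rw [f1, f2, e3, ← hp] at e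
    rw [e]; ring
  -- the two orthogonality relations determine `σ` and `τ`
  have hτ' : p - lam * δ = (∫ x, z x * Q c x) + τ * m1 := by
    have o : ∫ x, q1 x * Q c x = 0 := integral_eq_zero_of_odd fun x => by rw [q1odd, Qeven]; ring
    have i1 := integrable_mul hξ.2 pQ.2
    have i2 := integrable_mul pQ.2 pR.2
    have i3 := integrable_mul mq1 pQ.2
    have i4 := integrable_mul maq1 pQ.2
    have e : ∫ x, z x * Q c x = p - lam * δ - σ * (∫ x, q1 x * Q c x) - τ * m1 := by
      rw [hδdef, momentumDeriv, hp, hm1, ← integral_const_mul, ← integral_const_mul,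
        ← integral_const_mul, ← integral_sub i1 (i2.const_mul _),
        ← integral_sub (integrable_sub i1 (i2.const_mul _)) (i3.const_mul _),
        ← integral_sub (integrable_sub (integrable_sub i1 (i2.const_mul _)) (i3.const_mul _))
          (i4.const_mul _)]
      congr 1; funext x; simp only [hz, hζ]; ring
    rw [e, o]; ring
  have hσ' : s = (∫ x, z x * centering x) + σ * m2 := by
    have o : ∫ x, |q1 x| * centering x = 0 :=
      integral_eq_zero_of_odd fun x => by rw [q1odd, abs_neg, centering_neg]; ring
    have o2 : ∫ x, speedDeriv Q c x * centering x = 0 :=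
      integral_eq_zero_of_odd fun x => by rw [hQ.speedDeriv_neg_arg hc, centering_neg]; ring
    have i1 := integrable_mul hξ.2 mΨ
    have i2 := integrable_mul pR.2 mΨ
    have i3 := integrable_mul mq1 mΨ
    have i4 := integrable_mul maq1 mΨ
    have e : ∫ x, z x * centering x = s - lam * (∫ x, speedDeriv Q c x * centering x) -
        σ * m2 - τ * (∫ x, |q1 x| * centering x) := by
      rw [hs, hm2, ← integral_const_mul, ← integral_const_mul, ← integral_const_mul,
        ← integral_sub i1 (i2.const_mul _),
        ← integral_sub (integrable_sub i1 (i2.const_mul _)) (i3.const_mul _),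
        ← integral_sub (integrable_sub (integrable_sub i1 (i2.const_mul _)) (i3.const_mul _))
          (i4.const_mul _)]
      congr 1; funext x; simp only [hz, hζ]; ring
    rw [e, o, o2]; ring
  rw [sq_nrm, ← hp, ← hs]
  refine hconst (l2 z) lam p s σ τ (quadForm f Q c ξ η) (l2 ξ) (l2 η ^ 2) (l2_nonneg _)
    (l2_nonneg _) ?_ ?_ ?_ (by rw [hB]; linarith) ?_
  · have e : |τ| * m1 = |p - lam * δ - ∫ x, z x * Q c x| := by
      rw [hτ', add_sub_cancel_left, abs_mul, abs_of_pos m1pos]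
    rw [e]
    refine (abs_sub _ _).trans (add_le_add ((abs_sub _ _).trans ?_) (abs_integral_mul_le mz pQ.2))
    rw [abs_mul, abs_of_pos hδ]
  · have e : |σ| * (-m2) = |s - ∫ x, z x * centering x| := by
      rw [hσ', add_sub_cancel_left, abs_mul, abs_of_neg (neg_pos.1 m2pos)]
    rw [e]
    exact (abs_sub _ _).trans (add_le_add le_rfl (abs_integral_mul_le mz mΨ))
  · have e : ξ = fun x => (lam * speedDeriv Q c x + z x) + (σ * q1 x + τ * |q1 x|) := by
      funext x; simp only [hz, hζ]; ring
    have t1 := l2_add_le (pR.2.const_mul lam) mz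
    have t2 := l2_add_le (mq1.const_mul σ) (maq1.const_mul τ)
    have t3 := l2_add_le (f := fun x => lam * speedDeriv Q c x + z x)
      (g := fun x => σ * q1 x + τ * |q1 x|) ((pR.2.const_mul lam).add mz)
      ((mq1.const_mul σ).add (maq1.const_mul τ))
    rw [← e] at t3
    have t4 : l2 (fun x => |q1 x|) = l2 q1 := by simp only [l2, sq_abs]
    rw [l2_const_mul] at t1
    rw [l2_const_mul, l2_const_mul, t4] at t2
    linarith
  · rw [quadForm, sq_l2, sq_l2, ← integral_const_mul,
      ← integral_add (iform hξ) (hξ.2.integrable_sq.const_mul _)]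
    refine integral_mono hξ.3.integrable_sq
      ((iform hξ).add (hξ.2.integrable_sq.const_mul _)) fun x => ?_
    simp only
    have := mul_le_mul_of_nonneg_right (abs_le.1 (hb.potential x)).1 (sq_nonneg (ξ x))
    linarith

end SolitaryWaveFamily

/-- A speed at which the solitary wave is stable, with quantitative bounds `A`. -/
structure GoodSpeed (f : ℝ → ℝ) (Q : ℝ → ℝ → ℝ) (A c : ℝ) : Prop where
  bounds : SolitaryWaveFamily.ProfileBounds f Q c A
  coercive : Coercive f Q c A
  momentumDeriv_ge : 1 / A ≤ momentumDeriv Q c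
  transversal : 1 / A ≤ -∫ x, deriv (Q c) x * centering x
  speed_le : c ≤ A

lemma Coercive.mono {f : ℝ → ℝ} {Q : ℝ → ℝ → ℝ} {c A A' : ℝ} (h : Coercive f Q c A) (hA : 0 < A)
    (hAA' : A ≤ A') : Coercive f Q c A' := by
  intro ξ η hξ
  have h0 := h ξ η hξ
  set q := (∫ x, ξ x * Q c x) ^ 2 + (∫ x, ξ x * centering x) ^ 2
  have hq : 0 ≤ q := by positivity
  have h1 : 0 ≤ quadForm f Q c ξ η + A * q :=
    nonneg_of_mul_nonneg_right ((sq_nonneg _).trans h0) hA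
  calc nrm ξ η ^ 2 ≤ A * (quadForm f Q c ξ η + A * q) := h0
    _ ≤ A' * (quadForm f Q c ξ η + A * q) := by gcongr
    _ ≤ A' * (quadForm f Q c ξ η + A' * q) := by
        have : 0 ≤ A' := hA.le.trans hAA'
        gcongr

lemma GoodSpeed.mono {f : ℝ → ℝ} {Q : ℝ → ℝ → ℝ} {c A A' : ℝ} (h : GoodSpeed f Q A c) (hA : 0 < A)
    (hAA' : A ≤ A') : GoodSpeed f Q A' c where
  bounds := by
    have key : ∀ {x k : ℝ}, k ≤ A * wt x ^ 2 → k ≤ A' * wt x ^ 2 := fun h =>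
      h.trans (mul_le_mul_of_nonneg_right hAA' (sq_nonneg _))
    exact ⟨fun x => key (h.bounds.1 x), fun x => key (h.bounds.2 x), fun x => key (h.bounds.3 x),
      fun x => key (h.bounds.4 x), fun x => key (h.bounds.5 x),
      fun x => (h.bounds.6 x).trans hAA'⟩
  coercive := h.coercive.mono hA hAA'
  momentumDeriv_ge := le_trans (one_div_le_one_div_of_le hA hAA') h.momentumDeriv_ge
  transversal := le_trans (one_div_le_one_div_of_le hA hAA') h.transversal
  speed_le := h.speed_le.trans hAA'

namespace SolitaryWaveFamily

variable {f : ℝ → ℝ} {I₀ : Set ℝ} {Q : ℝ → ℝ → ℝ} {c A : ℝ}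

lemma abs_le_of_wt_sq {g : ℝ → ℝ} (hA : 0 ≤ A) (h : ∀ x, |g x| ≤ A * wt x ^ 2) (x : ℝ) :
    |g x| ≤ A := by
  refine (h x).trans (mul_le_of_le_one_right hA ?_)
  exact pow_le_one₀ (wt_pos x).le (wt_le_one x)

/-- The positive quantities at `c` lose at most a factor of two under small changes of the speed. -/
lemma eventually_goodSpeed (hQ : SolitaryWaveFamily f I₀ Q) (hf : AdmissibleNonlinearity f)
    (hc : c ∈ I₀) (hδ : 0 < momentumDeriv Q c) :
    ∃ A > 0, ∀ᶠ c' in 𝓝 c, GoodSpeed f Q A c' := by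
  obtain ⟨α, β, h1, h2, h3, A, hA, hb⟩ := hQ.exists_nhds_bounds hf hc
  have hs : Ioo α β ∈ 𝓝 c := Ioo_mem_nhds h1 h2
  have hs' : Ioo α β ⊆ I₀ := fun c' h => h3 (Ioo_subset_Icc_self h)
  have hcm : c ∈ Ioo α β := ⟨h1, h2⟩
  obtain ⟨C, hC, hco⟩ := hQ.exists_coercive hf hc hA (hb c hcm) hδ
  obtain ⟨L, hL, -, -, hL'⟩ := hf.exists_lipschitz A
  have m2 := hQ.integral_slope_mul_centering_neg hf hc
  set m := -∫ x, deriv (Q c) x * centering x with hm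
  set lw := l2 wt
  have lip := fun {c1 c2 : ℝ} (h1 : c1 ∈ Ioo α β) (h2 : c2 ∈ Ioo α β) =>
    hQ.lipschitz_wt hf (convex_Ioo α β) hs' hb h1 h2
  set A' := A + 2 * C + 2 / momentumDeriv Q c + 2 / m + |β|
  have a1 : 0 < 2 / momentumDeriv Q c := by positivity
  have a2 : 0 < 2 / m := by positivity
  have a3 := abs_nonneg β
  have A'p : 0 < A' := by positivity
  have ev1 : ∀ᶠ c' in 𝓝 c, momentumDeriv Q c / 2 < momentumDeriv Q c' :=
    (hQ.continuousAt_momentumDeriv hf hc).eventually (lt_mem_nhds (half_lt_self hδ))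
  have ev2 : ∀ᶠ c' in 𝓝 c, C * ((1 + L * A) * |c - c'|) + 2 * C ^ 2 * (A * |c - c'| * lw) ^ 2
      < 1 / 2 := by
    have : ContinuousAt (fun c' => C * ((1 + L * A) * |c - c'|) +
        2 * C ^ 2 * (A * |c - c'| * lw) ^ 2) c := by fun_prop
    exact this.eventually (gt_mem_nhds (by simp))
  have ev3 : ∀ᶠ c' in 𝓝 c, A * |c - c'| * lw * l2 centering < m / 2 := by
    have : ContinuousAt (fun c' => A * |c - c'| * lw * l2 centering) c := by fun_prop
    exact this.eventually (gt_mem_nhds (by simpa using m2))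
  refine ⟨A', A'p, ?_⟩
  filter_upwards [hs, ev1, ev2, ev3] with c' hc' e1 e2 e3
  have wdiff : ∀ {g : ℝ → ℝ}, Continuous g → (∀ x, |g x| ≤ A * |c - c'| * wt x ^ 2) →
      MemLp g 2 volume ∧ l2 g ≤ A * |c - c'| * lw := fun hg h =>
    ⟨memLp_of_wt hg.aestronglyMeasurable (le_wt_of_le_sq h), l2_le_of_wt (le_wt_of_le_sq h)⟩
  have hbb : ProfileBounds f Q c' A' := by
    have hAA' : A ≤ A' := by simp only [A']; linarith
    have key : ∀ {x k : ℝ}, k ≤ A * wt x ^ 2 → k ≤ A' * wt x ^ 2 := fun h =>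
      h.trans (mul_le_mul_of_nonneg_right hAA' (sq_nonneg _))
    have h := hb c' hc'
    exact ⟨fun x => key (h.1 x), fun x => key (h.2 x), fun x => key (h.3 x),
      fun x => key (h.4 x), fun x => key (h.5 x), fun x => (h.6 x).trans hAA'⟩
  refine ⟨hbb, ?_, ?_, ?_, ?_⟩
  · have hco' : Coercive f Q c' (2 * C) := by
      intro ξ η hξ
      have h0 := hco ξ η hξ
      set n := nrm ξ η
      have ln : l2 ξ ≤ n := l2_le_nrm ξ η
      have l0 := l2_nonneg ξ
      set v := (1 + L * A) * |c - c'|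
      set w := A * |c - c'| * lw
      have hw : 0 ≤ w := by have := l2_nonneg wt; positivity
      have iform : ∀ {c}, c ∈ Ioo α β →
          Integrable fun x => η x ^ 2 + (c - deriv f (Q c x)) * ξ x ^ 2 := fun h => by
        simp only [sq]
        exact (integrable_mul hξ.3 hξ.3).add
          (hQ.integrable_potential_mul hf (hs' h) (hb _ h) hξ.2 hξ.2)
      have hBd : quadForm f Q c ξ η ≤ quadForm f Q c' ξ η + v * n ^ 2 := by
        have : quadForm f Q c ξ η ≤ quadForm f Q c' ξ η + v * l2 ξ ^ 2 := by
          rw [quadForm, quadForm, sq_l2, ← integral_const_mul,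
            ← integral_add (iform hc') (hξ.2.integrable_sq.const_mul _)]
          refine integral_mono (iform hcm)
            ((iform hc').add (hξ.2.integrable_sq.const_mul _)) fun x => ?_
          simp only
          have b1 := abs_le.1 (abs_le_of_wt_sq hA.le (hb c hcm).profile x)
          have b2 := abs_le.1 (abs_le_of_wt_sq hA.le (hb c' hc').profile x)
          have b3 := hL' _ b1 _ b2
          have b4 : |Q c' x - Q c x| ≤ A * |c - c'| := by
            rw [abs_sub_comm]
            exact abs_le_of_wt_sq (by positivity) (fun x => (lip hcm hc' x).1) x
          have b5 : (c - deriv f (Q c x)) - (c' - deriv f (Q c' x)) ≤ v := by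
            have := le_abs_self (c - c')
            have := (abs_le.1 b3).2
            have : L * |Q c' x - Q c x| ≤ L * (A * |c - c'|) := by gcongr
            simp only [v]
            linarith
          have := mul_le_mul_of_nonneg_right b5 (sq_nonneg (ξ x))
          linarith
        refine this.trans ?_
        have : 0 ≤ v := by positivity
        gcongr
      obtain ⟨mg, lg⟩ := wdiff ((hQ.continuous hc).sub (hQ.continuous (hs' hc')))
        (fun x => (lip hcm hc' x).1)
      have hpd : (∫ x, ξ x * Q c x) ^ 2 ≤ 2 * (∫ x, ξ x * Q c' x) ^ 2 + 2 * w ^ 2 * n ^ 2 := by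
        have b : |∫ x, ξ x * (Q c x - Q c' x)| ≤ l2 ξ * l2 (Q c - Q c') :=
          abs_integral_mul_le hξ.2 mg
        have e : ∫ x, ξ x * (Q c x - Q c' x) = (∫ x, ξ x * Q c x) - ∫ x, ξ x * Q c' x := by
          rw [← integral_sub (integrable_mul hξ.2 (hQ.h1Pair hc (hb c hcm)).2)
            (integrable_mul hξ.2 (hQ.h1Pair (hs' hc') (hb c' hc')).2)]
          congr 1; funext x; ring
        rw [e] at b
        have b2 : |(∫ x, ξ x * Q c x) - ∫ x, ξ x * Q c' x| ≤ n * w :=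
          b.trans (mul_le_mul ln lg (l2_nonneg _) (nrm_nonneg _ _))
        have b3 := sq_le_sq' (abs_le.1 b2).1 (abs_le.1 b2).2
        nlinarith [sq_nonneg ((∫ x, ξ x * Q c x) - 2 * ∫ x, ξ x * Q c' x)]
      have e2' : (C * v + 2 * C ^ 2 * w ^ 2) * n ^ 2 ≤ 1 / 2 * n ^ 2 := by gcongr
      set p := (∫ x, ξ x * Q c x) ^ 2
      set p' := (∫ x, ξ x * Q c' x) ^ 2
      set s := (∫ x, ξ x * centering x) ^ 2
      have hs0 : 0 ≤ s := sq_nonneg _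
      have k1 : C * quadForm f Q c ξ η ≤ C * (quadForm f Q c' ξ η + v * n ^ 2) := by gcongr
      have k2 : C * (C * p) ≤ C * (C * (2 * p' + 2 * w ^ 2 * n ^ 2)) := by gcongr
      have k3 : 0 ≤ C * (C * s) := by positivity
      nlinarith
    exact hco'.mono (by positivity) (by simp only [A']; linarith)
  · rw [div_le_iff₀ A'p]
    have e : 1 = momentumDeriv Q c / 2 * (2 / momentumDeriv Q c) := by field_simp
    rw [e]
    exact mul_le_mul e1.le (by simp only [A']; linarith) a1.le (by linarith)
  · obtain ⟨mg, lg⟩ := wdiff ((hQ.continuous_deriv hc).sub (hQ.continuous_deriv (hs' hc')))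
      (fun x => (lip hcm hc' x).2)
    have b : |∫ x, (deriv (Q c) x - deriv (Q c') x) * centering x| ≤
        l2 (deriv (Q c) - deriv (Q c')) * l2 centering := abs_integral_mul_le mg memLp_centering
    have e : ∫ x, (deriv (Q c) x - deriv (Q c') x) * centering x =
        (∫ x, deriv (Q c) x * centering x) - ∫ x, deriv (Q c') x * centering x := by
      rw [← integral_sub (integrable_mul (hQ.h1Pair hc (hb c hcm)).3 memLp_centering)
        (integrable_mul (hQ.h1Pair (hs' hc') (hb c' hc')).3 memLp_centering)]
      congr 1; funext x; ring
    rw [e] at b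
    have b2 : m / 2 ≤ -∫ x, deriv (Q c') x * centering x := by
      have : l2 (deriv (Q c) - deriv (Q c')) * l2 centering ≤
          A * |c - c'| * lw * l2 centering := mul_le_mul_of_nonneg_right lg (l2_nonneg _)
      have := (abs_le.1 b).1
      simp only [hm] at e3 ⊢
      linarith
    refine le_trans ?_ b2
    rw [div_le_iff₀ A'p]
    have e : 1 = m / 2 * (2 / m) := by field_simp
    rw [e]
    exact mul_le_mul_of_nonneg_left (by simp only [A']; linarith) (by linarith)
  · simp only [A']
    linarith [hc'.2, le_abs_self β]

/-- All the constants are uniform for speeds near the compact set `I`. -/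
lemma exists_uniform_goodSpeed (hQ : SolitaryWaveFamily f I₀ Q) (hf : AdmissibleNonlinearity f)
    {I J : Set ℝ} (hI : IsCompact I) (hIJ : I ⊆ interior J) (hJ : J ⊆ I₀)
    (hstable : ∀ c ∈ I, 0 < deriv (fun c' => momentum (Q c')) c) :
    ∃ A ≥ 1, ∃ r > 0, ∀ c₀ ∈ I, ∀ c, |c - c₀| ≤ r → c ∈ J ∧ GoodSpeed f Q A c := by
  have loc : ∃ U, IsOpen U ∧ I ⊆ U ∧ ∃ A > 0, ∀ c ∈ U, c ∈ J ∧ GoodSpeed f Q A c := by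
    refine hI.induction_on (p := fun s => ∃ U, IsOpen U ∧ s ⊆ U ∧ ∃ A > 0, ∀ c ∈ U,
      c ∈ J ∧ GoodSpeed f Q A c) ?_ ?_ ?_ ?_
    · exact ⟨∅, isOpen_empty, Subset.rfl, 1, one_pos, by simp⟩
    · rintro s t hst ⟨U, hU, htU, hh⟩
      exact ⟨U, hU, hst.trans htU, hh⟩
    · rintro s t ⟨U, hU, hsU, A, hA, hh⟩ ⟨U', hU', hsU', A', hA', hh'⟩
      refine ⟨U ∪ U', hU.union hU', union_subset_union hsU hsU', max A A', by positivity, ?_⟩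
      rintro c (hc | hc)
      · exact ⟨(hh c hc).1, (hh c hc).2.mono hA (le_max_left _ _)⟩
      · exact ⟨(hh' c hc).1, (hh' c hc).2.mono hA' (le_max_right _ _)⟩
    · intro c hc
      have hcI : c ∈ I₀ := hJ (interior_subset (hIJ hc))
      have hδ := hstable c hc
      rw [(hQ.hasDerivAt_momentum hf hcI).deriv] at hδ
      obtain ⟨A, hA, ev⟩ := hQ.eventually_goodSpeed hf hcI hδ
      have ev2 := (isOpen_interior.mem_nhds (hIJ hc) : interior J ∈ 𝓝 c)
      obtain ⟨U, hU, hUo, hcU⟩ := mem_nhds_iff.1 (ev.and ev2)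
      exact ⟨U, mem_nhdsWithin_of_mem_nhds (hUo.mem_nhds hcU), U, hUo, Subset.rfl, A, hA,
        fun c' hc' => ⟨interior_subset (hU hc').2, (hU hc').1⟩⟩
  obtain ⟨U, hU, hIU, A, hA, hh⟩ := loc
  obtain ⟨r, hr, hrU⟩ := hI.exists_cthickening_subset_open hU hIU
  refine ⟨max A 1, le_max_right _ _, r, hr, fun c₀ hc₀ c hc => ?_⟩
  have : c ∈ U := hrU (Metric.mem_cthickening_of_dist_le c c₀ r I hc₀ (by rwa [Real.dist_eq]))
  exact ⟨(hh c this).1, (hh c this).2.mono hA (le_max_left _ _)⟩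

end SolitaryWaveFamily

/-! ### The expansion of the energy -/

/-- `g` is integrable with integral `v`. -/
structure HasInt (g : ℝ → ℝ) (v : ℝ) : Prop where
  integrable : Integrable g
  eq : ∫ x, g x = v

namespace HasInt

variable {g h : ℝ → ℝ} {v w : ℝ}

lemma of_integrable (hg : Integrable g) : HasInt g (∫ x, g x) := ⟨hg, rfl⟩

lemma add (hg : HasInt g v) (hh : HasInt h w) : HasInt (fun x => g x + h x) (v + w) :=
  ⟨hg.1.add hh.1, by rw [integral_add hg.1 hh.1, hg.2, hh.2]⟩

lemma sub (hg : HasInt g v) (hh : HasInt h w) : HasInt (fun x => g x - h x) (v - w) :=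
  ⟨hg.1.sub hh.1, by rw [integral_sub hg.1 hh.1, hg.2, hh.2]⟩

lemma const_mul (hg : HasInt g v) (k : ℝ) : HasInt (fun x => k * g x) (k * v) :=
  ⟨hg.1.const_mul k, by rw [integral_const_mul, hg.2]⟩

lemma congr (hg : HasInt g v) (h' : ∀ x, g x = h x) : HasInt h v :=
  (funext h' : g = h) ▸ hg

lemma abs_le (hg : HasInt g v) (hh : HasInt h w) (h' : ∀ x, |g x| ≤ h x) : |v| ≤ w := by
  rw [← hg.2, ← hh.2]
  exact (abs_integral_le_integral_abs).trans (integral_mono hg.1.abs hh.1 h')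

end HasInt

/-- Bounds with constant `C` for the nonlinearity on `[-M, M]`. -/
structure LocalBounds (f : ℝ → ℝ) (M C : ℝ) : Prop where
  one_le : 1 ≤ C
  abs_le : ∀ x, |x| ≤ M → |f x| ≤ C * |x|
  primitive_le : ∀ x, |x| ≤ M → |primitive f x| ≤ C * x ^ 2
  deriv_le : ∀ x, |x| ≤ M → |deriv f x| ≤ C
  lipschitz : ∀ x y, |x| ≤ M → |y| ≤ M → |f x - f y| ≤ C * |x - y|
  lipschitz_deriv : ∀ x y, |x| ≤ M → |y| ≤ M → |deriv f x - deriv f y| ≤ C * |x - y|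
  taylor : ∀ q x, |q| ≤ M → |q + x| ≤ M → |f (q + x) - f q - deriv f q * x| ≤ C * x ^ 2
  primitive_taylor_one : ∀ q x, |q| ≤ M → |q + x| ≤ M →
    |primitive f (q + x) - primitive f q - f q * x| ≤ C * x ^ 2
  primitive_taylor : ∀ q x, |q| ≤ M → |q + x| ≤ M →
    |primitive f (q + x) - primitive f q - f q * x - deriv f q / 2 * x ^ 2| ≤ C * |x| ^ 3

lemma AdmissibleNonlinearity.exists_localBounds {f : ℝ → ℝ} (hf : AdmissibleNonlinearity f) {M : ℝ}
    (hM : 0 ≤ M) : ∃ C, LocalBounds f M C := by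
  obtain ⟨C1, h1, a1, a2, a3⟩ := hf.exists_lipschitz M
  obtain ⟨C2, h2, b1, b2⟩ := hf.exists_taylor M
  have mem : ∀ {x}, |x| ≤ M → x ∈ Icc (-M) M := fun h => ⟨(abs_le.1 h).1, (abs_le.1 h).2⟩
  set C := 1 + C1 + C2 + C2 * (2 * M) + C1 / 2 with hC
  have c1 : C1 ≤ C := by simp only [hC]; nlinarith [mul_nonneg h2.le hM]
  have c2 : C2 ≤ C := by simp only [hC]; nlinarith [mul_nonneg h2.le hM]
  have c3 : C2 * (2 * M) + C1 / 2 ≤ C := by simp only [hC]; linarith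
  have c0 : 1 ≤ C := by simp only [hC]; nlinarith [mul_nonneg h2.le hM]
  have t1 : ∀ q x, |q| ≤ M → |q + x| ≤ M →
      |primitive f (q + x) - primitive f q - f q * x| ≤ C * x ^ 2 := by
    intro q x hq hx
    have h := b2 q (mem hq) (q + x) (mem hx)
    rw [add_sub_cancel_left] at h
    have hx2 : |x| ≤ 2 * M := by
      have e : x = q + x - q := by ring
      have := abs_sub (q + x) q
      rw [← e] at this
      linarith
    have hd := a1 q (mem hq)
    have k1 : |deriv f q / 2 * x ^ 2| ≤ C1 / 2 * x ^ 2 := by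
      rw [abs_mul, abs_div, abs_two, abs_of_nonneg (sq_nonneg x)]
      gcongr
    have k2 : C2 * |x| ^ 3 ≤ C2 * (2 * M) * x ^ 2 := by
      rw [pow_succ, sq_abs, mul_assoc, mul_comm (2 * M)]
      gcongr
    have k3 := mul_le_mul_of_nonneg_right c3 (sq_nonneg x)
    have e : primitive f (q + x) - primitive f q - f q * x =
      (primitive f (q + x) - primitive f q - f q * x - deriv f q / 2 * x ^ 2) +
        deriv f q / 2 * x ^ 2 := by ring
    rw [e]
    refine (abs_add_le _ _).trans ?_
    linarith
  have z : |(0 : ℝ)| ≤ M := by simpa using hM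
  refine ⟨C, c0, fun x hx => ?_, fun x hx => ?_, fun x hx => (a1 x (mem hx)).trans c1,
    fun x y hx hy => (a2 y (mem hy) x (mem hx)).trans
      (mul_le_mul_of_nonneg_right c1 (abs_nonneg _)),
    fun x y hx hy => (a3 y (mem hy) x (mem hx)).trans
      (mul_le_mul_of_nonneg_right c1 (abs_nonneg _)), fun q x hq hx => ?_, t1, fun q x hq hx => ?_⟩
  · have := a2 0 (mem z) x (mem hx)
    rw [hf.zero, sub_zero, sub_zero] at this
    exact this.trans (mul_le_mul_of_nonneg_right c1 (abs_nonneg _))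
  · simpa [hf.zero, primitive_zero] using t1 0 x z (by simpa using hx)
  · have h := b1 q (mem hq) (q + x) (mem hx)
    rw [add_sub_cancel_left] at h
    exact h.trans (mul_le_mul_of_nonneg_right c2 (sq_nonneg _))
  · have h := b2 q (mem hq) (q + x) (mem hx)
    rw [add_sub_cancel_left] at h
    exact h.trans (mul_le_mul_of_nonneg_right c2 (by positivity))

lemma LocalBounds.memLp_comp {f u : ℝ → ℝ} {M C : ℝ} (hf : AdmissibleNonlinearity f)
    (hC : LocalBounds f M C) (hu : Continuous u) (h2 : MemLp u 2 volume) (hM : ∀ x, |u x| ≤ M) :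
    MemLp (fun x => f (u x)) 2 volume := by
  refine memLp_of_abs_le (h2.const_mul C) (hf.continuous.comp hu).aestronglyMeasurable fun x => ?_
  rw [abs_mul, abs_of_pos (zero_lt_one.trans_le hC.one_le)]
  exact hC.abs_le _ (hM x)

lemma LocalBounds.integrable_primitive {f u : ℝ → ℝ} {M C : ℝ} (hf : AdmissibleNonlinearity f)
    (hC : LocalBounds f M C) (hu : Continuous u) (h2 : MemLp u 2 volume) (hM : ∀ x, |u x| ≤ M) :
    Integrable (fun x => primitive f (u x)) :=
  (h2.integrable_sq.const_mul C).mono' (hf.continuous_primitive.comp hu).aestronglyMeasurable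
    (ae_of_all _ fun x => hC.primitive_le _ (hM x))

/-- The energy `∫ (½ v_x² - F(v))`, where `V` is the derivative of `U`. -/
def energy (f U V : ℝ → ℝ) : ℝ := ∫ x, (1 / 2 * V x ^ 2 - primitive f (U x))

lemma abs_integral_wt_mul_le {ξ : ℝ → ℝ} (h : MemLp ξ 2 volume) : ∫ x, wt x * |ξ x| ≤ l2 wt * l2 ξ := by
  have := abs_integral_mul_le memLp_wt h.abs
  have e : l2 (fun x => |ξ x|) = l2 ξ := by simp only [l2, sq_abs]
  exact (le_abs_self _).trans (this.trans_eq (by rw [← e]; rfl))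

namespace SolitaryWaveFamily

variable {f : ℝ → ℝ} {I₀ : Set ℝ} {Q : ℝ → ℝ → ℝ} {c A C₀ : ℝ} {ξ η : ℝ → ℝ}

lemma profile_abs_le (hA : 0 ≤ A) (hg : GoodSpeed f Q A c) (x : ℝ) : |Q c x| ≤ A :=
  abs_le_of_wt_sq hA hg.bounds.profile x

lemma profile_add_abs_le (hA : 0 ≤ A) (hg : GoodSpeed f Q A c) (hξ : H1Pair ξ η)
    (h1 : nrm ξ η ≤ 1) (x : ℝ) : |Q c x + ξ x| ≤ A + 2 := by
  have a := profile_abs_le hA hg x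
  have b := hξ.abs_apply_le x
  have := abs_add_le (Q c x) (ξ x)
  linarith

/-- The pairings of the perturbation and of its derivative with `Q_c''` and `Q_c'` cancel: an
integration by parts that uses the profile equation. -/
lemma hasInt_slope_mul (hQ : SolitaryWaveFamily f I₀ Q) (hf : AdmissibleNonlinearity f)
    (hc : c ∈ I₀) (hb : ProfileBounds f Q c A) (hξ : H1Pair ξ η) :
    HasInt (fun x => deriv (Q c) x * η x + (c * Q c x - f (Q c x)) * ξ x) 0 := by
  have p1 := hQ.h1Pair_slope hf hc hb
  have i1 := integrable_mul p1.2 hξ.3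
  have i2 := integrable_mul p1.3 hξ.2
  refine ⟨i1.add i2, ?_⟩
  rw [integral_add i1 i2, integral_mul_eq_neg p1.1 hξ.1 (integrable_mul p1.2 hξ.2) i2 i1]
  ring

/-- The energy expanded around the solitary wave: the quadratic form is its second variation at
fixed momentum. -/
lemma energy_expansion (hQ : SolitaryWaveFamily f I₀ Q) (hf : AdmissibleNonlinearity f)
    (hc : c ∈ I₀) (hA : 0 ≤ A) (hg : GoodSpeed f Q A c) (hC : LocalBounds f (A + 2) C₀)
    (hξ : H1Pair ξ η) (h1 : nrm ξ η ≤ 1) :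
    |energy f (fun x => Q c x + ξ x) (fun x => deriv (Q c) x + η x) - profileEnergy f Q c +
      c * (momentum (fun x => Q c x + ξ x) - momentum (Q c)) - 1 / 2 * quadForm f Q c ξ η| ≤
      2 * C₀ * nrm ξ η ^ 3 := by
  have hb := hg.bounds
  have pQ := hQ.h1Pair hc hb
  have pu := pQ.add hξ
  have bQ : ∀ x, |Q c x| ≤ A + 2 := fun x => (profile_abs_le hA hg x).trans (by linarith)
  have bu := profile_add_abs_le hA hg hξ h1
  have i1 : Integrable fun x => 1 / 2 * (deriv (Q c) x + η x) ^ 2 - primitive f (Q c x + ξ x) :=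
    (pu.3.integrable_sq.const_mul _).sub (hC.integrable_primitive hf pu.1.continuous pu.2 bu)
  have i2 : Integrable fun x => 1 / 2 * deriv (Q c) x ^ 2 - primitive f (Q c x) :=
    (pQ.3.integrable_sq.const_mul _).sub (hC.integrable_primitive hf pQ.1.continuous pQ.2 bQ)
  have i3 : Integrable fun x => η x ^ 2 + (c - deriv f (Q c x)) * ξ x ^ 2 := by
    simp only [sq]
    exact (integrable_mul hξ.3 hξ.3).add (hQ.integrable_potential_mul hf hc hb hξ.2 hξ.2)
  have H := ((((HasInt.of_integrable i1).sub (.of_integrable i2)).add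
    (((HasInt.of_integrable pu.2.integrable_sq).sub
      (.of_integrable pQ.2.integrable_sq)).const_mul (c / 2))).sub
        ((HasInt.of_integrable i3).const_mul (1 / 2))).sub (hQ.hasInt_slope_mul hf hc hb hξ)
  have B := H.abs_le (((HasInt.of_integrable hξ.2.integrable_sq)).const_mul
    (2 * C₀ * nrm ξ η)) fun x => by
    have t := hC.primitive_taylor (Q c x) (ξ x) (bQ x) (bu x)
    have e : ∀ q p u w : ℝ, 1 / 2 * (p + w) ^ 2 - primitive f (q + u) -
        (1 / 2 * p ^ 2 - primitive f q) + c / 2 * ((q + u) ^ 2 - q ^ 2) -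
        1 / 2 * (w ^ 2 + (c - deriv f q) * u ^ 2) - (p * w + (c * q - f q) * u) =
        -(primitive f (q + u) - primitive f q - f q * u - deriv f q / 2 * u ^ 2) := by
      intro q p u w; ring
    rw [e, abs_neg]
    refine t.trans ?_
    have := hξ.abs_apply_le x
    have hC0 := zero_le_one.trans hC.one_le
    calc C₀ * |ξ x| ^ 3 = C₀ * |ξ x| * |ξ x| ^ 2 := by ring
      _ ≤ C₀ * (2 * nrm ξ η) * |ξ x| ^ 2 := by gcongr
      _ = _ := by rw [sq_abs]; ring
  have hC0 := zero_le_one.trans hC.one_le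
  have n0 := nrm_nonneg ξ η
  have l : ∫ x, ξ x ^ 2 ≤ nrm ξ η ^ 2 := by
    rw [← sq_l2]; exact pow_le_pow_left₀ (l2_nonneg _) (l2_le_nrm ξ η) 2
  have B2 : 2 * C₀ * nrm ξ η * ∫ x, ξ x ^ 2 ≤ 2 * C₀ * nrm ξ η ^ 3 := by
    calc 2 * C₀ * nrm ξ η * ∫ x, ξ x ^ 2 ≤ 2 * C₀ * nrm ξ η * nrm ξ η ^ 2 := by gcongr
      _ = _ := by ring
  refine le_trans (le_of_eq ?_) (B.trans B2)
  simp only [energy, profileEnergy, momentum, quadForm]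
  congr 1
  ring

end SolitaryWaveFamily

/-! ### Expansions of the force and of the test functional -/

/-- The function `(c - f'(Q_c)) Q_c - 3 Q_c''`: its pairing with the perturbation is the first order
term of the force that the gradient of the potential exerts on the energy. -/
def forceProfile (f : ℝ → ℝ) (Q : ℝ → ℝ → ℝ) (c x : ℝ) : ℝ :=
  (c - deriv f (Q c x)) * Q c x - 3 * (c * Q c x - f (Q c x))

lemma abs_sub_zero_le {β β' : ℝ → ℝ} {μ : ℝ} (hβ : ∀ x, HasDerivAt β (β' x) x)
    (hμ : ∀ x, |β' x| ≤ μ) (x : ℝ) : |β x - β 0| ≤ μ * |x| := by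
  have := convex_univ.norm_image_sub_le_of_norm_hasDerivWithin_le
    (fun z _ => (hβ z).hasDerivWithinAt) (fun z _ => hμ z) (mem_univ (0 : ℝ)) (mem_univ x)
  simpa using this

namespace SolitaryWaveFamily

variable {f : ℝ → ℝ} {I₀ : Set ℝ} {Q : ℝ → ℝ → ℝ} {c A C₀ : ℝ} {ξ η : ℝ → ℝ}

lemma abs_mul_wt_sq_le (x : ℝ) : |x| * wt x ^ 2 ≤ wt x := by
  have := mul_le_mul_of_nonneg_right (abs_mul_wt_le x) (wt_pos x).le
  calc |x| * wt x ^ 2 = |x| * wt x * wt x := by ring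
    _ ≤ _ := by linarith

lemma continuous_forceProfile (hQ : SolitaryWaveFamily f I₀ Q) (hf : AdmissibleNonlinearity f)
    (hc : c ∈ I₀) : Continuous (forceProfile f Q c) :=
  ((hQ.continuous_potential hf hc).mul (hQ.continuous hc)).sub
    (continuous_const.mul (hQ.continuous_second hf hc))

lemma forceProfile_abs_le (hA : 0 ≤ A) (hb : ProfileBounds f Q c A) (x : ℝ) :
    |forceProfile f Q c x| ≤ (A * A + 3 * A) * wt x ^ 2 := by
  have h1 : |(c - deriv f (Q c x)) * Q c x| ≤ A * (A * wt x ^ 2) := by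
    rw [abs_mul]
    exact mul_le_mul (hb.potential x) (hb.profile x) (abs_nonneg _) hA
  have h2 : |3 * (c * Q c x - f (Q c x))| ≤ 3 * (A * wt x ^ 2) := by
    rw [abs_mul, abs_of_pos three_pos]
    exact mul_le_mul_of_nonneg_left (hb.second x) three_pos.le
  refine (abs_sub _ _).trans ?_
  linarith

lemma memLp_forceProfile (hQ : SolitaryWaveFamily f I₀ Q) (hf : AdmissibleNonlinearity f)
    (hc : c ∈ I₀) (hA : 0 ≤ A) (hb : ProfileBounds f Q c A) :
    MemLp (forceProfile f Q c) 2 volume :=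
  memLp_of_wt (hQ.continuous_forceProfile hf hc).aestronglyMeasurable
    (le_wt_of_le_sq (forceProfile_abs_le hA hb))

/-- The zeroth order term of the force vanishes: by the first integral of the profile equation its
density is the derivative of `β Q_c Q_c'`. -/
lemma hasInt_force_zero (hQ : SolitaryWaveFamily f I₀ Q) (hf : AdmissibleNonlinearity f)
    (hc : c ∈ I₀) (hb : ProfileBounds f Q c A) {β β' : ℝ → ℝ}
    {ε μ : ℝ} (hβ : ∀ x, HasDerivAt β (β' x) x) (hε : ∀ x, |β x| ≤ ε) (hμ : ∀ x, |β' x| ≤ μ) :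
    HasInt (fun x => β x * (c / 2 * Q c x ^ 2 - Q c x * f (Q c x) + 3 / 2 * deriv (Q c) x ^ 2 +
      primitive f (Q c x)) + β' x * (Q c x * deriv (Q c) x)) 0 := by
  have pQ := hQ.h1Pair hc hb
  have p1 := hQ.h1Pair_slope hf hc hb
  have βc : Continuous β := continuous_iff_continuousAt.2 fun x => (hβ x).continuousAt
  have β'm : AEStronglyMeasurable β' volume := by
    have : β' = deriv β := funext fun x => (hβ x).deriv.symm
    rw [this]
    exact (measurable_deriv β).aestronglyMeasurable
  have i1 : Integrable fun x => β x * (Q c x * deriv (Q c) x) :=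
    (integrable_mul pQ.2 pQ.3).bdd_mul βc.aestronglyMeasurable (ae_of_all _ hε)
  have i2 : Integrable fun x => β' x * (Q c x * deriv (Q c) x) :=
    (integrable_mul pQ.2 pQ.3).bdd_mul β'm (ae_of_all _ hμ)
  have i3 : Integrable fun x => β x * (deriv (Q c) x * deriv (Q c) x +
      Q c x * (c * Q c x - f (Q c x))) :=
    ((integrable_mul pQ.3 pQ.3).fun_add (integrable_mul pQ.2 p1.3)).bdd_mul
      βc.aestronglyMeasurable (ae_of_all _ hε)
  have d : ∀ x, HasDerivAt (fun x => β x * (Q c x * deriv (Q c) x))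
      (β x * (deriv (Q c) x * deriv (Q c) x + Q c x * (c * Q c x - f (Q c x))) +
        β' x * (Q c x * deriv (Q c) x)) x := fun x =>
    ((hβ x).mul ((hQ.hasDerivAt hc x).mul (hQ.hasDerivAt_deriv hc x))).congr_deriv (by
      simp only [Pi.mul_apply]; ring)
  have H : HasInt _ 0 := ⟨i3.fun_add i2, integral_eq_zero_of_hasDerivAt_of_integrable d
    (i3.fun_add i2) i1⟩
  refine H.congr fun x => ?_
  have := hQ.first_integral hf hc x
  have e : primitive f (Q c x) = (c * Q c x ^ 2 - deriv (Q c) x ^ 2) / 2 := by linarith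
  rw [e]; ring

/-- The force term in the evolution of the energy, to first order in the perturbation. -/
lemma force_expansion (hQ : SolitaryWaveFamily f I₀ Q) (hf : AdmissibleNonlinearity f)
    (hA : 1 ≤ A) (hC : LocalBounds f (A + 2) C₀) :
    ∃ C > 0, ∀ (c : ℝ) (ξ η β β' : ℝ → ℝ) (ε μ : ℝ), c ∈ I₀ → GoodSpeed f Q A c → H1Pair ξ η →
      nrm ξ η ≤ 1 → (∀ x, HasDerivAt β (β' x) x) → (∀ x, |β x| ≤ ε) → (∀ x, |β' x| ≤ μ) → μ ≤ ε →
      Integrable (fun x => β x * (c / 2 * (Q c x + ξ x) ^ 2 - (Q c x + ξ x) * f (Q c x + ξ x) +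
        3 / 2 * (deriv (Q c) x + η x) ^ 2 + primitive f (Q c x + ξ x)) +
        β' x * ((Q c x + ξ x) * (deriv (Q c) x + η x))) ∧
      |(∫ x, (β x * (c / 2 * (Q c x + ξ x) ^ 2 - (Q c x + ξ x) * f (Q c x + ξ x) +
        3 / 2 * (deriv (Q c) x + η x) ^ 2 + primitive f (Q c x + ξ x)) +
        β' x * ((Q c x + ξ x) * (deriv (Q c) x + η x)))) - β 0 * ∫ x, ξ x * forceProfile f Q c x| ≤
      C * (ε * nrm ξ η ^ 2 + μ * nrm ξ η) := by
  have hC0 : 1 ≤ C₀ := hC.one_le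
  have hA0 : 0 ≤ A := by linarith
  set K := A / 2 + (A + 4) * C₀ + 2 + A * A + 4 * A with hK
  have K0 : 0 < K := by positivity
  have lw := l2_nonneg wt
  refine ⟨K * (1 + 2 * l2 wt), by positivity, ?_⟩
  intro c ξ η β β' ε μ hc hg hξ h1 hβ hε hμ hμε
  have hb := hg.bounds
  have pQ := hQ.h1Pair hc hb
  have pu := pQ.add hξ
  have bQ : ∀ x, |Q c x| ≤ A + 2 := fun x => (profile_abs_le hA0 hg x).trans (by linarith)
  have bu := profile_add_abs_le hA0 hg hξ h1
  have βc : Continuous β := continuous_iff_continuousAt.2 fun x => (hβ x).continuousAt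
  have β'm : AEStronglyMeasurable β' volume := by
    have : β' = deriv β := funext fun x => (hβ x).deriv.symm
    rw [this]
    exact (measurable_deriv β).aestronglyMeasurable
  have i1 : Integrable fun x => β x * (c / 2 * (Q c x + ξ x) ^ 2 - (Q c x + ξ x) *
      f (Q c x + ξ x) + 3 / 2 * (deriv (Q c) x + η x) ^ 2 + primitive f (Q c x + ξ x)) :=
    Integrable.bdd_mul (((integrable_sub (pu.2.integrable_sq.const_mul _)
      (integrable_mul pu.2 (hC.memLp_comp hf pu.1.continuous pu.2 bu))).fun_add
      (pu.3.integrable_sq.const_mul _)).fun_add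
      (hC.integrable_primitive hf pu.1.continuous pu.2 bu)) βc.aestronglyMeasurable (ae_of_all _ hε)
  have i2 : Integrable fun x => β' x * ((Q c x + ξ x) * (deriv (Q c) x + η x)) :=
    (integrable_mul pu.2 pu.3).bdd_mul β'm (ae_of_all _ hμ)
  refine ⟨i1.fun_add i2, ?_⟩
  -- the zeroth order term and the linear term at the origin are subtracted; adding a multiple of
  -- `hasInt_slope_mul`, which is zero, makes the linear term a pairing with `ξ` alone
  have H := (((HasInt.of_integrable (i1.fun_add i2)).sub
    (hQ.hasInt_force_zero hf hc hb hβ hε hμ)).sub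
    ((HasInt.of_integrable (integrable_mul hξ.2
      (hQ.memLp_forceProfile hf hc hA0 hb))).const_mul (β 0))).sub
    ((hQ.hasInt_slope_mul hf hc hb hξ).const_mul (3 * β 0))
  have ε0 : 0 ≤ ε := (abs_nonneg _).trans (hε 0)
  have μ0 : 0 ≤ μ := (abs_nonneg _).trans (hμ 0)
  have iw : Integrable fun x => wt x * |ξ x| := integrable_mul memLp_wt hξ.2.abs
  have iw' : Integrable fun x => wt x * |η x| := integrable_mul memLp_wt hξ.3.abs
  have B := H.abs_le ((((HasInt.of_integrable hξ.2.integrable_sq).add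
    (.of_integrable hξ.3.integrable_sq)).const_mul (K * ε)).add
      (((HasInt.of_integrable iw).add (.of_integrable iw')).const_mul (K * μ))) fun x => by
    have w0 := wt_pos x
    have xw := abs_mul_wt_sq_le x
    have cp := hQ.speed_pos c hc
    have ca := hg.speed_le
    obtain ⟨q, hq⟩ : ∃ q, q = Q c x := ⟨_, rfl⟩
    obtain ⟨p, hp⟩ : ∃ p, p = deriv (Q c) x := ⟨_, rfl⟩
    obtain ⟨u, hu⟩ : ∃ u, u = ξ x := ⟨_, rfl⟩
    obtain ⟨v, hv⟩ : ∃ v, v = η x := ⟨_, rfl⟩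
    have t1 := hC.taylor q u (hq ▸ bQ x) (hq ▸ hu ▸ bu x)
    have t2 := hC.primitive_taylor_one q u (hq ▸ bQ x) (hq ▸ hu ▸ bu x)
    have t3 := hC.deriv_le q (hq ▸ bQ x)
    have t4 : |q + u| ≤ A + 2 := hq ▸ hu ▸ bu x
    have t5 : |q| ≤ A * wt x ^ 2 := hq ▸ hb.profile x
    have t6 : |p| ≤ A * wt x ^ 2 := hp ▸ hb.slope x
    have t7 : |c - deriv f q| ≤ A := hq ▸ hb.potential x
    have t8 := abs_sub_zero_le hβ hμ x
    have t9 := hε x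
    have t10 := hμ x
    simp only [forceProfile, ← hq, ← hp, ← hu, ← hv]
    have e : β x * (c / 2 * (q + u) ^ 2 - (q + u) * f (q + u) + 3 / 2 * (p + v) ^ 2 +
        primitive f (q + u)) + β' x * ((q + u) * (p + v)) -
        (β x * (c / 2 * q ^ 2 - q * f q + 3 / 2 * p ^ 2 + primitive f q) + β' x * (q * p)) -
        β 0 * (u * ((c - deriv f q) * q - 3 * (c * q - f q))) -
        3 * β 0 * (p * v + (c * q - f q) * u) =
        β x * (c / 2 * u ^ 2 - (q + u) * (f (q + u) - f q - deriv f q * u) - deriv f q * u ^ 2 +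
          3 / 2 * v ^ 2 + (primitive f (q + u) - primitive f q - f q * u)) +
        (β x - β 0) * ((c - deriv f q) * q * u + 3 * (p * v)) +
        β' x * (q * v + u * p + u * v) := by ring
    rw [e]
    have a1 : |c / 2 * u ^ 2 - (q + u) * (f (q + u) - f q - deriv f q * u) - deriv f q * u ^ 2 +
        3 / 2 * v ^ 2 + (primitive f (q + u) - primitive f q - f q * u)| ≤
        (A / 2 + (A + 4) * C₀) * u ^ 2 + 3 / 2 * v ^ 2 := by
      have b1 : |c / 2 * u ^ 2| ≤ A / 2 * u ^ 2 := by
        rw [abs_of_nonneg (by positivity)]; gcongr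
      have b2 : |(q + u) * (f (q + u) - f q - deriv f q * u)| ≤ (A + 2) * (C₀ * u ^ 2) := by
        rw [abs_mul]; exact mul_le_mul t4 t1 (abs_nonneg _) (by linarith)
      have b3 : |deriv f q * u ^ 2| ≤ C₀ * u ^ 2 := by
        rw [abs_mul, abs_of_nonneg (sq_nonneg u)]; gcongr
      have b4 : |3 / 2 * v ^ 2| = 3 / 2 * v ^ 2 := abs_of_nonneg (by positivity)
      refine (abs_add_le _ _).trans ?_
      have c1 := (abs_add_le (c / 2 * u ^ 2 - (q + u) * (f (q + u) - f q - deriv f q * u) -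
        deriv f q * u ^ 2) (3 / 2 * v ^ 2))
      have c2 := abs_sub (c / 2 * u ^ 2 - (q + u) * (f (q + u) - f q - deriv f q * u))
        (deriv f q * u ^ 2)
      have c3 := abs_sub (c / 2 * u ^ 2) ((q + u) * (f (q + u) - f q - deriv f q * u))
      linarith
    have a2 : |(c - deriv f q) * q * u + 3 * (p * v)| ≤ (A * A + 3 * A) * wt x ^ 2 * (|u| + |v|) := by
      have b1 : |(c - deriv f q) * q * u| ≤ A * (A * wt x ^ 2) * |u| := by
        rw [abs_mul, abs_mul]; gcongr
      have b2 : |3 * (p * v)| ≤ 3 * (A * wt x ^ 2 * |v|) := by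
        rw [abs_mul, abs_mul, abs_of_pos three_pos]; gcongr
      refine (abs_add_le _ _).trans ((add_le_add b1 b2).trans ?_)
      have : 0 ≤ A * A * wt x ^ 2 * |v| + 3 * A * wt x ^ 2 * |u| := by positivity
      linarith
    have a3 : |q * v + u * p + u * v| ≤ A * wt x * (|u| + |v|) + (u ^ 2 + v ^ 2) / 2 := by
      have b1 : |q * v| ≤ A * wt x * |v| := by
        rw [abs_mul]; gcongr
        exact t5.trans (mul_le_mul_of_nonneg_left (wt_sq_le x) hA0)
      have b2 : |u * p| ≤ |u| * (A * wt x) := by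
        rw [abs_mul]; gcongr
        exact t6.trans (mul_le_mul_of_nonneg_left (wt_sq_le x) hA0)
      have b3 : |u * v| ≤ (u ^ 2 + v ^ 2) / 2 := by
        rw [abs_mul, ← sq_abs u, ← sq_abs v]; linarith [two_mul_le_add_sq (|u|) (|v|)]
      have c1 := abs_add_le (q * v + u * p) (u * v)
      have c2 := abs_add_le (q * v) (u * p)
      linarith
    have d1 := mul_le_mul t9 a1 (abs_nonneg _) ε0
    have d2 := mul_le_mul t8 a2 (abs_nonneg _) (by positivity)
    have d3 := mul_le_mul t10 a3 (abs_nonneg _) μ0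
    rw [← abs_mul] at d1 d2 d3
    have d2' : μ * |x| * ((A * A + 3 * A) * wt x ^ 2 * (|u| + |v|)) ≤
        μ * ((A * A + 3 * A) * wt x * (|u| + |v|)) := by
      calc μ * |x| * ((A * A + 3 * A) * wt x ^ 2 * (|u| + |v|)) =
          μ * ((A * A + 3 * A) * (|x| * wt x ^ 2) * (|u| + |v|)) := by ring
        _ ≤ _ := by gcongr
    have d3' : μ * ((u ^ 2 + v ^ 2) / 2) ≤ ε * ((u ^ 2 + v ^ 2) / 2) := by gcongr
    have K1 : A / 2 + (A + 4) * C₀ + 2 ≤ K := by rw [hK]; linarith [mul_nonneg hA0 hA0]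
    have K2 : A * A + 4 * A ≤ K := by rw [hK]; linarith [mul_nonneg hA0 (zero_le_one.trans hC0)]
    have f1 := mul_le_mul_of_nonneg_right K1 (by positivity : 0 ≤ ε * (u ^ 2 + v ^ 2))
    have f2 := mul_le_mul_of_nonneg_right K2 (by positivity : 0 ≤ μ * wt x * (|u| + |v|))
    have f3 : 0 ≤ ε * ((A / 2 + (A + 4) * C₀) * v ^ 2) := by positivity
    have f4 : 0 ≤ ε * u ^ 2 * (3 / 2) := by positivity
    refine (abs_add_le _ _).trans ((add_le_add_left (abs_add_le _ _) _).trans ?_)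
    linarith
  have l1 := abs_integral_wt_mul_le hξ.2
  have l2' := abs_integral_wt_mul_le hξ.3
  have l3 := mul_le_mul_of_nonneg_left (l2_le_nrm ξ η) lw
  have l4 := mul_le_mul_of_nonneg_left (l2_le_nrm' ξ η) lw
  have e2 : (∫ x, ξ x ^ 2) + ∫ x, η x ^ 2 = nrm ξ η ^ 2 := by rw [sq_nrm, sq_l2, sq_l2]
  rw [e2] at B
  have B2 : K * μ * ((∫ x, wt x * |ξ x|) + ∫ x, wt x * |η x|) ≤
      K * μ * (2 * l2 wt * nrm ξ η) := by
    gcongr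
    linarith
  have n0 := nrm_nonneg ξ η
  have n1 : 0 ≤ K * (2 * l2 wt * (ε * nrm ξ η ^ 2)) + K * (μ * nrm ξ η) := by positivity
  refine le_trans (le_of_eq ?_) (B.trans ?_)
  · congr 1; ring
  · linarith

/-- The right-hand side of the equation tested against a function with derivatives `w`, `w₁`, `w₂`,
in the frame of the solitary wave. -/
lemma test_expansion (hQ : SolitaryWaveFamily f I₀ Q) (hf : AdmissibleNonlinearity f)
    (hA : 1 ≤ A) (hC : LocalBounds f (A + 2) C₀) (hc : c ∈ I₀) (hg : GoodSpeed f Q A c)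
    (hξ : H1Pair ξ η) (h1 : nrm ξ η ≤ 1) {β w w₁ w₂ : ℝ → ℝ} {ε r S B : ℝ} (hw : H1Pair w w₁)
    (hw₁ : H1Pair w₁ w₂) (hβ : Continuous β) (hβB : ∀ x, |β x| ≤ B)
    (hε : ∀ x, |β x - β 0| ≤ ε * |x|) (hS : ∀ x, |w x| ≤ S) (hr : ∀ x, r < |x| → w x = 0)
    (hr0 : 0 ≤ r) (hε0 : 0 ≤ ε) :
    |(∫ x, ((Q c x + ξ x) * w₂ x + (f (Q c x + ξ x) - β x * (Q c x + ξ x)) * w x)) -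
      (c - β 0) * (∫ x, (Q c x + ξ x) * w x) +
      ∫ x, ξ x * (-w₂ x + (c - deriv f (Q c x)) * w x)| ≤
      C₀ * S * nrm ξ η ^ 2 + ε * (A * S * ∫ x, wt x) + ε * r * nrm ξ η * l2 w := by
  have hC0 : 1 ≤ C₀ := hC.one_le
  have hA0 : 0 ≤ A := by linarith
  have hb := hg.bounds
  have pQ := hQ.h1Pair hc hb
  have p1 := hQ.h1Pair_slope hf hc hb
  have pu := pQ.add hξ
  have bQ : ∀ x, |Q c x| ≤ A + 2 := fun x => (profile_abs_le hA0 hg x).trans (by linarith)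
  have bu := profile_add_abs_le hA0 hg hξ h1
  have S0 : 0 ≤ S := (abs_nonneg _).trans (hS 0)
  have muf := hC.memLp_comp hf pu.1.continuous pu.2 bu
  have i1 : Integrable fun x => (Q c x + ξ x) * w₂ x +
      (f (Q c x + ξ x) - β x * (Q c x + ξ x)) * w x := by
    have j1 := integrable_mul pu.2 hw₁.3
    have j2 := integrable_mul muf hw.2
    have j3 : Integrable fun x => β x * ((Q c x + ξ x) * w x) :=
      (integrable_mul pu.2 hw.2).bdd_mul hβ.aestronglyMeasurable (ae_of_all _ hβB)
    exact (j1.fun_add (integrable_sub j2 j3)).congr (ae_of_all _ fun x => by simp only; ring)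
  have i3 : Integrable fun x => ξ x * (-w₂ x + (c - deriv f (Q c x)) * w x) := by
    have j1 := integrable_mul hξ.2 hw₁.3
    have j2 := hQ.integrable_potential_mul hf hc hb hξ.2 hw.2
    exact (integrable_sub j2 j1).congr (ae_of_all _ fun x => by simp only; ring)
  have h0 : HasInt (fun x => Q c x * w₂ x - (c * Q c x - f (Q c x)) * w x) 0 := by
    have j1 := integrable_mul pQ.2 hw₁.3
    have j2 := integrable_mul p1.3 hw.2
    have e1 := integral_mul_eq_neg hw₁.1 pQ.1 (integrable_mul hw₁.2 pQ.2)
      (integrable_mul hw₁.3 pQ.2) (integrable_mul hw₁.2 pQ.3)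
    have e2 := integral_mul_eq_neg hw.1 p1.1 (integrable_mul hw.2 p1.2)
      (integrable_mul hw.3 p1.2) (integrable_mul hw.2 p1.3)
    refine ⟨j1.sub j2, ?_⟩
    rw [integral_sub j1 j2]
    simp only [mul_comm (Q c _) (w₂ _), mul_comm (c * Q c _ - f (Q c _)) (w _)]
    linarith
  have H := ((HasInt.of_integrable i1).sub ((HasInt.of_integrable
    (integrable_mul pu.2 hw.2)).const_mul (c - β 0))).add (.of_integrable i3) |>.sub h0
  have iwξ : Integrable fun x => |ξ x| * |w x| := integrable_mul hξ.2.abs hw.2.abs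
  have B := H.abs_le (((HasInt.of_integrable hξ.2.integrable_sq).const_mul (C₀ * S)).add
    ((HasInt.of_integrable integrable_wt).const_mul (ε * (A * S))) |>.add
    ((HasInt.of_integrable iwξ).const_mul (ε * r))) fun x => by
    have xw := abs_mul_wt_sq_le x
    have e : ∀ q u b b0 W W2 : ℝ, (q + u) * W2 + (f (q + u) - b * (q + u)) * W -
        (c - b0) * ((q + u) * W) + u * (-W2 + (c - deriv f q) * W) -
        (q * W2 - (c * q - f q) * W) =
        (f (q + u) - f q - deriv f q * u) * W - (b - b0) * q * W - (b - b0) * u * W := by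
      intros; ring
    rw [e]
    have t1 := hC.taylor (Q c x) (ξ x) (bQ x) (bu x)
    have b1 : |(f (Q c x + ξ x) - f (Q c x) - deriv f (Q c x) * ξ x) * w x| ≤
        C₀ * ξ x ^ 2 * S := by
      rw [abs_mul]; exact mul_le_mul t1 (hS x) (abs_nonneg _) (by positivity)
    have b2 : |(β x - β 0) * Q c x * w x| ≤ ε * (A * wt x) * S := by
      rw [abs_mul, abs_mul]
      refine mul_le_mul ?_ (hS x) (abs_nonneg _) (by have := wt_pos x; positivity)
      calc |β x - β 0| * |Q c x| ≤ ε * |x| * (A * wt x ^ 2) :=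
            mul_le_mul (hε x) (hb.profile x) (abs_nonneg _) (by positivity)
        _ = ε * (A * (|x| * wt x ^ 2)) := by ring
        _ ≤ _ := by gcongr
    have b3 : |(β x - β 0) * ξ x * w x| ≤ ε * r * (|ξ x| * |w x|) := by
      rw [abs_mul, abs_mul, mul_assoc]
      rcases le_or_gt |x| r with hx | hx
      · refine mul_le_mul_of_nonneg_right ((hε x).trans ?_) (by positivity)
        gcongr
      · simp [hr x hx]
    refine (abs_sub _ _).trans ((add_le_add_left (abs_sub _ _) _).trans ?_)
    linarith
  have n0 := nrm_nonneg ξ η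
  have l : ∫ x, ξ x ^ 2 ≤ nrm ξ η ^ 2 := by
    rw [← sq_l2]; exact pow_le_pow_left₀ (l2_nonneg _) (l2_le_nrm ξ η) 2
  have l' : ∫ x, |ξ x| * |w x| ≤ nrm ξ η * l2 w := by
    have t := (le_abs_self _).trans (abs_integral_mul_le hξ.2.abs hw.2.abs)
    have e1 : ∀ g : ℝ → ℝ, l2 (|g|) = l2 g := fun g => by simp only [l2, Pi.abs_apply, sq_abs]
    rw [e1, e1] at t
    exact t.trans (mul_le_mul_of_nonneg_right (l2_le_nrm ξ η) (l2_nonneg _))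
  have m1 : C₀ * S * ∫ x, ξ x ^ 2 ≤ C₀ * S * nrm ξ η ^ 2 := by gcongr
  have m2 : ε * r * ∫ x, |ξ x| * |w x| ≤ ε * r * (nrm ξ η * l2 w) := by gcongr
  refine le_trans (le_of_eq ?_) (B.trans ?_)
  · rw [sub_zero]
  · linarith

end SolitaryWaveFamily

/-! ### Localised test functions -/

lemma wt_le_three_mul {x y : ℝ} (h : |y - x| ≤ 1) : wt y ≤ 3 * wt x := by
  have h1 : (y - x) ^ 2 ≤ 1 := by rw [← sq_abs]; nlinarith [abs_nonneg (y - x)]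
  rw [wt, wt, ← div_eq_mul_inv, inv_eq_one_div, div_le_div_iff₀ (by positivity) (by positivity)]
  nlinarith [sq_nonneg (y + (y - x))]

/-- Translation is Lipschitz in `L²` on functions that decay together with their derivative. -/
lemma l2_shift_sub_le {φ φ' : ℝ → ℝ} {B : ℝ} (hd : ∀ x, HasDerivAt φ (φ' x) x)
    (h0 : ∀ x, |φ x| ≤ B * wt x) (h1 : ∀ x, |φ' x| ≤ B * wt x) (h : ℝ) :
    l2 (fun x => φ (x + h) - φ x) ≤ 3 * B * l2 wt * |h| := by
  have hB := nonneg_of_wt h0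
  have hc : Continuous φ := continuous_iff_continuousAt.2 fun x => (hd x).continuousAt
  have lw := l2_nonneg wt
  rcases le_total |h| 1 with hh | hh
  · have : ∀ x, |φ (x + h) - φ x| ≤ 3 * B * |h| * wt x := by
      intro x
      have := (convex_uIcc x (x + h)).norm_image_sub_le_of_norm_hasDerivWithin_le
        (f := φ) (f' := φ') (C := 3 * B * wt x) (fun z _ => (hd z).hasDerivWithinAt)
        (fun z hz => by
          refine (h1 z).trans ?_
          have := wt_le_three_mul (x := x) (y := z)
            ((abs_sub_left_of_mem_uIcc hz).trans (by simpa using hh))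
          calc B * wt z ≤ B * (3 * wt x) := by gcongr
            _ = _ := by ring) left_mem_uIcc right_mem_uIcc
      simp only [Real.norm_eq_abs, add_sub_cancel_left] at this
      linarith
    exact (l2_le_of_wt this).trans_eq (by ring)
  · have m := memLp_of_wt hc.aestronglyMeasurable h0
    have t := l2_sub_le (memLp_comp_add_right m h) m
    rw [l2_comp_add_right] at t
    have t2 := l2_le_of_wt h0
    have : B * l2 wt ≤ B * l2 wt * |h| := le_mul_of_one_le_right (by positivity) hh
    have : 0 ≤ B * l2 wt * |h| := by positivity
    linarith

lemma l2_wt_div {R : ℝ} (hR : 0 < R) : l2 (fun x => wt (x / R)) = Real.sqrt R * l2 wt := by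
  rw [l2, l2, ← Real.sqrt_mul hR.le, Measure.integral_comp_div (fun x => wt x ^ 2) R,
    abs_of_pos hR, smul_eq_mul]

/-- Mollification of an odd function of class `C³` with compact support. -/
lemma exists_smooth_approx {W W₁ W₂ W₃ : ℝ → ℝ} {r τ : ℝ} (d0 : ∀ x, HasDerivAt W (W₁ x) x)
    (d1 : ∀ x, HasDerivAt W₁ (W₂ x) x) (d2 : ∀ x, HasDerivAt W₂ (W₃ x) x) (hc : Continuous W₃)
    (hodd : ∀ x, W (-x) = -W x) (hr : ∀ x, r < |x| → W x = 0) (hτ : 0 < τ) :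
    ∃ φ : ℝ → ℝ, ContDiff ℝ ∞ φ ∧ (∀ x, φ (-x) = -φ x) ∧ (∀ x, r + 1 < |x| → φ x = 0) ∧
      (∀ x, |φ x - W x| ≤ τ) ∧ (∀ x, |deriv φ x - W₁ x| ≤ τ) ∧
      ∀ x, |iteratedDeriv 3 φ x - W₃ x| ≤ τ := by
  have e1 : W₁ = deriv W := funext fun x => (d0 x).deriv.symm
  have e2 : W₂ = deriv W₁ := funext fun x => (d1 x).deriv.symm
  have e3 : W₃ = deriv W₂ := funext fun x => (d2 x).deriv.symm
  have c0 : Continuous W := continuous_iff_continuousAt.2 fun x => (d0 x).continuousAt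
  have c1 : Continuous W₁ := continuous_iff_continuousAt.2 fun x => (d1 x).continuousAt
  have c2 : Continuous W₂ := continuous_iff_continuousAt.2 fun x => (d2 x).continuousAt
  have s0 : HasCompactSupport W := HasCompactSupport.intro (isCompact_Icc (a := -r) (b := r))
    fun x hx => hr x (by
      by_contra hh
      exact hx ⟨(abs_le.1 (not_lt.1 hh)).1, (abs_le.1 (not_lt.1 hh)).2⟩)
  have s1 : HasCompactSupport W₁ := e1 ▸ s0.deriv
  have s2 : HasCompactSupport W₂ := e2 ▸ s1.deriv
  have s3 : HasCompactSupport W₃ := e3 ▸ s2.deriv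
  have C1 : ∀ {g g' : ℝ → ℝ}, (∀ x, HasDerivAt g (g' x) x) → Continuous g' → ContDiff ℝ 1 g :=
    fun hd hc => contDiff_one_iff_deriv.2 ⟨fun x => (hd x).differentiableAt, by
      rwa [show deriv _ = _ from funext fun x => (hd x).deriv]⟩
  have unif : ∀ {g : ℝ → ℝ}, Continuous g → HasCompactSupport g →
      ∃ ρ > 0, ∀ x y, dist x y < ρ → dist (g x) (g y) < τ := fun hg hs => by
    obtain ⟨ρ, hρ, h⟩ := Metric.uniformContinuous_iff.1 (hs.uniformContinuous_of_continuous hg) τ hτ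
    exact ⟨ρ, hρ, fun x y hxy => h hxy⟩
  obtain ⟨ρ0, p0, u0⟩ := unif c0 s0
  obtain ⟨ρ1, p1, u1⟩ := unif c1 s1
  obtain ⟨ρ3, p3, u3⟩ := unif hc s3
  set ρ := min (min ρ0 ρ1) (min ρ3 1)
  have hρ : 0 < ρ := by positivity
  have q0 : ρ ≤ ρ0 := (min_le_left _ _).trans (min_le_left _ _)
  have q1 : ρ ≤ ρ1 := (min_le_left _ _).trans (min_le_right _ _)
  have q3 : ρ ≤ ρ3 := (min_le_right _ _).trans (min_le_left _ _)
  have q4 : ρ ≤ 1 := (min_le_right _ _).trans (min_le_right _ _)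
  let Φ : ContDiffBump (0 : ℝ) := ⟨ρ / 2, ρ, by positivity, by linarith⟩
  let m : (ℝ → ℝ) → ℝ → ℝ := fun g =>
    convolution (Φ.normed volume) g (ContinuousLinearMap.lsmul ℝ ℝ) volume
  have hΦ : LocallyIntegrable (Φ.normed volume) :=
    Φ.continuous_normed.locallyIntegrable
  have md : ∀ {g g' : ℝ → ℝ}, (∀ x, HasDerivAt g (g' x) x) → Continuous g' → HasCompactSupport g →
      ∀ x, HasDerivAt (m g) (m g' x) x := fun {g g'} hd hc hs x => by
    have := hs.hasDerivAt_convolution_right (ContinuousLinearMap.lsmul ℝ ℝ) hΦ (C1 hd hc) x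
    rwa [show deriv g = g' from funext fun x => (hd x).deriv] at this
  have close : ∀ {g : ℝ → ℝ} {ρ' : ℝ}, Continuous g → ρ ≤ ρ' →
      (∀ x y, dist x y < ρ' → dist (g x) (g y) < τ) → ∀ x, |m g x - g x| ≤ τ :=
    fun hg hle hu x => Φ.dist_normed_convolution_le hg.aestronglyMeasurable fun y hy =>
      (hu y x (lt_of_lt_of_le hy hle)).le
  have m1 : deriv (m W) = m W₁ := funext fun x => (md d0 c1 s0 x).deriv
  have m2 : deriv (m W₁) = m W₂ := funext fun x => (md d1 c2 s1 x).deriv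
  have m3 : deriv (m W₂) = m W₃ := funext fun x => (md d2 hc s2 x).deriv
  refine ⟨m W, ?_, fun x => ?_, fun x hx => ?_, close c0 q0 u0, ?_, ?_⟩
  · exact Φ.hasCompactSupport_normed.contDiff_convolution_left _ Φ.contDiff_normed
      c0.locallyIntegrable
  · simp only [m, convolution, ContinuousLinearMap.lsmul_apply, smul_eq_mul]
    rw [← integral_neg, ← integral_neg_eq_self]
    congr 1; funext y
    rw [Φ.normed_neg, ← mul_neg, ← hodd]
    congr 2; ring
  · have hx0 : W x = 0 := hr x (by linarith)
    have := Φ.dist_normed_convolution_le (μ := volume) (g := W) (x₀ := x) (ε := 0)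
      c0.aestronglyMeasurable fun y hy => by
        have hy' : |y - x| < 1 := lt_of_lt_of_le hy q4
        have hxy : |x| ≤ |y| + |y - x| := by
          have := abs_sub y (y - x)
          simpa using this
        rw [hx0, hr y (by linarith), dist_self]
    rw [hx0] at this
    exact dist_le_zero.1 this
  · rw [m1]; exact close c1 q1 u1
  · rw [iteratedDeriv_succ, iteratedDeriv_succ, iteratedDeriv_one, m1, m2, m3]
    exact close hc q3 u3

lemma exists_wt_bound {g : ℝ → ℝ} (hg : Continuous g) (hs : HasCompactSupport g) :
    ∃ K, ∀ x, |g x| ≤ K * wt x := by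
  have hc : Continuous fun x => g x * (1 + x ^ 2) := by fun_prop
  obtain ⟨K, hK⟩ := hc.bounded_above_of_compact_support (hs.mul_right)
  refine ⟨K, fun x => ?_⟩
  have := hK x
  rw [Real.norm_eq_abs, abs_mul, abs_of_pos (by positivity : 0 < 1 + x ^ 2)] at this
  rwa [wt, ← div_eq_mul_inv, le_div_iff₀ (by positivity)]

/-- The cutoff and its first three derivatives. -/
lemma exists_cutoff_derivs : ∃ (χ₁ χ₂ χ₃ : ℝ → ℝ) (K : ℝ), (∀ x, HasDerivAt (fun x => cutoff x) (χ₁ x) x) ∧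
    (∀ x, HasDerivAt χ₁ (χ₂ x) x) ∧ (∀ x, HasDerivAt χ₂ (χ₃ x) x) ∧ Continuous χ₃ ∧ 0 < K ∧
    (∀ x, |cutoff x| ≤ K * wt x) ∧ (∀ x, |χ₁ x| ≤ K * wt x) ∧ (∀ x, |χ₂ x| ≤ K * wt x) ∧
    ∀ x, |χ₃ x| ≤ K * wt x := by
  have D : ∀ {g : ℝ → ℝ}, ContDiff ℝ ∞ g → ContDiff ℝ ∞ (deriv g) ∧ ∀ x, HasDerivAt g (deriv g x) x :=
    fun hg => ⟨(contDiff_infty_iff_deriv.1 hg).2,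
      fun x => ((contDiff_infty_iff_deriv.1 hg).1 x).hasDerivAt⟩
  have g0 : ContDiff ℝ ∞ (fun x => cutoff x) := contDiff_cutoff
  obtain ⟨g1, d0⟩ := D g0
  obtain ⟨g2, d1⟩ := D g1
  obtain ⟨g3, d2⟩ := D g2
  have s0 := hasCompactSupport_cutoff
  obtain ⟨K0, h0⟩ := exists_wt_bound g0.continuous s0
  obtain ⟨K1, h1⟩ := exists_wt_bound g1.continuous s0.deriv
  obtain ⟨K2, h2⟩ := exists_wt_bound g2.continuous s0.deriv.deriv
  obtain ⟨K3, h3⟩ := exists_wt_bound g3.continuous s0.deriv.deriv.deriv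
  refine ⟨_, _, _, max (max K0 K1) (max (max K2 K3) 1), d0, d1, d2, g3.continuous, by positivity,
    fun x => (h0 x).trans ?_, fun x => (h1 x).trans ?_, fun x => (h2 x).trans ?_,
    fun x => (h3 x).trans ?_⟩ <;> refine mul_le_mul_of_nonneg_right ?_ (wt_pos x).le
  · exact (le_max_left _ _).trans (le_max_left _ _)
  · exact (le_max_right _ _).trans (le_max_left _ _)
  · exact (le_max_left _ _).trans ((le_max_left _ _).trans (le_max_right _ _))
  · exact (le_max_right _ _).trans ((le_max_left _ _).trans (le_max_right _ _))

/-- Smooth odd test functions of size `R` that approximate a given odd function `Y` with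
derivatives `Y₁`, `Y₂`, `Y₃`: the error in the derivatives is `O(R^{-1/2})` in `L²`, whereas the
test function itself is `O(R^{1/2})`. -/
lemma exists_testFunction (B : ℝ) : ∃ C > 0, ∀ (Y Y₁ Y₂ Y₃ : ℝ → ℝ) (R : ℝ), 1 ≤ R →
    (∀ x, HasDerivAt Y (Y₁ x) x) → (∀ x, HasDerivAt Y₁ (Y₂ x) x) →
    (∀ x, HasDerivAt Y₂ (Y₃ x) x) → Continuous Y₃ → (∀ x, Y (-x) = -Y x) →
    (∀ x, |Y x| ≤ B) → (∀ x, |Y₁ x| ≤ B * wt x) → (∀ x, |Y₂ x| ≤ B) → (∀ x, |Y₃ x| ≤ B * wt x) →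
    ∃ φ : ℝ → ℝ, ContDiff ℝ ∞ φ ∧ (∀ x, φ (-x) = -φ x) ∧ (∀ x, 3 * R < |x| → φ x = 0) ∧
      (∀ x, |φ x| ≤ C * wt (x / R)) ∧ (∀ x, |deriv φ x - Y₁ x| ≤ C / R * wt (x / R)) ∧
      ∀ x, |iteratedDeriv 3 φ x - Y₃ x| ≤ C / R * wt (x / R) := by
  obtain ⟨χ₁, χ₂, χ₃, K, e0, e1, e2, ec, hK, k0, k1, k2, k3⟩ := exists_cutoff_derivs
  refine ⟨7 * K * |B| + 2 * |B| + 10, by positivity, ?_⟩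
  intro Y Y₁ Y₂ Y₃ R hR d0 d1 d2 hc hodd b0 b1 b2 b3
  have hB : 0 ≤ B := (abs_nonneg _).trans (b0 0)
  rw [abs_of_nonneg hB]
  have R0 : 0 < R := by linarith
  have sc : ∀ {g g' : ℝ → ℝ}, (∀ x, HasDerivAt g (g' x) x) →
      ∀ x, HasDerivAt (fun x => g (x / R)) (g' (x / R) / R) x := fun h x => by
    have := (h (x / R)).comp x ((hasDerivAt_id x).div_const R)
    exact this.congr_deriv (by simp [div_eq_mul_inv])
  have c0 := sc e0
  have c1 := sc e1
  have c2 := sc e2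
  have D0 : ∀ x, HasDerivAt (fun x => cutoff (x / R) * Y x)
      (χ₁ (x / R) / R * Y x + cutoff (x / R) * Y₁ x) x := fun x => (c0 x).mul (d0 x)
  have D1 : ∀ x, HasDerivAt (fun x => χ₁ (x / R) / R * Y x + cutoff (x / R) * Y₁ x)
      (χ₂ (x / R) / R / R * Y x + 2 * (χ₁ (x / R) / R * Y₁ x) + cutoff (x / R) * Y₂ x) x := fun x =>
    ((((c1 x).div_const R).mul (d0 x)).add ((c0 x).mul (d1 x))).congr_deriv (by ring)
  have D2 : ∀ x, HasDerivAt (fun x => χ₂ (x / R) / R / R * Y x + 2 * (χ₁ (x / R) / R * Y₁ x) +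
      cutoff (x / R) * Y₂ x)
      (χ₃ (x / R) / R / R / R * Y x + 3 * (χ₂ (x / R) / R / R * Y₁ x) +
        3 * (χ₁ (x / R) / R * Y₂ x) + cutoff (x / R) * Y₃ x) x := fun x =>
    ((((((c2 x).div_const R).div_const R).mul (d0 x)).add
      ((((c1 x).div_const R).mul (d1 x)).const_mul 2)).add ((c0 x).mul (d2 x))).congr_deriv (by ring)
  have cY : Continuous Y := continuous_iff_continuousAt.2 fun x => (d0 x).continuousAt
  have cY1 : Continuous Y₁ := continuous_iff_continuousAt.2 fun x => (d1 x).continuousAt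
  have cY2 : Continuous Y₂ := continuous_iff_continuousAt.2 fun x => (d2 x).continuousAt
  have cc0 : Continuous fun x => cutoff x := cutoff.continuous
  have cc1 : Continuous χ₁ := continuous_iff_continuousAt.2 fun x => (e1 x).continuousAt
  have cc2 : Continuous χ₂ := continuous_iff_continuousAt.2 fun x => (e2 x).continuousAt
  have sup : ∀ x, 2 * R < |x| → cutoff (x / R) * Y x = 0 := fun x hx => by
    have : cutoff (x / R) = 0 := cutoff.zero_of_le_dist (by
      rw [Real.dist_eq, sub_zero, abs_div, abs_of_pos R0, le_div_iff₀ R0]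
      exact hx.le)
    rw [this, zero_mul]
  obtain ⟨φ, f1, f2, f3, f4, f5, f6⟩ := exists_smooth_approx D0 D1 D2 (by fun_prop)
    (fun x => by rw [hodd, neg_div, cutoff_neg]; ring) sup (τ := 1 / R) (by positivity)
  have f3' : ∀ x, 3 * R < |x| → φ x = 0 := fun x hx => f3 x (by linarith)
  -- a deviation bounded by `1 / R` and supported in `|x| ≤ 3 R` is controlled by the weight
  have tol : ∀ x, |x| ≤ 3 * R → 1 / R ≤ 10 / R * wt (x / R) := fun x hx => by
    have h1 : (x / R) ^ 2 ≤ 9 := by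
      rw [div_pow, div_le_iff₀ (by positivity), ← sq_abs]
      nlinarith [abs_nonneg x]
    have h2 : 1 ≤ 10 * wt (x / R) := by
      rw [wt, ← div_eq_mul_inv, le_div_iff₀ (by positivity)]; linarith
    calc 1 / R ≤ (10 * wt (x / R)) / R := by gcongr
      _ = _ := by ring
  have R1 : 1 / R ≤ 1 := by rw [div_le_one R0]; exact hR
  have tail : ∀ x, |cutoff (x / R) - 1| * wt x ≤ 2 / R * wt (x / R) := fun x => by
    have w := wt_pos (x / R)
    rcases le_or_gt |x| R with hx | hx
    · have : cutoff (x / R) = 1 := cutoff.one_of_mem_closedBall (by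
        rw [Metric.mem_closedBall, Real.dist_eq, sub_zero, abs_div, abs_of_pos R0,
          div_le_iff₀ R0]
        simpa [cutoff] using hx)
      rw [this, sub_self, abs_zero, zero_mul]
      positivity
    · have h1 : |cutoff (x / R) - 1| ≤ 1 := by
        rw [abs_le]
        exact ⟨by linarith [cutoff.nonneg (x := x / R)], by linarith [cutoff.le_one (x := x / R)]⟩
      have h2 : wt x ≤ 2 / R * wt (x / R) := by
        have hx2 : R ^ 2 ≤ x ^ 2 := by rw [← sq_abs x]; gcongr
        have e : 2 / R * wt (x / R) = 2 * R / (R ^ 2 + x ^ 2) := by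
          rw [wt]; field_simp
        rw [e, wt, inv_eq_one_div, div_le_div_iff₀ (by positivity) (by positivity)]
        nlinarith
      calc _ ≤ 1 * wt x := by gcongr; exact (wt_pos x).le
        _ ≤ _ := by linarith
  have outer : ∀ {x}, 3 * R < |x| → φ =ᶠ[𝓝 x] fun _ => 0 := fun hx => by
    filter_upwards [(isOpen_lt continuous_const continuous_abs).mem_nhds hx] with y hy using f3' y hy
  have outerW : ∀ {x}, 3 * R < |x| → (fun x => cutoff (x / R) * Y x) =ᶠ[𝓝 x] fun _ => 0 :=
    fun hx => by
      filter_upwards [(isOpen_lt continuous_const continuous_abs).mem_nhds hx] with y hy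
      exact sup y (by have : 3 * R < |y| := hy; linarith)
  have I1 : (fun x => χ₁ (x / R) / R * Y x + cutoff (x / R) * Y₁ x) =
      deriv (fun x => cutoff (x / R) * Y x) := funext fun x => (D0 x).deriv.symm
  have I3 : (fun x => χ₃ (x / R) / R / R / R * Y x + 3 * (χ₂ (x / R) / R / R * Y₁ x) +
        3 * (χ₁ (x / R) / R * Y₂ x) + cutoff (x / R) * Y₃ x) =
      iteratedDeriv 3 (fun x => cutoff (x / R) * Y x) := by
    rw [iteratedDeriv_succ, iteratedDeriv_succ, iteratedDeriv_one, ← I1,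
      show deriv _ = _ from funext fun x => (D1 x).deriv,
      show deriv _ = _ from funext fun x => (D2 x).deriv]
  have g4 : ∀ x, |φ x - cutoff (x / R) * Y x| ≤ 10 / R * wt (x / R) := fun x => by
    rcases le_or_gt |x| (3 * R) with hx | hx
    · exact (f4 x).trans (tol x hx)
    · have := wt_pos (x / R)
      rw [f3' x hx, sup x (by linarith), sub_zero, abs_zero]; positivity
  have g5 : ∀ x, |deriv φ x - (χ₁ (x / R) / R * Y x + cutoff (x / R) * Y₁ x)| ≤
      10 / R * wt (x / R) := fun x => by
    rcases le_or_gt |x| (3 * R) with hx | hx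
    · exact (f5 x).trans (tol x hx)
    · have := wt_pos (x / R)
      have e := congrFun I1 x
      rw [e, (outer hx).deriv_eq, (outerW hx).deriv_eq, sub_self, abs_zero]; positivity
  have g6 : ∀ x, |iteratedDeriv 3 φ x - (χ₃ (x / R) / R / R / R * Y x +
      3 * (χ₂ (x / R) / R / R * Y₁ x) + 3 * (χ₁ (x / R) / R * Y₂ x) + cutoff (x / R) * Y₃ x)| ≤
      10 / R * wt (x / R) := fun x => by
    rcases le_or_gt |x| (3 * R) with hx | hx
    · exact (f6 x).trans (tol x hx)
    · have := wt_pos (x / R)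
      have e := congrFun I3 x
      rw [e, (outer hx).iteratedDeriv_eq, (outerW hx).iteratedDeriv_eq, sub_self, abs_zero]
      positivity
  have B1 : ∀ x, |Y₁ x| ≤ B := fun x => (b1 x).trans (mul_le_of_le_one_right hB (wt_le_one x))
  have inv0 : 0 ≤ 1 / R := by positivity
  have term : ∀ {g y : ℝ → ℝ} (x : ℝ), |g (x / R)| ≤ K * wt (x / R) → |y x| ≤ B →
      |g (x / R) / R * y x| ≤ K * B / R * wt (x / R) := fun x hg hy => by
    have w := wt_pos (x / R)
    rw [abs_mul, abs_div, abs_of_pos R0]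
    calc _ ≤ K * wt (x / R) / R * B := by gcongr
      _ = _ := by ring
  have shrink : ∀ {z w : ℝ}, |z| ≤ w → 0 ≤ w → |z / R| ≤ w := fun hz hw => by
    rw [abs_div, abs_of_pos R0]
    exact (div_le_self (abs_nonneg _) hR).trans hz
  refine ⟨φ, f1, f2, f3', fun x => ?_, fun x => ?_, fun x => ?_⟩
  · have w := wt_pos (x / R)
    have h1 : |cutoff (x / R) * Y x| ≤ K * wt (x / R) * B := by
      rw [abs_mul]; gcongr; exacts [k0 _, b0 x]
    have h2 : 10 / R * wt (x / R) ≤ 10 * wt (x / R) := by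
      gcongr; exact div_le_self (by norm_num) hR
    have h3 := abs_add_le (φ x - cutoff (x / R) * Y x) (cutoff (x / R) * Y x)
    rw [sub_add_cancel] at h3
    have h4 : 0 ≤ (6 * K * B + 2 * B) * wt (x / R) := by positivity
    linarith [g4 x]
  · have w := wt_pos (x / R)
    have e : deriv φ x - Y₁ x = (deriv φ x - (χ₁ (x / R) / R * Y x + cutoff (x / R) * Y₁ x)) +
      χ₁ (x / R) / R * Y x + (cutoff (x / R) - 1) * Y₁ x := by ring
    have h1 := term (g := χ₁) x (k1 _) (b0 x)
    have h2 : |(cutoff (x / R) - 1) * Y₁ x| ≤ B * (2 / R * wt (x / R)) := by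
      rw [abs_mul]
      calc _ ≤ |cutoff (x / R) - 1| * (B * wt x) := by gcongr; exact b1 x
        _ = B * (|cutoff (x / R) - 1| * wt x) := by ring
        _ ≤ _ := mul_le_mul_of_nonneg_left (tail x) hB
    have h4 : 0 ≤ 6 * K * B / R * wt (x / R) := by positivity
    have h5 : (7 * K * B + 2 * B + 10) / R * wt (x / R) = 10 / R * wt (x / R) +
      K * B / R * wt (x / R) + B * (2 / R * wt (x / R)) + 6 * K * B / R * wt (x / R) := by ring
    rw [e, h5]
    refine (abs_add_le _ _).trans ?_
    have := abs_add_le (deriv φ x - (χ₁ (x / R) / R * Y x + cutoff (x / R) * Y₁ x))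
      (χ₁ (x / R) / R * Y x)
    linarith [g5 x]
  · have w := wt_pos (x / R)
    have Kw : 0 ≤ K * wt (x / R) := by positivity
    obtain ⟨V, hV⟩ : ∃ V, V = χ₃ (x / R) / R / R / R * Y x +
      3 * (χ₂ (x / R) / R / R * Y₁ x) + 3 * (χ₁ (x / R) / R * Y₂ x) + cutoff (x / R) * Y₃ x :=
      ⟨_, rfl⟩
    have g := g6 x
    rw [← hV] at g
    have h1 := term (g := fun z => χ₃ z / R / R) (y := Y) x
      (shrink (shrink (k3 _) Kw) Kw) (b0 x)
    have h2 := term (g := fun z => χ₂ z / R) (y := Y₁) x (shrink (k2 _) Kw) (B1 x)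
    have h3 := term (g := χ₁) x (k1 _) (b2 x)
    have h4 : |(cutoff (x / R) - 1) * Y₃ x| ≤ B * (2 / R * wt (x / R)) := by
      rw [abs_mul]
      calc _ ≤ |cutoff (x / R) - 1| * (B * wt x) := by gcongr; exact b3 x
        _ = B * (|cutoff (x / R) - 1| * wt x) := by ring
        _ ≤ _ := mul_le_mul_of_nonneg_left (tail x) hB
    have h5 : (7 * K * B + 2 * B + 10) / R * wt (x / R) = 10 / R * wt (x / R) +
      7 * (K * B / R * wt (x / R)) + B * (2 / R * wt (x / R)) := by ring
    rw [abs_le] at g h1 h2 h3 h4 ⊢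
    rw [h5]
    have e : iteratedDeriv 3 φ x - Y₃ x = (iteratedDeriv 3 φ x - V) + (χ₃ (x / R) / R / R / R * Y x +
      3 * (χ₂ (x / R) / R / R * Y₁ x) + 3 * (χ₁ (x / R) / R * Y₂ x) +
        (cutoff (x / R) - 1) * Y₃ x) := by rw [hV]; ring
    rw [e]
    constructor <;> linarith [g.1, g.2, h1.1, h1.2, h2.1, h2.2, h3.1, h3.2, h4.1, h4.2]

/-! ### The potential -/

section Slices

variable {g : ℝ → ℝ → ℝ}

lemma hasDerivAt_slice_snd (hg : Differentiable ℝ (Function.uncurry g)) (t x : ℝ) :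
    HasDerivAt (g t) (fderiv ℝ (Function.uncurry g) (t, x) (0, 1)) x :=
  HasFDerivAt.comp_hasDerivAt (f := fun y => (t, y)) x (hg (t, x)).hasFDerivAt
    ((hasDerivAt_const x t).prodMk (hasDerivAt_id x))

lemma hasDerivAt_slice_fst (hg : Differentiable ℝ (Function.uncurry g)) (t x : ℝ) :
    HasDerivAt (fun τ => g τ x) (fderiv ℝ (Function.uncurry g) (t, x) (1, 0)) t :=
  HasFDerivAt.comp_hasDerivAt (f := fun τ => (τ, x)) t (hg (t, x)).hasFDerivAt
    ((hasDerivAt_id t).prodMk (hasDerivAt_const t x))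

lemma hasDerivWithinAt_along {s : Set ℝ} {a : ℝ → ℝ} {a' t gt gx : ℝ}
    (hg : Differentiable ℝ (Function.uncurry g)) (ht : HasDerivAt (fun τ => g τ (a t)) gt t)
    (hx : HasDerivAt (g t) gx (a t)) (ha : HasDerivWithinAt a a' s t) :
    HasDerivWithinAt (fun τ => g τ (a τ)) (gt + gx * a') s t := by
  have h := (hg (t, a t)).hasFDerivAt.comp_hasDerivWithinAt t
    ((hasDerivWithinAt_id t s).prodMk ha)
  refine HasDerivWithinAt.congr_deriv (f := fun τ => g τ (a τ)) h ?_
  have e : ((1 : ℝ), a') = (1, 0) + a' • ((0 : ℝ), (1 : ℝ)) := by simp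
  rw [e, map_add, map_smul, ht.unique (hasDerivAt_slice_fst hg t (a t)),
    hx.unique (hasDerivAt_slice_snd hg t (a t)), smul_eq_mul, mul_comm]

end Slices

namespace AdmissiblePotential

variable {b : ℝ → ℝ → ℝ} {εa εx εt : ℝ}

lemma hasDerivAt_space (hb : AdmissiblePotential b εa εx εt) (t x : ℝ) :
    HasDerivAt (b t) (partialDeriv b 0 1 t x) x := by
  have := hasDerivAt_slice_snd hb.differentiable t x
  simp only [partialDeriv, iteratedDeriv_zero, iteratedDeriv_one]
  exact this.differentiableAt.hasDerivAt

lemma hasDerivAt_time (hb : AdmissiblePotential b εa εx εt) (t x : ℝ) :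
    HasDerivAt (fun τ => b τ x) (partialDeriv b 1 0 t x) t := by
  have := hasDerivAt_slice_fst hb.differentiable t x
  simp only [partialDeriv, iteratedDeriv_zero, iteratedDeriv_one]
  exact this.differentiableAt.hasDerivAt

lemma slope_eq (hb : AdmissiblePotential b εa εx εt) : Function.uncurry (partialDeriv b 0 1) =
    fun z => fderiv ℝ (Function.uncurry b) z (0, 1) := by
  funext ⟨t, x⟩
  exact (hb.hasDerivAt_space t x).unique (hasDerivAt_slice_snd hb.differentiable t x)

lemma differentiable_slope (hb : AdmissiblePotential b εa εx εt) :
    Differentiable ℝ (Function.uncurry (partialDeriv b 0 1)) := by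
  rw [hb.slope_eq]
  exact fun z => (hb.twice_differentiable z).clm_apply (differentiableAt_const _)

lemma continuous_rate (hb : AdmissiblePotential b εa εx εt) (t : ℝ) :
    Continuous (partialDeriv b 1 0 t) := by
  have : partialDeriv b 1 0 t = fun x => fderiv ℝ (Function.uncurry b) (t, x) (1, 0) :=
    funext fun x => (hb.hasDerivAt_time t x).unique (hasDerivAt_slice_fst hb.differentiable t x)
  rw [this]
  have h1 := hb.twice_differentiable.continuous
  exact (h1.comp (by fun_prop : Continuous fun x : ℝ => (t, x))).clm_apply continuous_const

lemma hasDerivAt_slope_space (hb : AdmissiblePotential b εa εx εt) (t x : ℝ) :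
    HasDerivAt (partialDeriv b 0 1 t) (partialDeriv b 0 2 t x) x := by
  have h := (hasDerivAt_slice_snd hb.differentiable_slope t x).differentiableAt.hasDerivAt
  have e : partialDeriv b 0 1 t = deriv (b t) := by
    funext y; simp only [partialDeriv, iteratedDeriv_zero, iteratedDeriv_one]
  have e2 : partialDeriv b 0 2 t x = deriv (partialDeriv b 0 1 t) x := by
    rw [e]; simp only [partialDeriv, iteratedDeriv_zero, iteratedDeriv_succ]
  rw [e2]; exact h

lemma hasDerivAt_slope_time (hb : AdmissiblePotential b εa εx εt) (t x : ℝ) :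
    HasDerivAt (fun τ => partialDeriv b 0 1 τ x) (partialDeriv b 1 1 t x) t := by
  have h := (hasDerivAt_slice_fst hb.differentiable_slope t x).differentiableAt.hasDerivAt
  have e2 : partialDeriv b 1 1 t x = deriv (fun τ => partialDeriv b 0 1 τ x) t := by
    simp only [partialDeriv, iteratedDeriv_zero, iteratedDeriv_one]
  rw [e2]; exact h

lemma abs_le_one (hb : AdmissiblePotential b εa εx εt) (t x : ℝ) : |b t x| ≤ 1 := by
  have := hb.bound 0 0 (by norm_num) (by norm_num) (by norm_num) t x
  simp only [partialDeriv, iteratedDeriv_zero, pow_zero, mul_one] at this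
  exact this.trans hb.amplitude.2

lemma slope_le (hb : AdmissiblePotential b εa εx εt) (t x : ℝ) :
    |partialDeriv b 0 1 t x| ≤ εa * εx := by
  simpa using hb.bound 0 1 (by norm_num) (by norm_num) (by norm_num) t x

lemma second_le (hb : AdmissiblePotential b εa εx εt) (t x : ℝ) :
    |partialDeriv b 0 2 t x| ≤ εa * εx * εx := by
  simpa [sq, mul_assoc] using hb.bound 0 2 (by norm_num) (by norm_num) (by norm_num) t x

lemma mixed_le (hb : AdmissiblePotential b εa εx εt) (t x : ℝ) :
    |partialDeriv b 1 1 t x| ≤ εa * εx * εt := by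
  simpa [mul_right_comm] using hb.bound 1 1 (by norm_num) (by norm_num) (by norm_num) t x

lemma rate_le_one (hb : AdmissiblePotential b εa εx εt) (t x : ℝ) :
    |partialDeriv b 1 0 t x| ≤ 1 := by
  have := hb.bound 1 0 (by norm_num) (by norm_num) (by norm_num) t x
  simp only [pow_one, pow_zero, mul_one] at this
  exact this.trans (mul_le_one₀ hb.amplitude.2 hb.time.1.le hb.time.2)

lemma prod_pos (hb : AdmissiblePotential b εa εx εt) : 0 < εa * εx :=
  mul_pos hb.amplitude.1 hb.length.1

lemma prod_le_one (hb : AdmissiblePotential b εa εx εt) : εa * εx ≤ 1 :=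
  mul_le_one₀ hb.amplitude.2 hb.length.1.le hb.length.2

lemma abs_sub_time_le (hb : AdmissiblePotential b εa εx εt) (t t' x : ℝ) :
    |b t x - b t' x| ≤ |t - t'| := by
  have := convex_univ.norm_image_sub_le_of_norm_hasDerivWithin_le
    (fun z _ => (hb.hasDerivAt_time z x).hasDerivWithinAt) (fun z _ => hb.rate_le_one z x)
    (mem_univ t') (mem_univ t)
  simpa using this

lemma abs_slope_sub_time_le (hb : AdmissiblePotential b εa εx εt) (t t' x : ℝ) :
    |partialDeriv b 0 1 t x - partialDeriv b 0 1 t' x| ≤ |t - t'| := by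
  have := convex_univ.norm_image_sub_le_of_norm_hasDerivWithin_le
    (fun z _ => (hb.hasDerivAt_slope_time z x).hasDerivWithinAt) (fun z _ => (hb.mixed_le z x).trans
      (mul_le_one₀ hb.prod_le_one hb.time.1.le hb.time.2))
    (mem_univ t') (mem_univ t)
  simpa using this

lemma abs_sub_space_le (hb : AdmissiblePotential b εa εx εt) (t x x' : ℝ) :
    |b t x - b t x'| ≤ εa * εx * |x - x'| := by
  have := convex_univ.norm_image_sub_le_of_norm_hasDerivWithin_le
    (fun z _ => (hb.hasDerivAt_space t z).hasDerivWithinAt) (fun z _ => hb.slope_le t z)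
    (mem_univ x') (mem_univ x)
  simpa using this

lemma continuous_space (hb : AdmissiblePotential b εa εx εt) (t : ℝ) : Continuous (b t) :=
  continuous_iff_continuousAt.2 fun x => (hb.hasDerivAt_space t x).continuousAt

lemma continuous_slope (hb : AdmissiblePotential b εa εx εt) (t : ℝ) :
    Continuous (partialDeriv b 0 1 t) :=
  continuous_iff_continuousAt.2 fun x => (hb.hasDerivAt_slope_space t x).continuousAt

lemma measurable_second (hb : AdmissiblePotential b εa εx εt) (t : ℝ) :
    Measurable (partialDeriv b 0 2 t) := by
  rw [show partialDeriv b 0 2 t = deriv (partialDeriv b 0 1 t) from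
    funext fun x => (hb.hasDerivAt_slope_space t x).deriv.symm]
  exact measurable_deriv _

end AdmissiblePotential

/-! ### Solutions with continuous representatives -/

/-- A solution given by its continuous representatives `U t` and their derivatives `V t`, with the
balance laws for the energy (without the potential) and for the momentum. -/
structure IsRegularSolution (f : ℝ → ℝ) (b U V : ℝ → ℝ → ℝ) : Prop where
  pair : ∀ t, 0 ≤ t → H1Pair (U t) (V t)
  continuous : ∀ t₀, 0 ≤ t₀ → Tendsto (fun t => nrm (fun x => U t x - U t₀ x)
    (fun x => V t x - V t₀ x)) (𝓝[Ici 0] t₀) (𝓝 0)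
  equation : ∀ φ : ℝ → ℝ, ContDiff ℝ ∞ φ → HasCompactSupport φ → ∀ t, 0 ≤ t →
    HasDerivWithinAt (fun τ => ∫ x, U τ x * φ x)
      (∫ x, (U t x * iteratedDeriv 3 φ x + (f (U t x) - b t x * U t x) * deriv φ x)) (Ici 0) t
  energy_law : ∀ t, 0 ≤ t → HasDerivWithinAt (fun τ => energy f (U τ) (V τ))
    (∫ x, (partialDeriv b 0 1 t x * (3 / 2 * V t x ^ 2 - U t x * f (U t x) + primitive f (U t x)) +
      partialDeriv b 0 2 t x * (U t x * V t x))) (Ici 0) t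
  momentum_law : ∀ t, 0 ≤ t → HasDerivWithinAt (fun τ => momentum (U τ))
    (1 / 2 * ∫ x, partialDeriv b 0 1 t x * U t x ^ 2) (Ici 0) t

/-- Passage to continuous representatives. The law for the energy without potential is the law for
the Hamiltonian minus the law for `∫ b u² / 2`, in which the terms with `∂_t b` cancel. -/
lemma IsSolution.exists_regular {f : ℝ → ℝ} (hf : AdmissibleNonlinearity f) {b u : ℝ → ℝ → ℝ}
    {εa εx εt : ℝ} (hb : AdmissiblePotential b εa εx εt) (hu : IsSolution f b u)
    (hbal : SatisfiesBalanceLaws f b u) :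
    ∃ U V : ℝ → ℝ → ℝ, IsRegularSolution f b U V ∧ ∀ t, 0 ≤ t → u t =ᵐ[volume] U t := by
  have h : ∀ t, ∃ U, 0 ≤ t → H1Pair U (weakDeriv (u t)) ∧ u t =ᵐ[volume] U := fun t => by
    by_cases ht : 0 ≤ t
    · obtain ⟨U, hU⟩ := (hu.memH1 t ht).exists_pair
      exact ⟨U, fun _ => hU⟩
    · exact ⟨0, fun h => absurd h ht⟩
  choose U hU using h
  set V := fun t => weakDeriv (u t) with hV
  have pr : ∀ t, 0 ≤ t → H1Pair (U t) (V t) := fun t ht => (hU t ht).1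
  have ae : ∀ t, 0 ≤ t → u t =ᵐ[volume] U t := fun t ht => (hU t ht).2
  -- integrability of the densities that occur in the balance laws
  have int : ∀ t, 0 ≤ t → Integrable (fun x => primitive f (U t x)) ∧
      MemLp (fun x => f (U t x)) 2 volume := fun t ht => by
    obtain ⟨C, hC⟩ := hf.exists_localBounds (M := 2 * nrm (U t) (V t))
      (by have := nrm_nonneg (U t) (V t); positivity)
    exact ⟨hC.integrable_primitive hf (pr t ht).1.continuous (pr t ht).2 (pr t ht).abs_apply_le,
      hC.memLp_comp hf (pr t ht).1.continuous (pr t ht).2 (pr t ht).abs_apply_le⟩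
  have eE : ∀ t, 0 ≤ t → energy f (U t) (V t) = hamiltonian f (b t) (u t) -
      1 / 2 * ∫ x, b t x * u t x ^ 2 := fun t ht => by
    have i1 : Integrable fun x => 1 / 2 * V t x ^ 2 - primitive f (U t x) :=
      ((pr t ht).3.integrable_sq.const_mul _).sub (int t ht).1
    have i2 : Integrable fun x => b t x * U t x ^ 2 :=
      (pr t ht).2.integrable_sq.bdd_mul (hb.continuous_space t).aestronglyMeasurable
        (ae_of_all _ (hb.abs_le_one t))
    have H := (HasInt.of_integrable i1).add ((HasInt.of_integrable i2).const_mul (1 / 2))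
    have e1 : hamiltonian f (b t) (u t) = (∫ x, (1 / 2 * V t x ^ 2 - primitive f (U t x))) +
        1 / 2 * ∫ x, b t x * U t x ^ 2 := by
      rw [← H.2, hamiltonian]
      apply integral_congr_ae
      filter_upwards [ae t ht] with x hx
      rw [hx]; ring
    have e2 : ∫ x, b t x * u t x ^ 2 = ∫ x, b t x * U t x ^ 2 := by
      apply integral_congr_ae
      filter_upwards [ae t ht] with x hx
      rw [hx]
    rw [e1, e2, energy]; ring
  have eP : ∀ t, 0 ≤ t → momentum (U t) = momentum (u t) := fun t ht => by
    rw [momentum, momentum]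
    congr 1
    apply integral_congr_ae
    filter_upwards [ae t ht] with x hx
    rw [hx]
  refine ⟨U, V, ⟨pr, fun t₀ ht₀ => ?_, fun φ hφ hs t ht => ?_, fun t ht => ?_, fun t ht => ?_⟩, ae⟩
  · refine (hu.continuous t₀ ht₀).congr' ?_
    filter_upwards [self_mem_nhdsWithin] with t ht
    refine ((pr t ht).sub (pr t₀ ht₀)).h1Norm_eq ?_
    filter_upwards [ae t ht, ae t₀ ht₀] with x h1 h2
    rw [h1, h2]
  · refine ((hu.equation φ hφ hs t ht).congr (fun τ hτ => ?_) ?_).congr_deriv ?_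
    · apply integral_congr_ae
      filter_upwards [ae τ hτ] with x hx
      rw [hx]
    · apply integral_congr_ae
      filter_upwards [ae t ht] with x hx
      rw [hx]
    · apply integral_congr_ae
      filter_upwards [ae t ht] with x hx
      rw [hx]
  · refine (((hbal.hamiltonian_law t ht).sub (hbal.potential_law t ht)).congr
      (fun τ hτ => eE τ hτ) (eE t ht)).congr_deriv ?_
    have i1 : Integrable fun x => partialDeriv b 1 0 t x * U t x ^ 2 :=
      (pr t ht).2.integrable_sq.bdd_mul (hb.continuous_rate t).aestronglyMeasurable
        (ae_of_all _ (hb.rate_le_one t))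
    have i2 : Integrable fun x => partialDeriv b 0 1 t x *
        (3 / 2 * V t x ^ 2 - U t x * f (U t x) + primitive f (U t x)) :=
      Integrable.bdd_mul ((integrable_sub ((pr t ht).3.integrable_sq.const_mul _)
        (integrable_mul (pr t ht).2 (int t ht).2)).fun_add (int t ht).1)
        (hb.continuous_slope t).aestronglyMeasurable (ae_of_all _ (hb.slope_le t))
    have i3 : Integrable fun x => partialDeriv b 0 2 t x * (U t x * V t x) :=
      (integrable_mul (pr t ht).2 (pr t ht).3).bdd_mul (hb.measurable_second t).aestronglyMeasurable
        (ae_of_all _ (hb.second_le t))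
    have H := ((HasInt.of_integrable i1).const_mul (1 / 2)).sub
      (.of_integrable (i2.fun_add i3))
    have e1 : ∫ x, partialDeriv b 1 0 t x * u t x ^ 2 = ∫ x, partialDeriv b 1 0 t x * U t x ^ 2 := by
      apply integral_congr_ae
      filter_upwards [ae t ht] with x hx
      rw [hx]
    have e2 : ∫ x, (1 / 2 * u t x ^ 2 * partialDeriv b 1 0 t x + partialDeriv b 0 1 t x *
        (u t x * f (u t x) - 3 / 2 * weakDeriv (u t) x ^ 2 - primitive f (u t x)) -
        partialDeriv b 0 2 t x * u t x * weakDeriv (u t) x) = 1 / 2 *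
        (∫ x, partialDeriv b 1 0 t x * U t x ^ 2) - ∫ x, (partialDeriv b 0 1 t x *
        (3 / 2 * V t x ^ 2 - U t x * f (U t x) + primitive f (U t x)) +
        partialDeriv b 0 2 t x * (U t x * V t x)) := by
      rw [← H.2]
      apply integral_congr_ae
      filter_upwards [ae t ht] with x hx
      rw [hx]; ring
    rw [e1, e2]; ring
  · refine ((hbal.momentum_law t ht).congr (fun τ hτ => eP τ hτ) (eP t ht)).congr_deriv ?_
    congr 1
    apply integral_congr_ae
    filter_upwards [ae t ht] with x hx
    rw [hx]

/-! ### Families of functions that are continuous in `L²` -/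

/-- The family `G t`, `t ∈ s`, is continuous with values in `L²(ℝ)`. -/
structure L2ContinuousOn (G : ℝ → ℝ → ℝ) (s : Set ℝ) : Prop where
  memLp : ∀ t ∈ s, MemLp (G t) 2 volume
  tendsto : ∀ t₀ ∈ s, Tendsto (fun t => l2 (fun x => G t x - G t₀ x)) (𝓝[s] t₀) (𝓝 0)

namespace L2ContinuousOn

variable {G H : ℝ → ℝ → ℝ} {s : Set ℝ}

lemma of_le {k : ℝ → ℝ → ℝ} (hG : ∀ t ∈ s, MemLp (G t) 2 volume)
    (hk : ∀ t₀ ∈ s, Tendsto (k t₀) (𝓝[s] t₀) (𝓝 0))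
    (h : ∀ t₀ ∈ s, ∀ᶠ t in 𝓝[s] t₀, l2 (fun x => G t x - G t₀ x) ≤ k t₀ t) :
    L2ContinuousOn G s :=
  ⟨hG, fun t₀ ht₀ => squeeze_zero' (Eventually.of_forall fun _ => l2_nonneg _) (h t₀ ht₀)
    (hk t₀ ht₀)⟩

lemma continuousOn_integral_mul (hG : L2ContinuousOn G s) (hH : L2ContinuousOn H s) :
    ContinuousOn (fun t => ∫ x, G t x * H t x) s := by
  intro t₀ ht₀
  rw [ContinuousWithinAt, tendsto_iff_norm_sub_tendsto_zero]
  set N := l2 (G t₀)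
  set N' := l2 (H t₀)
  have lim : Tendsto (fun t => l2 (fun x => G t x - G t₀ x) * (l2 (fun x => H t x - H t₀ x) + N') +
      N * l2 (fun x => H t x - H t₀ x)) (𝓝[s] t₀) (𝓝 0) := by
    have h1 := hG.tendsto t₀ ht₀
    have h2 := hH.tendsto t₀ ht₀
    simpa using (h1.mul (h2.add_const N')).add (h2.const_mul N)
  refine squeeze_zero' (Eventually.of_forall fun _ => norm_nonneg _) ?_ lim
  filter_upwards [self_mem_nhdsWithin] with t ht
  have m1 := hG.memLp t ht
  have m2 := hG.memLp t₀ ht₀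
  have m3 := hH.memLp t ht
  have m4 := hH.memLp t₀ ht₀
  have d1 : MemLp (fun x => G t x - G t₀ x) 2 volume := m1.sub m2
  have d2 : MemLp (fun x => H t x - H t₀ x) 2 volume := m3.sub m4
  have e : (∫ x, G t x * H t x) - ∫ x, G t₀ x * H t₀ x =
      (∫ x, (G t x - G t₀ x) * H t x) + ∫ x, G t₀ x * (H t x - H t₀ x) := by
    rw [← integral_sub (integrable_mul m1 m3) (integrable_mul m2 m4),
      ← integral_add (integrable_mul d1 m3) (integrable_mul m2 d2)]
    congr 1; funext x; ring
  have hN : l2 (H t) ≤ l2 (fun x => H t x - H t₀ x) + N' := by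
    have := l2_add_le d2 m4
    simpa using this
  rw [e, Real.norm_eq_abs]
  refine (abs_add_le _ _).trans (add_le_add ?_ (abs_integral_mul_le m2 d2))
  exact (abs_integral_mul_le d1 m3).trans (mul_le_mul_of_nonneg_left hN (l2_nonneg _))

lemma mono {s' : Set ℝ} (hG : L2ContinuousOn G s) (h : s' ⊆ s) : L2ContinuousOn G s' :=
  ⟨fun t ht => hG.1 t (h ht), fun t ht => (hG.2 t (h ht)).mono_left (nhdsWithin_mono _ h)⟩

lemma sub (hG : L2ContinuousOn G s) (hH : L2ContinuousOn H s) :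
    L2ContinuousOn (fun t x => G t x - H t x) s :=
  .of_le (k := fun t₀ t => l2 (fun x => G t x - G t₀ x) + l2 (fun x => H t x - H t₀ x))
    (fun t ht => (hG.1 t ht).sub (hH.1 t ht))
    (fun t₀ ht₀ => by simpa using (hG.2 t₀ ht₀).add (hH.2 t₀ ht₀))
    fun t₀ ht₀ => by
      filter_upwards [self_mem_nhdsWithin] with t ht
      have := l2_sub_le (f := fun x => G t x - G t₀ x) (g := fun x => H t x - H t₀ x)
        ((hG.1 t ht).sub (hG.1 t₀ ht₀)) ((hH.1 t ht).sub (hH.1 t₀ ht₀))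
      refine le_of_eq_of_le ?_ this
      congr 1; funext x; ring

/-- Multiplication by a bounded function that is Lipschitz in time. -/
lemma bdd_mul {β : ℝ → ℝ → ℝ} (hG : L2ContinuousOn G s) (hc : ∀ t, Continuous (β t))
    (h1 : ∀ t x, |β t x| ≤ 1) (h2 : ∀ t t' x, |β t x - β t' x| ≤ |t - t'|) :
    L2ContinuousOn (fun t x => β t x * G t x) s := by
  have mem : ∀ t {g : ℝ → ℝ}, MemLp g 2 volume → MemLp (fun x => β t x * g x) 2 volume :=
    fun t g hg => memLp_of_abs_le hg ((hc t).aestronglyMeasurable.mul hg.1) fun x => by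
      rw [abs_mul]; exact mul_le_of_le_one_left (abs_nonneg _) (h1 t x)
  refine .of_le (k := fun t₀ t => l2 (fun x => G t x - G t₀ x) + |t - t₀| * l2 (G t₀))
    (fun t ht => mem t (hG.1 t ht)) (fun t₀ ht₀ => ?_) fun t₀ ht₀ => ?_
  · have h3 : Tendsto (fun t => |t - t₀| * l2 (G t₀)) (𝓝[s] t₀) (𝓝 0) := by
      have : Continuous fun t => |t - t₀| * l2 (G t₀) := by fun_prop
      have := this.tendsto t₀
      simp only [sub_self, abs_zero, zero_mul] at this
      exact this.mono_left nhdsWithin_le_nhds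
    simpa using (hG.2 t₀ ht₀).add h3
  · filter_upwards [self_mem_nhdsWithin] with t ht
    have d : MemLp (fun x => G t x - G t₀ x) 2 volume := (hG.1 t ht).sub (hG.1 t₀ ht₀)
    have e : (fun x => β t x * G t x - β t₀ x * G t₀ x) =
        fun x => β t x * (G t x - G t₀ x) + (β t x - β t₀ x) * G t₀ x := by funext x; ring
    have m2 : MemLp (fun x => (β t x - β t₀ x) * G t₀ x) 2 volume :=
      memLp_of_abs_le ((hG.1 t₀ ht₀).const_mul |t - t₀|)
        (((hc t).sub (hc t₀)).aestronglyMeasurable.mul (hG.1 t₀ ht₀).1) fun x => by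
          rw [abs_mul, abs_mul, abs_abs]
          exact mul_le_mul_of_nonneg_right (h2 t t₀ x) (abs_nonneg _)
    rw [e]
    refine (l2_add_le (mem t d) m2).trans (add_le_add ?_ ?_)
    · exact l2_mono d fun x => by
        rw [abs_mul]; exact mul_le_of_le_one_left (abs_nonneg _) (h1 t x)
    · rw [← abs_abs (t - t₀), ← l2_const_mul]
      refine l2_mono ((hG.1 t₀ ht₀).const_mul _) fun x => ?_
      rw [abs_mul, abs_mul, abs_abs]
      exact mul_le_mul_of_nonneg_right (h2 t t₀ x) (abs_nonneg _)

end L2ContinuousOn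

/-- Translation is Lipschitz in `L²` on smooth functions with compact support. -/
lemma exists_l2_translate_le {φ : ℝ → ℝ} (hφ : ContDiff ℝ ∞ φ) (hs : HasCompactSupport φ) :
    ∃ K ≥ 0, ∀ a a', l2 (fun x => φ (x - a) - φ (x - a')) ≤ K * |a - a'| := by
  obtain ⟨K0, h0⟩ := exists_wt_bound hφ.continuous hs
  obtain ⟨K1, h1⟩ := exists_wt_bound (contDiff_infty_iff_deriv.1 hφ).2.continuous hs.deriv
  have l0 := l2_nonneg wt
  have hK := nonneg_of_wt h0
  refine ⟨3 * max K0 K1 * l2 wt, by positivity, fun a a' => ?_⟩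
  have := l2_shift_sub_le (B := max K0 K1)
    (fun x => ((contDiff_infty_iff_deriv.1 hφ).1 x).hasDerivAt)
    (fun x => (h0 x).trans (mul_le_mul_of_nonneg_right (le_max_left _ _) (wt_pos x).le))
    (fun x => (h1 x).trans (mul_le_mul_of_nonneg_right (le_max_right _ _) (wt_pos x).le)) (a' - a)
  rw [← l2_comp_add_right _ (-a')] at this
  rw [abs_sub_comm]
  refine le_of_eq_of_le ?_ this
  congr 1; funext x; ring_nf

lemma memLp_translate {φ : ℝ → ℝ} (hφ : Continuous φ) (hs : HasCompactSupport φ) (a : ℝ) :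
    MemLp (fun x => φ (x - a)) 2 volume := by
  simp only [sub_eq_add_neg]
  exact memLp_comp_add_right (memLp_of_hasCompactSupport hφ hs) (-a)

lemma L2ContinuousOn.translate {φ a : ℝ → ℝ} {s : Set ℝ} (hφ : ContDiff ℝ ∞ φ)
    (hs : HasCompactSupport φ) (ha : ContinuousOn a s) :
    L2ContinuousOn (fun t x => φ (x - a t)) s := by
  obtain ⟨K, hK, h⟩ := exists_l2_translate_le hφ hs
  refine .of_le (k := fun t₀ t => K * |a t - a t₀|)
    (fun t _ => memLp_translate hφ.continuous hs _) (fun t₀ ht₀ => ?_)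
    fun t₀ _ => Eventually.of_forall fun t => h _ _
  have := ((ha t₀ ht₀).sub_const (a t₀)).norm.const_mul K
  simpa using this

/-! ### Testing the equation along a moving centre -/

lemma abs_nrm_sub_nrm_le {U V U' V' : ℝ → ℝ} (h : H1Pair U V) (h' : H1Pair U' V') :
    |nrm U V - nrm U' V'| ≤ nrm (fun x => U x - U' x) (fun x => V x - V' x) := by
  have h1 := nrm_add_le (h.sub h') h'
  have h2 := nrm_add_le (h'.sub h) h
  have e := nrm_neg (fun x => U x - U' x) (fun x => V x - V' x)
  simp only [neg_sub] at e
  simp only [sub_add_cancel] at h1 h2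
  rw [e] at h2
  rw [abs_le]
  constructor <;> linarith

/-- Differentiation of the pairing of a fixed function with a translated test function. -/
lemma hasDerivAt_integral_translate {g φ : ℝ → ℝ} (hg : LocallyIntegrable g)
    (hφ : ContDiff ℝ ∞ φ) (hs : HasCompactSupport φ) (a : ℝ) :
    HasDerivAt (fun a => ∫ x, g x * φ (x - a)) (-∫ x, g x * deriv φ (x - a)) a := by
  have hneg : Topology.IsClosedEmbedding fun x : ℝ => -x :=
    (Homeomorph.neg ℝ).isClosedEmbedding
  have hs' : HasCompactSupport fun x => φ (-x) := hs.comp_isClosedEmbedding hneg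
  have hφ' : ContDiff ℝ 1 fun x => φ (-x) := (hφ.of_le (by norm_cast)).comp contDiff_neg
  have h := hs'.hasDerivAt_convolution_right (ContinuousLinearMap.lsmul ℝ ℝ) hg hφ' a
  have d : deriv (fun x => φ (-x)) = fun x => -deriv φ (-x) := by
    funext x; exact deriv_comp_neg φ x
  rw [d] at h
  have e : (fun a => ∫ x, g x * φ (x - a)) = convolution g (fun x => φ (-x))
      (ContinuousLinearMap.lsmul ℝ ℝ) volume := by
    funext a
    simp only [convolution_def, ContinuousLinearMap.lsmul_apply, smul_eq_mul, neg_sub]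
  rw [e]
  refine h.congr_deriv ?_
  simp only [convolution_def, ContinuousLinearMap.lsmul_apply, smul_eq_mul, neg_sub, mul_neg,
    integral_neg]

namespace IsRegularSolution

variable {f : ℝ → ℝ} {b U V : ℝ → ℝ → ℝ} {εa εx εt : ℝ}

lemma tendsto_nrm (hU : IsRegularSolution f b U V) {t₀ : ℝ} (ht₀ : 0 ≤ t₀) :
    Tendsto (fun t => nrm (U t) (V t)) (𝓝[Ici 0] t₀) (𝓝 (nrm (U t₀) (V t₀))) := by
  rw [tendsto_iff_norm_sub_tendsto_zero]
  refine squeeze_zero' (Eventually.of_forall fun _ => norm_nonneg _) ?_ (hU.continuous t₀ ht₀)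
  filter_upwards [self_mem_nhdsWithin] with t ht
  exact abs_nrm_sub_nrm_le (hU.pair t ht) (hU.pair t₀ ht₀)

lemma l2ContinuousOn (hU : IsRegularSolution f b U V) : L2ContinuousOn U (Ici 0) :=
  .of_le (fun t ht => (hU.pair t ht).2) (fun t₀ ht₀ => hU.continuous t₀ ht₀)
    fun _ _ => Eventually.of_forall fun _ => l2_le_nrm _ _

lemma l2ContinuousOn_comp (hU : IsRegularSolution f b U V) (hf : AdmissibleNonlinearity f) :
    L2ContinuousOn (fun t x => f (U t x)) (Ici 0) := by
  have key : ∀ t₀, 0 ≤ t₀ → ∃ C, ∀ᶠ t in 𝓝[Ici 0] t₀, MemLp (fun x => f (U t x)) 2 volume ∧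
      l2 (fun x => f (U t x) - f (U t₀ x)) ≤
        C * nrm (fun x => U t x - U t₀ x) (fun x => V t x - V t₀ x) := by
    intro t₀ ht₀
    have n0 := nrm_nonneg (U t₀) (V t₀)
    obtain ⟨C, hC⟩ := hf.exists_localBounds (M := 2 * (nrm (U t₀) (V t₀) + 1)) (by positivity)
    refine ⟨C, ?_⟩
    filter_upwards [self_mem_nhdsWithin,
      (hU.tendsto_nrm ht₀).eventually (gt_mem_nhds (lt_add_one _))] with t ht hn
    have b1 : ∀ x, |U t x| ≤ 2 * (nrm (U t₀) (V t₀) + 1) := fun x =>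
      ((hU.pair t ht).abs_apply_le x).trans (by linarith)
    have b0 : ∀ x, |U t₀ x| ≤ 2 * (nrm (U t₀) (V t₀) + 1) := fun x =>
      ((hU.pair t₀ ht₀).abs_apply_le x).trans (by linarith)
    refine ⟨hC.memLp_comp hf (hU.pair t ht).1.continuous (hU.pair t ht).2 b1, ?_⟩
    have hC0 : 0 < C := zero_lt_one.trans_le hC.one_le
    have d := ((hU.pair t ht).sub (hU.pair t₀ ht₀)).2
    calc _ ≤ l2 (fun x => C * (U t x - U t₀ x)) := by
          refine l2_mono (d.const_mul C) fun x => ?_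
          rw [abs_mul, abs_of_pos hC0]
          exact hC.lipschitz _ _ (b1 x) (b0 x)
      _ = C * l2 (fun x => U t x - U t₀ x) := by rw [l2_const_mul, abs_of_pos hC0]
      _ ≤ _ := by gcongr; exact l2_le_nrm _ _
  choose! C hC using key
  refine .of_le (k := fun t₀ t => C t₀ * nrm (fun x => U t x - U t₀ x) (fun x => V t x - V t₀ x))
    (fun t ht => ((hC t ht).self_of_nhdsWithin ht).1) (fun t₀ ht₀ => ?_)
    fun t₀ ht₀ => (hC t₀ ht₀).mono fun t ht => ht.2
  simpa using (hU.continuous t₀ ht₀).const_mul (C t₀)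

lemma l2ContinuousOn_flux (hU : IsRegularSolution f b U V) (hf : AdmissibleNonlinearity f)
    (hb : AdmissiblePotential b εa εx εt) :
    L2ContinuousOn (fun t x => f (U t x) - b t x * U t x) (Ici 0) :=
  (hU.l2ContinuousOn_comp hf).sub (hU.l2ContinuousOn.bdd_mul hb.continuous_space hb.abs_le_one
    hb.abs_sub_time_le)

/-- The equation tested against a test function that follows the path `a`. -/
lemma hasDerivWithinAt_test (hU : IsRegularSolution f b U V) {φ : ℝ → ℝ} (hφ : ContDiff ℝ ∞ φ)
    (hs : HasCompactSupport φ) {s : Set ℝ} (hs0 : s ⊆ Ici 0) {a : ℝ → ℝ} {a' t₀ : ℝ} (ht₀ : t₀ ∈ s)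
    (ha : HasDerivWithinAt a a' s t₀) :
    HasDerivWithinAt (fun t => ∫ x, U t x * φ (x - a t))
      ((∫ x, (U t₀ x * iteratedDeriv 3 φ (x - a t₀) +
        (f (U t₀ x) - b t₀ x * U t₀ x) * deriv φ (x - a t₀))) -
        a' * ∫ x, U t₀ x * deriv φ (x - a t₀)) s t₀ := by
  have hp := (hU.pair t₀ (hs0 ht₀)).2
  have hφa : ContDiff ℝ ∞ fun x => φ (x - a t₀) := hφ.comp (contDiff_id.sub contDiff_const)
  have hsa : HasCompactSupport fun x => φ (x - a t₀) :=
    hs.comp_isClosedEmbedding (Homeomorph.subRight (a t₀)).isClosedEmbedding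
  have d1 := (hU.equation _ hφa hsa t₀ (hs0 ht₀)).mono hs0
  have d2 := (hasDerivAt_integral_translate (locallyIntegrable_of_memLp hp) hφ hs
    (a t₀)).comp_hasDerivWithinAt t₀ ha
  obtain ⟨K, hK, hlip⟩ := exists_l2_translate_le hφ hs
  have d3 : HasDerivWithinAt (fun t => ∫ x, (U t x - U t₀ x) * (φ (x - a t) - φ (x - a t₀)))
      0 s t₀ := by
    rw [hasDerivWithinAt_iff_isLittleO]
    simp only [sub_self, zero_mul, integral_zero, sub_zero, smul_zero]
    have o1 : (fun t => l2 (fun x => U t x - U t₀ x)) =o[𝓝[s] t₀] fun _ => (1 : ℝ) :=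
      (Asymptotics.isLittleO_one_iff ℝ).2 ((hU.l2ContinuousOn.mono hs0).tendsto t₀ ht₀)
    have o2 : (fun t => K * (a t - a t₀)) =O[𝓝[s] t₀] fun t => t - t₀ :=
      (ha.hasFDerivWithinAt.isBigO_sub).const_mul_left K
    have o3 := o1.mul_isBigO o2
    simp only [one_mul] at o3
    refine Asymptotics.IsBigO.trans_isLittleO ?_ o3
    refine Asymptotics.IsBigO.of_bound 1 ?_
    filter_upwards [self_mem_nhdsWithin] with t ht
    have m1 : MemLp (fun x => U t x - U t₀ x) 2 volume := (hU.pair t (hs0 ht)).2.sub hp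
    have m2 : MemLp (fun x => φ (x - a t) - φ (x - a t₀)) 2 volume :=
      (memLp_translate hφ.continuous hs _).sub (memLp_translate hφ.continuous hs _)
    rw [one_mul, Real.norm_eq_abs, Real.norm_eq_abs, abs_mul, abs_of_nonneg (l2_nonneg _), abs_mul,
      abs_of_nonneg hK]
    exact (abs_integral_mul_le m1 m2).trans
      (mul_le_mul_of_nonneg_left (hlip _ _) (l2_nonneg _))
  have dec : ∀ t ∈ s, ∫ x, U t x * φ (x - a t) = (∫ x, U t x * φ (x - a t₀)) +
      (∫ x, U t₀ x * φ (x - a t)) - (∫ x, U t₀ x * φ (x - a t₀)) +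
      ∫ x, (U t x - U t₀ x) * (φ (x - a t) - φ (x - a t₀)) := fun t ht => by
    have m := (hU.pair t (hs0 ht)).2
    have mφ := fun a => memLp_translate hφ.continuous hs a
    have H := (((HasInt.of_integrable (integrable_mul m (mφ (a t₀)))).add
      (.of_integrable (integrable_mul hp (mφ (a t))))).sub
      (.of_integrable (integrable_mul hp (mφ (a t₀))))).add (.of_integrable
      (integrable_mul (f := fun x => U t x - U t₀ x) (g := fun x => φ (x - a t) - φ (x - a t₀))
        (m.sub hp) ((mφ (a t)).sub (mφ (a t₀)))))
    rw [← H.2]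
    congr 1; funext x; ring
  refine ((((d1.add d2).sub_const (∫ x, U t₀ x * φ (x - a t₀))).add d3).congr
    (fun t ht => dec t ht) (dec t₀ ht₀)).congr_deriv ?_
  have e1 : iteratedDeriv 3 (fun x => φ (x - a t₀)) = fun x => iteratedDeriv 3 φ (x - a t₀) := by
    funext x; exact iteratedDeriv_comp_sub_const 3 φ (a t₀) ▸ rfl
  have e2 : deriv (fun x => φ (x - a t₀)) = fun x => deriv φ (x - a t₀) := by
    funext x; exact deriv_comp_sub_const φ (a t₀) x
  rw [e1, e2]; ring

lemma contDiff_iteratedDeriv_three {φ : ℝ → ℝ} (hφ : ContDiff ℝ ∞ φ) (hs : HasCompactSupport φ) :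
    ContDiff ℝ ∞ (iteratedDeriv 3 φ) ∧ HasCompactSupport (iteratedDeriv 3 φ) := by
  rw [iteratedDeriv_succ, iteratedDeriv_succ, iteratedDeriv_one]
  have h1 := (contDiff_infty_iff_deriv.1 hφ).2
  have h2 := (contDiff_infty_iff_deriv.1 h1).2
  exact ⟨(contDiff_infty_iff_deriv.1 h2).2, hs.deriv.deriv.deriv⟩

lemma continuousOn_test (hU : IsRegularSolution f b U V) {φ : ℝ → ℝ} (hφ : ContDiff ℝ ∞ φ)
    (hs : HasCompactSupport φ) {s : Set ℝ} (hs0 : s ⊆ Ici 0) {a : ℝ → ℝ} (ha : ContinuousOn a s) :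
    ContinuousOn (fun t => ∫ x, U t x * φ (x - a t)) s :=
  (hU.l2ContinuousOn.mono hs0).continuousOn_integral_mul (.translate hφ hs ha)

lemma continuousOn_test_deriv (hU : IsRegularSolution f b U V) (hf : AdmissibleNonlinearity f)
    (hb : AdmissiblePotential b εa εx εt) {φ : ℝ → ℝ} (hφ : ContDiff ℝ ∞ φ)
    (hs : HasCompactSupport φ) {s : Set ℝ} (hs0 : s ⊆ Ici 0) {a : ℝ → ℝ} (ha : ContinuousOn a s) :
    ContinuousOn (fun t => ∫ x, (U t x * iteratedDeriv 3 φ (x - a t) +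
        (f (U t x) - b t x * U t x) * deriv φ (x - a t))) s := by
  obtain ⟨h3, s3⟩ := contDiff_iteratedDeriv_three hφ hs
  have h1 := (contDiff_infty_iff_deriv.1 hφ).2
  have c1 := hU.continuousOn_test h3 s3 hs0 ha
  have l1 := (hU.l2ContinuousOn_flux hf hb).mono hs0
  have l2 := L2ContinuousOn.translate h1 hs.deriv ha
  refine (c1.add (l1.continuousOn_integral_mul l2)).congr fun t ht => ?_
  exact integral_add (integrable_mul (hU.pair t (hs0 ht)).2 (memLp_translate h3.continuous s3 _))
    (integrable_mul (l1.1 t ht) (l2.1 t ht))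

lemma continuousOn_momentum_deriv (hU : IsRegularSolution f b U V)
    (hb : AdmissiblePotential b εa εx εt) :
    ContinuousOn (fun t => 1 / 2 * ∫ x, partialDeriv b 0 1 t x * U t x ^ 2) (Ici 0) := by
  have h := ((hU.l2ContinuousOn.bdd_mul hb.continuous_slope
    (fun t x => (hb.slope_le t x).trans hb.prod_le_one)
    hb.abs_slope_sub_time_le).continuousOn_integral_mul hU.l2ContinuousOn).const_smul (1 / 2 : ℝ)
  refine h.congr fun t _ => ?_
  simp only [Pi.smul_apply, smul_eq_mul]
  congr 2; funext x; ring

lemma momentum_nonneg (u : ℝ → ℝ) : 0 ≤ momentum u := by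
  have : 0 ≤ ∫ x, u x ^ 2 := integral_nonneg fun _ => sq_nonneg _
  rw [momentum]; positivity

lemma abs_momentum_deriv_le (hU : IsRegularSolution f b U V) (hb : AdmissiblePotential b εa εx εt)
    {t : ℝ} (ht : 0 ≤ t) :
    |1 / 2 * ∫ x, partialDeriv b 0 1 t x * U t x ^ 2| ≤ εa * εx * momentum (U t) := by
  have hp := (hU.pair t ht).2.integrable_sq
  have i : Integrable fun x => partialDeriv b 0 1 t x * U t x ^ 2 :=
    hp.bdd_mul (hb.continuous_slope t).aestronglyMeasurable (ae_of_all _ (hb.slope_le t))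
  have := (HasInt.of_integrable i).abs_le ((HasInt.of_integrable hp).const_mul (εa * εx)) fun x => by
    rw [abs_mul, abs_of_nonneg (sq_nonneg (U t x))]
    exact mul_le_mul_of_nonneg_right (hb.slope_le t x) (sq_nonneg _)
  rw [abs_mul, abs_of_pos one_half_pos, momentum]
  linarith

/-- The momentum varies slowly. -/
lemma abs_momentum_sub_le (hU : IsRegularSolution f b U V) (hb : AdmissiblePotential b εa εx εt)
    {t : ℝ} (ht : 0 ≤ t) (hεt : εa * εx * t ≤ 1) :
    |momentum (U t) - momentum (U 0)| ≤ 2 * momentum (U 0) * (εa * εx * t) := by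
  have ε0 := hb.prod_pos
  set ε := εa * εx
  set p0 := momentum (U 0)
  have hp0 : 0 ≤ p0 := momentum_nonneg _
  have hd : ∀ τ, 0 ≤ τ → HasDerivWithinAt (fun τ => momentum (U τ) - p0)
      (1 / 2 * ∫ x, partialDeriv b 0 1 τ x * U τ x ^ 2) (Ici τ) τ := fun τ hτ =>
    ((hU.momentum_law τ hτ).mono (Ici_subset_Ici.2 hτ)).sub_const p0
  have hcont : ContinuousOn (fun τ => momentum (U τ) - p0) (Icc 0 t) := fun τ hτ =>
    ((hU.momentum_law τ hτ.1).continuousWithinAt.mono Icc_subset_Ici_self).sub_const p0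
  have := norm_le_gronwallBound_of_norm_deriv_right_le (δ := 0) (K := ε) (ε := ε * p0) hcont
    (fun τ hτ => hd τ hτ.1) (by simp [p0]) (fun τ hτ => by
      refine (hU.abs_momentum_deriv_le hb hτ.1).trans ?_
      have h1 : momentum (U τ) ≤ ‖momentum (U τ) - p0‖ + p0 := by
        have := le_abs_self (momentum (U τ) - p0)
        rw [Real.norm_eq_abs]; linarith
      have := mul_le_mul_of_nonneg_left h1 ε0.le
      linarith) t ⟨ht, le_rfl⟩
  rw [Real.norm_eq_abs, gronwallBound_of_K_ne_0 ε0.ne'] at this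
  simp only [zero_mul, zero_add, sub_zero, mul_div_cancel_left₀ _ ε0.ne'] at this
  have h2 := Real.abs_exp_sub_one_le (x := ε * t) (by rwa [abs_of_nonneg (by positivity)])
  rw [abs_of_nonneg (by positivity : 0 ≤ ε * t)] at h2
  have h3 := mul_le_mul_of_nonneg_left ((le_abs_self _).trans h2) hp0
  linarith

end IsRegularSolution

/-! ### The modulation parameters -/

lemma memLp_translate_right {g : ℝ → ℝ} (hg : MemLp g 2 volume) (a : ℝ) :
    MemLp (fun x => g (x - a)) 2 volume := by
  simp only [sub_eq_add_neg]
  exact memLp_comp_add_right hg (-a)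

lemma l2_translate (g : ℝ → ℝ) (a : ℝ) : l2 (fun x => g (x - a)) = l2 g := by
  simp only [sub_eq_add_neg]
  exact l2_comp_add_right g (-a)

lemma H1Pair.translate {U V : ℝ → ℝ} (h : H1Pair U V) (a : ℝ) :
    H1Pair (fun x => U (x - a)) (fun x => V (x - a)) := by
  simp only [sub_eq_add_neg]
  exact h.comp_add_right (-a)

namespace SolitaryWaveFamily

variable {f : ℝ → ℝ} {I₀ : Set ℝ} {Q : ℝ → ℝ → ℝ} {A r c₀ : ℝ}

lemma l2_translate_sub_le {p q q' : ℝ → ℝ} {k a a' : ℝ} (hp : MemLp p 2 volume)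
    (hd : ∀ x, HasDerivAt q (q' x) x) (hq : ∀ x, |q x| ≤ A * wt x ^ 2)
    (hq' : ∀ x, |q' x| ≤ A * wt x ^ 2) (hpq : ∀ x, |p x - q x| ≤ A * k * wt x ^ 2) :
    l2 (fun x => p (x - a) - q (x - a')) ≤ 3 * A * l2 wt * (k + |a - a'|) := by
  have hqc : Continuous q := continuous_iff_continuousAt.2 fun x => (hd x).continuousAt
  have hqm : MemLp q 2 volume := memLp_of_wt hqc.aestronglyMeasurable (le_wt_of_le_sq hq)
  have hA := nonneg_of_wt (le_wt_of_le_sq hq)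
  have hk := nonneg_of_wt (le_wt_of_le_sq hpq)
  have t := l2_add_le (f := fun x => p (x - a) - q (x - a)) (g := fun x => q (x - a) - q (x - a'))
    (memLp_translate_right (hp.sub hqm) a)
    ((memLp_translate_right hqm a).sub (memLp_translate_right hqm a'))
  have t1 : l2 (fun x => p (x - a) - q (x - a)) ≤ A * k * l2 wt := by
    rw [l2_translate (fun x => p x - q x) a]
    exact l2_le_of_wt (le_wt_of_le_sq hpq)
  have t2 := l2_shift_sub_le hd (le_wt_of_le_sq hq) (le_wt_of_le_sq hq') (a' - a)
  rw [← l2_translate _ a', abs_sub_comm] at t2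
  have e : (fun x => q (x - a' + (a' - a)) - q (x - a')) = fun x => q (x - a) - q (x - a') := by
    funext x; ring_nf
  rw [e] at t2
  simp only [sub_add_sub_cancel] at t
  have : 0 ≤ A * k * l2 wt := mul_nonneg hk (l2_nonneg _)
  linarith

/-- The solitary waves depend in a Lipschitz way on the speed and on the position. -/
lemma nrm_soliton_sub_le (hQ : SolitaryWaveFamily f I₀ Q) (hf : AdmissibleNonlinearity f)
    (hgood : ∀ c, |c - c₀| ≤ r → c ∈ I₀ ∧ GoodSpeed f Q A c) {c c' : ℝ} (hc : |c - c₀| ≤ r)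
    (hc' : |c' - c₀| ≤ r) (a a' : ℝ) :
    nrm (fun x => Q c (x - a) - Q c' (x - a')) (fun x => deriv (Q c) (x - a) - deriv (Q c') (x - a'))
      ≤ 6 * A * l2 wt * (|c - c'| + |a - a'|) := by
  have lip := hQ.lipschitz_wt hf (s := Metric.closedBall c₀ r) (convex_closedBall c₀ r)
    (fun c hc => (hgood c hc).1) (fun c hc => (hgood c hc).2.bounds) hc hc'
  have hb := (hgood c hc).2.bounds
  have hb' := (hgood c' hc').2.bounds
  have pQ := hQ.h1Pair (hgood c hc).1 hb
  have t1 := l2_translate_sub_le (a := a) (a' := a') pQ.2 (hQ.hasDerivAt (hgood c' hc').1)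
    hb'.profile hb'.slope (fun x => (lip x).1)
  have t2 := l2_translate_sub_le (a := a) (a' := a') pQ.3 (hQ.hasDerivAt_deriv (hgood c' hc').1)
    hb'.slope hb'.second (fun x => (lip x).2)
  refine (nrm_le_add _ _).trans ((add_le_add t1 t2).trans_eq ?_)
  ring

/-- The speed as a function of the momentum. -/
lemma exists_momentum_inverse (hQ : SolitaryWaveFamily f I₀ Q) (hf : AdmissibleNonlinearity f)
    (hA : 1 ≤ A) (hr : 0 < r) (hgood : ∀ c, |c - c₀| ≤ r → c ∈ I₀ ∧ GoodSpeed f Q A c) :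
    ∃ g : ℝ → ℝ, ∀ y, |y - momentum (Q c₀)| < r / A →
      |g y - c₀| ≤ r ∧ |g y - c₀| ≤ A * |y - momentum (Q c₀)| ∧ momentum (Q (g y)) = y ∧
      HasDerivAt g (momentumDeriv Q (g y))⁻¹ y := by
  have A0 : 0 < A := by linarith
  set δ := fun c => momentum (Q c) with hδ
  have hd : ∀ c, |c - c₀| ≤ r → HasDerivAt δ (momentumDeriv Q c) c := fun c hc =>
    hQ.hasDerivAt_momentum hf (hgood c hc).1
  have mem : ∀ {c}, c ∈ Icc (c₀ - r) (c₀ + r) ↔ |c - c₀| ≤ r := fun {c} => by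
    rw [abs_le, mem_Icc]; constructor <;> intro h <;> constructor <;> linarith [h.1, h.2]
  have hcont : ContinuousOn δ (Icc (c₀ - r) (c₀ + r)) := fun c hc =>
    (hd c (mem.1 hc)).continuousAt.continuousWithinAt
  have mono : ∀ c c', |c - c₀| ≤ r → |c' - c₀| ≤ r → c ≤ c' → 1 / A * (c' - c) ≤ δ c' - δ c :=
    fun c c' hc hc' h => by
      refine (convex_Icc (c₀ - r) (c₀ + r)).mul_sub_le_image_sub_of_le_deriv hcont
        (fun z hz => (hd z (mem.1 (interior_subset hz))).differentiableAt.differentiableWithinAt)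
        (fun z hz => ?_) c (mem.2 hc) c' (mem.2 hc') h
      rw [(hd z (mem.1 (interior_subset hz))).deriv]
      exact (hgood z (mem.1 (interior_subset hz))).2.momentumDeriv_ge
  have exp : ∀ c c', |c - c₀| ≤ r → |c' - c₀| ≤ r → |c - c'| ≤ A * |δ c - δ c'| := by
    intro c c' hc hc'
    have e : ∀ z, z = A * (1 / A * z) := fun z => by field_simp
    rcases le_total c c' with h | h
    · have := mono c c' hc hc' h
      rw [abs_sub_comm, abs_sub_comm (δ c), abs_of_nonneg (sub_nonneg.2 h), e (c' - c)]
      exact mul_le_mul_of_nonneg_left (this.trans (le_abs_self _)) A0.le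
    · have := mono c' c hc' hc h
      rw [abs_of_nonneg (sub_nonneg.2 h), e (c - c')]
      exact mul_le_mul_of_nonneg_left (this.trans (le_abs_self _)) A0.le
  have z0 : |c₀ - c₀| ≤ r := by simpa using hr.le
  have surj : ∀ y, ∃ c, |y - δ c₀| < r / A → |c - c₀| ≤ r ∧ δ c = y := by
    intro y
    by_cases hy : |y - δ c₀| < r / A
    · have h1 := mono (c₀ - r) c₀ (by simp [abs_of_pos hr]) z0 (by linarith)
      have h2 := mono c₀ (c₀ + r) z0 (by simp [abs_of_pos hr]) (by linarith)
      have e : ∀ z, 1 / A * (z - (z - r)) = r / A := fun z => by ring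
      have e' : 1 / A * (c₀ + r - c₀) = r / A := by ring
      rw [e] at h1
      rw [e'] at h2
      rw [abs_lt] at hy
      obtain ⟨c, hc, hcy⟩ := intermediate_value_Icc (by linarith) hcont
        (⟨by linarith [hy.1], by linarith [hy.2]⟩ : y ∈ Icc (δ (c₀ - r)) (δ (c₀ + r)))
      exact ⟨c, fun _ => ⟨mem.1 hc, hcy⟩⟩
    · exact ⟨0, fun h => absurd h hy⟩
  choose g hg using surj
  refine ⟨g, fun y hy => ⟨(hg y hy).1, ?_, (hg y hy).2, ?_⟩⟩
  · have := exp (g y) c₀ (hg y hy).1 z0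
    rwa [(hg y hy).2] at this
  · have ev : ∀ᶠ z in 𝓝 y, |z - δ c₀| < r / A :=
      (isOpen_lt (continuous_abs.comp (continuous_id.sub continuous_const))
        continuous_const).mem_nhds hy
    refine HasDerivAt.of_local_left_inverse (f := δ) ?_ (hd _ (hg y hy).1) ?_ ?_
    · rw [ContinuousAt, tendsto_iff_norm_sub_tendsto_zero]
      refine squeeze_zero' (Eventually.of_forall fun _ => norm_nonneg _)
        (g := fun z => A * |z - y|) ?_ ?_
      · filter_upwards [ev] with z hz
        have := exp (g z) (g y) (hg z hz).1 (hg y hy).1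
        rwa [(hg z hz).2, (hg y hy).2] at this
      · have : Continuous fun z => A * |z - y| := by fun_prop
        simpa using this.tendsto y
    · have := (hgood _ (hg y hy).1).2.momentumDeriv_ge
      have : 0 < 1 / A := by positivity
      linarith
    · filter_upwards [ev] with z hz using (hg z hz).2

end SolitaryWaveFamily

/-- Global solvability of a scalar differential equation with a bounded right-hand side that is
Lipschitz in the unknown. -/
lemma exists_ode_solution {v : ℝ → ℝ → ℝ} {T L K a₀ : ℝ} (hT : 0 ≤ T)
    (hL : ∀ t ∈ Icc 0 T, ∀ x, |v t x| ≤ L)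
    (hK : ∀ t ∈ Icc 0 T, ∀ x y, |v t x - v t y| ≤ K * |x - y|)
    (hc : ∀ x, ContinuousOn (fun t => v t x) (Icc 0 T)) :
    ∃ a : ℝ → ℝ, a 0 = a₀ ∧ ∀ t ∈ Icc 0 T, HasDerivWithinAt a (v t (a t)) (Icc 0 T) t := by
  have h0 : (0 : ℝ) ∈ Icc 0 T := ⟨le_rfl, hT⟩
  have L0 : 0 ≤ L := (abs_nonneg _).trans (hL 0 h0 0)
  have K0 : 0 ≤ K := by
    have := (abs_nonneg _).trans (hK 0 h0 1 0)
    simpa using this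
  have P : IsPicardLindelof v (⟨0, h0⟩ : Icc (0 : ℝ) T) a₀ (Real.toNNReal (L * T)) 0
      (Real.toNNReal L) (Real.toNNReal K) :=
    { lipschitzOnWith := fun t ht => LipschitzOnWith.of_dist_le_mul fun x _ y _ => by
        rw [Real.coe_toNNReal _ K0]; exact hK t ht x y
      continuousOn := fun x _ => hc x
      norm_le := fun t ht x _ => by rw [Real.coe_toNNReal _ L0]; exact hL t ht x
      mul_max_le := by
        simp [Real.coe_toNNReal _ L0, Real.coe_toNNReal _ (mul_nonneg L0 hT), hT] }
  exact P.exists_eq_forall_mem_Icc_hasDerivWithinAt₀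

/-- The modulation parameters `a` and `c` on `[0, T]`: the speed is determined by the momentum, and
the position follows the expected equation up to a feedback of strength `K` that damps the
translation mode of the perturbation. -/
structure Modulation (f : ℝ → ℝ) (b U : ℝ → ℝ → ℝ) (Q : ℝ → ℝ → ℝ) (c₀ r K T : ℝ)
    (a c : ℝ → ℝ) : Prop where
  speed_near : ∀ t ∈ Icc 0 T, |c t - c₀| ≤ r
  momentum_eq : ∀ t ∈ Icc 0 T, momentum (Q (c t)) = momentum (U t)
  deriv_speed : ∀ t ∈ Icc 0 T, HasDerivWithinAt c
    ((momentumDeriv Q (c t))⁻¹ * (1 / 2 * ∫ x, partialDeriv b 0 1 t x * U t x ^ 2)) (Icc 0 T) t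
  deriv_position : ∀ t ∈ Icc 0 T, HasDerivWithinAt a
    (c t - b t (a t) + K * ∫ x, U t x * centering (x - a t)) (Icc 0 T) t

/-- The momentum is differentiable along the flow and invertible as a function of the speed, which
gives `c`; the equation for `a` is then an ordinary differential equation with a Lipschitz
right-hand side. -/
lemma exists_modulation {f : ℝ → ℝ} {I₀ : Set ℝ} {Q b U V : ℝ → ℝ → ℝ}
    {A r c₀ εa εx εt K T : ℝ} (hQ : SolitaryWaveFamily f I₀ Q) (hf : AdmissibleNonlinearity f)
    (hA : 1 ≤ A) (hr : 0 < r) (hgood : ∀ c, |c - c₀| ≤ r → c ∈ I₀ ∧ GoodSpeed f Q A c)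
    (hb : AdmissiblePotential b εa εx εt) (hU : IsRegularSolution f b U V) (hT : 0 ≤ T)
    (hK : 0 ≤ K) (a₀ : ℝ)
    (hp : ∀ t ∈ Icc 0 T, |momentum (U t) - momentum (Q c₀)| < r / A) :
    ∃ a c : ℝ → ℝ, a 0 = a₀ ∧ Modulation f b U Q c₀ r K T a c ∧
      ∀ t ∈ Icc 0 T, |c t - c₀| ≤ A * |momentum (U t) - momentum (Q c₀)| := by
  obtain ⟨g, hg⟩ := hQ.exists_momentum_inverse hf hA hr hgood
  set c := fun t => g (momentum (U t)) with hc
  have hsub : Icc 0 T ⊆ Ici 0 := Icc_subset_Ici_self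
  have dc : ∀ t ∈ Icc 0 T, HasDerivWithinAt c ((momentumDeriv Q (c t))⁻¹ *
      (1 / 2 * ∫ x, partialDeriv b 0 1 t x * U t x ^ 2)) (Icc 0 T) t := fun t ht =>
    (hg _ (hp t ht)).2.2.2.comp_hasDerivWithinAt t ((hU.momentum_law t ht.1).mono hsub)
  have cc : ContinuousOn c (Icc 0 T) := fun t ht => (dc t ht).continuousWithinAt
  have Lc := hU.l2ContinuousOn.mono hsub
  have cn : ContinuousOn (fun t => l2 (U t)) (Icc 0 T) := by
    have h := (Lc.continuousOn_integral_mul Lc).sqrt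
    refine h.congr fun t _ => ?_
    simp only [l2, sq]
  obtain ⟨M, hM⟩ := isCompact_Icc.exists_bound_of_continuousOn cn
  obtain ⟨C, hC⟩ := isCompact_Icc.exists_bound_of_continuousOn cc
  have hM' : ∀ t ∈ Icc 0 T, l2 (U t) ≤ M := fun t ht => (le_abs_self _).trans (hM t ht)
  obtain ⟨K₁, hK₁, hlip⟩ := exists_l2_translate_le contDiff_centering hasCompactSupport_centering
  have M0 : 0 ≤ M := (l2_nonneg _).trans (hM' 0 ⟨le_rfl, hT⟩)
  have mΨ := fun a => memLp_translate contDiff_centering.continuous hasCompactSupport_centering a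
  obtain ⟨a, ha0, ha⟩ : ∃ a : ℝ → ℝ, a 0 = a₀ ∧ ∀ t ∈ Icc 0 T, HasDerivWithinAt a
      (c t - b t (a t) + K * ∫ x, U t x * centering (x - a t)) (Icc 0 T) t := by
    refine exists_ode_solution (v := fun t x => c t - b t x + K * ∫ y, U t y * centering (y - x))
      (L := C + 1 + K * (M * l2 centering)) (K := 1 + K * (M * K₁)) hT (fun t ht x => ?_)
      (fun t ht x y => ?_) fun x => ?_
    · have h1 := hC t ht
      have h2 := hb.abs_le_one t x
      have h3 : |∫ y, U t y * centering (y - x)| ≤ M * l2 centering := by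
        refine (abs_integral_mul_le (hU.pair t ht.1).2 (mΨ x)).trans ?_
        rw [l2_translate]
        exact mul_le_mul_of_nonneg_right (hM' t ht) (l2_nonneg _)
      have h4 : |K * ∫ y, U t y * centering (y - x)| ≤ K * (M * l2 centering) := by
        rw [abs_mul, abs_of_nonneg hK]; gcongr
      rw [Real.norm_eq_abs] at h1
      have := abs_add_le (c t - b t x) (K * ∫ y, U t y * centering (y - x))
      have := abs_sub (c t) (b t x)
      linarith
    · have h1 : |b t x - b t y| ≤ |x - y| := (hb.abs_sub_space_le t x y).trans
        (mul_le_of_le_one_left (abs_nonneg _) hb.prod_le_one)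
      have h2 : |(∫ z, U t z * centering (z - x)) - ∫ z, U t z * centering (z - y)| ≤
          M * (K₁ * |x - y|) := by
        have hp := (hU.pair t ht.1).2
        rw [← integral_sub (integrable_mul hp (mΨ x)) (integrable_mul hp (mΨ y))]
        have e : (fun z => U t z * centering (z - x) - U t z * centering (z - y)) =
          fun z => U t z * (centering (z - x) - centering (z - y)) := by funext z; ring
        rw [e]
        exact (abs_integral_mul_le hp ((mΨ x).sub (mΨ y))).trans
          (mul_le_mul (hM' t ht) (hlip x y) (l2_nonneg _) M0)
      have e : c t - b t x + K * (∫ z, U t z * centering (z - x)) -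
          (c t - b t y + K * ∫ z, U t z * centering (z - y)) = -(b t x - b t y) +
          K * ((∫ z, U t z * centering (z - x)) - ∫ z, U t z * centering (z - y)) := by ring
      rw [e]
      refine (abs_add_le _ _).trans ?_
      rw [abs_neg, abs_mul, abs_of_nonneg hK]
      have := mul_le_mul_of_nonneg_left h2 hK
      linarith
    · have hbc : Continuous fun t => b t x :=
        continuous_iff_continuousAt.2 fun t => (hb.hasDerivAt_time t x).continuousAt
      exact (cc.sub hbc.continuousOn).add ((hU.continuousOn_test contDiff_centering
        hasCompactSupport_centering hsub continuousOn_const).const_smul K)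
  exact ⟨a, c, ha0, ⟨fun t ht => (hg _ (hp t ht)).1, fun t ht => (hg _ (hp t ht)).2.2.1, dc, ha⟩,
    fun t ht => (hg _ (hp t ht)).2.1⟩

/-! ### Correctors -/

/-- An odd test function localised on the scale `e⁻²`, at the speed `c₀`, for which the linearised
operator applied to its derivative is close to `τ c`, and the pairing of its derivative with `Q_c`
is close to `m`. -/
structure IsCorrector (f : ℝ → ℝ) (Q : ℝ → ℝ → ℝ) (c₀ r e C : ℝ) (φ : ℝ → ℝ) (τ : ℝ → ℝ → ℝ)
    (m : ℝ) : Prop where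
  contDiff : ContDiff ℝ ∞ φ
  odd : ∀ x, φ (-x) = -φ x
  support : ∀ x, 3 / e ^ 2 < |x| → φ x = 0
  l2_le : l2 φ ≤ C / e
  deriv_le : ∀ x, |deriv φ x| ≤ C
  l2_deriv_le : l2 (deriv φ) ≤ C
  operator : ∀ c, |c - c₀| ≤ r → l2 (fun x => -iteratedDeriv 3 φ x +
    (c - deriv f (Q c x)) * deriv φ x - τ c x) ≤ C * (e + |c - c₀|)
  moment : ∀ c, |c - c₀| ≤ r → |(∫ x, Q c x * deriv φ x) - m| ≤ C * (e + |c - c₀|)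

lemma IsCorrector.hasCompactSupport {f : ℝ → ℝ} {Q : ℝ → ℝ → ℝ} {c₀ r e C m : ℝ} {φ : ℝ → ℝ}
    {τ : ℝ → ℝ → ℝ} (h : IsCorrector f Q c₀ r e C φ τ m) : HasCompactSupport φ :=
  HasCompactSupport.intro (isCompact_Icc (a := -(3 / e ^ 2)) (b := 3 / e ^ 2)) fun x hx =>
    h.support x (by
      by_contra hh
      exact hx ⟨(abs_le.1 (not_lt.1 hh)).1, (abs_le.1 (not_lt.1 hh)).2⟩)

namespace SolitaryWaveFamily

variable {f : ℝ → ℝ} {I₀ : Set ℝ} {Q : ℝ → ℝ → ℝ} {A C₀ r c₀ : ℝ}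

lemma memLp_wt_div {R : ℝ} (hR : 1 ≤ R) : MemLp (fun x => wt (x / R)) 2 volume := by
  have R0 : 0 < R := by linarith
  refine memLp_of_wt (A := R ^ 2)
    (continuous_wt.comp (continuous_id.div_const R)).aestronglyMeasurable fun x => ?_
  have e : wt (x / R) = R ^ 2 * (R ^ 2 + x ^ 2)⁻¹ := by rw [wt]; field_simp
  rw [abs_of_pos (wt_pos _), e, wt]
  gcongr
  nlinarith

/-- A function that is `O(R⁻¹)` on the scale `R = e⁻²` has `L²` norm `O(e)`. -/
lemma l2_le_of_wt_div {g : ℝ → ℝ} {e k k' : ℝ} (he : 0 < e) (he1 : e ≤ 1) (hk : 0 ≤ k)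
    (hk' : 0 ≤ k')
    (h : ∀ x, |g x| ≤ k / (1 / e ^ 2) * wt (x / (1 / e ^ 2)) + k' * wt x) :
    l2 g ≤ k * l2 wt * e + k' * l2 wt := by
  have hR : 1 ≤ 1 / e ^ 2 := by
    rw [le_div_iff₀ (by positivity), one_mul]; exact pow_le_one₀ he.le he1
  have m1 := (memLp_wt_div hR).const_mul (k / (1 / e ^ 2))
  have m2 := memLp_wt.const_mul k'
  have h1 : l2 g ≤ l2 (fun x => k / (1 / e ^ 2) * wt (x / (1 / e ^ 2)) + k' * wt x) :=
    l2_mono (m1.add m2) fun x => (h x).trans (le_abs_self _)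
  refine h1.trans ((l2_add_le m1 m2).trans ?_)
  rw [l2_const_mul, l2_const_mul, l2_wt_div (by positivity), abs_of_nonneg (by positivity),
    abs_of_nonneg hk', Real.sqrt_div zero_le_one, Real.sqrt_one, Real.sqrt_sq he.le]
  refine le_of_eq ?_
  field_simp

lemma potential_sub_le (hQ : SolitaryWaveFamily f I₀ Q) (hf : AdmissibleNonlinearity f)
    (hA : 1 ≤ A) (hC : LocalBounds f (A + 2) C₀)
    (hgood : ∀ c, |c - c₀| ≤ r → c ∈ I₀ ∧ GoodSpeed f Q A c) {c : ℝ} (hc : |c - c₀| ≤ r) (x : ℝ) :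
    |Q c x - Q c₀ x| ≤ A * |c - c₀| * wt x ^ 2 ∧
    |(c - deriv f (Q c x)) - (c₀ - deriv f (Q c₀ x))| ≤ (1 + C₀ * A) * |c - c₀| := by
  have hr : 0 ≤ r := (abs_nonneg _).trans hc
  have hc0 : |c₀ - c₀| ≤ r := by simpa using hr
  have lip := (hQ.lipschitz_wt hf (s := Metric.closedBall c₀ r) (convex_closedBall c₀ r)
    (fun c hc => (hgood c hc).1) (fun c hc => (hgood c hc).2.bounds) hc hc0 x).1
  refine ⟨lip, ?_⟩
  have b1 := profile_abs_le (by linarith) (hgood c hc).2 x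
  have b2 := profile_abs_le (by linarith) (hgood c₀ hc0).2 x
  have h := hC.lipschitz_deriv (Q c x) (Q c₀ x) (by linarith) (by linarith)
  have hw : A * |c - c₀| * wt x ^ 2 ≤ A * |c - c₀| := mul_le_of_le_one_right (by positivity)
    (pow_le_one₀ (wt_pos x).le (wt_le_one x))
  have h2 : C₀ * |Q c x - Q c₀ x| ≤ C₀ * (A * |c - c₀|) :=
    mul_le_mul_of_nonneg_left (lip.trans hw) (zero_le_one.trans hC.one_le)
  have e : (c - deriv f (Q c x)) - (c₀ - deriv f (Q c₀ x)) =
    (c - c₀) - (deriv f (Q c x) - deriv f (Q c₀ x)) := by ring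
  rw [e]
  refine (abs_sub _ _).trans ?_
  linarith

/-- A corrector is a truncation, on the scale `e⁻²`, of an odd function `Y` that solves the equation
`-Y''' + (c₀ - f'(Q)) Y' = τ` exactly. The function `Y` itself need not decay: only `Y'` does. -/
lemma exists_corrector (hQ : SolitaryWaveFamily f I₀ Q) (hf : AdmissibleNonlinearity f)
    (hA : 1 ≤ A) (hC : LocalBounds f (A + 2) C₀) (B : ℝ) :
    ∃ C > 0, ∀ (c₀ r e : ℝ), 0 ≤ r → (∀ c, |c - c₀| ≤ r → c ∈ I₀ ∧ GoodSpeed f Q A c) → 0 < e →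
      e ≤ 1 → ∀ (Y Y₁ Y₂ Y₃ : ℝ → ℝ) (τ : ℝ → ℝ → ℝ),
      (∀ x, HasDerivAt Y (Y₁ x) x) → (∀ x, HasDerivAt Y₁ (Y₂ x) x) →
      (∀ x, HasDerivAt Y₂ (Y₃ x) x) → Continuous Y₃ → (∀ x, Y (-x) = -Y x) →
      (∀ x, |Y x| ≤ B) → (∀ x, |Y₁ x| ≤ B * wt x) → (∀ x, |Y₂ x| ≤ B) → (∀ x, |Y₃ x| ≤ B * wt x) →
      (∀ x, -Y₃ x + (c₀ - deriv f (Q c₀ x)) * Y₁ x = τ c₀ x) →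
      (∀ c, |c - c₀| ≤ r → ∀ x, |τ c x - τ c₀ x| ≤ B * |c - c₀| * wt x) →
      ∃ φ, IsCorrector f Q c₀ r e C φ τ (∫ x, Q c₀ x * Y₁ x) := by
  obtain ⟨C₁, hC₁, H⟩ := exists_testFunction B
  have lw := l2_nonneg wt
  have hC0 : 0 ≤ C₀ := zero_le_one.trans hC.one_le
  have hA0 : 0 ≤ A := by linarith
  set M := C₁ * l2 wt + C₁ + |B| + |B| * l2 wt + ((1 + A) * C₁ * l2 wt + (2 + C₀ * A) * |B| * l2 wt)
    + A * l2 wt * (C₁ * l2 wt) + A * l2 wt * (|B| * l2 wt) with hM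
  refine ⟨M, by positivity, ?_⟩
  intro c₀ r e hr hgood he he1 Y Y₁ Y₂ Y₃ τ d0 d1 d2 hc3 hodd b0 b1 b2 b3 hτ hτ'
  have hB : 0 ≤ B := (abs_nonneg _).trans (b0 0)
  rw [abs_of_nonneg hB] at hM
  have p1 : 0 ≤ C₁ * l2 wt := by positivity
  have p2 : 0 ≤ B * l2 wt := by positivity
  have p3 : 0 ≤ (1 + A) * C₁ * l2 wt := by positivity
  have p4 : 0 ≤ (2 + C₀ * A) * B * l2 wt := by positivity
  have p5 : 0 ≤ A * l2 wt * (C₁ * l2 wt) := by positivity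
  have p6 : 0 ≤ A * l2 wt * (B * l2 wt) := by positivity
  have hR : 1 ≤ 1 / e ^ 2 := by
    rw [le_div_iff₀ (by positivity), one_mul]; exact pow_le_one₀ he.le he1
  obtain ⟨φ, f1, f2, f3, f4, f5, f6⟩ := H Y Y₁ Y₂ Y₃ (1 / e ^ 2) hR d0 d1 d2 hc3 hodd b0 b1 b2 b3
  have cY1 : Continuous Y₁ := continuous_iff_continuousAt.2 fun x => (d1 x).continuousAt
  have mY1 : MemLp Y₁ 2 volume := memLp_of_wt cY1.aestronglyMeasurable b1
  have lY1 : l2 Y₁ ≤ B * l2 wt := l2_le_of_wt b1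
  have sφ : HasCompactSupport φ := HasCompactSupport.intro
    (isCompact_Icc (a := -(3 * (1 / e ^ 2))) (b := 3 * (1 / e ^ 2))) fun x hx => f3 x (by
      by_contra hh
      exact hx ⟨(abs_le.1 (not_lt.1 hh)).1, (abs_le.1 (not_lt.1 hh)).2⟩)
  have cφ1 : Continuous (deriv φ) := (contDiff_infty_iff_deriv.1 f1).2.continuous
  have mφ1 : MemLp (deriv φ) 2 volume := memLp_of_hasCompactSupport cφ1 sφ.deriv
  have md : MemLp (fun x => deriv φ x - Y₁ x) 2 volume := mφ1.sub mY1
  have wle : ∀ x, 1 / (1 / e ^ 2) * wt (x / (1 / e ^ 2)) ≤ 1 := fun x => by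
    have h1 : 1 / (1 / e ^ 2) ≤ 1 := by
      rw [one_div_one_div]; exact pow_le_one₀ he.le he1
    exact mul_le_one₀ h1 (wt_pos _).le (wt_le_one _)
  have ld : l2 (fun x => deriv φ x - Y₁ x) ≤ C₁ * l2 wt * e := by
    have := l2_le_of_wt_div (k := C₁) (k' := 0) he he1 hC₁.le le_rfl
      (fun x => (f5 x).trans (by simp))
    simpa using this
  have ld' : l2 (fun x => deriv φ x - Y₁ x) ≤ C₁ * l2 wt := ld.trans
    (mul_le_of_le_one_right p1 he1)
  refine ⟨φ, f1, f2, fun x hx => f3 x (by rwa [mul_one_div]), ?_, fun x => ?_, ?_, fun c hc => ?_,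
    fun c hc => ?_⟩
  · have h1 : l2 φ ≤ C₁ * (Real.sqrt (1 / e ^ 2) * l2 wt) := by
      rw [← l2_wt_div (by positivity), ← abs_of_pos hC₁, ← l2_const_mul]
      refine l2_mono ((memLp_wt_div hR).const_mul _) fun x => ?_
      exact (f4 x).trans (le_abs_self _)
    rw [Real.sqrt_div zero_le_one, Real.sqrt_one, Real.sqrt_sq he.le] at h1
    have e1 : C₁ * (1 / e * l2 wt) = C₁ * l2 wt / e := by ring
    rw [e1] at h1
    refine h1.trans (div_le_div_of_nonneg_right ?_ he.le)
    linarith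
  · have h1 : |deriv φ x - Y₁ x| ≤ C₁ := (f5 x).trans (by
      have := mul_le_mul_of_nonneg_left (wle x) hC₁.le
      rw [mul_one] at this
      refine le_of_eq_of_le ?_ this
      ring)
    have h2 : |Y₁ x| ≤ B := (b1 x).trans (mul_le_of_le_one_right hB (wt_le_one x))
    have h3 := abs_add_le (deriv φ x - Y₁ x) (Y₁ x)
    rw [sub_add_cancel] at h3
    linarith
  · have := l2_add_le md mY1
    simp only [sub_add_cancel] at this
    linarith
  · have k0 : 0 ≤ |c - c₀| := abs_nonneg _
    have := l2_le_of_wt_div (g := fun x => -iteratedDeriv 3 φ x +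
      (c - deriv f (Q c x)) * deriv φ x - τ c x) (k := (1 + A) * C₁)
      (k' := (2 + C₀ * A) * B * |c - c₀|) he he1 (by positivity) (by positivity) fun x => by
      have w := wt_pos x
      obtain ⟨-, hV⟩ := hQ.potential_sub_le hf hA hC hgood hc x
      have hVc := (hgood c hc).2.bounds.potential x
      have g5 := f5 x
      have g6 := f6 x
      have hy := b1 x
      have ht := hτ' c hc x
      rw [← hτ x] at ht
      obtain ⟨W, hW⟩ : ∃ W, W = wt (x / (1 / e ^ 2)) := ⟨_, rfl⟩
      have hW0 : 0 < W := hW ▸ wt_pos _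
      obtain ⟨Vc, hVc'⟩ : ∃ Vc, Vc = c - deriv f (Q c x) := ⟨_, rfl⟩
      obtain ⟨V0, hV0⟩ : ∃ V0, V0 = c₀ - deriv f (Q c₀ x) := ⟨_, rfl⟩
      rw [← hW] at g5 g6 ⊢
      rw [← hVc'] at hV hVc ⊢
      rw [← hV0] at hV ht
      have e1 : -iteratedDeriv 3 φ x + Vc * deriv φ x - τ c x =
        -(iteratedDeriv 3 φ x - Y₃ x) + Vc * (deriv φ x - Y₁ x) + (Vc - V0) * Y₁ x -
          (τ c x - (-Y₃ x + V0 * Y₁ x)) := by ring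
      have h1 : |Vc * (deriv φ x - Y₁ x)| ≤ A * (C₁ / (1 / e ^ 2) * W) := by
        rw [abs_mul]; exact mul_le_mul hVc g5 (abs_nonneg _) hA0
      have h2 : |(Vc - V0) * Y₁ x| ≤ (1 + C₀ * A) * |c - c₀| * (B * wt x) := by
        rw [abs_mul]; exact mul_le_mul hV hy (abs_nonneg _) (by positivity)
      rw [abs_le] at g6 h1 h2 ht ⊢
      rw [e1]
      have e2 : (1 + A) * C₁ / (1 / e ^ 2) * W + (2 + C₀ * A) * B * |c - c₀| * wt x =
        C₁ / (1 / e ^ 2) * W + A * (C₁ / (1 / e ^ 2) * W) +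
          (1 + C₀ * A) * |c - c₀| * (B * wt x) + B * |c - c₀| * wt x := by ring
      rw [e2]
      constructor <;> linarith [g6.1, g6.2, h1.1, h1.2, h2.1, h2.2, ht.1, ht.2]
    refine this.trans ?_
    have t1 : (1 + A) * C₁ * l2 wt * e ≤ M * e := by gcongr; linarith
    have t2 : (2 + C₀ * A) * B * l2 wt * |c - c₀| ≤ M * |c - c₀| := by gcongr; linarith
    linarith
  · have k0 : 0 ≤ |c - c₀| := abs_nonneg _
    have hc0 : |c₀ - c₀| ≤ r := by simpa using hr
    have mQ := (hQ.h1Pair (hgood c hc).1 (hgood c hc).2.bounds).2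
    have mQ0 := (hQ.h1Pair (hgood c₀ hc0).1 (hgood c₀ hc0).2.bounds).2
    have lQ : l2 (Q c) ≤ A * l2 wt := l2_le_of_wt (le_wt_of_le_sq (hgood c hc).2.bounds.profile)
    have mdQ : MemLp (fun x => Q c x - Q c₀ x) 2 volume := mQ.sub mQ0
    have ldQ : l2 (fun x => Q c x - Q c₀ x) ≤ A * |c - c₀| * l2 wt :=
      l2_le_of_wt (le_wt_of_le_sq fun x => (hQ.potential_sub_le hf hA hC hgood hc x).1)
    have e1 : (∫ x, Q c x * deriv φ x) - ∫ x, Q c₀ x * Y₁ x =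
        (∫ x, Q c x * (deriv φ x - Y₁ x)) + ∫ x, (Q c x - Q c₀ x) * Y₁ x := by
      rw [← integral_sub (integrable_mul mQ mφ1) (integrable_mul mQ0 mY1),
        ← integral_add (integrable_mul mQ md) (integrable_mul mdQ mY1)]
      congr 1; funext x; ring
    rw [e1]
    have h1 := (abs_integral_mul_le mQ md).trans
      (mul_le_mul lQ ld (l2_nonneg _) (by positivity))
    have h2 := (abs_integral_mul_le mdQ mY1).trans
      (mul_le_mul ldQ lY1 (l2_nonneg _) (by positivity))
    refine (abs_add_le _ _).trans ((add_le_add h1 h2).trans ?_)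
    have t1 : A * l2 wt * (C₁ * l2 wt) * e ≤ M * e := by gcongr; linarith
    have t2 : A * l2 wt * (B * l2 wt) * |c - c₀| ≤ M * |c - c₀| := by gcongr; linarith
    linarith

lemma forceProfile_sub_le (hQ : SolitaryWaveFamily f I₀ Q) (hf : AdmissibleNonlinearity f)
    (hA : 1 ≤ A) (hC : LocalBounds f (A + 2) C₀)
    (hgood : ∀ c, |c - c₀| ≤ r → c ∈ I₀ ∧ GoodSpeed f Q A c) {c : ℝ} (hc : |c - c₀| ≤ r) (x : ℝ) :
    |forceProfile f Q c x - forceProfile f Q c₀ x| ≤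
      (4 * A + 4 * (A * A) + C₀ * (A * A) + 3 * (C₀ * A)) * |c - c₀| * wt x := by
  have hC0 : 0 ≤ C₀ := zero_le_one.trans hC.one_le
  have hr : 0 ≤ r := (abs_nonneg _).trans hc
  have hc0 : |c₀ - c₀| ≤ r := by simpa using hr
  have w := wt_pos x
  have ww := wt_sq_le x
  have hA0 : 0 ≤ A := by linarith
  obtain ⟨h1, h2⟩ := hQ.potential_sub_le hf hA hC hgood hc x
  have h1' : |Q c x - Q c₀ x| ≤ A * |c - c₀| * wt x := h1.trans (by gcongr)
  have b1 := profile_abs_le hA0 (hgood c hc).2 x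
  have b2 := profile_abs_le hA0 (hgood c₀ hc0).2 x
  have h3 := hC.lipschitz (Q c x) (Q c₀ x) (by linarith) (by linarith)
  have h4 : |Q c x| ≤ A * wt x := le_wt_of_le_sq (hgood c hc).2.bounds.profile x
  have h5 := (hgood c₀ hc0).2.bounds.potential x
  have h6 : |c₀| ≤ A := by
    rw [abs_of_pos (hQ.speed_pos _ (hgood c₀ hc0).1)]; exact (hgood c₀ hc0).2.speed_le
  have k1 : |((c - deriv f (Q c x)) - (c₀ - deriv f (Q c₀ x))) * Q c x| ≤
      (1 + C₀ * A) * |c - c₀| * (A * wt x) := by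
    rw [abs_mul]; exact mul_le_mul h2 h4 (abs_nonneg _) (by positivity)
  have k2 : |(c₀ - deriv f (Q c₀ x)) * (Q c x - Q c₀ x)| ≤ A * (A * |c - c₀| * wt x) := by
    rw [abs_mul]; exact mul_le_mul h5 h1' (abs_nonneg _) hA0
  have k3 : |(c - c₀) * Q c x| ≤ |c - c₀| * (A * wt x) := by
    rw [abs_mul]; gcongr
  have k4 : |c₀ * (Q c x - Q c₀ x)| ≤ A * (A * |c - c₀| * wt x) := by
    rw [abs_mul]; exact mul_le_mul h6 h1' (abs_nonneg _) hA0
  have k5 : |f (Q c x) - f (Q c₀ x)| ≤ C₀ * (A * |c - c₀| * wt x) := h3.trans (by gcongr)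
  have e : forceProfile f Q c x - forceProfile f Q c₀ x =
      ((c - deriv f (Q c x)) - (c₀ - deriv f (Q c₀ x))) * Q c x +
      (c₀ - deriv f (Q c₀ x)) * (Q c x - Q c₀ x) - 3 * ((c - c₀) * Q c x) -
      3 * (c₀ * (Q c x - Q c₀ x)) + 3 * (f (Q c x) - f (Q c₀ x)) := by
    simp only [forceProfile]; ring
  rw [e]
  rw [abs_le] at k1 k2 k3 k4 k5 ⊢
  constructor <;> linarith [k1.1, k1.2, k2.1, k2.2, k3.1, k3.2, k4.1, k4.2, k5.1, k5.2]

/-- The identity `∫ Q (x Q)' = 1/2 ∫ Q²`. -/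
lemma integral_profile_mul_scaling (hQ : SolitaryWaveFamily f I₀ Q) {c : ℝ} (hc : c ∈ I₀)
    (hb : ProfileBounds f Q c A) :
    ∫ x, Q c x * (Q c x + x * deriv (Q c) x) = momentum (Q c) := by
  have hA := nonneg_of_wt (le_wt_of_le_sq hb.profile)
  have pQ := hQ.h1Pair hc hb
  have cQ := hQ.continuous hc
  have cq := hQ.continuous_deriv hc
  have xb : ∀ {g : ℝ → ℝ}, (∀ x, |g x| ≤ A * wt x ^ 2) → ∀ x, |x * g x| ≤ A * wt x := fun h x => by
    rw [abs_mul]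
    calc |x| * |_| ≤ |x| * (A * wt x ^ 2) := by gcongr; exact h x
      _ = A * (|x| * wt x ^ 2) := by ring
      _ ≤ _ := mul_le_mul_of_nonneg_left (abs_mul_wt_sq_le x) hA
  have mxQ : MemLp (fun x => x * Q c x) 2 volume :=
    memLp_of_wt (by fun_prop) (xb hb.profile)
  have mxq : MemLp (fun x => x * deriv (Q c) x) 2 volume :=
    memLp_of_wt (continuous_id.mul cq).aestronglyMeasurable (xb hb.slope)
  have d : ∀ x, HasDerivAt (fun x => x * Q c x * Q c x)
      (Q c x * Q c x + 2 * (Q c x * (x * deriv (Q c) x))) x := fun x =>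
    (((hasDerivAt_id x).mul (hQ.hasDerivAt hc x)).mul (hQ.hasDerivAt hc x)).congr_deriv (by
      simp only [Pi.mul_apply, id]; ring)
  have i1 := integrable_mul pQ.2 pQ.2
  have i2 : Integrable fun x => Q c x * (x * deriv (Q c) x) := integrable_mul pQ.2 mxq
  have z := integral_eq_zero_of_hasDerivAt_of_integrable d (i1.fun_add (i2.const_mul 2))
    (integrable_mul mxQ pQ.2)
  rw [integral_add i1 (i2.const_mul 2), integral_const_mul] at z
  have e : ∫ x, Q c x * (Q c x + x * deriv (Q c) x) =
      (∫ x, Q c x * Q c x) + ∫ x, Q c x * (x * deriv (Q c) x) := by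
    rw [← integral_add i1 i2]; congr 1; funext x; ring
  rw [e, momentum]
  simp only [sq]
  linarith

/-- The two correctors: the first one cancels the linear force term, the second one the
contribution of the perturbation to the velocity. -/
lemma exists_correctors (hQ : SolitaryWaveFamily f I₀ Q) (hf : AdmissibleNonlinearity f)
    (hA : 1 ≤ A) (hC : LocalBounds f (A + 2) C₀) :
    ∃ C > 0, ∀ (c₀ r e : ℝ), 0 ≤ r → (∀ c, |c - c₀| ≤ r → c ∈ I₀ ∧ GoodSpeed f Q A c) → 0 < e →
      e ≤ 1 → (∃ φ, IsCorrector f Q c₀ r e C φ (forceProfile f Q) (momentum (Q c₀))) ∧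
        ∃ φ, IsCorrector f Q c₀ r e C φ (fun c x => -Q c x) (momentumDeriv Q c₀) := by
  have hC0 : 0 ≤ C₀ := zero_le_one.trans hC.one_le
  have hA0 : 0 ≤ A := by linarith
  have iw : 0 ≤ ∫ x, wt x := integral_nonneg fun x => (wt_pos x).le
  set B := 4 * A + 4 * (A * A) + C₀ * (A * A) + 3 * (C₀ * A) + A * ∫ x, wt x with hB
  have q1 : 0 ≤ A * A := by positivity
  have q2 : 0 ≤ C₀ * (A * A) := by positivity
  have q3 : 0 ≤ C₀ * A := by positivity
  have q4 : 0 ≤ A * ∫ x, wt x := by positivity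
  obtain ⟨C, hCp, H⟩ := hQ.exists_corrector hf hA hC B
  refine ⟨C, hCp, fun c₀ r e hr hgood he he1 => ?_⟩
  have hc0 : |c₀ - c₀| ≤ r := by simpa using hr
  have hc := (hgood c₀ hc0).1
  have hb := (hgood c₀ hc0).2.bounds
  have sq_wt : ∀ {z : ℝ} {k : ℝ} (x : ℝ), 0 ≤ k → z ≤ k * wt x ^ 2 → z ≤ k * wt x := fun x hk hz =>
    hz.trans (mul_le_mul_of_nonneg_left (wt_sq_le x) hk)
  have xb : ∀ {g : ℝ → ℝ}, (∀ x, |g x| ≤ A * wt x ^ 2) → ∀ x, |x * g x| ≤ A * wt x := fun h x => by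
    rw [abs_mul]
    calc |x| * |_| ≤ |x| * (A * wt x ^ 2) := by gcongr; exact h x
      _ = A * (|x| * wt x ^ 2) := by ring
      _ ≤ _ := mul_le_mul_of_nonneg_left (abs_mul_wt_sq_le x) hA0
  have w1 : ∀ {k : ℝ} (x : ℝ), 0 ≤ k → k * wt x ≤ k := fun x hk =>
    mul_le_of_le_one_right hk (wt_le_one x)
  have d0 := hQ.hasDerivAt hc
  have d1 := hQ.hasDerivAt_deriv hc
  have d2 := hQ.hasDerivAt_deriv_deriv hf hc
  have cQ := hQ.continuous hc
  have cV := hQ.continuous_potential hf hc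
  constructor
  -- the generator of scaling, `Y = x Q`
  · have := H c₀ r e hr hgood he he1 (fun x => x * Q c₀ x) (fun x => Q c₀ x + x * deriv (Q c₀) x)
      (fun x => 2 * deriv (Q c₀) x + x * (c₀ * Q c₀ x - f (Q c₀ x)))
      (fun x => 3 * (c₀ * Q c₀ x - f (Q c₀ x)) + x * ((c₀ - deriv f (Q c₀ x)) * deriv (Q c₀) x))
      (forceProfile f Q)
      (fun x => ((hasDerivAt_id x).mul (d0 x)).congr_deriv (by simp))
      (fun x => ((d0 x).add ((hasDerivAt_id x).mul (d1 x))).congr_deriv (by simp; ring))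
      (fun x => (((d1 x).const_mul 2).add ((hasDerivAt_id x).mul (d2 x))).congr_deriv
        (by simp; ring))
      ((continuous_const.mul (hQ.continuous_second hf hc)).add
        (continuous_id.mul (cV.mul (hQ.continuous_deriv hc))))
      (fun x => by rw [hQ.even c₀ hc]; ring)
      (fun x => ((xb hb.profile x).trans (w1 x hA0)).trans (by linarith))
      (fun x => by
        refine (abs_add_le _ _).trans ((add_le_add (sq_wt x hA0 (hb.profile x))
          (xb hb.slope x)).trans ?_)
        rw [← add_mul]
        exact mul_le_mul_of_nonneg_right (by linarith) (wt_pos x).le)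
      (fun x => by
        refine (abs_add_le _ _).trans ?_
        rw [abs_mul, abs_two]
        have h1 := (sq_wt x hA0 (hb.slope x)).trans (w1 x hA0)
        have h2 := (xb hb.second x).trans (w1 x hA0)
        linarith)
      (fun x => by
        refine (abs_add_le _ _).trans ?_
        have h1 := sq_wt x hA0 (hb.second x)
        have h2 := mul_le_mul (hb.potential x) (xb hb.slope x) (abs_nonneg _) hA0
        have e1 : |x * ((c₀ - deriv f (Q c₀ x)) * deriv (Q c₀) x)| =
          |c₀ - deriv f (Q c₀ x)| * |x * deriv (Q c₀) x| := by rw [← abs_mul]; congr 1; ring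
        rw [abs_mul, abs_of_pos three_pos, e1]
        have : (3 * A + A * A) * wt x ≤ B * wt x :=
          mul_le_mul_of_nonneg_right (by linarith) (wt_pos x).le
        linarith)
      (fun x => by simp only [forceProfile]; ring)
      (fun c hc x => (hQ.forceProfile_sub_le hf hA hC hgood hc x).trans (by
        have := wt_pos x
        gcongr
        linarith))
    rwa [hQ.integral_profile_mul_scaling hc hb] at this
  -- `Y = ∫₀ˣ ∂_c Q`, since the linearised operator maps `∂_c Q` to `-Q`; here `Y` does not decay
  · have cR := hQ.continuous_speedDeriv hf hc
    have hR : ∀ x, |speedDeriv Q c₀ x| ≤ A * wt x := le_wt_of_le_sq hb.speed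
    exact H c₀ r e hr hgood he he1 (fun x => ∫ y in (0 : ℝ)..x, speedDeriv Q c₀ y)
      (speedDeriv Q c₀) (speedDerivFlux f Q c₀)
      (fun x => Q c₀ x + (c₀ - deriv f (Q c₀ x)) * speedDeriv Q c₀ x) (fun c x => -Q c x)
      (fun x => intervalIntegral.integral_hasDerivAt_right (cR.intervalIntegrable _ _)
        (cR.stronglyMeasurableAtFilter _ _) cR.continuousAt)
      (hQ.hasDerivAt_speedDeriv hf hc) (hQ.hasDerivAt_speedDerivFlux hf hc)
      (cQ.add (cV.mul cR))
      (fun x => by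
        have h := intervalIntegral.integral_comp_neg (a := 0) (b := x) (speedDeriv Q c₀)
        simp only [hQ.speedDeriv_neg_arg hc, neg_zero] at h
        rw [h, intervalIntegral.integral_symm])
      (fun x => by
        have h1 : |∫ y in (0 : ℝ)..x, speedDeriv Q c₀ y| ≤ ∫ y, A * wt y := by
          have iR := integrable_of_wt cR.aestronglyMeasurable hR
          rw [← Real.norm_eq_abs]
          refine (intervalIntegral.norm_integral_le_integral_norm_uIoc).trans ?_
          refine (setIntegral_le_integral iR.norm
            (ae_of_all _ fun _ => norm_nonneg _)).trans ?_
          exact integral_mono iR.norm (integrable_wt.const_mul A) hR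
        rw [integral_const_mul] at h1
        linarith)
      (fun x => (hR x).trans (mul_le_mul_of_nonneg_right (by linarith) (wt_pos x).le))
      (fun x => ((sq_wt x hA0 (hb.flux x)).trans (w1 x hA0)).trans (by linarith))
      (fun x => by
        refine (abs_add_le _ _).trans ?_
        have h1 := sq_wt x hA0 (hb.profile x)
        have h2 := mul_le_mul (hb.potential x) (hR x) (abs_nonneg _) hA0
        rw [abs_mul]
        have : (A + A * A) * wt x ≤ B * wt x :=
          mul_le_mul_of_nonneg_right (by linarith) (wt_pos x).le
        linarith)
      (fun x => by ring)
      (fun c hc x => by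
        have h1 := (hQ.potential_sub_le hf hA hC hgood hc x).1
        rw [show -Q c x - -Q c₀ x = -(Q c x - Q c₀ x) by ring, abs_neg]
        refine (sq_wt x (by positivity) h1).trans ?_
        have := wt_pos x
        gcongr
        linarith)

end SolitaryWaveFamily

/-! ### The perturbation of the solitary wave -/

/-- The difference between `U` and the profile of speed `c` centred at `a`, in the frame of the
profile. -/
def perturbation (Q : ℝ → ℝ → ℝ) (U : ℝ → ℝ) (a c x : ℝ) : ℝ := U (x + a) - Q c x

/-- The `H¹` distance between `U`, with derivative `V`, and the profile of speed `c` centred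
at `a`. -/
def displacement (Q : ℝ → ℝ → ℝ) (U V : ℝ → ℝ) (a c : ℝ) : ℝ :=
  nrm (perturbation Q U a c) (perturbation (fun c => deriv (Q c)) V a c)

section Frame

variable {f : ℝ → ℝ} {I₀ : Set ℝ} {Q : ℝ → ℝ → ℝ} {A C₀ c a : ℝ} {U V φ : ℝ → ℝ}

lemma profile_add_perturbation (Q : ℝ → ℝ → ℝ) (U : ℝ → ℝ) (a c x : ℝ) :
    Q c x + perturbation Q U a c x = U (x + a) := add_sub_cancel _ _

lemma displacement_nonneg (Q : ℝ → ℝ → ℝ) (U V : ℝ → ℝ) (a c : ℝ) :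
    0 ≤ displacement Q U V a c := nrm_nonneg _ _

lemma l2_perturbation_le (Q : ℝ → ℝ → ℝ) (U V : ℝ → ℝ) (a c : ℝ) :
    l2 (perturbation Q U a c) ≤ displacement Q U V a c := l2_le_nrm _ _

lemma integral_translate_eq (F : ℝ → ℝ → ℝ) (a : ℝ) : ∫ x, F x (x - a) = ∫ x, F (x + a) x := by
  rw [← integral_add_right_eq_self (fun x => F x (x - a)) a]
  simp

lemma displacement_eq (Q : ℝ → ℝ → ℝ) (U V : ℝ → ℝ) (a c : ℝ) : displacement Q U V a c =
    nrm (fun x => U x - Q c (x - a)) (fun x => V x - deriv (Q c) (x - a)) := by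
  rw [← nrm_comp_add_right _ _ a]
  simp only [displacement, add_sub_cancel_right]
  rfl

lemma SolitaryWaveFamily.h1Pair_perturbation (hQ : SolitaryWaveFamily f I₀ Q) (hc : c ∈ I₀)
    (hg : GoodSpeed f Q A c) (hU : H1Pair U V) :
    H1Pair (perturbation Q U a c) (perturbation (fun c => deriv (Q c)) V a c) :=
  (hU.comp_add_right a).sub (hQ.h1Pair hc hg.bounds)

/-- Odd test functions do not see the solitary wave. -/
lemma SolitaryWaveFamily.integral_mul_odd (hQ : SolitaryWaveFamily f I₀ Q) (hc : c ∈ I₀)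
    (hg : GoodSpeed f Q A c) (hU : H1Pair U V) (hφ : MemLp φ 2 volume) (ho : ∀ x, φ (-x) = -φ x) :
    ∫ x, U x * φ (x - a) = ∫ x, perturbation Q U a c x * φ x := by
  rw [integral_translate_eq (fun x y => U x * φ y)]
  have h0 : HasInt (fun x => Q c x * φ x) 0 :=
    ⟨integrable_mul (hQ.h1Pair hc hg.bounds).2 hφ,
      integral_eq_zero_of_odd fun x => by rw [hQ.even c hc, ho]; ring⟩
  have h1 := HasInt.of_integrable (integrable_mul (hQ.h1Pair_perturbation (a := a) hc hg hU).2 hφ)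
  rw [← zero_add (∫ x, perturbation Q U a c x * φ x), ← (h0.add h1).2]
  congr 1; funext x
  rw [← profile_add_perturbation Q U a c x]; ring

lemma SolitaryWaveFamily.momentum_perturbation (hQ : SolitaryWaveFamily f I₀ Q)
    (hc : c ∈ I₀) (hg : GoodSpeed f Q A c) (hU : H1Pair U V) :
    momentum U = momentum (Q c) + (∫ x, perturbation Q U a c x * Q c x) +
      1 / 2 * l2 (perturbation Q U a c) ^ 2 := by
  have pQ := (hQ.h1Pair hc hg.bounds).2
  have pξ := (hQ.h1Pair_perturbation (a := a) hc hg hU).2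
  have h := (((HasInt.of_integrable pQ.integrable_sq).add ((HasInt.of_integrable
    (integrable_mul pξ pQ)).const_mul 2)).add (.of_integrable pξ.integrable_sq)).2
  have e1 : ∫ x, (Q c x ^ 2 + 2 * (perturbation Q U a c x * Q c x) + perturbation Q U a c x ^ 2) =
      ∫ x, U x ^ 2 := by
    rw [← integral_add_right_eq_self (fun x => U x ^ 2) a]
    congr 1; funext x
    rw [← profile_add_perturbation Q U a c x]; ring
  rw [e1] at h
  rw [sq_l2, momentum, momentum, h]; ring

/-- When the momenta agree, the perturbation is orthogonal to the profile to first order. -/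
lemma SolitaryWaveFamily.abs_integral_perturbation_le (hQ : SolitaryWaveFamily f I₀ Q)
    (hc : c ∈ I₀) (hg : GoodSpeed f Q A c) (hU : H1Pair U V) (hp : momentum (Q c) = momentum U) :
    |∫ x, perturbation Q U a c x * Q c x| ≤ 1 / 2 * displacement Q U V a c ^ 2 := by
  have h := hQ.momentum_perturbation (a := a) hc hg hU
  have e3 := pow_le_pow_left₀ (l2_nonneg _) (l2_perturbation_le Q U V a c) 2
  have e4 := sq_nonneg (l2 (perturbation Q U a c))
  rw [abs_le]
  constructor <;> linarith

/-- The rate of change of `∫ U φ(x - a)` along the equation, up to the motion of the centre. -/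
lemma SolitaryWaveFamily.test_perturbation_le (hQ : SolitaryWaveFamily f I₀ Q)
    (hf : AdmissibleNonlinearity f) (hA : 1 ≤ A) (hC : LocalBounds f (A + 2) C₀) (hc : c ∈ I₀)
    (hg : GoodSpeed f Q A c) (hU : H1Pair U V) (hn : displacement Q U V a c ≤ 1)
    (hφ : ContDiff ℝ ∞ φ) {S R : ℝ} (hR : 0 ≤ R) (hS : ∀ x, |deriv φ x| ≤ S)
    (hsupp : ∀ x, R < |x| → φ x = 0) {b : ℝ → ℝ → ℝ} {εa εx εt : ℝ}
    (hb : AdmissiblePotential b εa εx εt) (t : ℝ) :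
    |(∫ x, (U x * iteratedDeriv 3 φ (x - a) + (f (U x) - b t x * U x) * deriv φ (x - a))) -
      (c - b t a) * (∫ x, U x * deriv φ (x - a)) +
      ∫ x, perturbation Q U a c x *
        (-iteratedDeriv 3 φ x + (c - deriv f (Q c x)) * deriv φ x)| ≤
      C₀ * S * displacement Q U V a c ^ 2 + εa * εx * (A * S * ∫ x, wt x) +
        εa * εx * R * displacement Q U V a c * l2 (deriv φ) := by
  have hs : HasCompactSupport φ := HasCompactSupport.intro (isCompact_Icc (a := -R) (b := R))
    fun x hx => hsupp x (by
      by_contra hh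
      exact hx ⟨(abs_le.1 (not_lt.1 hh)).1, (abs_le.1 (not_lt.1 hh)).2⟩)
  have d1 := (contDiff_infty_iff_deriv.1 hφ).2
  have d2 := (contDiff_infty_iff_deriv.1 d1).2
  have d3 := (contDiff_infty_iff_deriv.1 d2).2
  have s1 := hs.deriv
  have s2 := s1.deriv
  have e3 : iteratedDeriv 3 φ = deriv (deriv (deriv φ)) := by
    rw [iteratedDeriv_succ, iteratedDeriv_succ, iteratedDeriv_one]
  have p1 : H1Pair (deriv φ) (deriv (deriv φ)) := ⟨.of_hasDerivAt
    (fun x => (d1.differentiable (by simp) x).hasDerivAt) d2.continuous,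
    memLp_of_hasCompactSupport d1.continuous s1, memLp_of_hasCompactSupport d2.continuous s2⟩
  have p2 : H1Pair (deriv (deriv φ)) (iteratedDeriv 3 φ) := by
    rw [e3]
    exact ⟨.of_hasDerivAt (fun x => (d2.differentiable (by simp) x).hasDerivAt) d3.continuous,
      memLp_of_hasCompactSupport d2.continuous s2, memLp_of_hasCompactSupport d3.continuous s2.deriv⟩
  have h := hQ.test_expansion hf hA hC hc hg (hQ.h1Pair_perturbation (a := a) hc hg hU) hn
    (β := fun x => b t (x + a)) (ε := εa * εx) (B := 1) p1 p2
    ((hb.continuous_space t).comp (continuous_id.add continuous_const))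
    (fun x => hb.abs_le_one t _) (fun x => by
      have := hb.abs_sub_space_le t (x + a) (0 + a)
      rwa [add_sub_add_right_eq_sub, sub_zero] at this) hS
    (fun x hx => by
      have : φ =ᶠ[𝓝 x] fun _ => 0 := by
        filter_upwards [(isOpen_lt continuous_const continuous_abs).mem_nhds hx] with y hy
        exact hsupp y hy
      rw [this.deriv_eq, deriv_const]) hR hb.prod_pos.le
  simp only [profile_add_perturbation, zero_add] at h
  rw [integral_translate_eq (fun x y => U x * iteratedDeriv 3 φ y +
    (f (U x) - b t x * U x) * deriv φ y), integral_translate_eq (fun x y => U x * deriv φ y)]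
  exact h

/-- Along the flow, the pairing with a corrector changes at the rate `-ν m - ∫ ξ τ`, up to
higher-order terms, where `ν` is the deviation of the velocity from `c - b`. -/
lemma SolitaryWaveFamily.corrector_law (hQ : SolitaryWaveFamily f I₀ Q)
    (hf : AdmissibleNonlinearity f) (hA : 1 ≤ A) (hC : LocalBounds f (A + 2) C₀) {C : ℝ}
    (hC0 : 0 < C) :
    ∃ C' > 0, ∀ (c₀ r e c a : ℝ) (φ U V : ℝ → ℝ) (τ : ℝ → ℝ → ℝ) (m : ℝ) (b : ℝ → ℝ → ℝ)
      (εa εx εt t ν : ℝ), IsCorrector f Q c₀ r e C φ τ m → 0 < e → e ≤ 1 → |c - c₀| ≤ r → c ∈ I₀ →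
      GoodSpeed f Q A c → H1Pair U V → displacement Q U V a c ≤ 1 → MemLp (τ c) 2 volume →
      AdmissiblePotential b εa εx εt →
      |(∫ x, (U x * iteratedDeriv 3 φ (x - a) + (f (U x) - b t x * U x) * deriv φ (x - a))) -
        (c - b t a + ν) * (∫ x, U x * deriv φ (x - a)) + ν * m +
        ∫ x, perturbation Q U a c x * τ c x| ≤
      C' * (displacement Q U V a c ^ 2 + εa * εx + εa * εx * displacement Q U V a c / e ^ 2 +
        (displacement Q U V a c + |ν|) * (e + |c - c₀|) + |ν| * displacement Q U V a c) := by
  have iw : 0 ≤ ∫ x, wt x := integral_nonneg fun x => (wt_pos x).le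
  have hC1 := hC.one_le
  refine ⟨C₀ * C + A * C * (∫ x, wt x) + 3 * C + C, by positivity, fun c₀ r e c a φ U V τ m b εa εx
    εt t ν hφ he he1 hcr hc hg hU hn hτ hb => ?_⟩
  have pξ := (hQ.h1Pair_perturbation (a := a) hc hg hU)
  have h1 := hQ.test_perturbation_le hf hA hC hc hg hU hn hφ.contDiff (R := 3 / e ^ 2)
    (by positivity) hφ.deriv_le hφ.support hb t
  have hs := hφ.hasCompactSupport
  have d1 := (contDiff_infty_iff_deriv.1 hφ.contDiff).2
  have m1 : MemLp (deriv φ) 2 volume := memLp_of_hasCompactSupport d1.continuous hs.deriv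
  obtain ⟨d3, s3⟩ := IsRegularSolution.contDiff_iteratedDeriv_three hφ.contDiff hs
  have m3 : MemLp (iteratedDeriv 3 φ) 2 volume := memLp_of_hasCompactSupport d3.continuous s3
  have mV : MemLp (fun x => (c - deriv f (Q c x)) * deriv φ x) 2 volume :=
    memLp_of_hasCompactSupport ((hQ.continuous_potential hf hc).mul d1.continuous)
      hs.deriv.mul_left
  have mL : MemLp (fun x => -iteratedDeriv 3 φ x + (c - deriv f (Q c x)) * deriv φ x) 2 volume :=
    m3.neg.add mV
  have h2 := (abs_integral_mul_le pξ.2 (mL.sub hτ)).trans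
    (mul_le_mul (l2_perturbation_le Q U V a c) (hφ.operator c hcr) (l2_nonneg _)
      (displacement_nonneg _ _ _ _ _))
  have h3 : ∫ x, perturbation Q U a c x * (-iteratedDeriv 3 φ x +
      (c - deriv f (Q c x)) * deriv φ x - τ c x) = (∫ x, perturbation Q U a c x *
      (-iteratedDeriv 3 φ x + (c - deriv f (Q c x)) * deriv φ x)) -
      ∫ x, perturbation Q U a c x * τ c x := by
    rw [← ((HasInt.of_integrable (integrable_mul pξ.2 mL)).sub
      (.of_integrable (integrable_mul pξ.2 hτ))).2]
    congr 1; funext x; ring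
  have h4 : ∫ x, U x * deriv φ (x - a) = (∫ x, Q c x * deriv φ x) +
      ∫ x, perturbation Q U a c x * deriv φ x := by
    rw [integral_translate_eq (fun x y => U x * deriv φ y),
      ← ((HasInt.of_integrable (integrable_mul (hQ.h1Pair hc hg.bounds).2 m1)).add
      (.of_integrable (integrable_mul pξ.2 m1))).2]
    congr 1; funext x
    rw [← profile_add_perturbation Q U a c x]; ring
  have h5 := (abs_integral_mul_le pξ.2 m1).trans (mul_le_mul (l2_perturbation_le Q U V a c)
    hφ.l2_deriv_le (l2_nonneg _) (displacement_nonneg _ _ _ _ _))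
  have h6 := hφ.moment c hcr
  have h7 : εa * εx * (3 / e ^ 2) * displacement Q U V a c * l2 (deriv φ) ≤
      εa * εx * (3 / e ^ 2) * displacement Q U V a c * C := by
    have := hb.prod_pos
    have := displacement_nonneg Q U V a c
    exact mul_le_mul_of_nonneg_left hφ.l2_deriv_le (by positivity)
  replace h2 : |∫ x, perturbation Q U a c x * (-iteratedDeriv 3 φ x +
      (c - deriv f (Q c x)) * deriv φ x - τ c x)| ≤ _ := h2
  rw [h3] at h2
  have n0 := displacement_nonneg Q U V a c
  have ε0 := hb.prod_pos
  generalize displacement Q U V a c = n at *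
  generalize (∫ x, (U x * iteratedDeriv 3 φ (x - a) +
    (f (U x) - b t x * U x) * deriv φ (x - a))) = z₁ at *
  generalize (∫ x, perturbation Q U a c x *
      (-iteratedDeriv 3 φ x + (c - deriv f (Q c x)) * deriv φ x)) = z₂ at *
  generalize (∫ x, perturbation Q U a c x * τ c x) = z₃ at *
  generalize (∫ x, perturbation Q U a c x * deriv φ x) = z₄ at *
  generalize (∫ x, Q c x * deriv φ x) = z₅ at *
  generalize (∫ x, wt x) = W at *
  generalize εa * εx = ε at *
  generalize |c - c₀| = Δ at *
  rw [h4] at h1 ⊢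
  have e1 : z₁ - (c - b t a + ν) * (z₅ + z₄) + ν * m + z₃ =
      (z₁ - (c - b t a) * (z₅ + z₄) + z₂) - (z₂ - z₃) - ν * (z₅ - m) - ν * z₄ := by ring
  rw [e1]
  have b1 : |ν * (z₅ - m)| ≤ |ν| * (C * (e + Δ)) := by
    rw [abs_mul]; exact mul_le_mul_of_nonneg_left h6 (abs_nonneg _)
  have b2 : |ν * z₄| ≤ |ν| * (n * C) := by
    rw [abs_mul]; exact mul_le_mul_of_nonneg_left h5 (abs_nonneg _)
  refine (abs_sub _ _).trans ((add_le_add ((abs_sub _ _).trans (add_le_add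
    ((abs_sub _ _).trans (add_le_add (h1.trans (add_le_add_right h7 _)) h2)) b1)) b2).trans ?_)
  have Δ0 : 0 ≤ e + Δ := by
    by_contra h
    have h9 := (abs_nonneg _).trans h6
    nlinarith
  have q1 : 0 ≤ (A * C * W + 3 * C + C) * n ^ 2 := by positivity
  have q2 : 0 ≤ (C₀ * C + 3 * C + C) * ε := by positivity
  have q3 : 0 ≤ (C₀ * C + A * C * W + C) * (ε * n / e ^ 2) := by positivity
  have q4 : 0 ≤ (C₀ * C + A * C * W + 3 * C) * ((n + |ν|) * (e + Δ)) := by positivity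
  have q5 : 0 ≤ (C₀ * C + A * C * W + 3 * C) * (|ν| * n) := by positivity
  have e2 : ε * (3 / e ^ 2) * n * C = 3 * C * (ε * n / e ^ 2) := by ring
  rw [e2]
  linarith

end Frame

/-! ### The evolution of the modulated quantities -/

section

variable {f : ℝ → ℝ} {I₀ : Set ℝ} {Q : ℝ → ℝ → ℝ} {A C₀ : ℝ}

/-- The pairing with the centering function drifts slowly, apart from the motion of the centre;
the second bound gives the strength of the feedback. -/
lemma SolitaryWaveFamily.centering_law (hQ : SolitaryWaveFamily f I₀ Q)
    (hf : AdmissibleNonlinearity f) (hA : 1 ≤ A) (hC : LocalBounds f (A + 2) C₀) :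
    ∃ C > 0, ∀ (c a : ℝ) (U V : ℝ → ℝ) (b : ℝ → ℝ → ℝ) (εa εx εt t : ℝ), c ∈ I₀ →
      GoodSpeed f Q A c → H1Pair U V → displacement Q U V a c ≤ 1 →
      AdmissiblePotential b εa εx εt →
      |(∫ x, (U x * iteratedDeriv 3 centering (x - a) +
          (f (U x) - b t x * U x) * deriv centering (x - a))) -
        (c - b t a) * (∫ x, U x * deriv centering (x - a))| ≤
      C * (εa * εx + displacement Q U V a c) ∧
      1 / A - C * displacement Q U V a c ≤ ∫ x, U x * deriv centering (x - a) := by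
  have hA0 : 0 ≤ A := by linarith
  have hs := hasCompactSupport_centering
  have d1 := (contDiff_infty_iff_deriv.1 contDiff_centering).2
  have m1 : MemLp (deriv centering) 2 volume := memLp_of_hasCompactSupport d1.continuous hs.deriv
  obtain ⟨d3, s3⟩ := IsRegularSolution.contDiff_iteratedDeriv_three contDiff_centering hs
  have m3 : MemLp (iteratedDeriv 3 centering) 2 volume :=
    memLp_of_hasCompactSupport d3.continuous s3
  obtain ⟨S, hS⟩ := hs.deriv.exists_bound_of_continuous d1.continuous
  have S0 : 0 ≤ S := (norm_nonneg _).trans (hS 0)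
  have iw : 0 ≤ ∫ x, wt x := integral_nonneg fun x => (wt_pos x).le
  have hC1 := hC.one_le
  have l1 := l2_nonneg (deriv centering)
  have l3 := l2_nonneg (iteratedDeriv 3 centering)
  obtain ⟨C, hCdef⟩ : ∃ C, C = 1 + C₀ * S + A * S * (∫ x, wt x) + 2 * l2 (deriv centering) +
    l2 (iteratedDeriv 3 centering) + A * l2 (deriv centering) + l2 (deriv centering) := ⟨_, rfl⟩
  have z1 : 0 ≤ C₀ * S := by positivity
  have z2 : 0 ≤ A * S * ∫ x, wt x := by positivity
  have z3 : 0 ≤ A * l2 (deriv centering) := by positivity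
  refine ⟨C, by linarith, fun c a U V b εa εx εt t hc hg hU hn hb => ?_⟩
  have pξ := (hQ.h1Pair_perturbation (a := a) hc hg hU)
  have n0 := displacement_nonneg Q U V a c
  have lξ := l2_perturbation_le Q U V a c
  have ε0 := hb.prod_pos
  constructor
  · have h1 := hQ.test_perturbation_le hf hA hC hc hg hU hn contDiff_centering (R := 2)
      zero_le_two hS (fun x hx => by
        have : cutoff x = 0 := cutoff.zero_of_le_dist (by
          rw [Real.dist_eq, sub_zero]; exact hx.le)
        rw [centering, this, mul_zero]) hb t
    have mV : MemLp (fun x => (c - deriv f (Q c x)) * deriv centering x) 2 volume :=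
      memLp_of_hasCompactSupport ((hQ.continuous_potential hf hc).mul d1.continuous)
        hs.deriv.mul_left
    have lV : l2 (fun x => (c - deriv f (Q c x)) * deriv centering x) ≤
        A * l2 (deriv centering) := by
      rw [← abs_of_nonneg hA0, ← l2_const_mul]
      refine l2_mono (m1.const_mul _) fun x => ?_
      rw [abs_mul, abs_mul, abs_of_nonneg hA0]
      exact mul_le_mul_of_nonneg_right (hg.bounds.potential x) (abs_nonneg _)
    have l4 := l2_add_le m3.neg mV
    have e4 : l2 (-iteratedDeriv 3 centering) = l2 (iteratedDeriv 3 centering) := l2_neg _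
    rw [e4] at l4
    have h2 := (abs_integral_mul_le pξ.2 (m3.neg.add mV)).trans (mul_le_mul lξ
      (l4.trans (add_le_add_right lV _)) (l2_nonneg _) n0)
    replace h2 : |∫ x, perturbation Q U a c x * (-iteratedDeriv 3 centering x +
      (c - deriv f (Q c x)) * deriv centering x)| ≤ _ := h2
    have h3 := abs_sub_abs_le_abs_sub ((∫ x, (U x * iteratedDeriv 3 centering (x - a) +
      (f (U x) - b t x * U x) * deriv centering (x - a))) -
      (c - b t a) * (∫ x, U x * deriv centering (x - a))) (-∫ x, perturbation Q U a c x *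
      (-iteratedDeriv 3 centering x + (c - deriv f (Q c x)) * deriv centering x))
    rw [sub_neg_eq_add, abs_neg] at h3
    generalize displacement Q U V a c = n at *
    have nn : n ^ 2 ≤ n := by nlinarith
    have εn : εa * εx * n ≤ εa * εx := mul_le_of_le_one_right ε0.le hn
    have y1 := mul_le_mul_of_nonneg_left nn z1
    have y2 := mul_le_mul_of_nonneg_left εn (mul_nonneg zero_le_two l1)
    have y3 : 0 ≤ (1 + C₀ * S + l2 (iteratedDeriv 3 centering) + A * l2 (deriv centering) +
      l2 (deriv centering)) * (εa * εx) := by positivity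
    have y4 : 0 ≤ (1 + A * S * (∫ x, wt x) + 2 * l2 (deriv centering) +
      l2 (deriv centering)) * n := by positivity
    rw [hCdef]
    linarith
  · have h5 := (abs_le.1 ((abs_integral_mul_le pξ.2 m1).trans
      (mul_le_mul_of_nonneg_right lξ l1))).1
    have h4 : ∫ x, U x * deriv centering (x - a) = (∫ x, Q c x * deriv centering x) +
        ∫ x, perturbation Q U a c x * deriv centering x := by
      rw [integral_translate_eq (fun x y => U x * deriv centering y),
        ← ((HasInt.of_integrable (integrable_mul (hQ.h1Pair hc hg.bounds).2 m1)).add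
        (.of_integrable (integrable_mul pξ.2 m1))).2]
      congr 1; funext x
      rw [← profile_add_perturbation Q U a c x]; ring
    have pQ := hQ.h1Pair hc hg.bounds
    have h6 := integral_mul_eq_neg pQ.1 (.of_hasDerivAt (fun x =>
      (contDiff_centering.differentiable (by simp) x).hasDerivAt) d1.continuous)
      (integrable_mul pQ.2 memLp_centering) (integrable_mul pQ.3 memLp_centering)
      (integrable_mul pQ.2 m1)
    have h7 := hg.transversal
    rw [h6, neg_neg] at h7
    rw [h4]
    have y5 : displacement Q U V a c * l2 (deriv centering) ≤ C * displacement Q U V a c := by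
      rw [mul_comm]
      exact mul_le_mul_of_nonneg_right (by linarith) n0
    linarith

/-- A linear equation with strong damping. -/
lemma abs_le_of_damped {g D h : ℝ → ℝ} {T K d M : ℝ} (hK : 0 < K) (hd : 0 < d) (hM : 0 < M)
    (hg : ∀ t ∈ Icc 0 T, HasDerivWithinAt g (h t - K * g t * D t) (Icc 0 T) t)
    (hD : ∀ t ∈ Icc 0 T, d ≤ D t) (hh : ∀ t ∈ Icc 0 T, |h t| ≤ M) :
    ∀ t ∈ Icc 0 T, |g t| ≤ |g 0| + 2 * M / (K * d) := by
  have key : ∀ {g h : ℝ → ℝ}, (∀ t ∈ Icc 0 T,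
      HasDerivWithinAt g (h t - K * g t * D t) (Icc 0 T) t) → (∀ t ∈ Icc 0 T, |h t| ≤ M) →
      ∀ t ∈ Icc 0 T, g t ≤ |g 0| + 2 * M / (K * d) := fun {g h} hg hh t ht => by
    refine image_le_of_deriv_right_lt_deriv_boundary' (f' := fun t => h t - K * g t * D t)
      (B := fun _ => |g 0| + 2 * M / (K * d)) (B' := fun _ => 0)
      (fun t ht => (hg t ht).continuousWithinAt) (fun t ht =>
        (hg t (Ico_subset_Icc_self ht)).mono_of_mem_nhdsWithin (Icc_mem_nhdsGE_of_mem ht)) ?_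
      continuousOn_const (fun _ _ => hasDerivWithinAt_const _ _ _) (fun t ht he => ?_) ht
    · have : 0 ≤ 2 * M / (K * d) := by positivity
      linarith [le_abs_self (g 0)]
    · have ht' := Ico_subset_Icc_self ht
      have h1 : 2 * M / (K * d) ≤ g t := by rw [he]; linarith [abs_nonneg (g 0)]
      rw [div_le_iff₀ (by positivity)] at h1
      have g0 : 0 ≤ g t := by rw [he]; positivity
      have h2 := mul_le_mul_of_nonneg_left (hD t ht') (mul_nonneg hK.le g0)
      have h3 := (abs_le.1 (hh t ht')).2
      have e : g t * (K * d) = K * g t * d := by ring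
      linarith
  intro t ht
  have h1 := key hg hh t ht
  have h2 := key (g := fun t => -g t) (h := fun t => -h t)
    (fun t ht => (hg t ht).neg.congr_deriv (by ring)) (fun t ht => by rw [abs_neg]; exact hh t ht)
    t ht
  rw [abs_neg] at h2
  rw [abs_le]
  constructor <;> linarith

/-- The rate of change of the energy relative to that of the solitary wave of the same momentum. -/
lemma SolitaryWaveFamily.energy_law (hQ : SolitaryWaveFamily f I₀ Q)
    (hf : AdmissibleNonlinearity f) (hA : 1 ≤ A) (hC : LocalBounds f (A + 2) C₀) :
    ∃ C > 0, ∀ (b U V : ℝ → ℝ → ℝ) (εa εx εt c₀ r K T : ℝ) (a c : ℝ → ℝ) (t : ℝ),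
      (∀ c, |c - c₀| ≤ r → c ∈ I₀ ∧ GoodSpeed f Q A c) → AdmissiblePotential b εa εx εt →
      IsRegularSolution f b U V → Modulation f b U Q c₀ r K T a c → t ∈ Icc 0 T →
      displacement Q (U t) (V t) (a t) (c t) ≤ 1 →
      ∃ Λ' : ℝ, HasDerivWithinAt (fun t => energy f (U t) (V t) - profileEnergy f Q (c t)) Λ'
        (Icc 0 T) t ∧
      |Λ' - partialDeriv b 0 1 t (a t) *
        ∫ x, perturbation Q (U t) (a t) (c t) x * forceProfile f Q (c t) x| ≤
      C * (εa * εx * displacement Q (U t) (V t) (a t) (c t) ^ 2 +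
        εa * εx * εx * displacement Q (U t) (V t) (a t) (c t)) := by
  obtain ⟨C, hC0, H⟩ := hQ.force_expansion hf hA hC
  refine ⟨C, hC0, fun b U V εa εx εt c₀ r K T a c t hgood hb hU hmod ht hn => ?_⟩
  obtain ⟨hc, hg⟩ := hgood _ (hmod.speed_near t ht)
  have pU := hU.pair t ht.1
  have pξ := hQ.h1Pair_perturbation (a := a t) hc hg pU
  obtain ⟨i1, h1⟩ := H (c t) _ _ (fun x => partialDeriv b 0 1 t (x + a t))
    (fun x => partialDeriv b 0 2 t (x + a t)) (εa * εx) (εa * εx * εx) hc hg pξ hn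
    (fun x => (hb.hasDerivAt_slope_space t (x + a t)).comp_add_const x (a t))
    (fun x => hb.slope_le t _) (fun x => hb.second_le t _)
    (mul_le_of_le_one_right hb.prod_pos.le hb.length.2)
  simp only [profile_add_perturbation Q, profile_add_perturbation (fun c => deriv (Q c)),
    zero_add] at i1 h1
  obtain ⟨G, hG⟩ : ∃ G : ℝ → ℝ, G = fun x => partialDeriv b 0 1 t x *
    (c t / 2 * U t x ^ 2 - U t x * f (U t x) + 3 / 2 * V t x ^ 2 + primitive f (U t x)) +
    partialDeriv b 0 2 t x * (U t x * V t x) := ⟨_, rfl⟩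
  have e1 := integral_add_right_eq_self (μ := volume) G (a t)
  have iG : Integrable G := by
    have := i1.comp_sub_right (a t)
    rw [hG]
    simpa only [sub_add_cancel] using this
  rw [hG] at e1
  simp only at e1
  rw [e1, ← hG] at h1
  have iu : Integrable fun x => partialDeriv b 0 1 t x * U t x ^ 2 :=
    pU.2.integrable_sq.bdd_mul (hb.continuous_slope t).aestronglyMeasurable
      (ae_of_all _ (hb.slope_le t))
  have hsub : Icc 0 T ⊆ Ici 0 := Icc_subset_Ici_self
  have dE := (hU.energy_law t ht.1).mono hsub
  have dP := (hQ.hasDerivAt_profileEnergy hf hc).comp_hasDerivWithinAt t (hmod.deriv_speed t ht)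
  refine ⟨∫ x, G x, (dE.sub dP).congr_deriv ?_, h1⟩
  have δ0 : momentumDeriv Q (c t) ≠ 0 :=
    (lt_of_lt_of_le (by positivity) hg.momentumDeriv_ge).ne'
  have e2 := ((HasInt.of_integrable iG).sub ((HasInt.of_integrable iu).const_mul (c t / 2))).2
  have e3 : -c t * momentumDeriv Q (c t) * ((momentumDeriv Q (c t))⁻¹ *
      (1 / 2 * ∫ x, partialDeriv b 0 1 t x * U t x ^ 2)) =
      -(c t / 2 * ∫ x, partialDeriv b 0 1 t x * U t x ^ 2) := by
    field_simp
  rw [e3]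
  have e4 : (fun x => G x - c t / 2 * (partialDeriv b 0 1 t x * U t x ^ 2)) = fun x =>
      partialDeriv b 0 1 t x * (3 / 2 * V t x ^ 2 - U t x * f (U t x) + primitive f (U t x)) +
      partialDeriv b 0 2 t x * (U t x * V t x) := by
    funext x; rw [hG]; ring
  rw [e4] at e2
  rw [e2]; ring

end

/-! ### The energy argument -/

/-- The rate of change of `∫ U φ(x - a)` at a fixed time, when the centre `a` moves with
velocity `v` and `β` is the potential. -/
def testRate (f β U φ : ℝ → ℝ) (a v : ℝ) : ℝ :=
  (∫ x, (U x * iteratedDeriv 3 φ (x - a) + (f (U x) - β x * U x) * deriv φ (x - a))) -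
    v * ∫ x, U x * deriv φ (x - a)

/-- The feedback term in the velocity of the centre. -/
def feedback (K : ℝ) (U : ℝ → ℝ) (a : ℝ) : ℝ := K * ∫ x, U x * centering (x - a)

/-- The situation in which the long-time estimates are derived: on `[0, T]`, with `T` at most
`e⁻²` and not longer than the scales of variation of the potential, the solution stays within `e³`
of the solitary wave with the modulated parameters, whose speed stays within `O(e²)` of `c₀`. -/
structure NearSoliton (f : ℝ → ℝ) (I₀ : Set ℝ) (Q b U V : ℝ → ℝ → ℝ)
    (A B r K εa εx εt c₀ e T : ℝ) (a c : ℝ → ℝ) : Prop where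
  good : ∀ c, |c - c₀| ≤ r → c ∈ I₀ ∧ GoodSpeed f Q A c
  potential : AdmissiblePotential b εa εx εt
  solution : IsRegularSolution f b U V
  modulation : Modulation f b U Q c₀ r K T a c
  pos : 0 < e
  le_one : e ≤ 1
  prod_le : εa * εx ≤ e ^ 4
  time_le : T * e ^ 2 ≤ 1
  slow : T * (εt + εx) ≤ 1
  speed_close : ∀ t ∈ Icc 0 T, |c t - c₀| ≤ B * e ^ 2
  close : ∀ t ∈ Icc 0 T, displacement Q (U t) (V t) (a t) (c t) ≤ e ^ 3

section

variable {f : ℝ → ℝ} {I₀ : Set ℝ} {Q : ℝ → ℝ → ℝ} {A C₀ : ℝ}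

lemma SolitaryWaveFamily.abs_integral_odd_le (hQ : SolitaryWaveFamily f I₀ Q) {c a : ℝ}
    {U V φ : ℝ → ℝ} (hc : c ∈ I₀) (hg : GoodSpeed f Q A c) (hU : H1Pair U V)
    (hφ : MemLp φ 2 volume) (ho : ∀ x, φ (-x) = -φ x) :
    |∫ x, U x * φ (x - a)| ≤ displacement Q U V a c * l2 φ := by
  rw [hQ.integral_mul_odd hc hg hU hφ ho]
  exact (abs_integral_mul_le (hQ.h1Pair_perturbation hc hg hU).2 hφ).trans
    (mul_le_mul_of_nonneg_right (l2_perturbation_le _ _ _ _ _) (l2_nonneg _))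

lemma SolitaryWaveFamily.abs_feedback_le (hQ : SolitaryWaveFamily f I₀ Q) {c a K : ℝ}
    {U V : ℝ → ℝ} (hK : 0 ≤ K) (hc : c ∈ I₀) (hg : GoodSpeed f Q A c) (hU : H1Pair U V) :
    |feedback K U a| ≤ K * l2 centering * displacement Q U V a c := by
  rw [feedback, abs_mul, abs_of_nonneg hK, mul_assoc, mul_comm (l2 centering)]
  exact mul_le_mul_of_nonneg_left
    (hQ.abs_integral_odd_le hc hg hU memLp_centering centering_neg) hK

/-- The energy of the perturbed solitary wave, relative to the solitary wave of equal momentum. -/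
lemma SolitaryWaveFamily.energy_sub_le (hQ : SolitaryWaveFamily f I₀ Q)
    (hf : AdmissibleNonlinearity f) (hA : 1 ≤ A) (hC : LocalBounds f (A + 2) C₀) {c a : ℝ}
    {U V : ℝ → ℝ} (hc : c ∈ I₀) (hg : GoodSpeed f Q A c) (hU : H1Pair U V)
    (hp : momentum (Q c) = momentum U) (hn : displacement Q U V a c ≤ 1) :
    |energy f U V - profileEnergy f Q c - 1 / 2 * quadForm f Q c (perturbation Q U a c)
      (perturbation (fun c => deriv (Q c)) V a c)| ≤ 2 * C₀ * displacement Q U V a c ^ 3 := by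
  have h := hQ.energy_expansion hf hc (by linarith) hg hC
    (hQ.h1Pair_perturbation (a := a) hc hg hU) hn
  simp only [profile_add_perturbation Q, profile_add_perturbation (fun c => deriv (Q c))] at h
  have e1 : energy f (fun x => U (x + a)) (fun x => V (x + a)) = energy f U V :=
    integral_add_right_eq_self (μ := volume) (fun x => 1 / 2 * V x ^ 2 - primitive f (U x)) a
  have e2 : momentum (fun x => U (x + a)) = momentum U := by
    simp only [momentum]
    rw [integral_add_right_eq_self (μ := volume) (fun x => U x ^ 2) a]
  rwa [e1, e2, hp, sub_self, mul_zero, add_zero] at h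

lemma abs_quadForm_le (hQ : SolitaryWaveFamily f I₀ Q) (hf : AdmissibleNonlinearity f)
    (hA : 1 ≤ A) {c : ℝ} {ξ η : ℝ → ℝ} (hc : c ∈ I₀) (hg : GoodSpeed f Q A c) (hξ : H1Pair ξ η) :
    |quadForm f Q c ξ η| ≤ A * nrm ξ η ^ 2 := by
  have i1 := hQ.integrable_potential_mul hf hc hg.bounds hξ.2 hξ.2
  have i2 : Integrable fun x => η x ^ 2 + (c - deriv f (Q c x)) * ξ x ^ 2 := by
    simp only [sq]
    exact (integrable_mul hξ.3 hξ.3).add i1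
  have h := (HasInt.of_integrable i2).abs_le (((HasInt.of_integrable hξ.2.integrable_sq).add
    (.of_integrable hξ.3.integrable_sq)).const_mul A) fun x => by
      have h1 := mul_le_mul_of_nonneg_right (hg.bounds.potential x) (sq_nonneg (ξ x))
      have h2 := le_mul_of_one_le_left (sq_nonneg (η x)) hA
      refine (abs_add_le _ _).trans ?_
      rw [abs_mul, abs_of_nonneg (sq_nonneg (ξ x)), abs_of_nonneg (sq_nonneg (η x))]
      linarith
  rw [← sq_l2, ← sq_l2, ← sq_nrm] at h
  exact h

lemma Modulation.mono {b U : ℝ → ℝ → ℝ} {c₀ r K T T' : ℝ} {a c : ℝ → ℝ}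
    (h : Modulation f b U Q c₀ r K T a c) (hT : T' ≤ T) : Modulation f b U Q c₀ r K T' a c :=
  have hs : Icc 0 T' ⊆ Icc 0 T := Icc_subset_Icc_right hT
  ⟨fun t ht => h.1 t (hs ht), fun t ht => h.2 t (hs ht), fun t ht => (h.3 t (hs ht)).mono hs,
    fun t ht => (h.4 t (hs ht)).mono hs⟩

lemma Modulation.continuousOn_displacement (hQ : SolitaryWaveFamily f I₀ Q)
    (hf : AdmissibleNonlinearity f) {b U V : ℝ → ℝ → ℝ} {c₀ r K T : ℝ} {a c : ℝ → ℝ}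
    (hgood : ∀ c, |c - c₀| ≤ r → c ∈ I₀ ∧ GoodSpeed f Q A c)
    (hU : IsRegularSolution f b U V) (h : Modulation f b U Q c₀ r K T a c) :
    ContinuousOn (fun t => displacement Q (U t) (V t) (a t) (c t)) (Icc 0 T) := by
  have hsub : Icc 0 T ⊆ Ici 0 := Icc_subset_Ici_self
  intro t₀ ht₀
  refine tendsto_iff_dist_tendsto_zero.2 ?_
  have l1 := (hU.continuous t₀ ht₀.1).mono_left (nhdsWithin_mono t₀ hsub)
  have cc : ContinuousWithinAt c (Icc 0 T) t₀ := (h.deriv_speed t₀ ht₀).continuousWithinAt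
  have ca : ContinuousWithinAt a (Icc 0 T) t₀ := (h.deriv_position t₀ ht₀).continuousWithinAt
  have l2' : Tendsto (fun t => 6 * A * l2 wt * (|c t - c t₀| + |a t - a t₀|)) (𝓝[Icc 0 T] t₀)
      (𝓝 0) := by
    have : ContinuousWithinAt (fun t => 6 * A * l2 wt * (|c t - c t₀| + |a t - a t₀|))
        (Icc 0 T) t₀ := by fun_prop
    simpa [ContinuousWithinAt] using this
  refine squeeze_zero' (Eventually.of_forall fun _ => dist_nonneg) ?_
    (by simpa using l1.add l2')
  filter_upwards [self_mem_nhdsWithin] with t ht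
  have pc : ∀ t ∈ Icc 0 T, H1Pair (fun x => Q (c t) (x - a t)) (fun x => deriv (Q (c t)) (x - a t)) :=
    fun t ht => (hQ.h1Pair (hgood _ (h.1 t ht)).1 (hgood _ (h.1 t ht)).2.bounds).translate _
  have pU := fun t (ht : t ∈ Icc 0 T) => hU.pair t ht.1
  rw [Real.dist_eq, displacement_eq, displacement_eq]
  refine (abs_nrm_sub_nrm_le ((pU t ht).sub (pc t ht)) ((pU t₀ ht₀).sub (pc t₀ ht₀))).trans ?_
  have e := nrm_sub_le ((pU t ht).sub (pU t₀ ht₀)) ((pc t ht).sub (pc t₀ ht₀))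
  have e1 : ∀ x y z w : ℝ, x - y - (z - w) = x - z - (y - w) := fun x y z w => by ring
  simp only [e1] at e ⊢
  exact e.trans (add_le_add_right
    (hQ.nrm_soliton_sub_le hf hgood (h.1 t ht) (h.1 t₀ ht₀) (a t) (a t₀)) _)

/-- In the regime of closeness to a solitary wave, the rate of change of the pairing with a
corrector is determined up to `O(e⁴)`. -/
lemma NearSoliton.corrector_rate (hQ : SolitaryWaveFamily f I₀ Q)
    (hf : AdmissibleNonlinearity f) (hA : 1 ≤ A) (hC : LocalBounds f (A + 2) C₀) {B K C : ℝ}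
    (hB : 0 ≤ B) (hK : 0 ≤ K) (hC0 : 0 < C) :
    ∃ C' > 0, ∀ (b U V : ℝ → ℝ → ℝ) (r εa εx εt c₀ e T : ℝ) (a c φ : ℝ → ℝ) (τ : ℝ → ℝ → ℝ)
      (m : ℝ), NearSoliton f I₀ Q b U V A B r K εa εx εt c₀ e T a c →
      IsCorrector f Q c₀ r e C φ τ m →
      (∀ c, c ∈ I₀ → GoodSpeed f Q A c → MemLp (τ c) 2 volume) → ∀ t ∈ Icc 0 T,
      HasDerivWithinAt (fun t => ∫ x, U t x * φ (x - a t)) (testRate f (b t) (U t) φ (a t)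
        (c t - b t (a t) + feedback K (U t) (a t))) (Icc 0 T) t ∧
      |testRate f (b t) (U t) φ (a t) (c t - b t (a t) + feedback K (U t) (a t)) +
        feedback K (U t) (a t) * m + ∫ x, perturbation Q (U t) (a t) (c t) x * τ (c t) x| ≤
        C' * e ^ 4 ∧
      |∫ x, U t x * φ (x - a t)| ≤ C' * e ^ 2 := by
  obtain ⟨C', hC', H⟩ := hQ.corrector_law hf hA hC hC0
  have hκ : 0 ≤ K * l2 centering := mul_nonneg hK (l2_nonneg _)
  refine ⟨C' * (3 + (1 + K * l2 centering) * (1 + B) + K * l2 centering) + C, by positivity,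
    fun b U V r εa εx εt c₀ e T a c φ τ m h hφ hτ t ht => ?_⟩
  have hsub : Icc 0 T ⊆ Ici 0 := Icc_subset_Ici_self
  obtain ⟨hc, hg⟩ := h.good _ (h.modulation.speed_near t ht)
  have pU := h.solution.pair t ht.1
  have hs := hφ.hasCompactSupport
  have he := h.pos
  have he1 := h.le_one
  have e3 : e ^ 3 ≤ 1 := pow_le_one₀ he.le he1
  have hn := h.close t ht
  have hν := hQ.abs_feedback_le (a := a t) hK hc hg pU
  have n0 := displacement_nonneg Q (U t) (V t) (a t) (c t)
  have hW := hQ.abs_integral_odd_le (a := a t) hc hg pU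
    (memLp_of_hasCompactSupport hφ.contDiff.continuous hs) hφ.odd
  have hl := hφ.l2_le
  refine ⟨h.solution.hasDerivWithinAt_test hφ.contDiff hs hsub ht
    (h.modulation.deriv_position t ht), ?_, ?_⟩
  · refine (H c₀ r e (c t) (a t) φ (U t) (V t) τ m b εa εx εt t _ hφ he he1
      (h.modulation.speed_near t ht) hc hg pU (hn.trans e3) (hτ _ hc hg) h.potential).trans ?_
    have ε1 := h.prod_le
    have ε0 := h.potential.prod_pos
    have hΔ := h.speed_close t ht
    have Δ0 := abs_nonneg (c t - c₀)
    generalize |c t - c₀| = Δ at *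
    generalize |feedback K (U t) (a t)| = ν at *
    generalize displacement Q (U t) (V t) (a t) (c t) = n at *
    generalize εa * εx = ε at *
    generalize K * l2 centering = κ at *
    have hν' : ν ≤ κ * e ^ 3 := hν.trans (mul_le_mul_of_nonneg_left hn hκ)
    have p1 : n ^ 2 ≤ e ^ 4 := by
      calc n ^ 2 ≤ (e ^ 3) ^ 2 := pow_le_pow_left₀ n0 hn 2
        _ = e ^ 4 * e ^ 2 := by ring
        _ ≤ e ^ 4 := mul_le_of_le_one_right (by positivity) (pow_le_one₀ he.le he1)
    have p2 : ε * n / e ^ 2 ≤ e ^ 4 := by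
      rw [div_le_iff₀ (by positivity)]
      calc ε * n ≤ e ^ 4 * e ^ 3 := mul_le_mul ε1 hn n0 (by positivity)
        _ = e ^ 4 * e ^ 2 * e := by ring
        _ ≤ e ^ 4 * e ^ 2 := mul_le_of_le_one_right (by positivity) he1
    have p3 : e + Δ ≤ (1 + B) * e := by
      have : e ^ 2 ≤ e := by nlinarith
      have := mul_le_mul_of_nonneg_left this hB
      linarith
    have p4 : (n + ν) * (e + Δ) ≤ (1 + κ) * (1 + B) * e ^ 4 := by
      calc (n + ν) * (e + Δ) ≤ ((1 + κ) * e ^ 3) * (e + Δ) := by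
            exact mul_le_mul_of_nonneg_right (by linarith) (by positivity)
        _ ≤ ((1 + κ) * e ^ 3) * ((1 + B) * e) :=
          mul_le_mul_of_nonneg_left p3 (by positivity)
        _ = _ := by ring
    have p5 : ν * n ≤ κ * e ^ 4 := by
      calc ν * n ≤ (κ * e ^ 3) * e ^ 3 := mul_le_mul hν' hn n0 (by positivity)
        _ = κ * e ^ 4 * e ^ 2 := by ring
        _ ≤ κ * e ^ 4 := mul_le_of_le_one_right (by positivity) (pow_le_one₀ he.le he1)
    have p6 : n ^ 2 + ε + ε * n / e ^ 2 + (n + ν) * (e + Δ) + ν * n ≤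
        (3 + (1 + κ) * (1 + B) + κ) * e ^ 4 := by linarith
    have p7 := mul_le_mul_of_nonneg_left p6 hC'.le
    have p8 : 0 ≤ C * e ^ 4 := by positivity
    linarith
  · have p1 : displacement Q (U t) (V t) (a t) (c t) * l2 φ ≤ e ^ 3 * (C / e) :=
      mul_le_mul hn hl (l2_nonneg _) (by positivity)
    have p2 : e ^ 3 * (C / e) = C * e ^ 2 := by field_simp
    have p3 : 0 ≤ C' * (3 + (1 + K * l2 centering) * (1 + B) + K * l2 centering) * e ^ 2 := by
      positivity
    linarith

end

section

variable {f : ℝ → ℝ} {I₀ : Set ℝ} {Q : ℝ → ℝ → ℝ} {A C₀ : ℝ}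

lemma momentum_profile_le {c : ℝ} (hg : GoodSpeed f Q A c) :
    momentum (Q c) ≤ 1 / 2 * (A * l2 wt) ^ 2 := by
  have h := pow_le_pow_left₀ (l2_nonneg _) (l2_le_of_wt (le_wt_of_le_sq hg.bounds.profile)) 2
  rw [sq_l2] at h
  rw [momentum]; linarith

/-- The bound on the rate of change of the corrected energy, as a statement about real numbers. -/
lemma corrected_rate_le {Λ' q qt qx s β ν w d₁ d₂ z₁ z₂ n ε εx εt e k k₀ κ m₁ m₂ C₂ C₃ : ℝ}
    (he : 0 < e) (he1 : e ≤ 1) (hε : 0 ≤ ε) (hx : 0 ≤ εx) (ht : 0 ≤ εt) (hk : 0 ≤ k)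
    (hkk : k ≤ k₀) (hκ : 0 ≤ κ) (hC₂ : 0 ≤ C₂) (hC₃ : 0 ≤ C₃) (n0 : 0 ≤ n) (hn : n ≤ e ^ 3)
    (hkm : k * m₂ = m₁) (bΛ : |Λ' - q * z₁| ≤ C₃ * (ε * n ^ 2 + ε * εx * n))
    (b₁ : |d₁ + ν * m₁ + z₁| ≤ C₂ * e ^ 4) (b₂ : |d₂ + ν * m₂ + -z₂| ≤ C₂ * e ^ 4)
    (bw : |w| ≤ (1 + k₀) * C₂ * e ^ 2) (bq : |q| ≤ ε) (bqt : |qt| ≤ ε * εt)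
    (bqx : |qx| ≤ ε * εx) (bβ : |β| ≤ 1) (bν : |ν| ≤ κ * n) (s0 : 0 ≤ s) (hs : s ≤ A)
    (bz : |z₂| ≤ 1 / 2 * n ^ 2) :
    |Λ' + ((qt + qx * (s - β + ν)) * w + q * (d₁ - k * d₂))| ≤
      (2 * C₃ + (A + 2 + κ) * ((1 + k₀) * C₂) + k₀ + (1 + k₀) * C₂) *
        (ε * (e ^ 4 + (εt + εx) * e ^ 2)) := by
  have e1 : Λ' + ((qt + qx * (s - β + ν)) * w + q * (d₁ - k * d₂)) = (Λ' - q * z₁) +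
      (qt + qx * (s - β + ν)) * w +
      q * ((d₁ + ν * m₁ + z₁) - k * (d₂ + ν * m₂ + -z₂) - k * z₂) := by
    rw [← hkm]; ring
  have hk₀ : 0 ≤ k₀ := hk.trans hkk
  have hA : 0 ≤ A := s0.trans hs
  have e3 : e ^ 3 ≤ 1 := pow_le_one₀ he.le he1
  have e2 : n ≤ e ^ 2 := hn.trans (pow_le_pow_of_le_one he.le he1 (by norm_num))
  have n2 : n ^ 2 ≤ e ^ 4 := by
    calc n ^ 2 ≤ (e ^ 2) ^ 2 := pow_le_pow_left₀ n0 e2 2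
      _ = e ^ 4 := by ring
  have p1 : C₃ * (ε * n ^ 2 + ε * εx * n) ≤ C₃ * (ε * e ^ 4 + ε * εx * e ^ 2) := by gcongr
  have v1 : |s - β + ν| ≤ A + 1 + κ := by
    have h1 : κ * n ≤ κ := mul_le_of_le_one_right hκ (hn.trans e3)
    refine (abs_add_le _ _).trans ?_
    have h2 := abs_sub s β
    rw [abs_of_nonneg s0] at h2
    linarith
  have v2 : |qt + qx * (s - β + ν)| ≤ (A + 2 + κ) * (ε * (εt + εx)) := by
    refine (abs_add_le _ _).trans ?_
    rw [abs_mul]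
    have h1 : |qx| * |s - β + ν| ≤ ε * εx * (A + 1 + κ) :=
      mul_le_mul bqx v1 (abs_nonneg _) (by positivity)
    have h2 : 0 ≤ (A + 1 + κ) * (ε * εt) + ε * εx := by positivity
    linarith
  have p2 : |(qt + qx * (s - β + ν)) * w| ≤
      (A + 2 + κ) * (ε * (εt + εx)) * ((1 + k₀) * C₂ * e ^ 2) := by
    rw [abs_mul]
    exact mul_le_mul v2 bw (abs_nonneg _) (by positivity)
  have p3 : |q * ((d₁ + ν * m₁ + z₁) - k * (d₂ + ν * m₂ + -z₂) - k * z₂)| ≤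
      ε * (C₂ * e ^ 4 + k₀ * (C₂ * e ^ 4) + k₀ * (1 / 2 * e ^ 4)) := by
    rw [abs_mul]
    refine mul_le_mul bq ?_ (abs_nonneg _) hε
    have h1 : |k * (d₂ + ν * m₂ + -z₂)| ≤ k₀ * (C₂ * e ^ 4) := by
      rw [abs_mul, abs_of_nonneg hk]
      exact mul_le_mul hkk b₂ (abs_nonneg _) hk₀
    have h2 : |k * z₂| ≤ k₀ * (1 / 2 * e ^ 4) := by
      rw [abs_mul, abs_of_nonneg hk]
      exact mul_le_mul hkk (bz.trans (by linarith)) (abs_nonneg _) hk₀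
    exact (abs_sub _ _).trans (add_le_add ((abs_sub _ _).trans (add_le_add b₁ h1)) h2)
  rw [e1]
  refine (abs_add_le _ _).trans ((add_le_add ((abs_add_le _ _).trans
    (add_le_add (bΛ.trans p1) p2)) p3).trans ?_)
  have q1 : 0 ≤ (C₃ + (A + 2 + κ) * ((1 + k₀) * C₂) + 1 / 2 * k₀) * (ε * e ^ 4) := by positivity
  have q2 : 0 ≤ (2 * C₃ + k₀ + (1 + k₀) * C₂) * (ε * εt * e ^ 2) := by positivity
  have q3 : 0 ≤ (C₃ + k₀ + (1 + k₀) * C₂) * (ε * εx * e ^ 2) := by positivity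
  linarith

/-- The energy relative to the solitary wave is almost conserved. Its rate of change is, to first
order, linear in the perturbation; the pairing with a combination of the two correctors, chosen so
that the deviation of the velocity cancels, removes this linear term. -/
lemma NearSoliton.energy_variation (hQ : SolitaryWaveFamily f I₀ Q)
    (hf : AdmissibleNonlinearity f) (hA : 1 ≤ A) (hC : LocalBounds f (A + 2) C₀) {B K : ℝ}
    (hB : 0 ≤ B) (hK : 0 ≤ K) :
    ∃ C > 0, ∀ (b U V : ℝ → ℝ → ℝ) (r εa εx εt c₀ e T : ℝ) (a c : ℝ → ℝ), 0 ≤ r →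
      NearSoliton f I₀ Q b U V A B r K εa εx εt c₀ e T a c → ∀ t ∈ Icc 0 T,
      |(energy f (U t) (V t) - profileEnergy f Q (c t)) -
        (energy f (U 0) (V 0) - profileEnergy f Q (c 0))| ≤ C * (εa * εx * e ^ 2) := by
  have hA0 : 0 ≤ A := by linarith
  obtain ⟨C₁, hC₁, H₁⟩ := hQ.exists_correctors hf hA hC
  obtain ⟨C₂, hC₂, H₂⟩ := NearSoliton.corrector_rate hQ hf hA hC hB hK hC₁
  obtain ⟨C₃, hC₃, H₃⟩ := hQ.energy_law hf hA hC
  obtain ⟨k₀, hk₀⟩ : ∃ k₀, k₀ = A * (1 / 2 * (A * l2 wt) ^ 2) := ⟨_, rfl⟩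
  have k0' : 0 ≤ k₀ := by rw [hk₀]; positivity
  have hκ : 0 ≤ K * l2 centering := mul_nonneg hK (l2_nonneg _)
  obtain ⟨C₄, hC₄⟩ : ∃ C₄, C₄ = (1 + k₀) * C₂ := ⟨_, rfl⟩
  have hC₄' : 0 < C₄ := by rw [hC₄]; positivity
  obtain ⟨C₅, hC₅⟩ : ∃ C₅, C₅ = 2 * C₃ + (A + 2 + K * l2 centering) * C₄ + k₀ + C₄ := ⟨_, rfl⟩
  have hC₅' : 0 < C₅ := by rw [hC₅]; positivity
  refine ⟨2 * C₅ + 2 * C₄, by positivity,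
    fun b U V r εa εx εt c₀ e T a c hr h t ht => ?_⟩
  have he := h.pos
  have he1 := h.le_one
  have e3 : e ^ 3 ≤ 1 := pow_le_one₀ he.le he1
  have hb := h.potential
  have ε0 := hb.prod_pos
  have x0 := hb.length.1
  have t0 := hb.time.1
  obtain ⟨ε, hε⟩ : ∃ ε, ε = εa * εx := ⟨_, rfl⟩
  have hsub : Icc 0 T ⊆ Ici 0 := Icc_subset_Ici_self
  obtain ⟨hc₀, hg₀⟩ := h.good c₀ (by simpa using hr)
  have δ0 : 0 < momentumDeriv Q c₀ := lt_of_lt_of_le (by positivity) hg₀.momentumDeriv_ge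
  -- the two correctors have the moments `momentum (Q c₀)` and `momentumDeriv Q c₀`; with this ratio
  -- the deviation of the velocity drops out of the evolution of `φ₁ - k * φ₂`
  obtain ⟨k, hk⟩ : ∃ k, k = momentum (Q c₀) / momentumDeriv Q c₀ := ⟨_, rfl⟩
  have hkm : k * momentumDeriv Q c₀ = momentum (Q c₀) := by rw [hk]; field_simp
  have kn : 0 ≤ k := by rw [hk]; exact div_nonneg (IsRegularSolution.momentum_nonneg _) δ0.le
  have kk : k ≤ k₀ := by
    rw [hk, div_le_iff₀ δ0, hk₀]
    have h1 : 1 ≤ A * momentumDeriv Q c₀ := by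
      have := mul_le_mul_of_nonneg_left hg₀.momentumDeriv_ge hA0
      rwa [mul_one_div_cancel (by linarith)] at this
    calc momentum (Q c₀) ≤ 1 / 2 * (A * l2 wt) ^ 2 := momentum_profile_le hg₀
      _ ≤ 1 / 2 * (A * l2 wt) ^ 2 * (A * momentumDeriv Q c₀) :=
        le_mul_of_one_le_right (by positivity) h1
      _ = _ := by ring
  obtain ⟨⟨φ₁, hφ₁⟩, φ₂, hφ₂⟩ := H₁ c₀ r e hr h.good he he1
  have R₁ := H₂ b U V r εa εx εt c₀ e T a c φ₁ _ _ h hφ₁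
    fun c hc hg => hQ.memLp_forceProfile hf hc hA0 hg.bounds
  have R₂ := H₂ b U V r εa εx εt c₀ e T a c φ₂ _ _ h hφ₂
    fun c hc hg => (hQ.h1Pair hc hg.bounds).2.neg
  obtain ⟨W, hW⟩ : ∃ W : ℝ → ℝ, W = fun t => (∫ x, U t x * φ₁ (x - a t)) -
    k * ∫ x, U t x * φ₂ (x - a t) := ⟨_, rfl⟩
  have bW : ∀ t ∈ Icc 0 T, |W t| ≤ C₄ * e ^ 2 := fun t ht => by
    have h1 := (R₁ t ht).2.2
    have h2 := (R₂ t ht).2.2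
    have h3 : |k * ∫ x, U t x * φ₂ (x - a t)| ≤ k₀ * (C₂ * e ^ 2) := by
      rw [abs_mul, abs_of_nonneg kn]
      exact mul_le_mul kk h2 (abs_nonneg _) k0'
    rw [hW, hC₄]
    exact (abs_sub _ _).trans (by linarith)
  obtain ⟨Λ, hΛ⟩ : ∃ Λ : ℝ → ℝ, Λ = fun t => energy f (U t) (V t) - profileEnergy f Q (c t) :=
    ⟨_, rfl⟩
  obtain ⟨p, hp⟩ : ∃ p : ℝ → ℝ, p = fun t => partialDeriv b 0 1 t (a t) := ⟨_, rfl⟩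
  have bp : ∀ t, |p t| ≤ ε := fun t => by rw [hp, hε]; exact hb.slope_le t _
  -- `p * W` is the correction: its size is `O(ε e²)`, and it cancels the linear term in `Λ'`
  have key : ∀ t ∈ Icc 0 T, ∃ L', HasDerivWithinAt (fun t => Λ t + p t * W t) L' (Icc 0 T) t ∧
      |L'| ≤ C₅ * (ε * (e ^ 4 + (εt + εx) * e ^ 2)) := fun t ht => by
    obtain ⟨hc, hg⟩ := h.good _ (h.modulation.speed_near t ht)
    have pU := h.solution.pair t ht.1
    have hn := h.close t ht
    have n0 := displacement_nonneg Q (U t) (V t) (a t) (c t)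
    obtain ⟨Λ', dΛ, bΛ⟩ := H₃ b U V εa εx εt c₀ r K T a c t h.good hb h.solution h.modulation ht
      (hn.trans e3)
    obtain ⟨d1, b1, -⟩ := R₁ t ht
    obtain ⟨d2, b2, -⟩ := R₂ t ht
    have dp := hasDerivWithinAt_along hb.differentiable_slope (hb.hasDerivAt_slope_time t (a t))
      (hb.hasDerivAt_slope_space t (a t)) (h.modulation.deriv_position t ht)
    have bW' := bW t ht
    have bp' := bp t
    rw [hΛ, hp, hW]
    rw [hp] at bp'
    rw [hW] at bW'
    refine ⟨_, dΛ.add (dp.mul (d1.sub (d2.const_mul k))), ?_⟩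
    have m1 := hb.mixed_le t (a t)
    have m2 := hb.second_le t (a t)
    have m3 := hb.abs_le_one t (a t)
    have hν := hQ.abs_feedback_le (a := a t) hK hc hg pU
    have hs := hg.speed_le
    have hs0 := hQ.speed_pos _ hc
    have hξQ := hQ.abs_integral_perturbation_le (a := a t) hc hg pU (h.modulation.momentum_eq t ht)
    simp only [mul_neg, integral_neg] at b2
    change |_ + (_ * _ + partialDeriv b 0 1 t (a t) * (testRate f (b t) (U t) φ₁ (a t)
      (c t - b t (a t) + feedback K (U t) (a t)) - k * testRate f (b t) (U t) φ₂ (a t)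
      (c t - b t (a t) + feedback K (U t) (a t))))| ≤ _
    change HasDerivWithinAt _ (_ + _ * (c t - b t (a t) + feedback K (U t) (a t))) _ _ at dp
    change |_ + (((_ + _ * (c t - b t (a t) + feedback K (U t) (a t))) * _) + _)| ≤ _
    rw [hC₄] at bW'
    rw [← hε] at bΛ m1 m2
    rw [hC₅, hC₄]
    exact corrected_rate_le he he1 (hε ▸ ε0.le) x0.le t0.le kn kk hκ hC₂.le hC₃.le n0 hn hkm bΛ b1
      b2 bW' bp' m1 m2 m3 hν hs0.le hs hξQ
  choose! L' hL' bL' using key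
  have h0 : (0 : ℝ) ∈ Icc 0 T := ⟨le_rfl, ht.1.trans ht.2⟩
  have mv := norm_image_sub_le_of_norm_deriv_le_segment' hL'
    (fun t ht => bL' t (Ico_subset_Icc_self ht)) t ht
  rw [Real.norm_eq_abs, sub_zero] at mv
  have ε0' : 0 < ε := hε ▸ ε0
  -- both rates are integrated over a time that is at most `e⁻²` and at most `(εt + εx)⁻¹`
  have time : C₅ * (ε * (e ^ 4 + (εt + εx) * e ^ 2)) * t ≤ 2 * C₅ * (ε * e ^ 2) := by
    have s1 := h.time_le
    have s2 := h.slow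
    have y1 : t * e ^ 2 ≤ 1 := (mul_le_mul_of_nonneg_right ht.2 (by positivity)).trans s1
    have y2 : t * (εt + εx) ≤ 1 := (mul_le_mul_of_nonneg_right ht.2 (by positivity)).trans s2
    have y3 : C₅ * (ε * (e ^ 4 + (εt + εx) * e ^ 2)) * t =
        C₅ * (ε * e ^ 2) * (t * e ^ 2 + t * (εt + εx)) := by ring
    have y4 : 0 ≤ C₅ * (ε * e ^ 2) := by positivity
    have y5 := mul_le_mul_of_nonneg_left (add_le_add y1 y2) y4
    linarith
  have w1 : ∀ t ∈ Icc 0 T, |p t * W t| ≤ ε * (C₄ * e ^ 2) := fun t ht => by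
    rw [abs_mul]; exact mul_le_mul (bp t) (bW t ht) (abs_nonneg _) ε0'.le
  have e5 : energy f (U t) (V t) - profileEnergy f Q (c t) -
      (energy f (U 0) (V 0) - profileEnergy f Q (c 0)) =
      (Λ t + p t * W t - (Λ 0 + p 0 * W 0)) - p t * W t + p 0 * W 0 := by rw [hΛ]; ring
  rw [e5, ← hε]
  refine (abs_add_le _ _).trans ((add_le_add ((abs_sub _ _).trans
    (add_le_add (mv.trans time) (w1 t ht))) (w1 0 h0)).trans (le_of_eq ?_))
  ring

end

/-! ### Closing the estimates -/

/-- A continuous quantity that is at most `k / 2` as long as it is at most `k` stays below `k`. -/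
lemma le_of_bootstrap {n : ℝ → ℝ} {T k : ℝ} (hk : 0 < k) (hn : ContinuousOn n (Icc 0 T))
    (h0 : n 0 < k) (h : ∀ T' ∈ Icc 0 T, (∀ t ∈ Icc 0 T', n t ≤ k) → ∀ t ∈ Icc 0 T', n t ≤ k / 2) :
    ∀ t ∈ Icc 0 T, n t ≤ k := by
  by_contra! hcon
  obtain ⟨t₁, ht₁, hk₁⟩ := hcon
  have hc : IsCompact (Icc 0 T ∩ n ⁻¹' Ici k) :=
    isCompact_Icc.of_isClosed_subset (hn.preimage_isClosed_of_isClosed isClosed_Icc isClosed_Ici)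
      inter_subset_left
  obtain ⟨τ, ⟨hτ, hkτ⟩, hmin⟩ := hc.exists_isLeast ⟨t₁, ht₁, hk₁.le⟩
  have hkτ' : k ≤ n τ := hkτ
  have τ0 : 0 < τ := lt_of_le_of_ne hτ.1 fun h' => by rw [← h'] at hkτ'; linarith
  have lt : ∀ s ∈ Ico 0 τ, n s < k := fun s hs => by
    by_contra! hh
    exact absurd (hmin ⟨⟨hs.1, hs.2.le.trans hτ.2⟩, hh⟩) (not_le.2 hs.2)
  have le : ∀ s ∈ Ico 0 τ, n s ≤ k / 2 := fun s hs =>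
    h s ⟨hs.1, hs.2.le.trans hτ.2⟩ (fun t ht => (lt t ⟨ht.1, ht.2.trans_lt hs.2⟩).le) s
      ⟨hs.1, le_rfl⟩
  have := right_nhdsWithin_Ico_neBot τ0
  have lim := (hn τ hτ).mono (s := Ico 0 τ) fun s hs => ⟨hs.1, hs.2.le.trans hτ.2⟩
  have := le_of_tendsto lim (eventually_mem_nhdsWithin.mono le)
  linarith

/-- The gain from the coercivity of the second variation, as a statement about real numbers. -/
lemma half_of_coercive {n n₀ q q₀ z g lam lam₀ e σ ε A B C C₀ l : ℝ} (he : 0 < e) (he1 : e ≤ 1)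
    (heσ : e ≤ σ) (hε : ε ≤ σ * e ^ 4) (hA : 1 ≤ A) (hB : 0 ≤ B) (hC : 0 ≤ C) (hC₀ : 0 ≤ C₀)
    (hn0 : 0 ≤ n) (hn : n ≤ e ^ 3) (hi0 : 0 ≤ n₀) (hi : n₀ ≤ B * e ^ 4)
    (hσ : (2 * A * C + A * (A * B ^ 2 + 4 * C₀ * B ^ 3) + 4 * A * C₀ + A ^ 2 +
      2 * A ^ 2 * l ^ 2 * B ^ 2) * σ ≤ 1 / 8)
    (h : n ^ 2 ≤ A * (q + A * (z ^ 2 + g ^ 2))) (hz : |z| ≤ 1 / 2 * n ^ 2)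
    (hq : |lam - 1 / 2 * q| ≤ 2 * C₀ * n ^ 3) (hq₀ : |lam₀ - 1 / 2 * q₀| ≤ 2 * C₀ * n₀ ^ 3)
    (hq₀' : |q₀| ≤ A * n₀ ^ 2) (hlam : |lam - lam₀| ≤ C * (ε * e ^ 2))
    (hg : |g| ≤ l * B * e ^ 4 + e ^ 3 / (4 * A)) : n ≤ e ^ 3 / 2 := by
  have hA0 : 0 < A := by linarith
  have σ0 : 0 ≤ σ := he.le.trans heσ
  have e6 : 0 < e ^ 6 := by positivity
  have e7 : e ^ 7 ≤ σ * e ^ 6 := by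
    calc e ^ 7 = e * e ^ 6 := by ring
      _ ≤ _ := mul_le_mul_of_nonneg_right heσ e6.le
  have e8 : e ^ 8 ≤ σ * e ^ 6 := (pow_le_pow_of_le_one he.le he1 (by norm_num)).trans e7
  have e9 : e ^ 9 ≤ σ * e ^ 6 := (pow_le_pow_of_le_one he.le he1 (by norm_num)).trans e7
  have e12 : e ^ 12 ≤ σ * e ^ 6 := (pow_le_pow_of_le_one he.le he1 (by norm_num)).trans e7
  have n3 : n ^ 3 ≤ σ * e ^ 6 := by
    calc n ^ 3 ≤ (e ^ 3) ^ 3 := pow_le_pow_left₀ hn0 hn 3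
      _ = e ^ 9 := by ring
      _ ≤ _ := e9
  have i2 : n₀ ^ 2 ≤ B ^ 2 * (σ * e ^ 6) := by
    calc n₀ ^ 2 ≤ (B * e ^ 4) ^ 2 := pow_le_pow_left₀ hi0 hi 2
      _ = B ^ 2 * e ^ 8 := by ring
      _ ≤ _ := mul_le_mul_of_nonneg_left e8 (by positivity)
  have i3 : n₀ ^ 3 ≤ B ^ 3 * (σ * e ^ 6) := by
    calc n₀ ^ 3 ≤ (B * e ^ 4) ^ 3 := pow_le_pow_left₀ hi0 hi 3
      _ = B ^ 3 * e ^ 12 := by ring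
      _ ≤ _ := mul_le_mul_of_nonneg_left e12 (by positivity)
  have z2 : z ^ 2 ≤ σ * e ^ 6 := by
    calc z ^ 2 = |z| ^ 2 := (sq_abs z).symm
      _ ≤ (1 / 2 * n ^ 2) ^ 2 := pow_le_pow_left₀ (abs_nonneg _) hz 2
      _ = 1 / 4 * n ^ 4 := by ring
      _ ≤ 1 / 4 * (e ^ 3) ^ 4 := mul_le_mul_of_nonneg_left (pow_le_pow_left₀ hn0 hn 4) (by norm_num)
      _ ≤ e ^ 12 := by
        have : 0 ≤ e ^ 12 := by positivity
        rw [← pow_mul]; linarith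
      _ ≤ _ := e12
  have g2 : A ^ 2 * g ^ 2 ≤ 2 * A ^ 2 * l ^ 2 * B ^ 2 * (σ * e ^ 6) + e ^ 6 / 8 := by
    have h1 : g ^ 2 ≤ (l * B * e ^ 4 + e ^ 3 / (4 * A)) ^ 2 := by
      rw [← sq_abs g]; exact pow_le_pow_left₀ (abs_nonneg _) hg 2
    have h2 : (l * B * e ^ 4 + e ^ 3 / (4 * A)) ^ 2 ≤
        2 * (l * B * e ^ 4) ^ 2 + 2 * (e ^ 3 / (4 * A)) ^ 2 := by
      have := sq_nonneg (l * B * e ^ 4 - e ^ 3 / (4 * A))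
      linarith
    have h3 := mul_le_mul_of_nonneg_left (h1.trans h2) (sq_nonneg A)
    have h4 : A ^ 2 * (2 * (l * B * e ^ 4) ^ 2 + 2 * (e ^ 3 / (4 * A)) ^ 2) =
        2 * A ^ 2 * l ^ 2 * B ^ 2 * e ^ 8 + e ^ 6 / 8 := by field_simp; ring
    rw [h4] at h3
    have h5 := mul_le_mul_of_nonneg_left e8 (show 0 ≤ 2 * A ^ 2 * l ^ 2 * B ^ 2 by positivity)
    linarith
  have εe : C * (ε * e ^ 2) ≤ C * (σ * e ^ 6) := by
    have h1 := mul_le_mul_of_nonneg_right hε (sq_nonneg e)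
    have h2 : σ * e ^ 4 * e ^ 2 = σ * e ^ 6 := by ring
    exact mul_le_mul_of_nonneg_left (h2 ▸ h1) hC
  have j1 := (abs_le.1 hq).1
  have j2 := (abs_le.1 hlam).2
  have j3 := (abs_le.1 hq₀).2
  have j4 := (abs_le.1 hq₀').2
  have j5 := mul_le_mul_of_nonneg_left n3 hC₀
  have j6 := mul_le_mul_of_nonneg_left i3 hC₀
  have j7 := mul_le_mul_of_nonneg_left i2 hA0.le
  have hq' : q ≤ (2 * C + (A * B ^ 2 + 4 * C₀ * B ^ 3) + 4 * C₀) * (σ * e ^ 6) := by linarith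
  have j8 := mul_le_mul_of_nonneg_left hq' hA0.le
  have j9 := mul_le_mul_of_nonneg_left z2 (sq_nonneg A)
  have j10 := mul_le_mul_of_nonneg_right hσ e6.le
  have hfin : n ^ 2 ≤ (e ^ 3 / 2) ^ 2 := by linarith
  exact (sq_le_sq₀ hn0 (by positivity)).1 hfin

section

variable {f : ℝ → ℝ} {I₀ : Set ℝ} {Q : ℝ → ℝ → ℝ} {A C₀ : ℝ}

/-- With a strong enough feedback, closeness to the solitary wave improves itself. -/
lemma NearSoliton.exists_displacement_le_half (hQ : SolitaryWaveFamily f I₀ Q)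
    (hf : AdmissibleNonlinearity f) (hA : 1 ≤ A) (hC : LocalBounds f (A + 2) C₀) :
    ∃ K > 0, ∀ B, 0 ≤ B → ∃ σ > 0, ∀ (b U V : ℝ → ℝ → ℝ) (r εa εx εt c₀ e T : ℝ) (a c : ℝ → ℝ),
      0 ≤ r → NearSoliton f I₀ Q b U V A B r K εa εx εt c₀ e T a c → e ≤ σ →
      εa * εx ≤ σ * e ^ 4 → displacement Q (U 0) (V 0) (a 0) (c 0) ≤ B * e ^ 4 →
      ∀ t ∈ Icc 0 T, displacement Q (U t) (V t) (a t) (c t) ≤ e ^ 3 / 2 := by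
  have hA0 : 0 < A := by linarith
  have hC1 := hC.one_le
  obtain ⟨C₁, hC₁, H₁⟩ := hQ.centering_law hf hA hC
  -- damped with strength `K / (2 * A)` and driven by `2 * C₁ * e ^ 3`, the pairing with the centering
  -- function stays below `e ^ 3 / (4 * A)` up to its initial value
  obtain ⟨K, hKdef⟩ : ∃ K, K = 32 * A ^ 2 * C₁ := ⟨_, rfl⟩
  have hK : 0 < K := by rw [hKdef]; positivity
  refine ⟨K, hK, fun B hB => ?_⟩
  obtain ⟨C, hC0, H⟩ := NearSoliton.energy_variation hQ hf hA hC hB hK.le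
  obtain ⟨l, hl⟩ : ∃ l, l = l2 centering := ⟨_, rfl⟩
  have l0 : 0 ≤ l := hl ▸ l2_nonneg _
  obtain ⟨C₆, hC₆⟩ : ∃ C₆, C₆ = 2 * A * C + A * (A * B ^ 2 + 4 * C₀ * B ^ 3) + 4 * A * C₀ + A ^ 2 +
      2 * A ^ 2 * l ^ 2 * B ^ 2 := ⟨_, rfl⟩
  have hC₆' : 0 < C₆ := by rw [hC₆]; positivity
  refine ⟨min (1 / (2 * A * C₁)) (1 / (8 * C₆)), lt_min (by positivity) (by positivity),
    fun b U V r εa εx εt c₀ e T a c hr h heσ hε hi t ht => ?_⟩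
  obtain ⟨σ, hσ⟩ : ∃ σ, σ = min (1 / (2 * A * C₁)) (1 / (8 * C₆)) := ⟨_, rfl⟩
  rw [← hσ] at heσ hε
  have σ1 : σ ≤ 1 / (2 * A * C₁) := hσ ▸ min_le_left _ _
  have σ2 : σ ≤ 1 / (8 * C₆) := hσ ▸ min_le_right _ _
  rw [le_div_iff₀ (by positivity)] at σ1 σ2
  have he := h.pos
  have he1 := h.le_one
  have e3 : e ^ 3 ≤ 1 := pow_le_one₀ he.le he1
  have e34 : e ^ 4 ≤ e ^ 3 := pow_le_pow_of_le_one he.le he1 (by norm_num)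
  have e13 : e ^ 3 ≤ e := by simpa using pow_le_pow_of_le_one he.le he1 (show 1 ≤ 3 by norm_num)
  have h0 : (0 : ℝ) ∈ Icc 0 T := ⟨le_rfl, ht.1.trans ht.2⟩
  have hsub : Icc 0 T ⊆ Ici 0 := Icc_subset_Ici_self
  have good := fun t ht => h.good _ (h.modulation.speed_near t ht)
  have pU := fun t (ht : t ∈ Icc 0 T) => h.solution.pair t ht.1
  have hn1 := fun t ht => (h.close t ht).trans e3
  have d0 : 0 < 1 / (2 * A) := by positivity
  have M0 : 0 < 2 * C₁ * e ^ 3 := by positivity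
  have cen := abs_le_of_damped (g := fun t => ∫ x, U t x * centering (x - a t))
    (D := fun t => ∫ x, U t x * deriv centering (x - a t))
    (h := fun t => (∫ x, (U t x * iteratedDeriv 3 centering (x - a t) +
      (f (U t x) - b t x * U t x) * deriv centering (x - a t))) -
        (c t - b t (a t)) * ∫ x, U t x * deriv centering (x - a t)) (T := T) hK d0 M0
    (fun t ht => (h.solution.hasDerivWithinAt_test contDiff_centering hasCompactSupport_centering
      hsub ht (h.modulation.deriv_position t ht)).congr_deriv (by ring))
    (fun t ht => by
      have h1 := (H₁ (c t) (a t) (U t) (V t) b εa εx εt t (good t ht).1 (good t ht).2 (pU t ht)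
        (hn1 t ht) h.potential).2
      have h2 := mul_le_mul_of_nonneg_left ((h.close t ht).trans (e13.trans heσ)) hC₁.le
      have h3 : 1 / A = 1 / (2 * A) + 1 / (2 * A) := by field_simp; ring
      have h4 : C₁ * σ ≤ 1 / (2 * A) := by
        rw [le_div_iff₀ (by positivity)]; linarith
      linarith)
    (fun t ht => by
      have h1 := (H₁ (c t) (a t) (U t) (V t) b εa εx εt t (good t ht).1 (good t ht).2 (pU t ht)
        (hn1 t ht) h.potential).1
      have h2 := mul_le_mul_of_nonneg_left (add_le_add (h.prod_le.trans e34) (h.close t ht)) hC₁.le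
      refine h1.trans (h2.trans (le_of_eq ?_))
      ring) t ht
  have ini : |∫ x, U 0 x * centering (x - a 0)| ≤ l * B * e ^ 4 := by
    have h1 := hQ.abs_integral_odd_le (a := a 0) (good 0 h0).1 (good 0 h0).2 (pU 0 h0)
      memLp_centering centering_neg
    rw [← hl] at h1
    have h2 := mul_le_mul_of_nonneg_right hi l0
    linarith
  have e1 : 2 * (2 * C₁ * e ^ 3) / (K * (1 / (2 * A))) = e ^ 3 / (4 * A) := by
    rw [hKdef]; field_simp; ring
  rw [e1, hQ.integral_mul_odd (good t ht).1 (good t ht).2 (pU t ht) memLp_centering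
    centering_neg] at cen
  have pξ := fun t ht => hQ.h1Pair_perturbation (a := a t) (good t ht).1 (good t ht).2 (pU t ht)
  exact half_of_coercive he he1 heσ hε hA hB hC0.le (by linarith)
    (displacement_nonneg _ _ _ _ _) (h.close t ht) (displacement_nonneg _ _ _ _ _) hi
    (by rw [← hC₆]; linarith) ((good t ht).2.coercive _ _ (pξ t ht))
    (hQ.abs_integral_perturbation_le (good t ht).1 (good t ht).2 (pU t ht)
      (h.modulation.momentum_eq t ht))
    (hQ.energy_sub_le hf hA hC (good t ht).1 (good t ht).2 (pU t ht)
      (h.modulation.momentum_eq t ht) (hn1 t ht))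
    (hQ.energy_sub_le hf hA hC (good 0 h0).1 (good 0 h0).2 (pU 0 h0)
      (h.modulation.momentum_eq 0 h0) (hn1 0 h0))
    (abs_quadForm_le hQ hf hA (good 0 h0).1 (good 0 h0).2 (pξ 0 h0))
    (H b U V r εa εx εt c₀ e T a c hr h t ht) (cen.trans (add_le_add_left ini _))

/-- Correcting the position by the pairing with the second corrector cancels the contribution of
the perturbation to the velocity. -/
lemma NearSoliton.exists_position (hQ : SolitaryWaveFamily f I₀ Q)
    (hf : AdmissibleNonlinearity f) (hA : 1 ≤ A) (hC : LocalBounds f (A + 2) C₀) {B K : ℝ}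
    (hB : 0 ≤ B) (hK : 0 ≤ K) :
    ∃ C > 0, ∀ (b U V : ℝ → ℝ → ℝ) (r εa εx εt c₀ e T : ℝ) (a c : ℝ → ℝ), 0 ≤ r → 0 < T →
      NearSoliton f I₀ Q b U V A B r K εa εx εt c₀ e T a c →
      ∃ a' : ℝ → ℝ, ContDiffOn ℝ 1 a' (Icc 0 T) ∧ ∀ t ∈ Icc 0 T, |a' t - a t| ≤ C * e ^ 2 ∧
        |derivWithin a' (Icc 0 T) t - (c t - b t (a' t))| ≤ C * e ^ 4 := by
  have hA0 : 0 < A := by linarith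
  obtain ⟨C₁, hC₁, H₁⟩ := hQ.exists_correctors hf hA hC
  obtain ⟨C₂, hC₂, H₂⟩ := NearSoliton.corrector_rate hQ hf hA hC hB hK hC₁
  refine ⟨2 * A * C₂ + A, by positivity, fun b U V r εa εx εt c₀ e T a c hr hT h => ?_⟩
  have he := h.pos
  have he1 := h.le_one
  have e3 : e ^ 3 ≤ 1 := pow_le_one₀ he.le he1
  have hsub : Icc 0 T ⊆ Ici 0 := Icc_subset_Ici_self
  obtain ⟨hc₀, hg₀⟩ := h.good c₀ (by simpa using hr)
  obtain ⟨φ, hφ⟩ := (H₁ c₀ r e hr h.good he he1).2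
  -- the pairing with this corrector changes at the rate `-ν m` up to `O(e⁴)`, so adding `1 / m` times
  -- the pairing to the position removes the deviation `ν` caused by the feedback
  obtain ⟨m, hm⟩ : ∃ m, m = momentumDeriv Q c₀ := ⟨_, rfl⟩
  have hm0 : 1 / A ≤ m := hm ▸ hg₀.momentumDeriv_ge
  have m0 : 0 < m := lt_of_lt_of_le (by positivity) hm0
  have mA : 1 / m ≤ A := by rw [one_div_le m0 hA0]; exact hm0
  rw [← hm] at hφ
  have R := H₂ b U V r εa εx εt c₀ e T a c φ _ _ h hφ
    fun c hc hg => (hQ.h1Pair hc hg.bounds).2.neg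
  obtain ⟨v, hv⟩ : ∃ v : ℝ → ℝ, v = fun t => c t - b t (a t) + feedback K (U t) (a t) := ⟨_, rfl⟩
  have da : ∀ t ∈ Icc 0 T, HasDerivWithinAt (fun t => a t + 1 / m * ∫ x, U t x * φ (x - a t))
      (v t + 1 / m * testRate f (b t) (U t) φ (a t) (v t)) (Icc 0 T) t := fun t ht => by
    rw [hv]
    exact (h.modulation.deriv_position t ht).add ((R t ht).1.const_mul _)
  have ud := uniqueDiffOn_Icc hT
  have ca : ContinuousOn a (Icc 0 T) := fun t ht =>
    (h.modulation.deriv_position t ht).continuousWithinAt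
  have cc : ContinuousOn c (Icc 0 T) := fun t ht =>
    (h.modulation.deriv_speed t ht).continuousWithinAt
  have hs := hφ.hasCompactSupport
  have cv : ContinuousOn v (Icc 0 T) := by
    rw [hv]
    refine (cc.sub ?_).add (continuousOn_const.mul (h.solution.continuousOn_test
      contDiff_centering hasCompactSupport_centering hsub ca))
    exact h.potential.differentiable.continuous.comp_continuousOn (continuousOn_id.prodMk ca)
  refine ⟨fun t => a t + 1 / m * ∫ x, U t x * φ (x - a t), ?_, fun t ht => ?_⟩
  · refine (contDiffOn_one_iff_derivWithin ud).2
      ⟨fun t ht => (da t ht).differentiableWithinAt, ?_⟩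
    refine ContinuousOn.congr ?_ fun t ht => (da t ht).derivWithin (ud t ht)
    exact cv.add (continuousOn_const.mul ((h.solution.continuousOn_test_deriv hf h.potential
      hφ.contDiff hs hsub ca).sub (cv.mul (h.solution.continuousOn_test
      (contDiff_infty_iff_deriv.1 hφ.contDiff).2 hs.deriv hsub ca))))
  · obtain ⟨hc, hg⟩ := h.good _ (h.modulation.speed_near t ht)
    have pU := h.solution.pair t ht.1
    have b1 := (R t ht).2.1
    have b2 := (R t ht).2.2
    have hz := hQ.abs_integral_perturbation_le (a := a t) hc hg pU (h.modulation.momentum_eq t ht)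
    have hn := h.close t ht
    have n0 := displacement_nonneg Q (U t) (V t) (a t) (c t)
    have sh : |a t + 1 / m * (∫ x, U t x * φ (x - a t)) - a t| ≤ A * (C₂ * e ^ 2) := by
      rw [add_sub_cancel_left, abs_mul, abs_of_pos (by positivity)]
      exact mul_le_mul mA b2 (abs_nonneg _) hA0.le
    have q0 : 0 ≤ (A * C₂ + A) * e ^ 2 := by positivity
    refine ⟨sh.trans (by linarith), ?_⟩
    rw [(da t ht).derivWithin (ud t ht)]
    have bs := h.potential.abs_sub_space_le t (a t + 1 / m * ∫ x, U t x * φ (x - a t)) (a t)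
    have bs' : |b t (a t + 1 / m * ∫ x, U t x * φ (x - a t)) - b t (a t)| ≤ A * (C₂ * e ^ 4) := by
      refine bs.trans ((mul_le_mul h.prod_le sh (abs_nonneg _) (by positivity)).trans ?_)
      calc e ^ 4 * (A * (C₂ * e ^ 2)) = A * (C₂ * e ^ 4) * e ^ 2 := by ring
        _ ≤ A * (C₂ * e ^ 4) := mul_le_of_le_one_right (by positivity) (pow_le_one₀ he.le he1)
    simp only [mul_neg, integral_neg] at b1
    have n2 : displacement Q (U t) (V t) (a t) (c t) ^ 2 ≤ e ^ 4 := by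
      calc _ ≤ (e ^ 3) ^ 2 := pow_le_pow_left₀ n0 hn 2
        _ = e ^ 4 * e ^ 2 := by ring
        _ ≤ e ^ 4 := mul_le_of_le_one_right (by positivity) (pow_le_one₀ he.le he1)
    rw [hv]
    simp only []
    generalize testRate f (b t) (U t) φ (a t) (c t - b t (a t) + feedback K (U t) (a t)) = d at *
    generalize feedback K (U t) (a t) = ν at *
    generalize (∫ x, perturbation Q (U t) (a t) (c t) x * Q (c t) x) = z at *
    generalize b t (a t + 1 / m * ∫ x, U t x * φ (x - a t)) = β' at *
    have e1 : c t - b t (a t) + ν + 1 / m * d - (c t - β') =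
        1 / m * (d + ν * m + -z) + 1 / m * z + (β' - b t (a t)) := by
      field_simp; ring
    have y1 : |1 / m * (d + ν * m + -z)| ≤ A * (C₂ * e ^ 4) := by
      rw [abs_mul, abs_of_pos (by positivity)]
      exact mul_le_mul mA b1 (abs_nonneg _) hA0.le
    have y2 : |1 / m * z| ≤ A * e ^ 4 := by
      rw [abs_mul, abs_of_pos (by positivity)]
      exact mul_le_mul mA (hz.trans (by linarith [sq_nonneg (displacement Q (U t) (V t) (a t) (c t))]))
        (abs_nonneg _) hA0.le
    rw [e1]
    refine (abs_add_le _ _).trans ((add_le_add ((abs_add_le _ _).trans (add_le_add y1 y2))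
      bs').trans (le_of_eq ?_))
    ring

end

/-! ### The choice of the constants -/

section

variable {f : ℝ → ℝ} {I₀ : Set ℝ} {Q : ℝ → ℝ → ℝ} {A C₀ : ℝ}

/-- The basic small parameter is `e = ε^(s/2)`; the condition `s < 1/2` makes `ε` small
compared with `e⁴`. -/
lemma exists_small_parameter {s κ : ℝ} (hs : 0 < s) (hs' : s < 1 / 2) (hκ : 0 < κ) :
    ∃ η > 0, ∀ ε, 0 < ε → ε ≤ η → ∃ e, 0 < e ∧ e ≤ κ ∧ ε ≤ κ * e ^ 4 ∧ e ^ 2 = ε ^ s ∧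
      e ^ 4 = ε ^ (2 * s) := by
  have h2 : 0 < 1 - 2 * s := by linarith
  refine ⟨min (κ ^ (2 / s)) (κ ^ (1 / (1 - 2 * s))),
    lt_min (Real.rpow_pos_of_pos hκ _) (Real.rpow_pos_of_pos hκ _), fun ε hε hη => ?_⟩
  have p2 : (ε ^ (s / 2)) ^ 2 = ε ^ s := by
    rw [← Real.rpow_natCast, ← Real.rpow_mul hε.le]; congr 1; push_cast; ring
  have p4 : (ε ^ (s / 2)) ^ 4 = ε ^ (2 * s) := by
    rw [← Real.rpow_natCast, ← Real.rpow_mul hε.le]; congr 1; push_cast; ring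
  refine ⟨ε ^ (s / 2), Real.rpow_pos_of_pos hε _, ?_, ?_, p2, p4⟩
  · refine (Real.rpow_le_rpow hε.le (hη.trans (min_le_left _ _)) (by positivity)).trans ?_
    rw [← Real.rpow_mul hκ.le, show 2 / s * (s / 2) = 1 by field_simp, Real.rpow_one]
  · have h1 : ε ^ (1 - 2 * s) ≤ κ := by
      refine (Real.rpow_le_rpow hε.le (hη.trans (min_le_right _ _)) h2.le).trans ?_
      rw [← Real.rpow_mul hκ.le, show 1 / (1 - 2 * s) * (1 - 2 * s) = 1 by field_simp,
        Real.rpow_one]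
    rw [p4]
    calc ε = ε ^ (1 - 2 * s) * ε ^ (2 * s) := by
          rw [← Real.rpow_add hε, sub_add_cancel, Real.rpow_one]
      _ ≤ κ * ε ^ (2 * s) := mul_le_mul_of_nonneg_right h1 (Real.rpow_nonneg hε.le _)

/-- The speed changes at the rate of the momentum, which the slope of the potential bounds. -/
lemma Modulation.contDiffOn_speed (hQ : SolitaryWaveFamily f I₀ Q) (hf : AdmissibleNonlinearity f)
    {b U V : ℝ → ℝ → ℝ} {c₀ r K T εa εx εt : ℝ} {a c : ℝ → ℝ} (hT : 0 < T)
    (hA : 0 < A) (hgood : ∀ c, |c - c₀| ≤ r → c ∈ I₀ ∧ GoodSpeed f Q A c)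
    (hb : AdmissiblePotential b εa εx εt) (hU : IsRegularSolution f b U V)
    (h : Modulation f b U Q c₀ r K T a c) : ContDiffOn ℝ 1 c (Icc 0 T) ∧ ∀ t ∈ Icc 0 T,
      |derivWithin c (Icc 0 T) t| ≤ A * (1 / 2 * (A * l2 wt) ^ 2) * (εa * εx) := by
  have ud := uniqueDiffOn_Icc hT
  have hsub : Icc 0 T ⊆ Ici 0 := Icc_subset_Ici_self
  have cc : ContinuousOn c (Icc 0 T) := fun t ht => (h.deriv_speed t ht).continuousWithinAt
  have pos : ∀ t ∈ Icc 0 T, 0 < momentumDeriv Q (c t) := fun t ht =>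
    lt_of_lt_of_le (by positivity) (hgood _ (h.speed_near t ht)).2.momentumDeriv_ge
  refine ⟨(contDiffOn_one_iff_derivWithin ud).2
    ⟨fun t ht => (h.deriv_speed t ht).differentiableWithinAt, ?_⟩, fun t ht => ?_⟩
  · refine ContinuousOn.congr ?_ fun t ht => (h.deriv_speed t ht).derivWithin (ud t ht)
    refine ContinuousOn.mul (ContinuousOn.inv₀ ?_ fun t ht => (pos t ht).ne')
      ((hU.continuousOn_momentum_deriv hb).mono hsub)
    exact fun t ht => (hQ.continuousAt_momentumDeriv hf
      (hgood _ (h.speed_near t ht)).1).comp_continuousWithinAt (cc t ht)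
  · obtain ⟨hc, hg⟩ := hgood _ (h.speed_near t ht)
    rw [(h.deriv_speed t ht).derivWithin (ud t ht), abs_mul, abs_of_pos (inv_pos.2 (pos t ht)),
      mul_assoc]
    refine mul_le_mul ?_ ((hU.abs_momentum_deriv_le hb ht.1).trans ?_) (abs_nonneg _) hA.le
    · rw [inv_le_comm₀ (pos t ht) hA, ← one_div]
      exact hg.momentumDeriv_ge
    · rw [← h.momentum_eq t ht, mul_comm]
      exact mul_le_mul_of_nonneg_right (momentum_profile_le hg) hb.prod_pos.le

/-- The main estimate, in terms of the parameter `e` and for the continuous representatives. -/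
lemma SolitaryWaveFamily.exists_long_time (hQ : SolitaryWaveFamily f I₀ Q)
    (hf : AdmissibleNonlinearity f) (hA : 1 ≤ A) (hC : LocalBounds f (A + 2) C₀) {r : ℝ}
    (hr : 0 < r) :
    ∃ C > 0, ∃ σ > 0, ∀ (b U V : ℝ → ℝ → ℝ) (εa εx εt c₀ a₀ e T : ℝ),
      (∀ c, |c - c₀| ≤ r → c ∈ I₀ ∧ GoodSpeed f Q A c) → AdmissiblePotential b εa εx εt →
      IsRegularSolution f b U V → 0 < e → e ≤ σ → εa * εx ≤ σ * e ^ 4 → 0 < T →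
      T * e ^ 2 ≤ 1 → T * (εt + εx) ≤ 1 → displacement Q (U 0) (V 0) a₀ c₀ ≤ 2 * e ^ 4 →
      ∃ a c : ℝ → ℝ, ContDiffOn ℝ 1 a (Icc 0 T) ∧ ContDiffOn ℝ 1 c (Icc 0 T) ∧
        ∀ t ∈ Icc 0 T, |c t - c₀| ≤ r ∧ displacement Q (U t) (V t) (a t) (c t) ≤ C * e ^ 2 ∧
          |derivWithin a (Icc 0 T) t - (c t - b t (a t))| ≤ C * e ^ 4 ∧
          |derivWithin c (Icc 0 T) t| ≤ C * e ^ 4 := by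
  have hA0 : 0 < A := by linarith
  obtain ⟨K, hK, HK⟩ := NearSoliton.exists_displacement_le_half hQ hf hA hC
  obtain ⟨l, hl⟩ : ∃ l, l = l2 wt := ⟨_, rfl⟩
  have l0 : 0 ≤ l := hl ▸ l2_nonneg _
  -- `P` bounds the momenta of the profiles, `B₁ e⁴` the initial mismatch of the momentum, and `B`
  -- both the drift of the speed, in units of `e²`, and the initial displacement, in units of `e⁴`
  obtain ⟨P, hP⟩ : ∃ P, P = 1 / 2 * (A * l) ^ 2 := ⟨_, rfl⟩
  have P0 : 0 ≤ P := by rw [hP]; positivity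
  obtain ⟨B₁, hB₁⟩ : ∃ B₁, B₁ = 2 * (A * l) + 2 := ⟨_, rfl⟩
  have B₁0 : 0 ≤ B₁ := by rw [hB₁]; positivity
  obtain ⟨B, hBdef⟩ : ∃ B, B = A * (2 * P + 3 * B₁) + 2 + 6 * A * l * (A * B₁) := ⟨_, rfl⟩
  have hB : 0 ≤ B := by rw [hBdef]; positivity
  obtain ⟨σ, hσ, Hσ⟩ := HK B hB
  obtain ⟨C, hC0, HC⟩ := NearSoliton.exists_position hQ hf hA hC hB hK.le
  have r0 : 0 < r / (A * (2 * P + 3 * B₁ + 1)) := by positivity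
  refine ⟨C + 1 + 6 * A * l * C + A * P, by positivity,
    min (min 1 σ) (min (r / (A * (2 * P + 3 * B₁ + 1))) (1 / (B + 1))),
    lt_min (lt_min one_pos hσ) (lt_min r0 (by positivity)),
    fun b U V εa εx εt c₀ a₀ e T hgood hb hU he heσ hε hT hTe hTs hini => ?_⟩
  have he1 : e ≤ 1 := heσ.trans ((min_le_left _ _).trans (min_le_left _ _))
  have heσ' : e ≤ σ := heσ.trans ((min_le_left _ _).trans (min_le_right _ _))
  have her : e ≤ r / (A * (2 * P + 3 * B₁ + 1)) :=
    heσ.trans ((min_le_right _ _).trans (min_le_left _ _))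
  have heB : e ≤ 1 / (B + 1) := heσ.trans ((min_le_right _ _).trans (min_le_right _ _))
  have e4 : 0 < e ^ 4 := by positivity
  have hε1 : εa * εx ≤ e ^ 4 := hε.trans (mul_le_of_le_one_left e4.le
    ((min_le_left _ _).trans (min_le_left _ _)))
  have hεσ : εa * εx ≤ σ * e ^ 4 := hε.trans (mul_le_mul_of_nonneg_right
    ((min_le_left _ _).trans (min_le_right _ _)) e4.le)
  have e42 : e ^ 4 ≤ e ^ 2 := pow_le_pow_of_le_one he.le he1 (by norm_num)
  have e32 : e ^ 3 ≤ e ^ 2 := pow_le_pow_of_le_one he.le he1 (by norm_num)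
  have e21 : e ^ 2 ≤ e := by simpa using pow_le_pow_of_le_one he.le he1 (show 1 ≤ 2 by norm_num)
  have ε0 := hb.prod_pos
  obtain ⟨hc₀, hg₀⟩ := hgood c₀ (by simpa using hr.le)
  have h0 : (0 : ℝ) ∈ Icc 0 T := ⟨le_rfl, hT.le⟩
  have pU := fun t (ht : t ∈ Icc 0 T) => hU.pair t ht.1
  have lQ : l2 (Q c₀) ≤ A * l := hl ▸ l2_le_of_wt (le_wt_of_le_sq hg₀.bounds.profile)
  have mom0 : |momentum (U 0) - momentum (Q c₀)| ≤ B₁ * e ^ 4 := by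
    have lξ := (l2_perturbation_le Q (U 0) (V 0) a₀ c₀).trans hini
    have h1 := (abs_integral_mul_le (hQ.h1Pair_perturbation (a := a₀) hc₀ hg₀ (pU 0 h0)).2
      (hQ.h1Pair hc₀ hg₀.bounds).2).trans (mul_le_mul lξ lQ (l2_nonneg _) (by positivity))
    have h2 := pow_le_pow_left₀ (l2_nonneg _) lξ 2
    have h3 : (2 * e ^ 4) ^ 2 ≤ 4 * e ^ 4 := by
      have := mul_le_of_le_one_right e4.le (pow_le_one₀ he.le he1 : e ^ 4 ≤ 1)
      linarith
    rw [hQ.momentum_perturbation (a := a₀) hc₀ hg₀ (pU 0 h0)]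
    have e1 : ∀ x y z : ℝ, x + y + z - x = y + z := fun x y z => by ring
    rw [e1]
    refine (abs_add_le _ _).trans ?_
    rw [abs_of_nonneg (show 0 ≤ 1 / 2 * l2 (perturbation Q (U 0) a₀ c₀) ^ 2 by positivity), hB₁]
    linarith
  have momU : momentum (U 0) ≤ P + B₁ := by
    have h1 := (abs_le.1 mom0).2
    have h2 := momentum_profile_le hg₀
    rw [← hl, ← hP] at h2
    have h3 : B₁ * e ^ 4 ≤ B₁ := mul_le_of_le_one_right B₁0 (pow_le_one₀ he.le he1)
    linarith
  -- the momentum changes at the rate `O(ε)`, and `ε T ≤ e⁴ T ≤ e²`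
  have mom : ∀ t ∈ Icc 0 T, |momentum (U t) - momentum (Q c₀)| ≤ (2 * P + 3 * B₁) * e ^ 2 :=
    fun t ht => by
      have h1 : t * e ^ 2 ≤ 1 := (mul_le_mul_of_nonneg_right ht.2 (by positivity)).trans hTe
      have h2 : εa * εx * t ≤ e ^ 2 := by
        calc εa * εx * t ≤ e ^ 4 * t := mul_le_mul_of_nonneg_right hε1 ht.1
          _ = e ^ 2 * (t * e ^ 2) := by ring
          _ ≤ e ^ 2 := mul_le_of_le_one_right (by positivity) h1
      have h3 := hU.abs_momentum_sub_le hb ht.1 (h2.trans (pow_le_one₀ he.le he1))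
      have h4 := mul_le_mul (mul_le_mul_of_nonneg_left momU zero_le_two) h2
        (mul_nonneg ε0.le ht.1) (by positivity)
      have h5 := mul_le_mul_of_nonneg_left e42 B₁0
      have e1 : momentum (U t) - momentum (Q c₀) = (momentum (U t) - momentum (U 0)) +
        (momentum (U 0) - momentum (Q c₀)) := by ring
      rw [e1]
      refine (abs_add_le _ _).trans ?_
      linarith
  have momr : ∀ t ∈ Icc 0 T, |momentum (U t) - momentum (Q c₀)| < r / A := fun t ht => by
    rw [le_div_iff₀ (by positivity)] at her
    rw [lt_div_iff₀ hA0]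
    have h1 := mul_le_mul_of_nonneg_right ((mom t ht).trans (mul_le_mul_of_nonneg_left e21
      (by positivity))) hA0.le
    have h2 : 0 < e * A := by positivity
    linarith
  obtain ⟨a, c, ha0, hmod, hcc⟩ := exists_modulation hQ hf hA hr hgood hb hU hT.le hK.le a₀ momr
  have spd : ∀ t ∈ Icc 0 T, |c t - c₀| ≤ B * e ^ 2 := fun t ht => by
    have h1 := (hcc t ht).trans (mul_le_mul_of_nonneg_left (mom t ht) hA0.le)
    have h2 : 0 ≤ (2 + 6 * A * l * (A * B₁)) * e ^ 2 := by positivity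
    rw [hBdef]; linarith
  have hini' : displacement Q (U 0) (V 0) (a 0) (c 0) ≤ B * e ^ 4 := by
    have h1 := (hcc 0 h0).trans (mul_le_mul_of_nonneg_left mom0 hA0.le)
    have pc : ∀ c, |c - c₀| ≤ r → H1Pair (fun x => Q c (x - a₀)) (fun x => deriv (Q c) (x - a₀)) :=
      fun c hc => (hQ.h1Pair (hgood c hc).1 (hgood c hc).2.bounds).translate _
    have hcc₀ : |c₀ - c₀| ≤ r := by simpa using hr.le
    have h2 := hQ.nrm_soliton_sub_le hf hgood hcc₀ (hmod.speed_near 0 h0) a₀ a₀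
    rw [sub_self, abs_zero, add_zero, abs_sub_comm, ← hl] at h2
    have h3 := nrm_add_le ((pU 0 h0).sub (pc _ hcc₀)) ((pc _ hcc₀).sub
      (pc _ (hmod.speed_near 0 h0)))
    simp only [sub_add_sub_cancel] at h3
    rw [← displacement_eq, ← displacement_eq] at h3
    rw [ha0]
    have h4 := mul_le_mul_of_nonneg_left h1 (show 0 ≤ 6 * A * l by positivity)
    have h5 : 0 ≤ A * (2 * P + 3 * B₁) * e ^ 4 := by positivity
    rw [hBdef]; linarith
  have near : ∀ T' ∈ Icc 0 T, (∀ t ∈ Icc 0 T', displacement Q (U t) (V t) (a t) (c t) ≤ e ^ 3) →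
      NearSoliton f I₀ Q b U V A B r K εa εx εt c₀ e T' a c := fun T' hT' hcl =>
    { good := hgood
      potential := hb
      solution := hU
      modulation := hmod.mono hT'.2
      pos := he
      le_one := he1
      prod_le := hε1
      time_le := (mul_le_mul_of_nonneg_right hT'.2 (by positivity)).trans hTe
      slow := (mul_le_mul_of_nonneg_right hT'.2
        (add_pos hb.time.1 hb.length.1).le).trans hTs
      speed_close := fun t ht => spd t ⟨ht.1, ht.2.trans hT'.2⟩
      close := hcl }
  have close : ∀ t ∈ Icc 0 T, displacement Q (U t) (V t) (a t) (c t) ≤ e ^ 3 := by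
    refine le_of_bootstrap (by positivity) (hmod.continuousOn_displacement hQ hf hgood hU) ?_
      fun T' hT' hcl => Hσ b U V r εa εx εt c₀ e T' a c hr.le (near T' hT' hcl) heσ' hεσ hini'
    rw [le_div_iff₀ (by positivity)] at heB
    have h1 : B * e < 1 := by linarith
    calc _ ≤ B * e ^ 4 := hini'
      _ = B * e * e ^ 3 := by ring
      _ < 1 * e ^ 3 := mul_lt_mul_of_pos_right h1 (by positivity)
      _ = e ^ 3 := one_mul _
  obtain ⟨a', ha', hpos⟩ := HC b U V r εa εx εt c₀ e T a c hr.le hT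
    (near T ⟨hT.le, le_rfl⟩ close)
  obtain ⟨hcC, hcd⟩ := hmod.contDiffOn_speed hQ hf hT hA0 hgood hb hU
  refine ⟨a', c, ha', hcC, fun t ht => ⟨hmod.speed_near t ht, ?_, ?_, ?_⟩⟩
  · have hct := hmod.speed_near t ht
    have pc : ∀ a, H1Pair (fun x => Q (c t) (x - a)) (fun x => deriv (Q (c t)) (x - a)) :=
      fun a => (hQ.h1Pair (hgood _ hct).1 (hgood _ hct).2.bounds).translate _
    have h2 := hQ.nrm_soliton_sub_le hf hgood hct hct (a t) (a' t)
    rw [sub_self, abs_zero, zero_add, abs_sub_comm, ← hl] at h2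
    have h3 := nrm_add_le ((pU t ht).sub (pc (a t))) ((pc (a t)).sub (pc (a' t)))
    simp only [sub_add_sub_cancel] at h3
    rw [← displacement_eq, ← displacement_eq] at h3
    have h4 := mul_le_mul_of_nonneg_left (hpos t ht).1 (show 0 ≤ 6 * A * l by positivity)
    have h5 := close t ht
    have h6 : 0 ≤ (C + A * P) * e ^ 2 := by positivity
    linarith
  · have h6 : 0 ≤ (1 + 6 * A * l * C + A * P) * e ^ 4 := by positivity
    linarith [(hpos t ht).2]
  · have h1 := hcd t ht
    rw [← hl, ← hP] at h1
    have h2 := mul_le_mul_of_nonneg_left hε1 (show 0 ≤ A * P by positivity)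
    have h6 : 0 ≤ (C + 1 + 6 * A * l * C) * e ^ 4 := by positivity
    linarith

end

end BKdV

end

/-- Long-time dynamics of solutions of the bKdV equation that start near the manifold of stable
solitary waves. The constants `C`, `K`, `κ`, `η` depend only on `f`, `Q`, `I`, `J` and `s`. -/
theorem mainTheorem1
    (f : ℝ → ℝ) (hf : BKdV.AdmissibleNonlinearity f)
    (I₀ : Set ℝ) (Q : ℝ → ℝ → ℝ) (hQ : BKdV.SolitaryWaveFamily f I₀ Q)
    (I J : Set ℝ) (hI : IsCompact I) (hI' : I.Nonempty)
    (hIJ : I ⊆ interior J) (hJ : J ⊆ I₀)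
    (hstable : ∀ c ∈ I, 0 < deriv (fun c' => BKdV.momentum (Q c')) c)
    (s : ℝ) (hs : 0 < s) (hs' : s < 1 / 2) :
    ∃ C > 0, ∃ K > 0, ∃ κ > 0, ∃ η > 0,
      ∀ (εa εx εt ε₀ : ℝ) (b u : ℝ → ℝ → ℝ),
        BKdV.AdmissiblePotential b εa εx εt →
        εa * εx ≤ η →
        ε₀ ≤ κ * (εa * εx) ^ (2 * s) →
        BKdV.IsSolution f b u →
        BKdV.SatisfiesBalanceLaws f b u →
        (⨅ p : I × ℝ, BKdV.h1Norm (fun x => u 0 x - Q p.1 (x - p.2))) ≤ ε₀ →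
        ∃ a c : ℝ → ℝ,
          ContDiffOn ℝ 1 a (Set.Icc 0 (C * (εt + εx + (εa * εx) ^ s)⁻¹)) ∧
          ContDiffOn ℝ 1 c (Set.Icc 0 (C * (εt + εx + (εa * εx) ^ s)⁻¹)) ∧
          ∀ t ∈ Set.Icc 0 (C * (εt + εx + (εa * εx) ^ s)⁻¹),
            c t ∈ J ∧
            BKdV.MemH1 (fun x => u t x - Q (c t) (x - a t)) ∧
            BKdV.h1Norm (fun x => u t x - Q (c t) (x - a t)) ≤ K * (εa * εx) ^ s ∧
            |derivWithin a (Set.Icc 0 (C * (εt + εx + (εa * εx) ^ s)⁻¹)) t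
                - (c t - b t (a t))| ≤ K * ((εa * εx) ^ (2 * s) + εa * εx ^ 2) ∧
            |derivWithin c (Set.Icc 0 (C * (εt + εx + (εa * εx) ^ s)⁻¹)) t|
              ≤ K * ((εa * εx) ^ (2 * s) + εa * εx ^ 2) := by
  obtain ⟨A, hA, r, hr, hgood⟩ := hQ.exists_uniform_goodSpeed hf hI hIJ hJ hstable
  obtain ⟨C₀, hC₀⟩ := hf.exists_localBounds (M := A + 2) (by linarith)
  obtain ⟨K, hK, σ, hσ, H⟩ := hQ.exists_long_time hf hA hC₀ hr
  obtain ⟨η, hη, Hη⟩ := BKdV.exists_small_parameter hs hs' hσ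
  refine ⟨1, one_pos, K, hK, 1, one_pos, η, hη, fun εa εx εt ε₀ b u hb hεη hε₀ hu hbal hini => ?_⟩
  have ε0 := hb.prod_pos
  have x0 := hb.length.1
  have t0 := hb.time.1
  obtain ⟨e, he, heσ, hεe, e2, e4⟩ := Hη _ ε0 hεη
  obtain ⟨U, V, hU, huU⟩ := hu.exists_regular hf hb hbal
  rw [← e4, one_mul] at hε₀
  have : Nonempty (I × ℝ) := ⟨⟨⟨_, hI'.some_mem⟩, 0⟩⟩
  -- the infimum need not be attained: a solitary wave at distance less than `2 * e ^ 4` suffices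
  obtain ⟨⟨⟨c₀, hc₀⟩, a₀⟩, hp⟩ := exists_lt_of_ciInf_lt
    ((hini.trans hε₀).trans_lt (show e ^ 4 < 2 * e ^ 4 by linarith [pow_pos he 4]))
  have hgood₀ : ∀ c, |c - c₀| ≤ r → c ∈ I₀ ∧ BKdV.GoodSpeed f Q A c := fun c hc =>
    ⟨hJ (hgood c₀ hc₀ c hc).1, (hgood c₀ hc₀ c hc).2⟩
  have pair : ∀ c, |c - c₀| ≤ r → ∀ a t, 0 ≤ t →
      BKdV.MemH1 (fun x => u t x - Q c (x - a)) ∧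
      BKdV.h1Norm (fun x => u t x - Q c (x - a)) = BKdV.displacement Q (U t) (V t) a c :=
    fun c hc a t ht => by
      have h1 := (hU.pair t ht).sub
        ((hQ.h1Pair (hgood₀ c hc).1 (hgood₀ c hc).2.bounds).translate a)
      have h2 : (fun x => u t x - Q c (x - a)) =ᵐ[volume] fun x => U t x - Q c (x - a) := by
        filter_upwards [huU t ht] with x hx
        rw [hx]
      rw [BKdV.displacement_eq]
      exact ⟨(h1.memH1 h2).1, h1.h1Norm_eq h2⟩
  rw [(pair c₀ (by simpa using hr.le) a₀ 0 le_rfl).2] at hp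
  obtain ⟨D, hD⟩ : ∃ D, D = εt + εx + (εa * εx) ^ s := ⟨_, rfl⟩
  have hD0 : 0 < D := by rw [hD, ← e2]; positivity
  rw [← hD, one_mul, ← e2, ← e4]
  obtain ⟨a, c, ha, hc, h⟩ := H b U V εa εx εt c₀ a₀ e D⁻¹ hgood₀ hb hU he heσ hεe
    (inv_pos.2 hD0)
    (by rw [inv_mul_le_iff₀ hD0, mul_one, hD, ← e2]; linarith)
    (by rw [inv_mul_le_iff₀ hD0, mul_one, hD, ← e2]; linarith [sq_nonneg e]) hp.le
  have weaken : ∀ z, z ≤ K * e ^ 4 → z ≤ K * (e ^ 4 + εa * εx ^ 2) := fun z hz =>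
    hz.trans (mul_le_mul_of_nonneg_left
      (le_add_of_nonneg_right (mul_nonneg hb.amplitude.1.le (sq_nonneg _))) hK.le)
  refine ⟨a, c, ha, hc, fun t ht => ?_⟩
  obtain ⟨h1, h2, h3, h4⟩ := h t ht
  obtain ⟨m1, m2⟩ := pair (c t) h1 (a t) t ht.1
  exact ⟨(hgood c₀ hc₀ _ h1).1, m1, m2 ▸ h2, weaken _ h3, weaken _ h4⟩
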